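/- **Setting and notation.** Let $A$ be a finite dimensional Frobenius algebra over a field $k$ with associative non-degenerate bilinear form $\langle\ ,\ \rangle$; let $(u_i)$, $(v_i)$ be bases with $\langle v_i,u_j\rangle=\delta_{ij}$, let $\nu(x)=\sum_i\langle x,v_i\rangle u_i$ be the Nakayama automorphism ($\langle a,b\rangle=\langle b,\nu a\rangle$), and assume that $\nu$ is diagonalizable over $k$, $A=\bigoplus_\mu A_\mu$. Put $\overline A=A/k1$, let $\bar a$ be the class of $a$, and $\bar a_{i,j}=\bar a_i\otimes\cdots\otimes\bar a_j$. Let $d_p:A\otimes\overline A^{\otimes p}\otimes A\to A\otimes\overline A^{\otimes p-1}\otimes A$ be the differential of the normalized bar resolution ($d_0:A\otimes A\to A$ the multiplication) and $\overline\Omega^p(A)=\operatorname{Im}d_p$, so $\overline\Omega^0(A)=A$. For a bimodule $M$, $\mathrm{Ext}^r_{A^e}(A,M)$ is computed by the normalized Hochschild complex $C^r(A,M)=\mathrm{Hom}_k(\overline A^{\otimes r},M)$ with $\delta f(\bar a_{1,r+1})=a_1f(\bar a_{2,r+1})+\sum_{i=1}^r(-1)^if(\bar a_{1,i-1}\otimes\overline{a_ia_{i+1}}\otimes\bar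 a_{i+2,r+1})+(-1)^{r+1}f(\bar a_{1,r})a_{r+1}$. **Complete cohomology.** $\mathcal D^r=C^r(A,A)$ for $r\ge0$ and $\mathcal D^{r}=C_{-r-1}(A,A_{\nu^{-1}})=A\otimes\overline A^{\otimes -r-1}$ for $r\le-1$. Its differential is $\delta$ in degrees $\ge 0$, $a\mapsto\sum_iu_iav_i$ from degree $-1$ to degree $0$, and in degrees $\le-2$ the Hochschild differential $\partial(a_0\otimes\bar a_{1,r})=a_0\nu^{-1}(a_1)\otimes\bar a_{2,r}+\sum_{i=1}^{r-1}(-1)^ia_0\otimes\bar a_{1,i-1}\otimes\overline{a_ia_{i+1}}\otimes\bar a_{i+2,r}+(-1)^ra_ra_0\otimes\bar a_{1,r-1}$. Its cohomology is $\widehat{\mathrm{HH}}^\bullet(A)$. The subcomplex $\mathcal D_{(1)}$ consists, in degrees $r\ge0$, of the $f$ with $f(\overline A_{\mu_1}\otimes\cdots\otimes\overline A_{\mu_r})\subseteq A_{\mu_1\cdots\mu_r}$ and, in degrees $r\leq -1$, of the sum of the $A_{\mu_0}\otimes\overline A_{\mu_1}\otimes\cdots\otimes\overline A_{\mu_{-r-1}}$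 with $\mu_0\mu_1\cdots\mu_{-r-1}=1$; its cohomology is $\widehat{\mathrm{HH}}^\bullet_{(1)}(A)$. For $f\in C^m(A,A)$ and $\alpha=a_0\otimes\bar a_{1,p}\in\mathcal D^{-p-1}$ let $f\star\alpha=f(\bar a_{p-m+1,p})a_0\otimes\bar a_{1,p-m}$ if $m\le p$, and $(f\star\alpha)(\bar b_{1,m-p-1})=\sum_if(\bar b_{1,m-p-1}\otimes\overline{u_i\nu(a_0)}\otimes\bar a_{1,p})v_i$ if $m>p$. Let $B^{\nu^{-1}}(a_0\otimes\bar a_{1,r})=\sum_{i=1}^{r+1}(-1)^{ir}\,1\otimes\bar a_{i,r}\otimes\bar a_0\otimes\overline{\nu^{-1}a}_{1,i-1}$; it is read as $0$ on $\mathcal D^r$ for $r\ge 0$. Let $\widehat\Delta:\mathcal D^r\to\mathcal D^{r-1}$ be $(-1)^rB^{\nu^{-1}}$ for $r\le-1$, $0$ for $r=0$, and for $r\ge1$ the operator $\Delta^\nu$ with $\langle\Delta^\nu f(\bar a_{1,r-1}),a_r\rangle=\sum_{i=1}^{r}(-1)^{i(r-1)}\langle f(\bar a_{i,r-1}\otimes\bar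 a_r\otimes\overline{\nu a}_{1,i-1}),1\rangle$. Let $\kappa$ be induced by $\kappa_{r,p}(a_0\otimes\bar a_{1,r})(\bar b_{1,p})=\sum_id_{r+p+1}(u_i\nu(a_0)\otimes\bar a_{1,r}\otimes\bar v_i\otimes\bar b_{1,p}\otimes1)$, as a map $\widehat{\mathrm{HH}}^{-r-1}(A)\to\mathrm{Ext}^p_{A^e}(A,\overline\Omega^{r+p+1}(A))$. **Wang's bracket.** Let $\pi^{(r)}:\overline\Omega^p(A)\to A\otimes\overline A^{\otimes p}$ and $\pi^{(b)}:\overline\Omega^p(A)\to\overline A^{\otimes p+1}$ be the restrictions of the maps $a_0\otimes\bar a_{1,p-1}\otimes a_p\mapsto a_0\otimes\bar a_{1,p}$ and $\mapsto\bar a_{0,p}$ (for $p=0$ the identity and the projection of $A$). For $f\in C^m(A,\overline\Omega^p(A))$, $g\in C^n(A,\overline\Omega^q(A))$, $m,n\ge1$, define maps $\overline A^{\otimes m+n-1}\to\overline\Omega^{p+q}(A)$ by $f\bullet_ig=d\big((\pi^{(r)}f\otimes\mathrm{id}^{\otimes q})(\mathrm{id}^{\otimes i-1}\otimes\pi^{(b)}g\otimes\mathrm{id}^{\otimes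 m-i})(-)\otimes1\big)$ for $1\le i\le m$, $f\bullet_{-j}g=d\big((\mathrm{id}_A\otimes\mathrm{id}^{\otimes j-1}\otimes\pi^{(b)}f\otimes\mathrm{id}^{\otimes q-j})(\pi^{(r)}g\otimes\mathrm{id}^{\otimes m-1})(-)\otimes1\big)$ for $1\le j\le q$, where $d=d_{p+q}$, and $f\bullet g=\sum_{i=1}^m(-1)^{p+q+(i-1)(q-n-1)}f\bullet_ig+\sum_{j=1}^q(-1)^{p+q+j(p-m-1)}f\bullet_{-j}g$, $[f,g]_{\rm sg}=f\bullet g-(-1)^{(m-p-1)(n-q-1)}g\bullet f$. For $m\in\mathbb Z$ let $\underline{\mathrm{Ext}}^m_{A^e}(A,A)$ be the colimit over $p\ge i:=\max(0,-m)$ of $\mathrm{Ext}^{m+p}_{A^e}(A,\overline\Omega^p(A))$ along the maps $(-1)^{m+i}\theta$ for $p=i$ and $(-1)^m\theta$ for $p>i$, where $\theta(f)(\bar b_{1,M+1})=(-1)^M d_{p+1}(f(\bar b_{1,M})\otimes\bar b_{M+1}\otimes 1)$ for $f \in C^M(A,\overline\Omega^p(A))$, $M=m+p$ (the last tensor factor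 of $f(\bar b_{1,M})$ being projected to $\overline A$ if $p\geq 1$). **Proposition.** Let $n\ge m\ge1$ be integers. For $f\in\mathcal D^m$ and $z\in\mathcal D^{-n}$ ($|f|=m$, $|z|=-n$) put $$\{f,z\}=(-1)^{|f||z|+|f|+|z|}\big((-1)^{|f|+1}\widehat\Delta(f\star z)+(-1)^{|f|}\widehat\Delta(f)\star z+f\star\widehat\Delta(z)\big)\in\mathcal D^{m-n-1}.$$ This is equal to $(-1)^{|f||z|+|f|+|z|}\big((-1)^{|z|+1}B^{\nu^{-1}}(f\star z)+(-1)^{|f|}\Delta^\nu(f)\star z+(-1)^{|z|}f\star B^{\nu^{-1}}(z)\big)$. Then $\{\ ,\ \}$ and $[\ ,\ ]_{\rm sg}$ induce bilinear maps on the cohomology groups below (in the last row, $[\ ,\ ]_{\rm sg}$ applied to cocycles in $C^M(A,\overline\Omega^p(A))$ and $C^N(A,\overline\Omega^q(A))$ with $M=m+p\ge1$, $N=-n+q\ge1$ representing the two classes), and there is a commutative diagram $$\begin{array}{ccc} \widehat{\mathrm{HH}}^m_{(1)}(A)\otimes\widehat{\mathrm{HH}}^{-n}_{(1)}(A)&\xrightarrow{\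 \{\ ,\ \}\ }&\widehat{\mathrm{HH}}^{m-n-1}_{(1)}(A)\\ \downarrow\cong&&\downarrow\cong\\ \mathrm{Ext}^m_{A^e}(A,A)\otimes\widehat{\mathrm{HH}}^{-n}(A)&&\widehat{\mathrm{HH}}^{m-n-1}(A)\\ {\scriptstyle \mathrm{id}\otimes\kappa_{n-1,1}}\downarrow\cong&&\cong\downarrow{\scriptstyle\kappa_{n-m,m}}\\ \mathrm{Ext}^m_{A^e}(A,A)\otimes\mathrm{Ext}^1_{A^e}(A,\overline\Omega^{n+1}(A))&\xrightarrow{\ [\ ,\ ]_{\rm sg}\ }&\mathrm{Ext}^m_{A^e}(A,\overline\Omega^{n+1}(A))\\ \downarrow\cong&&\downarrow\cong\\ \underline{\mathrm{Ext}}^m_{A^e}(A,A)\otimes\underline{\mathrm{Ext}}^{-n}_{A^e}(A,A)&\xrightarrow{\ [\ ,\ ]_{\rm sg}\ }&\underline{\mathrm{Ext}}^{m-n-1}_{A^e}(A,A) \end{array}$$ in which the upper vertical maps are induced by the inclusion of $\mathcal D_{(1)}$ in $\mathcal D$, the lower ones are the canonical maps to the colimits, and all vertical maps are isomorphisms. 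-/

import Mathlib

open scoped TensorProduct

universe u

noncomputable section

namespace TateHochschild

/-! ## Words: the spaces `Ā^{⊗n}`, `A ⊗ Ā^{⊗n}` and `A ⊗ Ā^{⊗n} ⊗ A` -/

section Words

variable (k A : Type u) [Field k] [Ring A] [Algebra k A]

/-- The quotient space `Ā = A / k·1`. -/
abbrev Abar : Type u := A ⧸ Submodule.span k {(1 : A)}

/-- The canonical epimorphism `π : A → Ā`. -/
def proj : A →ₗ[k] Abar k A := (Submodule.span k {(1 : A)}).mkQ

/-- `Ā^{⊗n}`. -/
abbrev T (n : ℕ) : Type u := ⨂[k]^n (Abar k A)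

/-- `A ⊗ Ā^{⊗n}`. -/
abbrev X (n : ℕ) : Type u := A ⊗[k] T k A n

/-- The term `A ⊗ Ā^{⊗n} ⊗ A` of the normalized bar resolution. -/
abbrev Bar (n : ℕ) : Type u := (A ⊗[k] T k A n) ⊗[k] A

variable {k A}

/-- The class `ā₁ ⊗ ⋯ ⊗ āₙ` of a word. -/
def word {n : ℕ} (a : Fin n → A) : T k A n := PiTensorProduct.tprod k (fun i => proj k A (a i))

/-- Concatenation `Ā^{⊗m} ⊗ Ā^{⊗n} ≃ Ā^{⊗(m+n)}`. -/
def cat {m n r : ℕ} (h : m + n = r) : T k A m ⊗[k] T k A n ≃ₗ[k] T k A r :=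
  TensorPower.mulEquiv ≪≫ₗ TensorPower.cast k (Abar k A) h

/-- `Ā ≃ Ā^{⊗1}`. -/
def letter : Abar k A ≃ₗ[k] T k A 1 :=
  (PiTensorProduct.subsingletonEquiv (s := fun _ : Fin 1 => Abar k A) (0 : Fin 1)).symm

/-- `Ā^{⊗0} ≃ k`. -/
def empty : T k A 0 ≃ₗ[k] k := PiTensorProduct.isEmptyEquiv (Fin 0)

/-- `id^{⊗i} ⊗ h ⊗ id^{⊗l} : Ā^{⊗(i+a+l)} → Ā^{⊗(i+b+l)}`. -/
def slot {a b N N' : ℕ} (i l : ℕ) (hN : i + a + l = N) (hN' : i + b + l = N')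
    (h : T k A a →ₗ[k] T k A b) : T k A N →ₗ[k] T k A N' :=
  (cat hN').toLinearMap ∘ₗ
    TensorProduct.map
      ((cat rfl).toLinearMap ∘ₗ TensorProduct.map LinearMap.id h ∘ₗ (cat rfl).symm.toLinearMap)
      LinearMap.id ∘ₗ
    (cat hN).symm.toLinearMap

/-- `a₀ ⊗ w ⊗ w' ↦ a₀ ⊗ ww'`. -/
def appendX {p q s : ℕ} (h : p + q = s) : X k A p ⊗[k] T k A q →ₗ[k] X k A s :=
  TensorProduct.map LinearMap.id (cat h).toLinearMap ∘ₗ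
    (TensorProduct.assoc k A (T k A p) (T k A q)).toLinearMap

/-- `a₀ ⊗ w ↦ \overline{σ(a₀)} ⊗ w`. -/
def consBar (σ : A →ₗ[k] A) {p q : ℕ} (h : 1 + p = q) : X k A p →ₗ[k] T k A q :=
  (cat h).toLinearMap ∘ₗ
    TensorProduct.map (letter.toLinearMap ∘ₗ proj k A ∘ₗ σ) LinearMap.id

/-- `w ↦ w ⊗ x` for a letter `x`. -/
def snoc (x : Abar k A) {p q : ℕ} (h : p + 1 = q) : T k A p →ₗ[k] T k A q :=
  (cat h).toLinearMap ∘ₗ (TensorProduct.mk k (T k A p) (T k A 1)).flip (letter x)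

lemma cat_word {m n r : ℕ} (h : m + n = r) (a : Fin m → A) (b : Fin n → A) (c : Fin r → A)
    (ha : ∀ i : Fin m, c ⟨i, by omega⟩ = a i) (hb : ∀ i : Fin n, c ⟨m + i, by omega⟩ = b i) :
    cat h (word (k := k) a ⊗ₜ[k] word b) = word c := by
  subst h
  have hc : c = Fin.append a b := by
    funext j
    refine Fin.addCases (fun i => ?_) (fun i => ?_) j
    · rw [Fin.append_left, ← ha]; rfl
    · rw [Fin.append_right, ← hb]; rfl
  subst hc
  simp only [cat, word, LinearEquiv.trans_apply, TensorPower.cast_refl, LinearEquiv.refl_apply]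
  rw [← TensorPower.gMul_def, TensorPower.tprod_mul_tprod]
  congr 1
  funext j
  refine Fin.addCases (fun i => ?_) (fun i => ?_) j <;> simp

lemma letter_proj (x : A) (a : Fin 1 → A) (ha : a 0 = x) :
    letter (proj k A x) = word (k := k) a := by
  subst ha
  rw [letter, LinearEquiv.symm_apply_eq, word]
  exact (PiTensorProduct.subsingletonEquiv_apply_tprod (R := k) (s := fun _ : Fin 1 => Abar k A) 0
    fun i => proj k A (a i)).symm

lemma slot_word {r s : ℕ} (i : Fin r) (hN : (i : ℕ) + 2 + (r - 1 - i) = s)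
    (hN' : (i : ℕ) + 1 + (r - 1 - i) = r) (h : T k A 2 →ₗ[k] T k A 1)
    (c : Fin s → A) (z : A)
    (hz : h (word ![c ⟨i, by omega⟩, c ⟨i + 1, by omega⟩]) = word ![z]) (c' : Fin r → A)
    (h1 : ∀ j : Fin r, j < i → c' j = c ⟨j, by omega⟩) (h2 : c' i = z)
    (h3 : ∀ j : Fin r, i < j → c' j = c ⟨j + 1, by omega⟩) :
    slot (i : ℕ) (r - 1 - i) hN hN' h (word c) = word c' := by
  have e0 := cat_word (k := k) (rfl : (i : ℕ) + 2 = i + 2)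
    (fun j : Fin i => c ⟨j, by omega⟩) ![c ⟨i, by omega⟩, c ⟨i + 1, by omega⟩]
    (fun j : Fin (i + 2) => c ⟨j, by omega⟩) (fun _ => rfl)
    (fun j => by fin_cases j <;> rfl)
  have e1 := cat_word (k := k) hN (fun j : Fin (i + 2) => c ⟨j, by omega⟩)
    (fun j : Fin (r - 1 - i) => c ⟨i + 2 + j, by omega⟩) c (fun _ => rfl) (fun _ => rfl)
  have e2 := cat_word (k := k) (rfl : (i : ℕ) + 1 = i + 1)
    (fun j : Fin i => c ⟨j, by omega⟩) ![z]
    (fun j : Fin (i + 1) => c' ⟨j, by omega⟩) (fun j => h1 _ j.2)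
    (fun j => by fin_cases j; exact h2)
  have e3 := cat_word (k := k) hN' (fun j : Fin (i + 1) => c' ⟨j, by omega⟩)
    (fun j : Fin (r - 1 - i) => c ⟨i + 2 + j, by omega⟩) c' (fun _ => rfl)
    (fun j => by
      rw [h3 _ (by rw [Fin.lt_def]; simp only; omega)]
      congr 1
      ext
      simp only
      omega)
  rw [← e1, ← e3, ← e0, ← e2, ← hz]
  simp [slot]

end Words

/-! ## The normalized bar resolution -/

section BarResolution

variable (k A : Type u) [Field k] [Ring A] [Algebra k A]

lemma exists_sec : ∃ s : Abar k A →ₗ[k] A, proj k A ∘ₗ s = LinearMap.id :=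
  (proj k A).exists_rightInverse_of_surjective (Submodule.range_mkQ _)

/-- A choice of representatives `Ā → A`; the differential does not depend on it,
see `dbar_word`. -/
def sec : Abar k A →ₗ[k] A := (exists_sec k A).choose

/-- `ā ⊗ b̄ ↦ \overline{ab}` on the chosen representatives. -/
def mulBar : T k A 2 →ₗ[k] T k A 1 :=
  letter.toLinearMap ∘ₗ proj k A ∘ₗ LinearMap.mul' k A ∘ₗ
    TensorProduct.map (sec k A ∘ₗ letter.symm.toLinearMap) (sec k A ∘ₗ letter.symm.toLinearMap) ∘ₗ
    (cat (show 1 + 1 = 2 from rfl)).symm.toLinearMap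

variable {k A}

/-- `w ↦ d(1 ⊗ w ⊗ 1)`, that is
`a₁ ⊗ ā₂⋯āₛ ⊗ 1 + ∑ (-1)^i 1 ⊗ ā₁⋯\overline{aᵢaᵢ₊₁}⋯āₛ ⊗ 1 + (-1)^s 1 ⊗ ā₁⋯āₛ₋₁ ⊗ aₛ`,
where `s = r + 1`. -/
def dbar {r s : ℕ} (h : r + 1 = s) : T k A s →ₗ[k] Bar k A r :=
  (TensorProduct.mk k (X k A r) A).flip 1 ∘ₗ
      TensorProduct.map (sec k A ∘ₗ letter.symm.toLinearMap) LinearMap.id ∘ₗ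
      (cat (show 1 + r = s by omega)).symm.toLinearMap
    + ∑ i : Fin r, (-1 : k) ^ ((i : ℕ) + 1) •
      ((TensorProduct.mk k (X k A r) A).flip 1 ∘ₗ TensorProduct.mk k A (T k A r) 1 ∘ₗ
        slot (i : ℕ) (r - 1 - i) (by omega) (by omega) (mulBar k A))
    + (-1 : k) ^ s •
      (TensorProduct.map (TensorProduct.mk k A (T k A r) 1) (sec k A ∘ₗ letter.symm.toLinearMap) ∘ₗ
        (cat h).symm.toLinearMap)

lemma exists_sec_proj (x : A) : ∃ c : k, sec k A (proj k A x) = x + c • 1 := by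
  have h : proj k A (sec k A (proj k A x) - x) = 0 := by
    rw [map_sub, sub_eq_zero]
    exact LinearMap.congr_fun (exists_sec k A).choose_spec (proj k A x)
  rw [proj, Submodule.mkQ_apply, Submodule.Quotient.mk_eq_zero, Submodule.mem_span_singleton] at h
  obtain ⟨c, hc⟩ := h
  exact ⟨c, by rw [hc]; abel⟩

lemma mulBar_word (x y : A) :
    mulBar k A (word ![x, y]) =
      word ![sec k A (proj k A x) * sec k A (proj k A y)] := by
  have e := cat_word (k := k) (show 1 + 1 = 2 from rfl) ![x] ![y] ![x, y]
    (fun j => by fin_cases j; rfl) (fun j => by fin_cases j; rfl)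
  rw [← e, ← letter_proj x ![x] rfl, ← letter_proj y ![y] rfl, ← letter_proj _ ![_] rfl]
  simp [mulBar]

lemma word_contract {r : ℕ} (i : Fin r) (a : Fin (r + 1) → A) (z : A) (c₀ c₁ : k)
    (hz : ∃ c : k, z = a i.castSucc * a i.succ + c₀ • a i.succ + c₁ • a i.castSucc + c • 1) :
    word (k := k) (fun j : Fin r => if j < i then a j.castSucc else if j = i then z else a j.succ) =
      word (Fin.contractNth i.castSucc (· * ·) a) + c₀ • word (i.castSucc.removeNth a)
        + c₁ • word (i.succ.removeNth a) := by
  obtain ⟨c, hz⟩ := hz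
  have one : proj k A 1 = 0 := by
    rw [proj, Submodule.mkQ_apply, Submodule.Quotient.mk_eq_zero]
    exact Submodule.mem_span_singleton_self 1
  set w : Fin r → Abar k A := fun j => proj k A (if j < i then a j.castSucc else a j.succ) with hw
  have key : ∀ (b : Fin r → A), (∀ j, j < i → b j = a j.castSucc) → (∀ j, i < j → b j = a j.succ) →
      word (k := k) b = PiTensorProduct.tprod k (Function.update w i (proj k A (b i))) := by
    intro b h1 h2
    rw [word]
    congr 1
    funext j
    rcases lt_trichotomy j i with h | h | h
    · simp [Function.update_of_ne h.ne, hw, h, h1 j h]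
    · subst h; simp
    · simp [Function.update_of_ne h.ne', hw, h.not_gt, h2 j h]
  rw [key _ (fun j h => by simp [h]) (fun j h => by simp [h.not_gt, h.ne']),
    key (Fin.contractNth i.castSucc (· * ·) a)
      (fun j h => by rw [Fin.contractNth_apply_of_lt _ _ _ _ (by simpa using h)])
      (fun j h => by rw [Fin.contractNth_apply_of_gt _ _ _ _ (by simpa using h)]),
    key (i.castSucc.removeNth a)
      (fun j h => by
        rw [Fin.removeNth_apply, Fin.succAbove_of_castSucc_lt _ _ (by simpa using h)])
      (fun j h => by
        rw [Fin.removeNth_apply, Fin.succAbove_of_le_castSucc _ _ (by simpa using h.le)]),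
    key (i.succ.removeNth a)
      (fun j h => by
        rw [Fin.removeNth_apply, Fin.succAbove_of_castSucc_lt _ _
          (by rw [Fin.lt_def] at h ⊢; simp; omega)])
      (fun j h => by
        rw [Fin.removeNth_apply, Fin.succAbove_of_le_castSucc _ _
          (by rw [Fin.lt_def] at h; rw [Fin.le_def]; simp; omega)])]
  rw [Fin.contractNth_apply_of_eq _ _ _ _ (by simp), Fin.removeNth_apply, Fin.removeNth_apply,
    Fin.succAbove_of_le_castSucc _ _ (by simp),
    Fin.succAbove_of_castSucc_lt _ _ (by rw [Fin.lt_def]; simp)]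
  simp only [lt_irrefl, if_false, if_true, hz, map_add, map_smul, one, smul_zero, add_zero,
    MultilinearMap.map_update_add, MultilinearMap.map_update_smul]

lemma sum_telescope {M : Type u} [AddCommGroup M] [Module k M] {r : ℕ} (W : Fin (r + 1) → M) :
    ∑ i : Fin r, (-1 : k) ^ ((i : ℕ) + 1) • (W i.castSucc + W i.succ)
      = - W 0 + (-1 : k) ^ r • W (Fin.last r) := by
  induction r with
  | zero => simp
  | succ r ih =>
    rw [Fin.sum_univ_castSucc]
    have h := ih fun i => W i.castSucc
    simp only [Fin.val_castSucc, Fin.val_last, Fin.castSucc_zero, Fin.succ_last,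
      ← Fin.succ_castSucc] at h ⊢
    rw [h, pow_succ]
    module

lemma telescope_aux {M : Type u} [AddCommGroup M] [Module k M] (x y z u v w t : M) (r : ℕ)
    (h : u + v = - y + (-1 : k) ^ r • t) :
    x + y + (z + u + v) + (w + (-1 : k) ^ (r + 1) • t) = x + z + w := by
  have : x + y + (z + u + v) = x + y + (z + (u + v)) := by abel
  rw [this, h, pow_succ]
  module

/-- The formula for `d(1 ⊗ ā_{1,r+1} ⊗ 1)`, for arbitrary representatives. -/
lemma dbar_word {r : ℕ} (a : Fin (r + 1) → A) :
    dbar (k := k) (rfl : r + 1 = r + 1) (word a) =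
      (a 0 ⊗ₜ[k] word fun j => a j.succ) ⊗ₜ[k] (1 : A)
        + ∑ i : Fin r, (-1 : k) ^ ((i : ℕ) + 1) •
            ((1 : A) ⊗ₜ[k] word (Fin.contractNth i.castSucc (· * ·) a)) ⊗ₜ[k] (1 : A)
        + (-1 : k) ^ (r + 1) •
            ((1 : A) ⊗ₜ[k] word fun j => a j.castSucc) ⊗ₜ[k] a (Fin.last r) := by
  choose c hc using fun i => exists_sec_proj (k := k) (a i)
  have t1 : (cat (show 1 + r = r + 1 by omega)).symm (word (k := k) a) =
      letter (proj k A (a 0)) ⊗ₜ[k] word fun j => a j.succ := by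
    rw [LinearEquiv.symm_apply_eq, letter_proj (a 0) ![a 0] rfl]
    refine (cat_word _ _ _ _ (fun j => by fin_cases j; rfl) (fun j => ?_)).symm
    congr 1; ext; simp; omega
  have t3 : (cat (rfl : r + 1 = r + 1)).symm (word (k := k) a) =
      (word fun j => a j.castSucc) ⊗ₜ[k] letter (proj k A (a (Fin.last r))) := by
    rw [LinearEquiv.symm_apply_eq, letter_proj (a (Fin.last r)) ![a (Fin.last r)] rfl]
    exact (cat_word _ _ _ _ (fun j => rfl) (fun j => by fin_cases j; rfl)).symm
  have t2 : ∀ i : Fin r, slot (i : ℕ) (r - 1 - i) (by omega) (by omega) (mulBar k A)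
      (word (k := k) a) = word (Fin.contractNth i.castSucc (· * ·) a)
        + c i.castSucc • word (i.castSucc.removeNth a)
        + c i.succ • word (i.succ.removeNth a) := by
    intro i
    rw [← word_contract i a (sec k A (proj k A (a i.castSucc)) * sec k A (proj k A (a i.succ)))]
    · refine slot_word i _ _ _ a _ (mulBar_word _ _) _ (fun j h => ?_) ?_ (fun j h => ?_)
      · simp only [h, if_true]; rfl
      · simp; rfl
      · simp only [h.not_gt, h.ne', if_false]; rfl
    · refine ⟨c i.castSucc * c i.succ, ?_⟩
      rw [hc, hc]
      simp only [add_mul, mul_add, smul_mul_assoc, mul_smul_comm, one_mul, mul_one, mul_smul,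
        smul_add]
      rw [smul_comm (c i.succ)]
      abel
  have tele := sum_telescope (k := k)
    (fun i : Fin (r + 1) => (c i • ((1 : A) ⊗ₜ[k] word (i.removeNth a)) ⊗ₜ[k] (1 : A) : Bar k A r))
  have h0 : (fun j => a j.succ) = (0 : Fin (r + 1)).removeNth a := by
    funext j; simp [Fin.removeNth_apply]
  have hl : (fun j => a j.castSucc) = (Fin.last r).removeNth a := by
    funext j; simp [Fin.removeNth_apply]
  simp only [dbar, LinearMap.add_apply, LinearMap.comp_apply, LinearMap.sum_apply,
    LinearMap.smul_apply, LinearEquiv.coe_coe, t1, t2, t3, TensorProduct.map_tmul,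
    LinearEquiv.symm_apply_apply, hc, LinearMap.id_apply, LinearMap.flip_apply,
    TensorProduct.mk_apply, TensorProduct.add_tmul, TensorProduct.tmul_add,
    TensorProduct.tmul_smul, ← TensorProduct.smul_tmul', smul_add, Finset.sum_add_distrib, h0, hl]
  simp only [smul_add, Finset.sum_add_distrib] at tele
  exact telescope_aux _ _ _ _ _ _ _ r tele

variable (k A)

/-- The modules `A ⊗ Ā^{⊗(p-1)} ⊗ A`, read as `A` for `p = 0`. -/
def B : ℕ → Type u
  | 0 => A
  | p + 1 => Bar k A p

instance instAddCommGroupB : ∀ p, AddCommGroup (B k A p)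
  | 0 => inferInstanceAs (AddCommGroup A)
  | p + 1 => inferInstanceAs (AddCommGroup (Bar k A p))

instance instModuleB : ∀ p, Module k (B k A p)
  | 0 => inferInstanceAs (Module k A)
  | p + 1 => inferInstanceAs (Module k (Bar k A p))

/-- The bimodule structure `(a, x, b) ↦ a x b` of `A`. -/
def actA : A →ₗ[k] A →ₗ[k] A →ₗ[k] A :=
  (LinearMap.mul k A).compr₂ (LinearMap.mul k A)

/-- The bimodule structure `(a, x, b) ↦ a x b` of `A ⊗ Ā^{⊗r} ⊗ A`. -/
def actBar (r : ℕ) : A →ₗ[k] Bar k A r →ₗ[k] A →ₗ[k] Bar k A r :=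
  (LinearMap.rTensorHom A ∘ₗ LinearMap.rTensorHom (T k A r) ∘ₗ LinearMap.mul k A).compr₂
    (LinearMap.lTensorHom (X k A r) ∘ₗ (LinearMap.mul k A).flip).flip

/-- The bimodule structure `(a, x, b) ↦ a x b` of `B p`. -/
def actB : ∀ p, A →ₗ[k] B k A p →ₗ[k] A →ₗ[k] B k A p
  | 0 => actA k A
  | p + 1 => actBar k A p

variable {k A}

/-- For a linear map `f : Ā^{⊗r} → M`, the bimodule map `a ⊗ w ⊗ b ↦ a f(w) b`. -/
def bimoduleExt {M : Type u} [AddCommGroup M] [Module k M] (act : A →ₗ[k] M →ₗ[k] A →ₗ[k] M)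
    {r : ℕ} (f : T k A r →ₗ[k] M) : Bar k A r →ₗ[k] M :=
  TensorProduct.lift (TensorProduct.lift (act.compl₂ f))

/-- The differential `δ` of the normalized Hochschild cochain complex `Hom(Ā^{⊗r}, M)`. -/
def delta {M : Type u} [AddCommGroup M] [Module k M] (act : A →ₗ[k] M →ₗ[k] A →ₗ[k] M)
    {r s : ℕ} (h : r + 1 = s) : (T k A r →ₗ[k] M) →ₗ[k] (T k A s →ₗ[k] M) where
  toFun f := bimoduleExt act f ∘ₗ dbar h
  map_add' f g := by
    have : bimoduleExt act (f + g) = bimoduleExt act f + bimoduleExt act g := by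
      ext; simp [bimoduleExt]
    rw [this, LinearMap.add_comp]
  map_smul' c f := by
    have : bimoduleExt act (c • f) = c • bimoduleExt act f := by
      ext; simp [bimoduleExt]
    rw [this, LinearMap.smul_comp, RingHom.id_apply]

variable (k A)

/-- The differential `d_p : A ⊗ Ā^{⊗p} ⊗ A → A ⊗ Ā^{⊗(p-1)} ⊗ A`, where `d₀` is the
multiplication `A ⊗ A → A`. -/
def d : ∀ p, Bar k A p →ₗ[k] B k A p
  | 0 => LinearMap.mul' k A ∘ₗ
      TensorProduct.map ((TensorProduct.rid k A).toLinearMap ∘ₗ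
        TensorProduct.map LinearMap.id empty.toLinearMap) LinearMap.id
  | p + 1 => bimoduleExt (actBar k A p) (dbar (k := k) (A := A) (r := p) rfl)

/-- `Ω̄^p(A) = Im d_p`. -/
def Omega (p : ℕ) : Submodule k (B k A p) := LinearMap.range (d k A p)

/-- `x ↦ d_p(x ⊗ 1)` on `A ⊗ Ā^{⊗p}`. -/
def closeD (p : ℕ) : X k A p →ₗ[k] B k A p :=
  d k A p ∘ₗ (TensorProduct.mk k (X k A p) A).flip 1

/-- `π_p^{(r)} : A ⊗ Ā^{⊗(p-1)} ⊗ A → A ⊗ Ā^{⊗p}`, the identity of `A` for `p = 0`. -/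
def piR : ∀ p, B k A p →ₗ[k] X k A p
  | 0 => TensorProduct.map LinearMap.id empty.symm.toLinearMap ∘ₗ
      (TensorProduct.rid k A).symm.toLinearMap
  | p + 1 => appendX rfl ∘ₗ
      TensorProduct.map LinearMap.id (letter.toLinearMap ∘ₗ proj k A)

/-- `π_p^{(b)} : A ⊗ Ā^{⊗(p-1)} ⊗ A → Ā^{⊗(p+1)}`, the projection `A → Ā` for `p = 0`. -/
def piB (p : ℕ) : B k A p →ₗ[k] T k A (p + 1) :=
  consBar LinearMap.id (by omega) ∘ₗ piR k A p

end BarResolution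

/-! ## The groups `Ext^m(A, Ω̄^p(A))`, their colimit, and the bracket `[ , ]_sg` -/

section Singular

variable (k A : Type u) [Field k] [Ring A] [Algebra k A]

/-- The subquotient `Z / (B ∩ Z)`. -/
abbrev SubQuot {R V : Type u} [Field R] [AddCommGroup V] [Module R V] (Z B : Submodule R V) :
    Type u := Z ⧸ B.submoduleOf Z

/-- The class in `Z / (B ∩ Z)` of an element of `Z`. -/
def cls {R V : Type u} [Field R] [AddCommGroup V] [Module R V] (Z B : Submodule R V) :
    Z →ₗ[R] SubQuot Z B := (B.submoduleOf Z).mkQ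

/-- `C^m(A, Ω̄^p(A)) = Hom(Ā^{⊗m}, Ω̄^p(A))`. -/
def Coch (m p : ℕ) : Submodule k (T k A m →ₗ[k] B k A p) where
  carrier := {f | ∀ w, f w ∈ Omega k A p}
  add_mem' hf hg w := (Omega k A p).add_mem (hf w) (hg w)
  zero_mem' _ := (Omega k A p).zero_mem
  smul_mem' c _ hf w := (Omega k A p).smul_mem c (hf w)

/-- The cocycles in `C^m(A, Ω̄^p(A))`. -/
def ZExt (m p : ℕ) : Submodule k (T k A m →ₗ[k] B k A p) :=
  Coch k A m p ⊓ LinearMap.ker (delta (actB k A p) (rfl : m + 1 = m + 1))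

/-- The coboundaries in `C^m(A, Ω̄^p(A))`. -/
def BExt : ∀ m p : ℕ, Submodule k (T k A m →ₗ[k] B k A p)
  | 0, _ => ⊥
  | m + 1, p => (Coch k A m p).map (delta (actB k A p) (rfl : m + 1 = m + 1))

/-- `Ext^m_{A^e}(A, Ω̄^p(A))`, computed by the normalized Hochschild cochain complex. -/
def Ext (m p : ℕ) : Type u := SubQuot (ZExt k A m p) (BExt k A m p)

instance (m p : ℕ) : AddCommGroup (Ext k A m p) :=
  inferInstanceAs (AddCommGroup (SubQuot (ZExt k A m p) (BExt k A m p)))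

instance (m p : ℕ) : Module k (Ext k A m p) :=
  inferInstanceAs (Module k (SubQuot (ZExt k A m p) (BExt k A m p)))

/-- The class of a cocycle in `Ext^m(A, Ω̄^p(A))`. -/
def extClass (m p : ℕ) : ZExt k A m p →ₗ[k] Ext k A m p := cls (ZExt k A m p) (BExt k A m p)

variable {k A}

/-- `θ_{m,p}(f)(b̄_{1,m+1}) = (-1)^m d_{p+1}(f(b̄_{1,m}) ⊗ b̄_{m+1} ⊗ 1)`. -/
def theta (m p : ℕ) (f : T k A m →ₗ[k] B k A p) : T k A (m + 1) →ₗ[k] B k A (p + 1) :=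
  (-1 : k) ^ m • (closeD k A (p + 1) ∘ₗ appendX rfl ∘ₗ
    TensorProduct.map (piR k A p ∘ₗ f) LinearMap.id ∘ₗ (cat rfl).symm.toLinearMap)

/-- The transition maps of the inductive system `p ↦ Ext^{m+p}(A, Ω̄^p(A))`, on cochains
(`M = m + p`): `(-1)^{m+i} θ` for the least index `i = max(0,-m)` and `(-1)^m θ` for `p > i`. -/
def phi (m : ℤ) (M p : ℕ) (f : T k A M →ₗ[k] B k A p) : T k A (M + 1) →ₗ[k] B k A (p + 1) :=
  if p = (-m).toNat then (m + p).negOnePow • theta M p f else m.negOnePow • theta M p f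

variable (k A)

/-- The pairs `(M, p)` of natural numbers with `M = m + p`. -/
abbrev Lev (m : ℤ) : Type := {x : ℕ × ℕ // (x.1 : ℤ) = m + x.2}

open Classical in
/-- The submodule of `⨁_p Ext^{m+p}(A, Ω̄^p(A))` spanned by all `x - φ(x)`. -/
def sgRel (m : ℤ) : Submodule k (DirectSum (Lev m) fun x => Ext k A x.1.1 x.1.2) :=
  Submodule.span k
    {y | ∃ (M p : ℕ) (h : (M : ℤ) = m + p) (f : ZExt k A M p) (g : ZExt k A (M + 1) (p + 1)),
      g.1 = phi m M p f.1 ∧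
      y = DirectSum.lof k (Lev m) (fun x => Ext k A x.1.1 x.1.2) ⟨(M, p), h⟩ (extClass k A M p f)
        - DirectSum.lof k (Lev m) (fun x => Ext k A x.1.1 x.1.2)
            ⟨(M + 1, p + 1), by push_cast; omega⟩ (extClass k A (M + 1) (p + 1) g)}

/-- Tate–Hochschild cohomology of `A` in degree `m`, the colimit over `p` of
`Ext^{m+p}(A, Ω̄^p(A))` along the maps `φ`. -/
abbrev ExtSg (m : ℤ) : Type u :=
  (DirectSum (Lev m) fun x => Ext k A x.1.1 x.1.2) ⧸ sgRel k A m

open Classical in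
/-- The canonical map `Ext^M(A, Ω̄^p(A)) → ExtSg^m`, `M = m + p`. -/
def toSg (m : ℤ) (M p : ℕ) (h : (M : ℤ) = m + p) : Ext k A M p →ₗ[k] ExtSg k A m :=
  (sgRel k A m).mkQ ∘ₗ
    DirectSum.lof k (Lev m) (fun x => Ext k A x.1.1 x.1.2) ⟨(M, p), h⟩

variable {k A}

/-- `f •_{i+1} g`, `0 ≤ i < m`, for `f ∈ C^m(A, Ω̄^p)` and `g ∈ C^n(A, Ω̄^q)`,
where `r = m + n - 1` and `s = p + q`. -/
def bulletPos {m n p q r s : ℕ} (hr : r + 1 = m + n) (hs : p + q = s)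
    (f : T k A m →ₗ[k] B k A p) (g : T k A n →ₗ[k] B k A q) (i : Fin m) :
    T k A r →ₗ[k] B k A s :=
  closeD k A s ∘ₗ appendX hs ∘ₗ
    TensorProduct.map (piR k A p ∘ₗ f) LinearMap.id ∘ₗ
    (cat (rfl : m + q = m + q)).symm.toLinearMap ∘ₗ
    slot (i : ℕ) (m - 1 - i) (by omega) (by omega) (piB k A q ∘ₗ g)

/-- `f •_{-(j+1)} g`, `0 ≤ j < q`. -/
def bulletNeg {m n p q r s : ℕ} (hm : 1 ≤ m) (hr : r + 1 = m + n) (hs : p + q = s)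
    (f : T k A m →ₗ[k] B k A p) (g : T k A n →ₗ[k] B k A q) (j : Fin q) :
    T k A r →ₗ[k] B k A s :=
  closeD k A s ∘ₗ
    TensorProduct.map LinearMap.id
      (slot (j : ℕ) (q - 1 - j) (by omega) (by omega) (piB k A p ∘ₗ f)) ∘ₗ
    appendX (rfl : q + (m - 1) = q + (m - 1)) ∘ₗ
    TensorProduct.map (piR k A q ∘ₗ g) LinearMap.id ∘ₗ
    (cat (show n + (m - 1) = r by omega)).symm.toLinearMap

/-- `f • g = ∑_{i=1}^m (-1)^{p+q+(i-1)(q-n-1)} f •_i g + ∑_{j=1}^q (-1)^{p+q+j(p-m-1)} f •_{-j} g`. -/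
def bullet {m n p q r s : ℕ} (hm : 1 ≤ m) (hr : r + 1 = m + n) (hs : p + q = s)
    (f : T k A m →ₗ[k] B k A p) (g : T k A n →ₗ[k] B k A q) : T k A r →ₗ[k] B k A s :=
  ∑ i : Fin m, ((p : ℤ) + q + i * ((q : ℤ) - n - 1)).negOnePow • bulletPos hr hs f g i
    + ∑ j : Fin q, ((p : ℤ) + q + (j + 1) * ((p : ℤ) - m - 1)).negOnePow • bulletNeg hm hr hs f g j

/-- Wang's bracket `[f, g]_sg = f • g - (-1)^{(m-p-1)(n-q-1)} g • f` on cochains. -/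
def sgBracket {m n p q r s : ℕ} (hm : 1 ≤ m) (hn : 1 ≤ n) (hr : r + 1 = m + n) (hs : p + q = s)
    (f : T k A m →ₗ[k] B k A p) (g : T k A n →ₗ[k] B k A q) : T k A r →ₗ[k] B k A s :=
  bullet hm hr hs f g
    - (((m : ℤ) - p - 1) * ((n : ℤ) - q - 1)).negOnePow •
      bullet hn (hr.trans (Nat.add_comm m n)) ((Nat.add_comm q p).trans hs) g f

end Singular

/-! ## Frobenius algebras and the complete complex -/

/-- An associative non-degenerate bilinear form, making `A` a Frobenius algebra. -/
structure FrobeniusForm (k A : Type u) [Field k] [Ring A] [Algebra k A] where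
  form : LinearMap.BilinForm k A
  assoc : ∀ a b c : A, form (a * b) c = form a (b * c)
  nondegenerate : form.Nondegenerate

namespace FrobeniusForm

variable {k A : Type u} [Field k] [Ring A] [Algebra k A] (F : FrobeniusForm k A)

lemma eq_of_form_left {x y : A} (h : ∀ a, F.form x a = F.form y a) : x = y := by
  rw [← sub_eq_zero]
  refine F.nondegenerate.1 _ fun a => ?_
  rw [map_sub, LinearMap.sub_apply, h, sub_self]

lemma eq_of_form_right {x y : A} (h : ∀ a, F.form a x = F.form a y) : x = y := by
  rw [← sub_eq_zero]
  refine F.nondegenerate.2 _ fun a => ?_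
  rw [map_sub, h, sub_self]

variable [FiniteDimensional k A]

/-- A basis `(u_i)` of `A`. -/
def u (_ : FrobeniusForm k A) : Module.Basis (Fin (Module.finrank k A)) k A := Module.finBasis k A

/-- The dual basis: `⟨v_i, u_j⟩ = δ_ij`. -/
def v : Module.Basis (Fin (Module.finrank k A)) k A := F.form.dualBasis F.nondegenerate F.u

/-- The Nakayama automorphism `ν(x) = ∑ ⟨x, v_i⟩ u_i`. -/
def nakayama : A →ₗ[k] A := ∑ i, (F.form.flip (F.v i)).smulRight (F.u i)

/-- The inverse of the Nakayama automorphism, `ν⁻¹(x) = ∑ ⟨u_i, x⟩ v_i`. -/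
def nakayamaInv : A →ₗ[k] A := ∑ i, (F.form (F.u i)).smulRight (F.v i)

lemma form_v_u (i j) : F.form (F.v i) (F.u j) = if j = i then 1 else 0 :=
  LinearMap.BilinForm.apply_dualBasis_left _ _ _ _

lemma sum_form_u (x : A) : ∑ i, F.form x (F.u i) • F.v i = x := by
  conv_rhs => rw [← F.v.sum_repr x]
  refine Finset.sum_congr rfl fun i _ => ?_
  rw [v, LinearMap.BilinForm.dualBasis_repr_apply]

lemma form_v (x : A) (i) : F.form (F.v i) x = F.u.repr x i := by
  conv_lhs => rw [← F.u.sum_repr x]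
  simp only [map_sum, map_smul, form_v_u, smul_eq_mul]
  simp

lemma sum_form_v (x : A) : ∑ i, F.form (F.v i) x • F.u i = x := by
  conv_rhs => rw [← F.u.sum_repr x]
  exact Finset.sum_congr rfl fun i _ => by rw [form_v]

lemma nakayama_spec (a b : A) : F.form a b = F.form b (F.nakayama a) := by
  conv_lhs => rw [← F.sum_form_u b]
  simp only [map_sum, map_smul, nakayama, LinearMap.sum_apply, LinearMap.smulRight_apply,
    smul_eq_mul]
  exact Finset.sum_congr rfl fun i _ => mul_comm _ _

lemma nakayamaInv_spec (a b : A) : F.form (F.nakayamaInv b) a = F.form a b := by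
  conv_rhs => rw [← F.sum_form_v a]
  simp only [map_sum, map_smul, nakayamaInv, LinearMap.sum_apply, LinearMap.smulRight_apply,
    LinearMap.smul_apply, smul_eq_mul]
  exact Finset.sum_congr rfl fun i _ => mul_comm _ _

lemma nakayama_nakayamaInv (x : A) : F.nakayama (F.nakayamaInv x) = x :=
  F.eq_of_form_right fun a => by rw [← nakayama_spec, nakayamaInv_spec]

lemma nakayamaInv_nakayama (x : A) : F.nakayamaInv (F.nakayama x) = x :=
  F.eq_of_form_left fun a => by rw [nakayamaInv_spec, ← nakayama_spec]

lemma nakayama_mul (x y : A) : F.nakayama (x * y) = F.nakayama x * F.nakayama y :=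
  F.eq_of_form_right fun a => by
    rw [← nakayama_spec, F.assoc, nakayama_spec, F.assoc, nakayama_spec, F.assoc]

lemma nakayama_one : F.nakayama 1 = 1 :=
  F.eq_of_form_right fun a => by
    rw [← nakayama_spec]
    simpa using F.assoc 1 a 1 |>.symm

lemma nakayamaInv_one : F.nakayamaInv 1 = 1 := by
  simpa [F.nakayama_one] using F.nakayamaInv_nakayama 1

/-! ### The complex `𝒟^•(A, A)` -/

/-- `∑ u_i ν(a₀) ⊗ (w ⊗ v̄_i)` for `a₀ ⊗ w`. -/
def casimirSnoc (N : ℕ) : X k A N →ₗ[k] X k A (N + 1) :=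
  ∑ i, TensorProduct.map (LinearMap.mulLeft k (F.u i) ∘ₗ F.nakayama) (snoc (proj k A (F.v i)) rfl)

/-- The differential `∂` of the normalized Hochschild chain complex `C_r(A, A_{ν⁻¹}) = A ⊗ Ā^{⊗r}`:
if `d(1 ⊗ w ⊗ 1) = ∑ a ⊗ w' ⊗ b`, then `∂(a₀ ⊗ w) = ∑ b a₀ ν⁻¹(a) ⊗ w'`. -/
def partialD {r s : ℕ} (h : r + 1 = s) : X k A s →ₗ[k] X k A r :=
  TensorProduct.map (LinearMap.mul' k A) LinearMap.id ∘ₗ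
    (TensorProduct.assoc k A A (T k A r)).symm.toLinearMap ∘ₗ
    TensorProduct.map LinearMap.id
      (TensorProduct.map (LinearMap.mul' k A ∘ₗ TensorProduct.map LinearMap.id F.nakayamaInv)
          LinearMap.id ∘ₗ
        (TensorProduct.assoc k A A (T k A r)).symm.toLinearMap) ∘ₗ
    (TensorProduct.comm k (A ⊗[k] X k A r) A).toLinearMap ∘ₗ
    (TensorProduct.assoc k A (X k A r) A).symm.toLinearMap ∘ₗ
    TensorProduct.map LinearMap.id (dbar h)

/-- The map `μ(a) = ∑ u_i a v_i` from `C_0(A, A_{ν⁻¹}) = A` to `C^0(A, A) = A`. -/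
def mu : X k A 0 →ₗ[k] (T k A 0 →ₗ[k] A) :=
  LinearMap.smulRightₗ empty.toLinearMap ∘ₗ
    (∑ i, LinearMap.mulLeft k (F.u i) ∘ₗ LinearMap.mulRight k (F.v i)) ∘ₗ
    (TensorProduct.rid k A).toLinearMap ∘ₗ
    TensorProduct.map LinearMap.id empty.toLinearMap

/-- `𝒟^r(A, A)`: `C^r(A, A)` for `r ≥ 0` and `C_{-r-1}(A, A_{ν⁻¹})` for `r ≤ -1`. -/
def D (k A : Type u) [Field k] [Ring A] [Algebra k A] : ℤ → Type u
  | .ofNat r => T k A r →ₗ[k] A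
  | .negSucc r => X k A r

instance instAddCommGroupD : ∀ r, AddCommGroup (D k A r)
  | .ofNat r => inferInstanceAs (AddCommGroup (T k A r →ₗ[k] A))
  | .negSucc r => inferInstanceAs (AddCommGroup (X k A r))

instance instModuleD : ∀ r, Module k (D k A r)
  | .ofNat r => inferInstanceAs (Module k (T k A r →ₗ[k] A))
  | .negSucc r => inferInstanceAs (Module k (X k A r))

/-- The differential `𝒟^r → 𝒟^s`, `s = r + 1` (the last case does not occur). -/
def dhat : ∀ (r s : ℤ), r + 1 = s → D k A r →ₗ[k] D k A s
  | .ofNat _, .ofNat _, h => delta (actA k A) (by simpa using Int.ofNat_inj.1 h)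
  | .negSucc 0, .ofNat 0, _ => F.mu
  | .negSucc _, .negSucc _, h => F.partialD (by omega)
  | _, _, _ => 0

/-! ### The `⋆`-product -/

/-- The `⋆`-product `𝒟^r ⊗ 𝒟^s → 𝒟^t`, `t = r + s` (the last case does not occur). -/
def star : ∀ (r s t : ℤ), r + s = t → D k A r → D k A s → D k A t
  -- the cup product
  | .ofNat m, .ofNat n, .ofNat l, h => fun f g =>
      LinearMap.mul' k A ∘ₗ TensorProduct.map f g ∘ₗ
        (cat (show m + n = l by simpa using Int.ofNat_inj.1 h)).symm.toLinearMap
  -- `α ⋆ f = a₀ ν⁻¹(f(ā_{1,m})) ⊗ ā_{m+1,p}`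
  | .negSucc p, .ofNat m, .negSucc l, h => fun α f =>
      (TensorProduct.map (LinearMap.mul' k A ∘ₗ TensorProduct.map LinearMap.id (F.nakayamaInv ∘ₗ f))
          LinearMap.id ∘ₗ
        (TensorProduct.assoc k A (T k A m) (T k A l)).symm.toLinearMap ∘ₗ
        TensorProduct.map LinearMap.id
          (cat (show m + l = p by simp at h; omega)).symm.toLinearMap) α
  -- `f ⋆ α = f(ā_{p-m+1,p}) a₀ ⊗ ā_{1,p-m}`
  | .ofNat m, .negSucc p, .negSucc l, h => fun f α =>
      ((TensorProduct.comm k (T k A l) A).toLinearMap ∘ₗ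
        TensorProduct.map LinearMap.id (LinearMap.mul' k A) ∘ₗ
        (TensorProduct.assoc k (T k A l) A A).toLinearMap ∘ₗ
        (TensorProduct.comm k A (T k A l ⊗[k] A)).toLinearMap ∘ₗ
        TensorProduct.map LinearMap.id
          (TensorProduct.map LinearMap.id f ∘ₗ
            (cat (show l + m = p by simp at h; omega)).symm.toLinearMap)) α
  -- `(f ⋆ α)(b) = ∑ f(b ⊗ \overline{u_i ν(a₀)} ⊗ ā_{1,p}) v_i`
  | .ofNat m, .negSucc p, .ofNat l, h => fun f α =>
      ∑ i, LinearMap.mulRight k (F.v i) ∘ₗ f ∘ₗ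
        (cat (show l + (1 + p) = m by simp at h; omega)).toLinearMap ∘ₗ
        (TensorProduct.mk k (T k A l) (T k A (1 + p))).flip
          (consBar (LinearMap.mulLeft k (F.u i) ∘ₗ F.nakayama) rfl α)
  -- `(α ⋆ f)(b) = ∑ u_i ν(a₀) f(ā_{1,p} ⊗ v̄_i ⊗ b)`
  | .negSucc p, .ofNat m, .ofNat l, h => fun α f =>
      LinearMap.mul' k A ∘ₗ TensorProduct.map LinearMap.id f ∘ₗ
        appendX (show (p + 1) + l = m by simp at h; omega) ∘ₗ
        TensorProduct.mk k (X k A (p + 1)) (T k A l) (F.casimirSnoc p α)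
  -- `α ⋆ β = ∑ v_i b₀ ⊗ b_{1,q} ⊗ \overline{u_i ν(a₀)} ⊗ ā_{1,p}`
  | .negSucc p, .negSucc q, .negSucc l, h => fun α β =>
      ∑ i, appendX (show q + (1 + p) = l by omega)
        (TensorProduct.map (LinearMap.mulLeft k (F.v i)) LinearMap.id β ⊗ₜ[k]
          consBar (LinearMap.mulLeft k (F.u i) ∘ₗ F.nakayama) rfl α)
  | _, _, _, _ => fun _ _ => 0

/-! ### The operator `Δ̂` and the bracket `{ , }` -/

/-- The endomorphism of `Ā` induced by a linear map `σ` with `σ(1) = 1`. -/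
def barMap (σ : A →ₗ[k] A) (hσ : σ 1 = 1) : Abar k A →ₗ[k] Abar k A :=
  Submodule.mapQ _ _ σ (by
    rw [Submodule.span_singleton_le_iff_mem, Submodule.mem_comap, hσ]
    exact Submodule.mem_span_singleton_self 1)

/-- `a₀ ⊗ ā_{1,r} ↦ ∑_{i=1}^{r+1} (-1)^{ir} ā_{i,r} ⊗ ā₀ ⊗ \overline{σ(a₁)} ⊗ ⋯ ⊗ \overline{σ(a_{i-1})}`. -/
def connesWord (σ : A →ₗ[k] A) (hσ : σ 1 = 1) {r s : ℕ} (h : r + 1 = s) : X k A r →ₗ[k] T k A s :=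
  ∑ i : Fin (r + 1), (-1 : k) ^ (((i : ℕ) + 1) * r) •
    ((cat (show (r - i + 1) + (i : ℕ) = s by omega)).toLinearMap ∘ₗ
      (TensorProduct.comm k (T k A i) (T k A (r - i + 1))).toLinearMap ∘ₗ
      TensorProduct.map (PiTensorProduct.map fun _ => barMap σ hσ)
        ((cat rfl).toLinearMap ∘ₗ
          TensorProduct.map LinearMap.id (letter.toLinearMap ∘ₗ proj k A)) ∘ₗ
      (TensorProduct.assoc k (T k A i) (T k A (r - i)) A).toLinearMap ∘ₗ
      (TensorProduct.comm k A (T k A i ⊗[k] T k A (r - i))).toLinearMap ∘ₗ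
      TensorProduct.map LinearMap.id
        (cat (show (i : ℕ) + (r - i) = r by omega)).symm.toLinearMap)

/-- The twisted Connes operator `B^{ν⁻¹} : C_r(A, A_{ν⁻¹}) → C_{r+1}(A, A_{ν⁻¹})`. -/
def connes {r s : ℕ} (h : r + 1 = s) : X k A r →ₗ[k] X k A s :=
  TensorProduct.mk k A (T k A s) 1 ∘ₗ connesWord F.nakayamaInv F.nakayamaInv_one h

/-- The operator `Δ^ν : C^{r+1}(A, A) → C^r(A, A)` with
`⟨Δ^ν(f)(ā_{1,r}), a_{r+1}⟩ = ∑_{i=1}^{r+1} (-1)^{ir} ⟨f(ā_{i,r} ⊗ ā_{r+1} ⊗ ν ā_{1,i-1}), 1⟩`,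
written out by `y = ∑_j ⟨y, u_j⟩ v_j`. -/
def deltaNu {r s : ℕ} (h : r + 1 = s) : (T k A s →ₗ[k] A) →ₗ[k] (T k A r →ₗ[k] A) where
  toFun f := ∑ j, LinearMap.smulRight
    (F.form.flip 1 ∘ₗ f ∘ₗ connesWord F.nakayama F.nakayama_one h ∘ₗ
      TensorProduct.mk k A (T k A r) (F.u j)) (F.v j)
  map_add' f g := by
    ext; simp [add_smul, Finset.sum_add_distrib]
  map_smul' c f := by
    ext; simp [mul_smul, Finset.smul_sum]

lemma form_deltaNu {r s : ℕ} (h : r + 1 = s) (f : T k A s →ₗ[k] A) (w : T k A r) (a : A) :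
    F.form (F.deltaNu h f w) a =
      F.form (f (connesWord F.nakayama F.nakayama_one h (a ⊗ₜ[k] w))) 1 := by
  conv_rhs => rw [← F.sum_form_v a]
  simp [deltaNu, TensorProduct.sum_tmul, ← TensorProduct.smul_tmul', mul_comm]

/-- `Δ̂ : 𝒟^r → 𝒟^s`, `s = r - 1`: it is `Δ^ν` for `r ≥ 1`, zero for `r = 0` and
`(-1)^r B^{ν⁻¹}` for `r ≤ -1`. -/
def deltaHat : ∀ (r s : ℤ), s + 1 = r → D k A r →ₗ[k] D k A s
  | .ofNat _, .ofNat _, h => F.deltaNu (by simpa using Int.ofNat_inj.1 h)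
  | .negSucc r, .negSucc _, h => (Int.negSucc r).negOnePow • F.connes (by omega)
  | _, _, _ => 0

/-- `B^{ν⁻¹}` in the negative degrees of `𝒟`, zero in the others: `𝒟^r → 𝒟^s`, `s = r - 1`. -/
def connesHat : ∀ (r s : ℤ), s + 1 = r → D k A r →ₗ[k] D k A s
  | .negSucc _, .negSucc _, h => F.connes (by omega)
  | _, _, _ => 0

/-- `{α, β} = (-1)^{|α||β|+|α|+|β|} ((-1)^{|α|+1} Δ̂(α ⋆ β) + (-1)^{|α|} Δ̂(α) ⋆ β + α ⋆ Δ̂(β))`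
for `α ∈ 𝒟^r`, `β ∈ 𝒟^s`, with value in `𝒟^t`, `t = r + s - 1`. -/
def curly (r s t : ℤ) (h : r + s - 1 = t) (α : D k A r) (β : D k A s) : D k A t :=
  (r * s + r + s).negOnePow •
    ((r + 1).negOnePow • F.deltaHat (r + s) t (by omega) (F.star r s (r + s) rfl α β)
      + r.negOnePow • F.star (r - 1) s t (by omega) (F.deltaHat r (r - 1) (by omega) α) β
      + F.star r (s - 1) t (by omega) α (F.deltaHat s (s - 1) (by omega) β))

/-- The expression `(-1)^{|f||z|+|f|+|z|} ((-1)^{|z|+1} B^{ν⁻¹}(f ⋆ z) + (-1)^{|f|} Δ^ν(f) ⋆ z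
+ (-1)^{|z|} f ⋆ B^{ν⁻¹}(z))` for `f ∈ 𝒟^r`, `z ∈ 𝒟^s`, with value in `𝒟^t`, `t = r + s - 1`. -/
def curlyB (r s t : ℤ) (h : r + s - 1 = t) (f : D k A r) (z : D k A s) : D k A t :=
  (r * s + r + s).negOnePow •
    ((s + 1).negOnePow • F.connesHat (r + s) t (by omega) (F.star r s (r + s) rfl f z)
      + r.negOnePow • F.star (r - 1) s t (by omega) (F.deltaHat r (r - 1) (by omega) f) z
      + s.negOnePow • F.star r (s - 1) t (by omega) f (F.connesHat s (s - 1) (by omega) z))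

/-! ### The subcomplex `𝒟_(1)` and cohomology -/

/-- `𝒟_(1)^r(A, A)`: for `r ≥ 0` the cochains `f` with
`f(Ā_{μ₁} ⊗ ⋯ ⊗ Ā_{μ_r}) ⊆ A_{μ₁⋯μ_r}`, and for `r ≤ -1` the span of the subspaces
`A_{μ₀} ⊗ Ā_{μ₁} ⊗ ⋯ ⊗ Ā_{μ_{-r-1}}` with `μ₀ μ₁ ⋯ = 1`; here `A_μ` is the eigenspace of `ν`. -/
def D1 : ∀ r, Submodule k (D k A r)
  | .ofNat r =>
    { carrier := {f : T k A r →ₗ[k] A | ∀ (μ : Fin r → k) (a : Fin r → A),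
        (∀ i, a i ∈ Module.End.eigenspace F.nakayama (μ i)) →
          f (word a) ∈ Module.End.eigenspace F.nakayama (∏ i, μ i)}
      add_mem' := fun hf hg μ a ha => Submodule.add_mem _ (hf μ a ha) (hg μ a ha)
      zero_mem' := fun _ _ _ => Submodule.zero_mem _
      smul_mem' := fun c _ hf μ a ha => Submodule.smul_mem _ c (hf μ a ha) }
  | .negSucc r => Submodule.span k
      {x : X k A r | ∃ (μ₀ : k) (μ : Fin r → k) (a₀ : A) (a : Fin r → A),
        μ₀ * ∏ i, μ i = 1 ∧ a₀ ∈ Module.End.eigenspace F.nakayama μ₀ ∧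
        (∀ i, a i ∈ Module.End.eigenspace F.nakayama (μ i)) ∧ x = a₀ ⊗ₜ[k] word a}

/-- The cocycles of `𝒟^r`. -/
def Z (r : ℤ) : Submodule k (D k A r) := LinearMap.ker (F.dhat r (r + 1) rfl)

/-- The coboundaries of `𝒟^r`. -/
def Bd (r : ℤ) : Submodule k (D k A r) := LinearMap.range (F.dhat (r - 1) r (by omega))

/-- The cocycles of `𝒟_(1)^r`. -/
def Z1 (r : ℤ) : Submodule k (D k A r) := F.D1 r ⊓ F.Z r

/-- The coboundaries of `𝒟_(1)^r`. -/
def Bd1 (r : ℤ) : Submodule k (D k A r) := (F.D1 (r - 1)).map (F.dhat (r - 1) r (by omega))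

/-- The complete cohomology `ĤH^r(A)`. -/
abbrev HH (r : ℤ) : Type u := SubQuot (F.Z r) (F.Bd r)

/-- The class of a cocycle in `ĤH^r(A)`. -/
def clsHH (r : ℤ) : F.Z r →ₗ[k] F.HH r := cls (F.Z r) (F.Bd r)

/-- The complete cohomology `ĤH_(1)^r(A)`. -/
abbrev HH1 (r : ℤ) : Type u := SubQuot (F.Z1 r) (F.Bd1 r)

/-- The class of a cocycle in `ĤH_(1)^r(A)`. -/
def clsHH1 (r : ℤ) : F.Z1 r →ₗ[k] F.HH1 r := cls (F.Z1 r) (F.Bd1 r)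

/-! ### The maps `κ` -/

/-- `κ(a₀ ⊗ w)(b) = ∑ d_s(u_i ν(a₀) ⊗ w ⊗ v̄_i ⊗ b ⊗ 1)` for `a₀ ⊗ w ∈ A ⊗ Ā^{⊗N}` and
`b ∈ Ā^{⊗p}`, where `s = N + 1 + p`. -/
def kappaChain {N p s : ℕ} (h : N + 1 + p = s) : X k A N →ₗ[k] (T k A p →ₗ[k] B k A s) :=
  (TensorProduct.mk k (X k A (N + 1)) (T k A p)).compr₂ (closeD k A s ∘ₗ appendX h) ∘ₗ
    F.casimirSnoc N

/-- `κ_{-r-1,p} : 𝒟^r → C^p(A, Ω̄^s(A))` in negative degree `r`, where `s = p - r`. -/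
def kappa : ∀ (r : ℤ) (p s : ℕ), (p : ℤ) - r = s → D k A r →ₗ[k] (T k A p →ₗ[k] B k A s)
  | .negSucc _, _, _, h => F.kappaChain (by omega)
  | .ofNat _, _, _, _ => 0

/-- In degree `m ≥ 0`, an element of `𝒟^m` is a cochain in `C^m(A, A) = C^m(A, Ω̄^0(A))`. -/
def toCoch (m : ℕ) : D k A (m : ℤ) →ₗ[k] (T k A m →ₗ[k] B k A 0) :=
  (LinearMap.id : (T k A m →ₗ[k] A) →ₗ[k] (T k A m →ₗ[k] A))

end FrobeniusForm

/-! ## Maps induced on classes -/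

section Induced

variable {k V V₁ V₂ V₃ H H₁ H₂ H₃ : Type u} [Field k] [AddCommGroup V] [Module k V]
  [AddCommGroup V₁] [Module k V₁] [AddCommGroup V₂] [Module k V₂] [AddCommGroup V₃] [Module k V₃]
  [AddCommGroup H] [Module k H] [AddCommGroup H₁] [Module k H₁] [AddCommGroup H₂] [Module k H₂]
  [AddCommGroup H₃] [Module k H₃]

/-- The map `f` sends cocycles (elements of `Z`) to cocycles (elements of `Z₁`) and `φ` sends the
class `c z` of a cocycle `z` to the class of `f z`. -/
def Induces {Z : Submodule k V} (c : Z →ₗ[k] H) {Z₁ : Submodule k V₁} (c₁ : Z₁ →ₗ[k] H₁)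
    (f : V → V₁) (φ : H → H₁) : Prop :=
  ∀ z : Z, ∃ h : f z ∈ Z₁, φ (c z) = c₁ ⟨f z, h⟩

/-- The analogue of `Induces` for a product `f` of two arguments. -/
def Induces₂ {Z₁ : Submodule k V₁} (c₁ : Z₁ →ₗ[k] H₁) {Z₂ : Submodule k V₂} (c₂ : Z₂ →ₗ[k] H₂)
    {Z₃ : Submodule k V₃} (c₃ : Z₃ →ₗ[k] H₃) (f : V₁ → V₂ → V₃) (φ : H₁ → H₂ → H₃) : Prop :=
  ∀ (x : Z₁) (y : Z₂), ∃ h : f x y ∈ Z₃, φ (c₁ x) (c₂ y) = c₃ ⟨f x y, h⟩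

end Induced

end TateHochschild

end

open TateHochschild

noncomputable section

namespace TateHochschild

set_option maxSynthPendingDepth 3
set_option linter.unusedSectionVars false
set_option linter.unusedSimpArgs false

section WordCalculus

variable {k A : Type u} [Field k] [Ring A] [Algebra k A]

/-- The embedding of `Ā^{⊗n}` in the tensor algebra of `Ā`. -/
def emb (n : ℕ) : T k A n →ₗ[k] TensorAlgebra k (Abar k A) := TensorPower.toTensorAlgebra

lemma emb_injective (n : ℕ) : Function.Injective (emb (k := k) (A := A) n) := by
  intro x y h
  have key : ∀ z : T k A n, TensorAlgebra.toDirectSum (R := k) (emb (k := k) (A := A) n z) =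
      DirectSum.lof k ℕ (fun n => ⨂[k]^n (Abar k A)) n z := by
    intro z
    have : ((TensorAlgebra.toDirectSum (R := k) (M := Abar k A)).toLinearMap ∘ₗ
        emb (k := k) (A := A) n) = DirectSum.lof k ℕ (fun n => ⨂[k]^n (Abar k A)) n := by
      refine PiTensorProduct.ext (MultilinearMap.ext fun x => ?_)
      simp only [LinearMap.compMultilinearMap_apply, LinearMap.comp_apply, emb,
        TensorPower.toTensorAlgebra_tprod]
      exact TensorAlgebra.toDirectSum_tensorPower_tprod x
    exact LinearMap.congr_fun this z
  have h2 := congrArg (TensorAlgebra.toDirectSum (R := k)) h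
  rw [key, key] at h2
  exact DFinsupp.single_injective h2

lemma emb_cast {m n : ℕ} (h : m = n) (x : T k A m) :
    emb n (TensorPower.cast k (Abar k A) h x) = emb m x := by
  subst h; simp

@[simp]
lemma emb_cat {m n r : ℕ} (h : m + n = r) (x : T k A m) (y : T k A n) :
    emb r (cat h (x ⊗ₜ[k] y)) = emb m x * emb n y := by
  rw [cat, LinearEquiv.trans_apply, emb_cast]
  exact TensorPower.toTensorAlgebra_gMul x y

@[simp]
lemma emb_letter (x : Abar k A) : emb 1 (letter (k := k) x) = TensorAlgebra.ι k x := by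
  have : letter (k := k) x = PiTensorProduct.tprod k fun _ : Fin 1 => x := by
    rw [letter, LinearEquiv.symm_apply_eq]
    exact (PiTensorProduct.subsingletonEquiv_apply_tprod (R := k) (s := fun _ : Fin 1 => Abar k A) 0
      fun _ => x).symm
  rw [this, emb, TensorPower.toTensorAlgebra_tprod, TensorAlgebra.tprod_apply]
  simp

@[simp]
lemma emb_empty_symm (c : k) :
    emb 0 ((empty (k := k) (A := A)).symm c) = algebraMap k _ c := by
  have : (empty (k := k) (A := A)).symm c = c • PiTensorProduct.tprod k isEmptyElim := by
    rw [LinearEquiv.symm_apply_eq]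
    simp [empty]
  rw [this, map_smul, emb, TensorPower.toTensorAlgebra_tprod, TensorAlgebra.tprod_apply]
  simp [Algebra.algebraMap_eq_smul_one]

lemma emb_zero_eq (x : T k A 0) : emb 0 x = algebraMap k _ (empty x) := by
  rw [← emb_empty_symm, LinearEquiv.symm_apply_apply]

lemma ext_cat {M : Type*} [AddCommMonoid M] [Module k M] {a b r : ℕ} (h : a + b = r)
    {F G : T k A r →ₗ[k] M}
    (H : ∀ x y, F (cat h (x ⊗ₜ[k] y)) = G (cat h (x ⊗ₜ[k] y))) : F = G := by
  have : F ∘ₗ (cat h).toLinearMap = G ∘ₗ (cat h).toLinearMap := TensorProduct.ext' H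
  ext1
  ext x
  obtain ⟨y, hy⟩ := (cat h).surjective (PiTensorProduct.tprod k x)
  simp only [LinearMap.compMultilinearMap_apply, ← hy]
  exact LinearMap.congr_fun this y

lemma ext_cat3 {M : Type*} [AddCommMonoid M] [Module k M] {a b c s r : ℕ} (h : a + s = r)
    (h' : b + c = s) {F G : T k A r →ₗ[k] M}
    (H : ∀ x y z, F (cat h (x ⊗ₜ[k] cat h' (y ⊗ₜ[k] z))) =
      G (cat h (x ⊗ₜ[k] cat h' (y ⊗ₜ[k] z)))) : F = G := by
  refine ext_cat h fun x w => ?_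
  have : F ∘ₗ (cat h).toLinearMap ∘ₗ TensorProduct.mk k _ _ x =
      G ∘ₗ (cat h).toLinearMap ∘ₗ TensorProduct.mk k _ _ x := ext_cat h' fun y z => H x y z
  exact LinearMap.congr_fun this w

/-- An equation between linear expressions in a word holds if it holds for concatenations. -/
lemma cat_induction {a b r : ℕ} (h : a + b = r) {p : T k A r → Prop} (x : T k A r)
    (add : ∀ x y, p x → p y → p (x + y)) (zero : p 0) (H : ∀ x y, p (cat h (x ⊗ₜ[k] y))) : p x := by
  obtain ⟨y, rfl⟩ := (cat h).surjective x
  induction y with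
  | zero => simpa using zero
  | tmul x y => exact H x y
  | add x y hx hy => rw [map_add]; exact add _ _ hx hy

lemma cat_assoc {a b c s t r : ℕ} (h1 : s + c = r) (h2 : a + b = s) (h3 : a + t = r)
    (h4 : b + c = t) (x : T k A a) (y : T k A b) (z : T k A c) :
    cat h1 (cat h2 (x ⊗ₜ[k] y) ⊗ₜ[k] z) = cat h3 (x ⊗ₜ[k] cat h4 (y ⊗ₜ[k] z)) :=
  emb_injective _ (by simp [mul_assoc])

lemma cat_zero_left {n : ℕ} (h : 0 + n = n) (x : T k A 0) (y : T k A n) :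
    cat h (x ⊗ₜ[k] y) = empty x • y :=
  emb_injective _ (by simp [emb_zero_eq, Algebra.smul_def])

lemma cat_zero_right {n : ℕ} (h : n + 0 = n) (x : T k A 0) (y : T k A n) :
    cat h (y ⊗ₜ[k] x) = empty x • y :=
  emb_injective _ (by
    rw [emb_cat, emb_zero_eq, map_smul, Algebra.smul_def, Algebra.commutes])

/-- The empty word. -/
def nil : T k A 0 := empty.symm 1

@[simp] lemma emb_nil : emb 0 (nil (k := k) (A := A)) = 1 := by simp [nil]

@[simp] lemma empty_nil : empty (nil (k := k) (A := A)) = 1 := by simp [nil]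

lemma eq_smul_nil (x : T k A 0) : x = empty x • nil :=
  empty.injective (by simp)

lemma ext_nil {M : Type*} [AddCommMonoid M] [Module k M] {F G : T k A 0 →ₗ[k] M}
    (H : F nil = G nil) : F = G :=
  LinearMap.ext fun x => by rw [eq_smul_nil x, map_smul, map_smul, H]

@[simp] lemma cat_nil_left {n : ℕ} (h : 0 + n = n) (y : T k A n) :
    cat h (nil ⊗ₜ[k] y) = y := by simp [cat_zero_left]

@[simp] lemma cat_nil_right {n : ℕ} (h : n + 0 = n) (y : T k A n) :
    cat h (y ⊗ₜ[k] nil) = y := by simp [cat_zero_right]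

lemma slot_cat {i l a b s s' N N' : ℕ} (hN : i + a + l = N) (hN' : i + b + l = N')
    (h : T k A a →ₗ[k] T k A b) (h1 : i + s = N) (h2 : a + l = s) (h3 : i + s' = N')
    (h4 : b + l = s') (x : T k A i) (y : T k A a) (z : T k A l) :
    slot i l hN hN' h (cat h1 (x ⊗ₜ[k] cat h2 (y ⊗ₜ[k] z))) =
      cat h3 (x ⊗ₜ[k] cat h4 (h y ⊗ₜ[k] z)) := by
  rw [← cat_assoc hN rfl h1 h2, ← cat_assoc hN' rfl h3 h4]
  simp [slot]

lemma proj_one : proj k A 1 = 0 := by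
  rw [proj, Submodule.mkQ_apply, Submodule.Quotient.mk_eq_zero]
  exact Submodule.mem_span_singleton_self 1

lemma proj_sec (x : Abar k A) : proj k A (sec k A x) = x :=
  LinearMap.congr_fun (exists_sec k A).choose_spec x

@[simp]
lemma appendX_tmul {p q s : ℕ} (h : p + q = s) (a : A) (x : T k A p) (y : T k A q) :
    appendX h ((a ⊗ₜ[k] x) ⊗ₜ[k] y) = a ⊗ₜ[k] cat h (x ⊗ₜ[k] y) := rfl

@[simp]
lemma consBar_tmul (σ : A →ₗ[k] A) {p q : ℕ} (h : 1 + p = q) (a : A) (x : T k A p) :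
    consBar σ h (a ⊗ₜ[k] x) = cat h (letter (proj k A (σ a)) ⊗ₜ[k] x) := rfl

@[simp]
lemma snoc_apply (x : Abar k A) {p q : ℕ} (h : p + 1 = q) (w : T k A p) :
    snoc x h w = cat h (w ⊗ₜ[k] letter x) := rfl

lemma appendX_appendX {a b c s t r : ℕ} (h1 : s + c = r) (h2 : a + b = s) (h3 : a + t = r)
    (h4 : b + c = t) (x : X k A a) (y : T k A b) (z : T k A c) :
    appendX h1 (appendX h2 (x ⊗ₜ[k] y) ⊗ₜ[k] z) = appendX h3 (x ⊗ₜ[k] cat h4 (y ⊗ₜ[k] z)) := by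
  induction x using TensorProduct.induction_on with
  | zero => simp only [TensorProduct.tmul_zero, TensorProduct.zero_tmul, map_zero, LinearMap.zero_apply, smul_zero]
  | add x y hx hy => simp only [TensorProduct.add_tmul, map_add, hx, hy]
  | tmul a x => simp [cat_assoc h1 h2 h3 h4]

lemma consBar_appendX (σ : A →ₗ[k] A) {a b s t r : ℕ} (h1 : 1 + s = r) (h2 : a + b = s)
    (h3 : t + b = r) (h4 : 1 + a = t) (x : X k A a) (y : T k A b) :
    consBar σ h1 (appendX h2 (x ⊗ₜ[k] y)) = cat h3 (consBar σ h4 x ⊗ₜ[k] y) := by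
  induction x using TensorProduct.induction_on with
  | zero => simp only [TensorProduct.tmul_zero, TensorProduct.zero_tmul, map_zero, LinearMap.zero_apply, smul_zero]
  | add x y hx hy => simp only [TensorProduct.add_tmul, map_add, hx, hy]
  | tmul a x => simp [cat_assoc h3 h4 h1 h2]

end WordCalculus


section BarCalculus

variable {k A : Type u} [Field k] [Ring A] [Algebra k A]

/-- Right multiplication by `b` on `A ⊗ Ā^{⊗N} ⊗ A`. -/
def rm {N : ℕ} (b : A) : Bar k A N →ₗ[k] Bar k A N :=
  TensorProduct.map LinearMap.id (LinearMap.mulRight k b)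

@[simp] lemma rm_tmul {N : ℕ} (b c : A) (x : X k A N) :
    rm b (x ⊗ₜ[k] c) = x ⊗ₜ[k] (c * b) := rfl

@[simp] lemma smul_tmul_X {N : ℕ} (a b : A) (w : T k A N) :
    a • (b ⊗ₜ[k] w : X k A N) = (a * b) ⊗ₜ[k] w := rfl

@[simp] lemma smul_tmul_Bar {N : ℕ} (a b : A) (x : X k A N) :
    a • (x ⊗ₜ[k] b : Bar k A N) = (a • x) ⊗ₜ[k] b := rfl

lemma bar_induction {N : ℕ} {p : Bar k A N → Prop} (x : Bar k A N)
    (add : ∀ x y, p x → p y → p (x + y)) (zero : p 0)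
    (H : ∀ a w b, p ((a ⊗ₜ[k] w) ⊗ₜ[k] b)) : p x := by
  induction x using TensorProduct.induction_on with
  | zero => exact zero
  | add x y hx hy => exact add _ _ hx hy
  | tmul x b =>
    induction x using TensorProduct.induction_on with
    | zero => simpa using zero
    | add x y hx hy => rw [TensorProduct.add_tmul]; exact add _ _ hx hy
    | tmul a w => exact H a w b

/-- Left `A`-linear maps. -/
def IsL {N N' : ℕ} (G : Bar k A N →ₗ[k] Bar k A N') : Prop := ∀ (a : A) x, G (a • x) = a • G x

/-- Right `A`-linear maps. -/
def IsR {N N' : ℕ} (G : Bar k A N →ₗ[k] Bar k A N') : Prop := ∀ b x, G (rm b x) = rm b (G x)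

lemma smul_rm {N : ℕ} (a b : A) (x : Bar k A N) : rm b (a • x) = a • rm b x := by
  induction x using bar_induction with
  | add x y hx hy => simp only [smul_add, map_add, hx, hy]
  | zero => simp only [TensorProduct.tmul_zero, TensorProduct.zero_tmul, map_zero, LinearMap.zero_apply, smul_zero]
  | H c w d => rfl

lemma actBar_apply (r : ℕ) (a b : A) (x : Bar k A r) : actBar k A r a x b = a • rm b x := by
  induction x using bar_induction with
  | add x y hx hy => simp only [map_add, smul_add, LinearMap.add_apply, hx, hy]
  | zero => simp only [TensorProduct.tmul_zero, TensorProduct.zero_tmul, map_zero, LinearMap.zero_apply, smul_zero]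
  | H c w d => simp [actBar]

/-- The bimodule extension of a map `Ā^{⊗N} → A ⊗ Ā^{⊗N'}`, linear on both sides. -/
def lext {N N' : ℕ} (φ : T k A N →ₗ[k] X k A N') : Bar k A N →ₗ[k] Bar k A N' :=
  TensorProduct.map (TensorProduct.lift ((Algebra.lsmul k k (X k A N')).toLinearMap.compl₂ φ))
    LinearMap.id

@[simp] lemma lext_tmul {N N' : ℕ} (φ : T k A N →ₗ[k] X k A N') (a b : A) (w : T k A N) :
    lext φ ((a ⊗ₜ[k] w) ⊗ₜ[k] b) = (a • φ w) ⊗ₜ[k] b := rfl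

lemma isL_lext {N N' : ℕ} (φ : T k A N →ₗ[k] X k A N') : IsL (lext φ) := by
  intro a x
  induction x using bar_induction with
  | add x y hx hy => simp only [map_add, smul_add, hx, hy]
  | zero => simp only [TensorProduct.tmul_zero, TensorProduct.zero_tmul, map_zero, LinearMap.zero_apply, smul_zero]
  | H c w d => simp [mul_smul]

lemma isR_lext {N N' : ℕ} (φ : T k A N →ₗ[k] X k A N') : IsR (lext φ) := by
  intro a x
  induction x using bar_induction with
  | add x y hx hy => simp only [map_add, hx, hy]
  | zero => simp only [TensorProduct.tmul_zero, TensorProduct.zero_tmul, map_zero, LinearMap.zero_apply, smul_zero]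
  | H c w d => simp

/-- The left contraction `a ⊗ w ⊗ b ↦ 1 ⊗ āw ⊗ b`. -/
def hL {N N' : ℕ} (h : 1 + N = N') : Bar k A N →ₗ[k] Bar k A N' :=
  TensorProduct.map (TensorProduct.mk k A _ 1 ∘ₗ consBar LinearMap.id h) LinearMap.id

@[simp] lemma hL_tmul {N N' : ℕ} (h : 1 + N = N') (x : X k A N) (b : A) :
    hL h (x ⊗ₜ[k] b) = ((1 : A) ⊗ₜ[k] consBar LinearMap.id h x) ⊗ₜ[k] b := rfl

lemma isR_hL {N N' : ℕ} (h : 1 + N = N') : IsR (hL (k := k) (A := A) h) := by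
  intro a x
  induction x using bar_induction with
  | add x y hx hy => simp only [map_add, hx, hy]
  | zero => simp only [TensorProduct.tmul_zero, TensorProduct.zero_tmul, map_zero, LinearMap.zero_apply, smul_zero]
  | H c w d => simp

/-- The right contraction `a ⊗ w ⊗ b ↦ a ⊗ wb̄ ⊗ 1`. -/
def hR {N N' : ℕ} (h : N + 1 = N') : Bar k A N →ₗ[k] Bar k A N' :=
  (TensorProduct.mk k (X k A N') A).flip 1 ∘ₗ appendX h ∘ₗ
    TensorProduct.map LinearMap.id (letter.toLinearMap ∘ₗ proj k A)

@[simp] lemma hR_tmul {N N' : ℕ} (h : N + 1 = N') (x : X k A N) (b : A) :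
    hR h (x ⊗ₜ[k] b) = appendX h (x ⊗ₜ[k] letter (proj k A b)) ⊗ₜ[k] 1 := rfl

lemma smul_appendX {p q s : ℕ} (h : p + q = s) (a : A) (x : X k A p) (y : T k A q) :
    appendX h ((a • x) ⊗ₜ[k] y) = a • appendX h (x ⊗ₜ[k] y) := by
  induction x using TensorProduct.induction_on with
  | zero => simp only [TensorProduct.tmul_zero, TensorProduct.zero_tmul, map_zero, LinearMap.zero_apply, smul_zero]
  | add x y hx hy => simp only [smul_add, TensorProduct.add_tmul, map_add, hx, hy]
  | tmul c w => simp

lemma isL_hR {N N' : ℕ} (h : N + 1 = N') : IsL (hR (k := k) (A := A) h) := by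
  intro a x
  induction x using bar_induction with
  | add x y hx hy => simp only [map_add, smul_add, hx, hy]
  | zero => simp only [TensorProduct.tmul_zero, TensorProduct.zero_tmul, map_zero, LinearMap.zero_apply, smul_zero]
  | H c w d => simp

lemma hL_hR {N N' N₁ N₂ : ℕ} (h : 1 + N = N') (h' : N' + 1 = N₂) (h1 : N + 1 = N₁)
    (h2 : 1 + N₁ = N₂) (x : Bar k A N) : hR h' (hL h x) = hL h2 (hR h1 x) := by
  induction x using bar_induction with
  | add x y hx hy => simp only [map_add, hx, hy]
  | zero => simp only [TensorProduct.tmul_zero, TensorProduct.zero_tmul, map_zero, LinearMap.zero_apply, smul_zero]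
  | H c w d => simp [cat_assoc h' h h2 h1]

/-- Left linear statements hold if they hold on the image of `hL`. -/
lemma hL_induction {N N' : ℕ} (h : 1 + N = N') {p : Bar k A N' → Prop} (x : Bar k A N')
    (add : ∀ x y, p x → p y → p (x + y)) (smul : ∀ (a : A) x, p x → p (a • x))
    (H : ∀ x, p (hL h x)) : p x := by
  induction x using bar_induction with
  | add x y hx hy => exact add _ _ hx hy
  | zero => simpa using H 0
  | H a w b =>
    induction w using cat_induction h with
    | add x y hx hy => rw [TensorProduct.tmul_add, TensorProduct.add_tmul]; exact add _ _ hx hy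
    | zero => simpa using H 0
    | H x y =>
      have : (a ⊗ₜ[k] cat h (x ⊗ₜ[k] y)) ⊗ₜ[k] b =
          a • hL h ((sec k A (letter.symm x) ⊗ₜ[k] y) ⊗ₜ[k] b) := by
        simp [proj_sec]
      rw [this]
      exact smul _ _ (H _)

lemma one_induction {N : ℕ} {p : Bar k A N → Prop} (x : Bar k A N)
    (add : ∀ x y, p x → p y → p (x + y)) (smul : ∀ (a : A) x, p x → p (a • x))
    (H : ∀ w b, p (((1 : A) ⊗ₜ[k] w) ⊗ₜ[k] b)) : p x := by
  induction x using bar_induction with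
  | add x y hx hy => exact add _ _ hx hy
  | zero => simpa using H 0 0
  | H a w b => simpa using smul a _ (H w b)

section Predicates

variable {N N' N'' : ℕ}

lemma IsL.comp {F : Bar k A N' →ₗ[k] Bar k A N''} {G : Bar k A N →ₗ[k] Bar k A N'} (hF : IsL F)
    (hG : IsL G) : IsL (F ∘ₗ G) := fun a x => by
  rw [LinearMap.comp_apply, LinearMap.comp_apply, hG, hF]

lemma IsR.comp {F : Bar k A N' →ₗ[k] Bar k A N''} {G : Bar k A N →ₗ[k] Bar k A N'} (hF : IsR F)
    (hG : IsR G) : IsR (F ∘ₗ G) := fun a x => by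
  rw [LinearMap.comp_apply, LinearMap.comp_apply, hG, hF]

end Predicates

/-! ### The differential -/

/-- The differential `A ⊗ Ā^{⊗s} ⊗ A → A ⊗ Ā^{⊗r} ⊗ A`, `s = r + 1`. -/
def dB {r s : ℕ} (h : r + 1 = s) : Bar k A s →ₗ[k] Bar k A r :=
  bimoduleExt (actBar k A r) (dbar h)

lemma dB_tmul {r s : ℕ} (h : r + 1 = s) (a b : A) (w : T k A s) :
    dB h ((a ⊗ₜ[k] w) ⊗ₜ[k] b) = a • rm b (dbar h w) := by
  rw [← actBar_apply]
  simp [dB, bimoduleExt]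

lemma rm_mul {N : ℕ} (a b : A) (x : Bar k A N) : rm (a * b) x = rm b (rm a x) := by
  induction x using bar_induction with
  | add x y hx hy => simp only [map_add, hx, hy]
  | zero => simp only [TensorProduct.tmul_zero, TensorProduct.zero_tmul, map_zero, LinearMap.zero_apply, smul_zero]
  | H c w d => simp [mul_assoc]

lemma isL_dB {r s : ℕ} (h : r + 1 = s) : IsL (dB (k := k) (A := A) h) := by
  intro a x
  induction x using bar_induction with
  | add x y hx hy => simp only [map_add, smul_add, hx, hy]
  | zero => simp only [TensorProduct.tmul_zero, TensorProduct.zero_tmul, map_zero, LinearMap.zero_apply, smul_zero]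
  | H c w d => simp [dB_tmul, mul_smul]

lemma isR_dB {r s : ℕ} (h : r + 1 = s) : IsR (dB (k := k) (A := A) h) := by
  intro a x
  induction x using bar_induction with
  | add x y hx hy => simp only [map_add, hx, hy]
  | zero => simp only [TensorProduct.tmul_zero, TensorProduct.zero_tmul, map_zero, LinearMap.zero_apply, smul_zero]
  | H c w d => simp [dB_tmul, rm_mul, smul_rm]

/-- The multiplication `A ⊗ A → A`. -/
def aug : Bar k A 0 →ₗ[k] A := d k A 0

@[simp] lemma aug_tmul (a b : A) (w : T k A 0) :
    aug ((a ⊗ₜ[k] w) ⊗ₜ[k] b) = empty w • (a * b) := by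
  have : aug ((a ⊗ₜ[k] w) ⊗ₜ[k] b) = (empty w • a) * b := rfl
  rw [this, smul_mul_assoc]

lemma slot_cons {i l a b N N' M M' : ℕ} (hN : i + a + l = N) (hN' : i + b + l = N')
    (hM : (i + 1) + a + l = M) (hM' : (i + 1) + b + l = M') (h1 : 1 + N = M) (h2 : 1 + N' = M')
    (h : T k A a →ₗ[k] T k A b) (c : T k A 1) (w : T k A N) :
    slot (i + 1) l hM hM' h (cat h1 (c ⊗ₜ[k] w)) = cat h2 (c ⊗ₜ[k] slot i l hN hN' h w) := by
  have e1 : i + (a + l) = N := by omega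
  have e2 : i + (b + l) = N' := by omega
  have e3 : (i + 1) + (a + l) = M := by omega
  have e4 : (i + 1) + (b + l) = M' := by omega
  induction w using cat_induction e1 with
  | add x y hx hy => simp only [TensorProduct.tmul_add, map_add, hx, hy]
  | zero => simp only [TensorProduct.tmul_zero, TensorProduct.zero_tmul, map_zero, LinearMap.zero_apply, smul_zero]
  | H x w =>
    induction w using cat_induction (rfl : a + l = a + l) with
    | add x y hx hy => simp only [TensorProduct.tmul_add, map_add, hx, hy]
    | zero => simp only [TensorProduct.tmul_zero, TensorProduct.zero_tmul, map_zero, LinearMap.zero_apply, smul_zero]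
    | H y z =>
      rw [slot_cat hN hN' h e1 rfl e2 rfl, ← cat_assoc e3 (Nat.add_comm 1 i) h1 e1,
        slot_cat hM hM' h e3 rfl e4 rfl, ← cat_assoc e4 (Nat.add_comm 1 i) h2 e2]

/-- `w ↦ a₁ ⊗ ā₂⋯` on chosen representatives. -/
def firstX {r s : ℕ} (h : 1 + r = s) : T k A s →ₗ[k] X k A r :=
  TensorProduct.map (sec k A ∘ₗ letter.symm.toLinearMap) LinearMap.id ∘ₗ (cat h).symm.toLinearMap

lemma slot_mulBar {r s t : ℕ} (hs : 1 + r = s) (ht : 1 + s = t) (h1 : 0 + 2 + r = t)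
    (h2 : 0 + 1 + r = s) (c : Abar k A) (w : T k A s) :
    slot 0 r h1 h2 (mulBar k A) (cat ht (letter c ⊗ₜ[k] w)) =
      consBar LinearMap.id hs (sec k A c • firstX hs w) := by
  induction w using cat_induction hs with
  | add x y hx hy => simp only [TensorProduct.tmul_add, map_add, smul_add, hx, hy]
  | zero => simp only [TensorProduct.tmul_zero, TensorProduct.zero_tmul, map_zero, LinearMap.zero_apply, smul_zero]
  | H x w =>
    obtain ⟨y, rfl⟩ := letter.surjective x
    have e1 : 2 + r = t := by omega
    have e2 : cat ht (letter c ⊗ₜ[k] cat hs (letter y ⊗ₜ[k] w)) =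
        cat (show 0 + t = t by omega) (nil ⊗ₜ[k] cat e1
          (cat (show 1 + 1 = 2 from rfl) (letter c ⊗ₜ[k] letter y) ⊗ₜ[k] w)) := by
      rw [cat_nil_left, cat_assoc e1 rfl ht hs]
    rw [e2, slot_cat h1 h2 (mulBar k A) (by omega) e1 (show 0 + s = s by omega) hs, cat_nil_left]
    simp [firstX, mulBar]

lemma dbar_cons {r s t : ℕ} (hs : r + 1 = s) (ht : s + 1 = t) (h1 : 1 + s = t) (h2 : 1 + r = s)
    (c : Abar k A) (w : T k A s) :
    dbar ht (cat h1 (letter c ⊗ₜ[k] w)) =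
      (sec k A c ⊗ₜ[k] w) ⊗ₜ[k] 1 - hL h2 (sec k A c • dbar hs w) := by
  subst hs
  have last : ∀ w : T k A (r + 1),
      (TensorProduct.map (TensorProduct.mk k A (T k A (r + 1)) 1)
        (sec k A ∘ₗ letter.symm.toLinearMap) ∘ₗ (cat ht).symm.toLinearMap)
          (cat h1 (letter c ⊗ₜ[k] w)) =
      hL h2 (sec k A c • (TensorProduct.map (TensorProduct.mk k A (T k A r) 1)
        (sec k A ∘ₗ letter.symm.toLinearMap) ∘ₗ (cat (rfl : r + 1 = r + 1)).symm.toLinearMap) w) := by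
    intro w
    induction w using cat_induction (rfl : r + 1 = r + 1) with
    | add x y hx hy => simp only [TensorProduct.tmul_add, map_add, smul_add, hx, hy]
    | zero => simp only [TensorProduct.tmul_zero, TensorProduct.zero_tmul, map_zero, LinearMap.zero_apply, smul_zero]
    | H x y =>
      rw [← cat_assoc ht h2 h1 rfl]
      simp [proj_sec]
  have first : ∀ w : T k A (r + 1), dbar rfl w =
      firstX h2 w ⊗ₜ[k] 1 + (∑ i : Fin r, (-1 : k) ^ ((i : ℕ) + 1) •
        (((1 : A) ⊗ₜ[k] slot (i : ℕ) (r - 1 - i) (by omega) (by omega) (mulBar k A) w)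
          ⊗ₜ[k] (1 : A)))
      + (-1 : k) ^ (r + 1) • (TensorProduct.map (TensorProduct.mk k A (T k A r) 1)
        (sec k A ∘ₗ letter.symm.toLinearMap) ∘ₗ (cat (rfl : r + 1 = r + 1)).symm.toLinearMap) w := by
    intro w
    simp [dbar, firstX]
  set Q : Bar k A r →ₗ[k] Bar k A (r + 1) :=
    hL h2 ∘ₗ (Algebra.lsmul k k (Bar k A r) (sec k A c)) with hQ
  have hQ' : ∀ x, hL h2 (sec k A c • x) = Q x := fun _ => rfl
  rw [hQ'] at *
  simp only [hQ'] at last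
  rw [first, map_add, map_add, map_smul Q, map_sum, ← last]
  have e : ∀ j : Fin r, slot ((j : ℕ) + 1) (r + 1 - 1 - (j + 1)) (by omega) (by omega) (mulBar k A)
      (cat h1 (letter c ⊗ₜ[k] w)) = cat h2 (letter c ⊗ₜ[k]
        slot (j : ℕ) (r - 1 - j) (by omega) (by omega) (mulBar k A) w) := by
    intro j
    have : r + 1 - 1 - (j + 1) = r - 1 - j := by omega
    simp only [this]
    exact slot_cons _ _ _ _ _ _ _ _ _
  have e0 : (1 : A) ⊗ₜ[k] slot 0 (r + 1 - 1 - 0) (by omega) (by omega) (mulBar k A)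
      (cat h1 (letter c ⊗ₜ[k] w)) ⊗ₜ[k] (1 : A) = Q (firstX h2 w ⊗ₜ[k] 1) := by
    rw [← hQ', smul_tmul_Bar, hL_tmul]
    exact congrArg (fun x => ((1 : A) ⊗ₜ[k] x) ⊗ₜ[k] (1 : A)) (slot_mulBar h2 h1 _ _ c w)
  have e1 : ∀ j : Fin r, Q ((-1 : k) ^ ((j : ℕ) + 1) •
        (((1 : A) ⊗ₜ[k] slot (j : ℕ) (r - 1 - j) (by omega) (by omega) (mulBar k A) w)
          ⊗ₜ[k] (1 : A))) = (-1 : k) ^ ((j : ℕ) + 1) •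
        (((1 : A) ⊗ₜ[k] slot ((j : ℕ) + 1) (r + 1 - 1 - (j + 1)) (by omega) (by omega) (mulBar k A)
          (cat h1 (letter c ⊗ₜ[k] w))) ⊗ₜ[k] (1 : A)) := by
    intro j
    rw [map_smul, e, ← hQ', smul_tmul_Bar, hL_tmul, smul_tmul_X, consBar_tmul, mul_one,
      LinearMap.id_apply, proj_sec]
  rw [Finset.sum_congr rfl fun j _ => e1 j, ← e0]
  have : dbar ht (cat h1 (letter c ⊗ₜ[k] w)) = (sec k A c ⊗ₜ[k] w) ⊗ₜ[k] 1
      + (∑ i : Fin (r + 1), (-1 : k) ^ ((i : ℕ) + 1) •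
        (((1 : A) ⊗ₜ[k] slot (i : ℕ) (r + 1 - 1 - i) (by omega) (by omega) (mulBar k A)
          (cat h1 (letter c ⊗ₜ[k] w))) ⊗ₜ[k] (1 : A)))
      + (-1 : k) ^ t • (TensorProduct.map (TensorProduct.mk k A (T k A (r + 1)) 1)
        (sec k A ∘ₗ letter.symm.toLinearMap) ∘ₗ (cat ht).symm.toLinearMap)
          (cat h1 (letter c ⊗ₜ[k] w)) := by
    simp [dbar]
  have ht' : (-1 : k) ^ t = - (-1 : k) ^ (r + 1) := by rw [← ht]; ring
  rw [this, Fin.sum_univ_succ, ht']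
  simp only [neg_smul, Fin.val_zero, Fin.val_succ, pow_succ _ (_ + 1), mul_neg_one, zero_add,
    pow_one, Finset.sum_neg_distrib, one_smul]
  abel

lemma dbar_letter {t : ℕ} (ht : 0 + 1 = t) (h1 : 1 + 0 = t) (c : Abar k A) (w : T k A 0) :
    dbar ht (cat h1 (letter c ⊗ₜ[k] w)) =
      (sec k A c ⊗ₜ[k] w) ⊗ₜ[k] 1 - ((1 : A) ⊗ₜ[k] w) ⊗ₜ[k] sec k A c := by
  subst ht
  have : cat h1 (letter c ⊗ₜ[k] w) = cat (rfl : 0 + 1 = 1) (w ⊗ₜ[k] letter c) :=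
    emb_injective _ (by simp [emb_zero_eq, Algebra.commutes])
  simp only [dbar, LinearMap.add_apply, LinearMap.comp_apply, LinearEquiv.coe_coe,
    LinearEquiv.symm_apply_apply, LinearMap.smul_apply]
  rw [this]
  simp [sub_eq_add_neg]

lemma hL_one {N N' : ℕ} (h : 1 + N = N') (w : T k A N) (b : A) :
    hL h (((1 : A) ⊗ₜ[k] w) ⊗ₜ[k] b) = 0 := by
  simp [proj_one]

lemma hL_hL {N N' N₂ : ℕ} (h : 1 + N = N') (h' : 1 + N' = N₂) (x : Bar k A N) :
    hL h' (hL h x) = 0 := by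
  induction x using bar_induction with
  | add x y hx hy => simp only [map_add, hx, hy, add_zero]
  | zero => simp only [TensorProduct.tmul_zero, TensorProduct.zero_tmul, map_zero, LinearMap.zero_apply, smul_zero]
  | H a w b => rw [hL_tmul, hL_one]

lemma hL_smul_one {N N' : ℕ} (h : 1 + N = N') (a : A) (w : T k A N) (b : A) :
    hL h (((a : A) ⊗ₜ[k] w) ⊗ₜ[k] b) = ((1 : A) ⊗ₜ[k] cat h (letter (proj k A a) ⊗ₜ[k] w)) ⊗ₜ[k] b :=
  rfl

lemma hL_dbar {r s : ℕ} (hs : r + 1 = s) (h : 1 + r = s) (w : T k A s) :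
    hL h (dbar hs w) = ((1 : A) ⊗ₜ[k] w) ⊗ₜ[k] 1 := by
  induction w using cat_induction h with
  | add x y hx hy => simp only [map_add, hx, hy, TensorProduct.tmul_add, TensorProduct.add_tmul]
  | zero => simp only [TensorProduct.tmul_zero, TensorProduct.zero_tmul, map_zero, LinearMap.zero_apply, smul_zero]
  | H c w =>
    obtain ⟨c, rfl⟩ := letter.surjective c
    cases r with
    | zero =>
      rw [dbar_letter, map_sub, hL_one, hL_smul_one, proj_sec, sub_zero]
    | succ r =>
      rw [dbar_cons rfl hs h (by omega), map_sub, hL_hL, hL_smul_one, proj_sec, sub_zero]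

lemma dB_hL {r s t : ℕ} (hs : r + 1 = s) (ht : s + 1 = t) (h1 : 1 + s = t) (h2 : 1 + r = s)
    (x : Bar k A s) : dB ht (hL h1 x) = x - hL h2 (dB hs x) := by
  induction x using bar_induction with
  | add x y hx hy => simp only [map_add, hx, hy]; abel
  | zero => simp
  | H a w b =>
    obtain ⟨c, hc⟩ := exists_sec_proj (k := k) a
    rw [hL_smul_one, dB_tmul, dbar_cons hs ht h1 h2, hc, one_smul, dB_tmul]
    have h3 : hL h2 ((a + c • (1 : A)) • dbar hs w) =
        hL h2 (a • dbar hs w) + c • ((1 : A) ⊗ₜ[k] w) ⊗ₜ[k] (1 : A) := by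
      rw [add_smul, map_add, smul_assoc, one_smul, LinearMap.map_smul, hL_dbar]
    rw [h3, map_sub, map_add, ← isR_hL, smul_rm, TensorProduct.add_tmul, TensorProduct.add_tmul,
      map_add, LinearMap.map_smul]
    simp only [rm_tmul, one_mul, ← TensorProduct.smul_tmul', LinearMap.map_smul]
    abel

lemma dB_hL_zero {t : ℕ} (ht : 0 + 1 = t) (h1 : 1 + 0 = t) (x : Bar k A 0) :
    dB ht (hL h1 x) = x - ((1 : A) ⊗ₜ[k] nil) ⊗ₜ[k] aug x := by
  induction x using bar_induction with
  | add x y hx hy => simp only [map_add, hx, hy, TensorProduct.tmul_add]; abel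
  | zero => simp
  | H a w b =>
    obtain ⟨c, hc⟩ := exists_sec_proj (k := k) a
    rw [eq_smul_nil w]
    simp only [TensorProduct.tmul_smul, ← TensorProduct.smul_tmul', map_smul, ← smul_sub]
    rw [hL_smul_one, dB_tmul, dbar_letter, hc, one_smul, aug_tmul]
    simp [TensorProduct.add_tmul, TensorProduct.tmul_add, ← TensorProduct.smul_tmul',
      TensorProduct.tmul_smul]

lemma aug_smul (a : A) (x : Bar k A 0) : aug (a • x) = a * aug x := by
  induction x using bar_induction with
  | add x y hx hy => simp only [map_add, smul_add, hx, hy, mul_add]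
  | zero => simp
  | H c w d => simp [mul_assoc]

lemma aug_rm (b : A) (x : Bar k A 0) : aug (rm b x) = aug x * b := by
  induction x using bar_induction with
  | add x y hx hy => simp only [map_add, hx, hy, add_mul]
  | zero => simp
  | H c w d => simp [mul_assoc]

lemma aug_dB {t : ℕ} (ht : 0 + 1 = t) (x : Bar k A t) : aug (dB ht x) = 0 := by
  induction x using hL_induction (show 1 + 0 = t by omega) with
  | add x y hx hy => rw [map_add, map_add, hx, hy, add_zero]
  | smul a x hx => rw [isL_dB, aug_smul, hx, mul_zero]
  | H x => rw [dB_hL_zero]; simp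

lemma dB_dB {r s t : ℕ} (hs : r + 1 = s) (ht : s + 1 = t) (x : Bar k A t) :
    dB hs (dB ht x) = 0 := by
  induction r generalizing s t with
  | zero =>
    induction x using hL_induction (show 1 + s = t by omega) with
    | add x y hx hy => rw [map_add, map_add, hx, hy, add_zero]
    | smul a x hx => rw [isL_dB, isL_dB, hx, smul_zero]
    | H x => rw [dB_hL hs _ _ (by omega), map_sub, dB_hL_zero, aug_dB]; simp
  | succ r ih =>
    induction x using hL_induction (show 1 + s = t by omega) with
    | add x y hx hy => rw [map_add, map_add, hx, hy, add_zero]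
    | smul a x hx => rw [isL_dB, isL_dB, hx, smul_zero]
    | H x => rw [dB_hL hs _ _ (by omega), map_sub, dB_hL rfl _ _ (by omega), ih]; simp

lemma dB_hR_zero {t : ℕ} (ht : 0 + 1 = t) (x : Bar k A 0) :
    dB ht (hR ht x) = (aug x ⊗ₜ[k] nil) ⊗ₜ[k] 1 - x := by
  induction x using bar_induction with
  | add x y hx hy => simp only [map_add, hx, hy, TensorProduct.add_tmul]; abel
  | zero => simp
  | H a w b =>
    obtain ⟨c, hc⟩ := exists_sec_proj (k := k) b
    rw [eq_smul_nil w]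
    simp only [TensorProduct.tmul_smul, ← TensorProduct.smul_tmul', map_smul, ← smul_sub]
    have : cat ht (nil ⊗ₜ[k] letter (proj k A b)) = cat (show 1 + 0 = t by omega)
      (letter (proj k A b) ⊗ₜ[k] nil) := emb_injective _ (by simp)
    rw [hR_tmul, appendX_tmul, this, dB_tmul, dbar_letter, hc, aug_tmul, map_sub, smul_sub]
    simp [TensorProduct.add_tmul, TensorProduct.tmul_add, ← TensorProduct.smul_tmul',
      TensorProduct.tmul_smul]

lemma dB_hR {r s t : ℕ} (hs : r + 1 = s) (ht : s + 1 = t) (x : Bar k A s) :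
    dB ht (hR ht x) = hR hs (dB hs x) - (-1 : k) ^ s • x := by
  induction r generalizing s t with
  | zero =>
    subst hs
    induction x using hL_induction (show 1 + 0 = 0 + 1 by omega) with
    | add x y hx hy => simp only [map_add, hx, hy, smul_add]; abel
    | smul a x hx => simp only [isL_dB _ a, isL_hR _ a, hx, smul_sub, smul_comm a]
    | H x =>
      rw [hL_hR (h1 := rfl) (h2 := by omega),
        dB_hL (rfl : 0 + 1 = 0 + 1) ht (by omega) (by omega), dB_hR_zero, map_sub, dB_hL_zero,
        map_sub, hL_smul_one, hR_tmul, appendX_tmul]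
      have : cat (rfl : 0 + 1 = 1) (nil ⊗ₜ[k] letter (proj k A (aug x))) =
        cat (rfl : 1 + 0 = 1) (letter (proj k A (aug x)) ⊗ₜ[k] nil) := emb_injective _ (by simp)
      rw [this]
      module
  | succ r ih =>
    subst hs
    induction x using hL_induction (show 1 + (r + 1) = r + 1 + 1 by omega) with
    | add x y hx hy => simp only [map_add, hx, hy, smul_add]; abel
    | smul a x hx => simp only [isL_dB _ a, isL_hR _ a, hx, smul_sub, smul_comm a]
    | H x =>
      rw [hL_hR (h1 := rfl) (h2 := by omega), dB_hL (rfl : r + 1 + 1 = r + 1 + 1) ht (by omega) (by omega), ih rfl,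
        dB_hL rfl _ _ (by omega), map_sub, map_sub, hL_hR (h1 := rfl) (h2 := by omega),
        LinearMap.map_smul]
      module

lemma exists_dB_eq {r s t : ℕ} (hs : r + 1 = s) (ht : s + 1 = t) {x : Bar k A s}
    (hx : dB hs x = 0) : ∃ y, dB ht y = x :=
  ⟨hL (by omega) x, by rw [dB_hL hs _ _ (by omega), hx]; simp⟩

lemma exists_dB_eq_of_aug {t : ℕ} (ht : 0 + 1 = t) {x : Bar k A 0} (hx : aug x = 0) :
    ∃ y, dB ht y = x :=
  ⟨hL (by omega) x, by rw [dB_hL_zero, hx]; simp⟩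

end BarCalculus

section Operators

variable {k A : Type u} [Field k] [Ring A] [Algebra k A]

/-- The map `x ↦ x ⊗ 1`. -/
def cap {N : ℕ} : X k A N →ₗ[k] Bar k A N := (TensorProduct.mk k (X k A N) A).flip 1

lemma cap_apply {N : ℕ} (x : X k A N) : cap x = x ⊗ₜ[k] (1 : A) := rfl

lemma rm_cap {N : ℕ} (b : A) (x : X k A N) : rm b (cap x) = x ⊗ₜ[k] b := by
  simp [cap_apply]

lemma cap_injective (N : ℕ) : Function.Injective (cap (k := k) (A := A) (N := N)) := by
  rcases subsingleton_or_nontrivial A with hA | hA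
  · have : Subsingleton (X k A N) := Module.subsingleton A _
    exact Function.injective_of_subsingleton _
  · obtain ⟨l, hl⟩ := (LinearMap.toSpanSingleton k A 1).exists_leftInverse_of_injective
      (LinearMap.ker_eq_bot.2 fun a b h => by
        simpa [← Algebra.algebraMap_eq_smul_one] using h)
    have h1 : l 1 = 1 := by simpa using LinearMap.congr_fun hl 1
    intro x y h
    have := congrArg (TensorProduct.rid k _ ∘ TensorProduct.map LinearMap.id l) h
    simpa [cap_apply, h1] using this

lemma hR_cap {N N' : ℕ} (h : N + 1 = N') (x : X k A N) : hR h (cap x) = 0 := by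
  simp [cap_apply, proj_one]

/-- Right linear statements hold if they hold on the image of `hR`. -/
lemma hR_induction {N N' : ℕ} (h : N + 1 = N') {p : Bar k A N' → Prop} (x : Bar k A N')
    (add : ∀ x y, p x → p y → p (x + y)) (rmul : ∀ (b : A) x, p x → p (rm b x))
    (H : ∀ x, p (hR h x)) : p x := by
  induction x using bar_induction with
  | add x y hx hy => exact add _ _ hx hy
  | zero => simpa using H 0
  | H a w b =>
    induction w using cat_induction h with
    | add x y hx hy => rw [TensorProduct.tmul_add, TensorProduct.add_tmul]; exact add _ _ hx hy
    | zero => simpa using H 0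
    | H x y =>
      have : (a ⊗ₜ[k] cat h (x ⊗ₜ[k] y)) ⊗ₜ[k] b =
          rm b (hR h ((a ⊗ₜ[k] x) ⊗ₜ[k] (sec k A (letter.symm y)))) := by
        simp [proj_sec]
      rw [this]
      exact rmul _ _ (H _)

lemma d_succ (p : ℕ) (x : Bar k A (p + 1)) : d k A (p + 1) x = dB rfl x := rfl

lemma d_zero (x : Bar k A 0) : d k A 0 x = aug x := rfl

lemma d_dB {p t : ℕ} (h : p + 1 = t) (x : Bar k A t) : d k A p (dB h x) = 0 := by
  cases p with
  | zero => exact aug_dB h x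
  | succ p => exact dB_dB rfl h x

lemma exists_dB {p t : ℕ} (h : p + 1 = t) {x : Bar k A p} (hx : d k A p x = 0) :
    ∃ y, dB h y = x := by
  cases p with
  | zero => exact exists_dB_eq_of_aug h hx
  | succ p => exact exists_dB_eq rfl h hx

lemma closeD_apply (p : ℕ) (x : X k A p) : closeD k A p x = d k A p (cap x) := rfl

lemma piR_succ (p : ℕ) (y : Bar k A p) : cap (piR k A (p + 1) y) = hR rfl y := rfl

lemma piR_zero (a : A) : piR k A 0 a = a ⊗ₜ[k] nil := rfl

/-- The right contraction of `d_p`. -/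
lemma dB_hR_eq {p t : ℕ} (h : p + 1 = t) (x : Bar k A p) :
    dB h (hR h x) = cap (piR k A p (d k A p x)) - (-1 : k) ^ p • x := by
  cases p with
  | zero => rw [dB_hR_zero, pow_zero, one_smul, d_zero, piR_zero]; rfl
  | succ p => rw [dB_hR rfl, d_succ, piR_succ]

lemma piR_closeD (p : ℕ) (x : X k A p) : piR k A p (closeD k A p x) = (-1 : k) ^ p • x := by
  apply cap_injective
  have := dB_hR_eq rfl (cap x)
  rw [hR_cap, map_zero, eq_comm, sub_eq_zero] at this
  rw [closeD_apply, this, LinearMap.map_smul]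

lemma closeD_piR_d (p : ℕ) (y : Bar k A p) :
    closeD k A p (piR k A p (d k A p y)) = (-1 : k) ^ p • d k A p y := by
  have := congrArg (d k A p) (dB_hR_eq rfl y)
  rw [d_dB, map_sub, eq_comm, sub_eq_zero] at this
  rw [closeD_apply, this, LinearMap.map_smul]

lemma neg_one_pow_mul_self (p : ℕ) : (-1 : k) ^ p * (-1 : k) ^ p = 1 := by
  rw [← mul_pow]; simp

/-! ### The operators `λ`, `ψ`, `ρ` attached to a map `Ā^{⊗m} → A ⊗ Ā^{⊗p}` -/

/-- Application of `x` to the first `m` letters. -/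
def lam {m p l N N' : ℕ} (x : T k A m →ₗ[k] X k A p) (h : m + l = N) (h' : p + l = N') :
    Bar k A N →ₗ[k] Bar k A N' :=
  lext (appendX h' ∘ₗ TensorProduct.map x LinearMap.id ∘ₗ (cat h).symm.toLinearMap)

section lam

variable {m p l N N' : ℕ} (x : T k A m →ₗ[k] X k A p) (h : m + l = N) (h' : p + l = N')

lemma isL_lam : IsL (lam x h h') := isL_lext _

lemma isR_lam : IsR (lam x h h') := isR_lext _

@[simp] lemma lam_tmul (a b : A) (w : T k A m) (w' : T k A l) :
    lam x h h' ((a ⊗ₜ[k] cat h (w ⊗ₜ[k] w')) ⊗ₜ[k] b) =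
      (a • appendX h' (x w ⊗ₜ[k] w')) ⊗ₜ[k] b := by
  simp [lam]

lemma lam_cap_one (w : T k A m) (h : m + 0 = m) (h' : p + 0 = p) (a b : A) :
    lam x h h' ((a ⊗ₜ[k] w) ⊗ₜ[k] b) = (a • x w) ⊗ₜ[k] b := by
  have : w = cat h (w ⊗ₜ[k] nil) := by simp
  rw [this, lam_tmul, ← this]
  congr 2
  induction x w using TensorProduct.induction_on with
  | zero => simp only [TensorProduct.tmul_zero, TensorProduct.zero_tmul, map_zero, LinearMap.zero_apply, smul_zero]
  | add x y hx hy => simp only [TensorProduct.add_tmul, map_add, hx, hy]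
  | tmul a x => simp

lemma lam_hR {l' N₁ N₁' : ℕ} (h₁ : m + l' = N₁) (h₁' : p + l' = N₁') (hl : l + 1 = l')
    (hN : N + 1 = N₁) (hN' : N' + 1 = N₁') (y : Bar k A N) :
    lam x h₁ h₁' (hR hN y) = hR hN' (lam x h h' y) := by
  induction y using bar_induction with
  | add x y hx hy => simp only [map_add, hx, hy]
  | zero => simp only [TensorProduct.tmul_zero, TensorProduct.zero_tmul, map_zero, LinearMap.zero_apply, smul_zero]
  | H a w b =>
    induction w using cat_induction h with
    | add x y hx hy =>
      simp only [TensorProduct.tmul_add, TensorProduct.add_tmul, map_add, hx, hy]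
    | zero => simp only [TensorProduct.tmul_zero, TensorProduct.zero_tmul, map_zero, LinearMap.zero_apply, smul_zero]
    | H w w' =>
      rw [hR_tmul, appendX_tmul, cat_assoc hN h h₁ hl, lam_tmul, lam_tmul, hR_tmul, smul_appendX,
        appendX_appendX hN' h' h₁' hl]

end lam

lemma npow_congr {a b : ℕ} (h : a % 2 = b % 2) : (-1 : k) ^ a = (-1) ^ b := by
  rw [neg_one_pow_eq_pow_mod_two, h, ← neg_one_pow_eq_pow_mod_two]

/-- The sign `(-1)^{m-p-1}`. -/
def eps (k : Type u) [Field k] (m p : ℕ) : k := (-1) ^ (m + p + 1)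

lemma eps_mul_self (m p : ℕ) : eps k m p * eps k m p = 1 := neg_one_pow_mul_self _

lemma eps_succ_left (m p : ℕ) : eps k (m + 1) p = - eps k m p := by
  simp only [eps]; ring

/-- The map `x'` is, up to sign, the coboundary of `x`. -/
def Rel {m p : ℕ} (x : T k A m →ₗ[k] X k A p) (x' : T k A (m + 1) →ₗ[k] X k A p) : Prop :=
  ∀ ⦃l l' N N₁ N' N₁' : ℕ⦄ (h : m + l = N) (h' : p + l = N') (h₁ : m + l' = N₁)
    (h₁' : p + l' = N₁') (_ : l + 1 = l') (h₂ : (m + 1) + l = N₁) (hN : N + 1 = N₁)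
    (hN' : N' + 1 = N₁') (y : Bar k A N₁),
    dB hN' (lam x h₁ h₁' y) = lam x' h₂ h' y - eps k m p • lam x h h' (dB hN y)

lemma Rel_of_zero {m p : ℕ} {x : T k A m →ₗ[k] X k A p} {x' : T k A (m + 1) →ₗ[k] X k A p}
    (H : ∀ y : Bar k A (m + 1), dB rfl (lam x (l := 1) rfl rfl y) =
      lam x' (l := 0) rfl rfl y - eps k m p • lam x (l := 0) rfl rfl (dB rfl y)) :
    Rel x x' := by
  intro l
  induction l with
  | zero =>
    intro l' N N₁ N' N₁' h h' h₁ h₁' hl h₂ hN hN' y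
    subst hl h h' h₁ h₁'
    exact H y
  | succ l ih =>
    intro l' N N₁ N' N₁' h h' h₁ h₁' hl h₂ hN hN' y
    obtain ⟨M, hM⟩ : ∃ M, m + l = M := ⟨_, rfl⟩
    obtain ⟨M', hM'⟩ : ∃ M', p + l = M' := ⟨_, rfl⟩
    have e : M + 1 = N := by omega
    have e' : M' + 1 = N' := by omega
    induction y using hR_induction hN with
    | add x y hx hy => simp only [map_add, hx, hy, smul_add]; abel
    | rmul b x hx =>
      simp only [isR_dB _ b, isR_lam _ _ _ b, hx, map_sub, LinearMap.map_smul]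
    | H y =>
      rw [lam_hR x h h' h₁ h₁' hl hN hN', dB_hR e' hN', dB_hR e hN,
        ih hM hM' h h' rfl (by omega) e e', map_sub (lam x _ _), LinearMap.map_smul,
        lam_hR x hM hM' h h' rfl e e', lam_hR x' (by omega) hM' h₂ h' rfl hN e', map_sub,
        LinearMap.map_smul]
      have : (-1 : k) ^ N' = (-1 : k) ^ 1 * (eps k m p * (-1) ^ N) := by
        simp only [eps, ← pow_add]
        exact npow_congr (by omega)
      rw [this]
      module

lemma bimoduleExt_closeD {m p : ℕ} (x : T k A m →ₗ[k] X k A p) (h' : p + 0 = p)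
    (hm : m + 0 = m) (y : Bar k A m) :
    bimoduleExt (actB k A p) (closeD k A p ∘ₗ x) y = d k A p (lam x hm h' y) := by
  induction y using bar_induction with
  | add x y hx hy => simp only [map_add, hx, hy]
  | zero => simp only [TensorProduct.tmul_zero, TensorProduct.zero_tmul, map_zero, LinearMap.zero_apply, smul_zero]
  | H a w b =>
    rw [lam_cap_one]
    have : bimoduleExt (actB k A p) (closeD k A p ∘ₗ x) ((a ⊗ₜ[k] w) ⊗ₜ[k] b) =
      actB k A p a (closeD k A p (x w)) b := rfl
    rw [this, closeD_apply]
    have e : (a • x w) ⊗ₜ[k] b = a • rm b (cap (x w)) := by rw [rm_cap]; rfl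
    rw [e]
    cases p with
    | zero => rw [d_zero, d_zero, aug_smul, aug_rm, ← mul_assoc]; rfl
    | succ p => rw [d_succ, d_succ, isL_dB, isR_dB]; exact actBar_apply p a b _

lemma delta_closeD {m n p : ℕ} (x : T k A m →ₗ[k] X k A p) (h : m + 1 = n) (h' : p + 0 = p)
    (hm : m + 0 = m) (w : T k A n) :
    delta (actB k A p) h (closeD k A p ∘ₗ x) w =
      d k A p (lam x hm h' (dB h (cap ((1 : A) ⊗ₜ[k] w)))) := by
  rw [cap_apply, dB_tmul, one_smul]
  have : rm (1 : A) (dbar (k := k) h w) = dbar h w := by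
    induction dbar (k := k) h w using bar_induction with
    | add x y hx hy => rw [map_add, hx, hy]
    | zero => simp only [TensorProduct.tmul_zero, TensorProduct.zero_tmul, map_zero, LinearMap.zero_apply, smul_zero]
    | H a w b => simp
  rw [this, ← bimoduleExt_closeD x]
  rfl

/-- The map `Ā^{⊗m+1} → A ⊗ Ā^{⊗p}` corresponding to the coboundary, up to sign. -/
def xdelta {m p : ℕ} (x : T k A m →ₗ[k] X k A p) : T k A (m + 1) →ₗ[k] X k A p :=
  (eps k m p * (-1) ^ p) • (piR k A p ∘ₗ delta (actB k A p) rfl (closeD k A p ∘ₗ x))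

lemma tmul_eq_smul_rm {N : ℕ} (a b : A) (w : T k A N) :
    (a ⊗ₜ[k] w) ⊗ₜ[k] b = a • rm b (cap ((1 : A) ⊗ₜ[k] w)) := by
  rw [rm_cap]; simp

lemma rel_xdelta {m p : ℕ} (x : T k A m →ₗ[k] X k A p) : Rel x (xdelta x) := by
  refine Rel_of_zero fun y => ?_
  rw [eq_sub_iff_add_eq]
  induction y using bar_induction with
  | add x y hx hy => simp only [map_add, smul_add] at *; rw [← hx, ← hy]; abel
  | zero => simp
  | H a w b =>
    have h0 : hR rfl (cap ((1 : A) ⊗ₜ[k] w)) = 0 := hR_cap rfl _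
    rw [tmul_eq_smul_rm]
    generalize hy : cap ((1 : A) ⊗ₜ[k] w) = y0 at h0
    simp only [isL_dB _ a, isR_dB _ b, isL_lam _ _ _ a, isR_lam _ _ _ b, smul_comm _ a,
      ← LinearMap.map_smul, ← smul_add, ← map_add]
    congr 2
    have e1 : hR rfl (dB rfl (lam x (l := 1) rfl rfl y0)) =
        (-1 : k) ^ (p + 1) • lam x (l := 1) rfl rfl y0 := by
      have := dB_hR rfl rfl (lam x (l := 1) rfl rfl y0)
      rwa [← lam_hR x rfl rfl (l' := 2) rfl rfl rfl rfl rfl, h0, map_zero, map_zero, eq_comm,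
        sub_eq_zero] at this
    have e2 : hR rfl (dB rfl y0) = (-1 : k) ^ (m + 1) • y0 := by
      have := dB_hR rfl rfl y0
      rwa [h0, map_zero, eq_comm, sub_eq_zero] at this
    set E := dB rfl (lam x (l := 1) rfl rfl y0) +
      eps k m p • lam x (l := 0) (N := m) rfl rfl (dB rfl y0) with hE
    have e3 : hR rfl E = 0 := by
      rw [hE, map_add, e1, LinearMap.map_smul, ← lam_hR x rfl rfl (l' := 1) rfl rfl rfl rfl rfl,
        e2, LinearMap.map_smul, smul_smul]
      have : eps k m p * (-1) ^ (m + 1) = (-1) ^ 1 * (-1) ^ (p + 1) := by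
        simp only [eps, ← pow_add]
        exact npow_congr (by omega)
      rw [this]
      module
    have e4 := dB_hR_eq rfl E
    rw [e3, map_zero, eq_comm, sub_eq_zero] at e4
    have e5 : d k A p E = eps k m p • delta (actB k A p) rfl (closeD k A p ∘ₗ x) w := by
      rw [hE, map_add, delta_closeD x rfl rfl rfl, hy]
      erw [d_dB]
      rw [zero_add, LinearMap.map_smul]
    rw [e5] at e4
    have : lam (xdelta x) (l := 0) (N := m + 1) rfl rfl y0 = cap (xdelta x w) := by
      rw [← hy, cap_apply, lam_cap_one, one_smul, cap_apply]
    rw [this, xdelta, LinearMap.smul_apply, LinearMap.comp_apply, mul_comm, mul_smul,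
      ← LinearMap.map_smul (piR k A p), LinearMap.map_smul (cap (k := k) (A := A)), e4, smul_smul,
      neg_one_pow_mul_self, one_smul, hE]
    simp only [LinearMap.map_smul]

/-- `a ⊗ w ⊗ b ↦ a ⊗ φ(w) ⊗ b`. -/
def mid {N N' : ℕ} (φ : T k A N →ₗ[k] T k A N') : Bar k A N →ₗ[k] Bar k A N' :=
  TensorProduct.map (TensorProduct.map LinearMap.id φ) LinearMap.id

@[simp] lemma mid_tmul {N N' : ℕ} (φ : T k A N →ₗ[k] T k A N') (a b : A) (w : T k A N) :
    mid φ ((a ⊗ₜ[k] w) ⊗ₜ[k] b) = (a ⊗ₜ[k] φ w) ⊗ₜ[k] b := rfl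

/-- Insertion of `x` in all places of a word: `∑_j ε^j id^{⊗j} ⊗ x̄ ⊗ id^{⊗(t-1-j)}`. -/
def psiT {m p N N' : ℕ} (x : T k A m →ₗ[k] X k A p) (t : ℕ) (h : m + t = N + 1) (h' : p + t = N') :
    T k A N →ₗ[k] T k A N' :=
  ∑ j : Fin t, eps k m p ^ (j : ℕ) •
    slot (j : ℕ) (t - 1 - j) (by omega) (by omega)
      (consBar LinearMap.id (Nat.add_comm 1 p) ∘ₗ x)

/-- The operator `a ⊗ w ⊗ b ↦ ∑_j ε^j a ⊗ (id^{⊗j} ⊗ x̄ ⊗ id^{⊗(t-1-j)})(w) ⊗ b`. -/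
def psi {m p N N' : ℕ} (x : T k A m →ₗ[k] X k A p) (t : ℕ) (h : m + t = N + 1) (h' : p + t = N') :
    Bar k A N →ₗ[k] Bar k A N' := mid (psiT x t h h')

section psi

variable {m p t N N' : ℕ} (x : T k A m →ₗ[k] X k A p) (h : m + t = N + 1) (h' : p + t = N')

lemma isL_psi : IsL (psi x t h h') := by
  intro a y
  induction y using bar_induction with
  | add x y hx hy => simp only [map_add, smul_add, hx, hy]
  | zero => simp only [TensorProduct.tmul_zero, TensorProduct.zero_tmul, map_zero, LinearMap.zero_apply, smul_zero]
  | H c w d => simp [psi]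

lemma isR_psi : IsR (psi x t h h') := by
  intro a y
  induction y using bar_induction with
  | add x y hx hy => simp only [map_add, hx, hy]
  | zero => simp only [TensorProduct.tmul_zero, TensorProduct.zero_tmul, map_zero, LinearMap.zero_apply, smul_zero]
  | H c w d => simp [psi]

lemma psi_zero (h : m + 0 = N + 1) (h' : p + 0 = N') (y : Bar k A N) : psi x 0 h h' y = 0 := by
  induction y using bar_induction with
  | add x y hx hy => simp only [map_add, hx, hy, add_zero]
  | zero => simp only [TensorProduct.tmul_zero, TensorProduct.zero_tmul, map_zero, LinearMap.zero_apply, smul_zero]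
  | H c w d => simp [psi, psiT]

lemma slot_zero_consBar {N₁ N₂ : ℕ} (h1 : 0 + m + t = N) (h2 : 0 + (p + 1) + t = N₁)
    (h3 : m + t = N) (h4 : p + t = N₂) (h5 : 1 + N₂ = N₁) (w : T k A N) (b : A) :
    ((1 : A) ⊗ₜ[k] slot 0 t h1 h2 (consBar LinearMap.id (Nat.add_comm 1 p) ∘ₗ x) w) ⊗ₜ[k] b =
      hL h5 (lam x h3 h4 (((1 : A) ⊗ₜ[k] w) ⊗ₜ[k] b)) := by
  induction w using cat_induction h3 with
  | add x y hx hy =>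
    simp only [TensorProduct.tmul_add, TensorProduct.add_tmul, map_add, hx, hy]
  | zero => simp only [TensorProduct.tmul_zero, TensorProduct.zero_tmul, map_zero, LinearMap.zero_apply, smul_zero]
  | H w w' =>
    have e : cat h3 (w ⊗ₜ[k] w') = cat (show 0 + N = N by omega) (nil ⊗ₜ[k] cat h3 (w ⊗ₜ[k] w')) := by
      simp
    have h6 : p + 1 + t = N₁ := by omega
    conv_lhs => rw [e, slot_cat h1 h2 _ (by omega) h3 (show 0 + N₁ = N₁ by omega) h6, cat_nil_left]
    rw [lam_tmul, one_smul, hL_tmul, consBar_appendX _ h5 h4 h6 (Nat.add_comm 1 p)]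
    rfl

lemma psi_succ_hL {N₁ N₁' : ℕ} (h₁ : m + (t + 1) = N₁ + 1) (h₁' : p + (t + 1) = N₁')
    (hN : 1 + N = N₁) (hN' : 1 + N' = N₁') (h₂ : m + t = N₁) (y : Bar k A N) :
    psi x (t + 1) h₁ h₁' (hL hN y) =
      hL hN' (lam x h₂ h' (hL hN y)) + eps k m p • hL hN' (psi x t h h' y) := by
  induction y using bar_induction with
  | add x y hx hy => simp only [map_add, hx, hy, smul_add]; abel
  | zero => simp
  | H a w b =>
    rw [hL_smul_one, ← slot_zero_consBar x (by omega) (by omega) h₂ h' hN']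
    have e : ∀ j : Fin t, slot ((j : ℕ) + 1) (t + 1 - 1 - (j + 1)) (by omega) (by omega)
        (consBar LinearMap.id (Nat.add_comm 1 p) ∘ₗ x)
        (cat hN (letter (proj k A a) ⊗ₜ[k] w)) = cat hN' (letter (proj k A a) ⊗ₜ[k]
        slot (j : ℕ) (t - 1 - j) (by omega) (by omega)
          (consBar LinearMap.id (Nat.add_comm 1 p) ∘ₗ x) w) := by
      intro j
      have : t + 1 - 1 - (j + 1) = t - 1 - j := by omega
      simp only [this]
      exact slot_cons _ _ _ _ _ _ _ _ _
    simp only [psi, mid_tmul, psiT, LinearMap.sum_apply, LinearMap.add_apply, LinearMap.smul_apply, Fin.sum_univ_succ,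
      Fin.val_zero, Fin.val_succ, e, pow_zero, one_smul, TensorProduct.tmul_add,
      TensorProduct.add_tmul, hL_smul_one, TensorProduct.tmul_sum, TensorProduct.sum_tmul,
      TensorProduct.tmul_smul, ← TensorProduct.smul_tmul', map_sum, map_smul,
      Finset.smul_sum, smul_smul, ← pow_succ']
    rfl

lemma psi_one (h : m + 1 = N + 1) (h' : p + 1 = N') (h₂ : m + 0 = N) (hN' : 1 + p = N') (w : T k A N)
    (b : A) : psi x 1 h h' (((1 : A) ⊗ₜ[k] w) ⊗ₜ[k] b) =
      hL hN' (lam x h₂ rfl (((1 : A) ⊗ₜ[k] w) ⊗ₜ[k] b)) := by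
  rw [← slot_zero_consBar x (by omega) (by omega) h₂ rfl hN']
  simp [psi, psiT]

end psi

/-- The contraction of `B_p` with values in `Ā^{⊗p} ⊗ A`. -/
def sB : ∀ p, B k A p →ₗ[k] T k A p ⊗[k] A
  | 0 => TensorProduct.mk k (T k A 0) A nil
  | p + 1 => TensorProduct.map (consBar LinearMap.id (Nat.add_comm 1 p)) LinearMap.id

/-- `s ⊗ b ↦ 1 ⊗ ws ⊗ b`. -/
def put {l p N : ℕ} (h : l + p = N) (w : T k A l) : T k A p ⊗[k] A →ₗ[k] Bar k A N :=
  TensorProduct.map (TensorProduct.mk k A _ 1 ∘ₗ (cat h).toLinearMap ∘ₗ TensorProduct.mk k _ _ w)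
    LinearMap.id

@[simp] lemma put_tmul {l p N : ℕ} (h : l + p = N) (w : T k A l) (s : T k A p) (b : A) :
    put h w (s ⊗ₜ[k] b) = ((1 : A) ⊗ₜ[k] cat h (w ⊗ₜ[k] s)) ⊗ₜ[k] b := rfl

lemma put_sB_d {p t : ℕ} (h : p + 1 = t) (h1 : 1 + p = t) (h0 : 0 + p = p) (y : Bar k A p) :
    put h0 nil (sB p (d k A p y)) = y - dB h (hL h1 y) := by
  cases p with
  | zero =>
    have : put h0 nil (sB 0 (d k A 0 y)) = ((1 : A) ⊗ₜ[k] cat h0 (nil ⊗ₜ[k] nil)) ⊗ₜ[k] aug y := rfl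
    rw [dB_hL_zero, sub_sub_cancel, this, cat_nil_left]
  | succ p =>
    rw [dB_hL rfl h h1 (Nat.add_comm 1 p), sub_sub_cancel, d_succ]
    generalize dB (k := k) rfl y = z
    change put h0 nil (TensorProduct.map (consBar LinearMap.id (Nat.add_comm 1 p)) LinearMap.id z)
      = _
    induction z using TensorProduct.induction_on with
    | zero => simp only [TensorProduct.tmul_zero, TensorProduct.zero_tmul, map_zero, LinearMap.zero_apply, smul_zero]
    | add x y hx hy => simp only [map_add, hx, hy]
    | tmul x b => simp

/-- Application of `s ∘ d ∘ x` to the last `m` letters. -/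
def rho {m p l N N' : ℕ} (x : T k A m →ₗ[k] X k A p) (h : l + m = N) (h' : l + p = N') :
    Bar k A N →ₗ[k] Bar k A N' :=
  (- eps k m p) ^ l • bimoduleExt (actBar k A N')
    (TensorProduct.map (TensorProduct.mk k A _ 1 ∘ₗ (cat h').toLinearMap) LinearMap.id ∘ₗ
      (TensorProduct.assoc k (T k A l) (T k A p) A).symm.toLinearMap ∘ₗ
      TensorProduct.map LinearMap.id (sB p ∘ₗ closeD k A p ∘ₗ x) ∘ₗ (cat h).symm.toLinearMap)

section rho

variable {m p l N N' : ℕ} (x : T k A m →ₗ[k] X k A p) (h : l + m = N) (h' : l + p = N')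

lemma rho_tmul (a b : A) (w : T k A l) (w' : T k A m) :
    rho x h h' ((a ⊗ₜ[k] cat h (w ⊗ₜ[k] w')) ⊗ₜ[k] b) =
      (- eps k m p) ^ l • a • rm b (put h' w (sB p (closeD k A p (x w')))) := by
  rw [rho, LinearMap.smul_apply, ← actBar_apply]
  simp only [bimoduleExt, TensorProduct.lift.tmul, LinearMap.compl₂_apply, LinearMap.comp_apply,
    LinearEquiv.coe_coe, LinearEquiv.symm_apply_apply, TensorProduct.map_tmul, LinearMap.id_apply]
  congr 3
  generalize sB p (closeD k A p (x w')) = s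
  induction s using TensorProduct.induction_on with
  | zero => simp only [TensorProduct.tmul_zero, TensorProduct.zero_tmul, map_zero, LinearMap.zero_apply, smul_zero]
  | add x y hx hy => simp only [map_add, TensorProduct.tmul_add, hx, hy]
  | tmul s b => simp

lemma isL_rho : IsL (rho x h h') := by
  intro a y
  induction y using bar_induction with
  | add x y hx hy => simp only [map_add, smul_add, hx, hy]
  | zero => simp only [TensorProduct.tmul_zero, TensorProduct.zero_tmul, map_zero, LinearMap.zero_apply, smul_zero]
  | H c w d =>
    induction w using cat_induction h with
    | add x y hx hy =>
      simp only [TensorProduct.tmul_add, TensorProduct.add_tmul, map_add, smul_add] at *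
      simp only [hx, hy]
    | zero => simp only [TensorProduct.tmul_zero, TensorProduct.zero_tmul, map_zero, LinearMap.zero_apply, smul_zero]
    | H x y => rw [smul_tmul_Bar, smul_tmul_X, rho_tmul, rho_tmul, mul_smul,
        smul_comm a ((- eps k m p) ^ l)]

lemma hL_smul_put {N₁ : ℕ} (hN : 1 + N' = N₁) {l' : ℕ} (hl : 1 + l = l') (h₁ : l' + p = N₁) (a : A)
    (w : T k A l) (s : T k A p ⊗[k] A) :
    hL hN (a • put h' w s) = put h₁ (cat hl (letter (proj k A a) ⊗ₜ[k] w)) s := by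
  induction s using TensorProduct.induction_on with
  | zero => simp only [TensorProduct.tmul_zero, TensorProduct.zero_tmul, map_zero, LinearMap.zero_apply, smul_zero]
  | add x y hx hy => simp only [map_add, smul_add, hx, hy]
  | tmul s b => simp [cat_assoc h₁ hl hN h']

lemma rho_hL {N₁ N₁' l' : ℕ} (h₁ : l' + m = N₁) (h₁' : l' + p = N₁') (hl : l + 1 = l')
    (hN : 1 + N = N₁) (hN' : 1 + N' = N₁') (y : Bar k A N) :
    rho x h₁ h₁' (hL hN y) = - eps k m p • hL hN' (rho x h h' y) := by
  induction y using bar_induction with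
  | add x y hx hy => simp only [map_add, hx, hy, smul_add]
  | zero => simp only [TensorProduct.tmul_zero, TensorProduct.zero_tmul, map_zero, LinearMap.zero_apply, smul_zero]
  | H a w b =>
    induction w using cat_induction h with
    | add x y hx hy =>
      simp only [TensorProduct.tmul_add, TensorProduct.add_tmul, map_add, hx, hy, smul_add]
    | zero => simp only [TensorProduct.tmul_zero, TensorProduct.zero_tmul, map_zero, LinearMap.zero_apply, smul_zero]
    | H w w' =>
      have hl' : 1 + l = l' := by omega
      rw [hL_smul_one, ← cat_assoc h₁ hl' hN h, rho_tmul, rho_tmul, one_smul, LinearMap.map_smul,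
        ← smul_rm, isR_hL, hL_smul_put h' hN' hl' h₁', smul_smul,
        show (- eps k m p) ^ l' = - eps k m p * (- eps k m p) ^ l by rw [← hl, pow_succ']]

lemma rho_zero (h : 0 + m = m) (h' : 0 + p = p) (hm : m + 0 = m) (hp : p + 0 = p) {t : ℕ}
    (ht : p + 1 = t) (ht' : 1 + p = t) (w : T k A m) (b : A) :
    rho x h h' (((1 : A) ⊗ₜ[k] w) ⊗ₜ[k] b) =
      lam x hm hp (((1 : A) ⊗ₜ[k] w) ⊗ₜ[k] b) - dB ht (hL ht' (lam x hm hp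
        (((1 : A) ⊗ₜ[k] w) ⊗ₜ[k] b))) := by
  have : w = cat h (nil ⊗ₜ[k] w) := by simp
  conv_lhs => rw [this, rho_tmul]
  rw [lam_cap_one, one_smul, pow_zero, one_smul, one_smul, closeD_apply, put_sB_d ht ht',
    ← rm_cap b, isR_hL, isR_dB, map_sub]

end rho

/-! ### The relations between the operators -/

section Relations

variable {m p : ℕ} {x : T k A m →ₗ[k] X k A p} {x' : T k A (m + 1) →ₗ[k] X k A p}

lemma dB_psi_one (x : T k A m →ₗ[k] X k A p) {t : ℕ} (h : m + 1 = m + 1) (h' : p + 1 = t)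
    (h₁ : m + 0 = m) (h₂ : p + 0 = p) (h₃ : 0 + m = m) (h₄ : 0 + p = p) (y : Bar k A m) :
    dB h' (psi x 1 h h' y) = lam x h₁ h₂ y - rho x h₃ h₄ y := by
  induction y using one_induction with
  | add x y hx hy => simp only [map_add, hx, hy]; abel
  | smul a y hy => rw [isL_psi, isL_dB, isL_lam, isL_rho, hy, smul_sub]
  | H w b =>
    rw [psi_one x h h' h₁ (by omega), rho_zero x _ _ h₁ h₂ h' (by omega), sub_sub_cancel]

lemma dB_psi (hx : Rel x x') {l N N₁ N' N₁' : ℕ} (h : m + l = N + 1) (h' : p + l = N')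
    (h₁ : m + (l + 1) = N₁ + 1) (h₁' : p + (l + 1) = N₁') (h₂ : m + l = N₁) (h₃ : l + m = N₁)
    (h₄ : l + p = N') (h₅ : (m + 1) + l = N₁ + 1) (hN : N + 1 = N₁) (hN' : N' + 1 = N₁')
    (y : Bar k A N₁) :
    dB hN' (psi x (l + 1) h₁ h₁' y) = eps k m p • psi x l h h' (dB hN y) + lam x h₂ h' y
      - rho x h₃ h₄ y - psi x' l h₅ h' y := by
  induction l generalizing N N₁ N' N₁' with
  | zero =>
    obtain rfl : N₁ = m := by omega
    obtain rfl : N' = p := by omega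
    rw [psi_zero, psi_zero, smul_zero, zero_add (lam x _ _ y), sub_zero]
    exact dB_psi_one x _ _ _ _ _ _ y
  | succ l ih =>
    obtain ⟨M', hM'⟩ : ∃ M', p + l = M' := ⟨_, rfl⟩
    induction y using hL_induction (show 1 + N = N₁ by omega) with
    | add x y hx hy => simp only [map_add, hx, hy, smul_add]; abel
    | smul a y hy =>
      rw [isL_psi, isL_dB, hy, isL_dB, isL_psi, isL_lam, isL_rho, isL_psi, smul_sub, smul_sub,
        smul_add, smul_comm a]
    | H y =>
      rw [psi_succ_hL x (N := N) h h' h₁ h₁' (by omega) (by omega) h₂, map_add, LinearMap.map_smul,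
        dB_hL (show M' + 1 = N' by omega) hN' _ (by omega),
        dB_hL (show M' + 1 = N' by omega) hN' _ (by omega),
        hx (show m + l = N by omega) hM' h₂ h' rfl (by omega) hN (by omega),
        rho_hL x (show l + m = N by omega) (show l + p = M' by omega) h₃ h₄ rfl _ (by omega),
        psi_succ_hL x' (show m + 1 + l = N + 1 by omega) hM' h₅ h' _ (by omega) (by omega),
        eps_succ_left]
      rcases N with _ | M
      · obtain rfl : m = 0 := by omega
        obtain rfl : l = 0 := by omega
        obtain rfl : p = M' := by omega
        rw [dB_hL_zero, dB_psi_one x _ _ rfl rfl rfl (by omega), psi_zero, map_sub (lam x _ _),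
          map_sub (psi x _ _ _), psi_one x h h' rfl (by omega)]
        simp only [map_sub, map_zero, LinearMap.map_smul]
        module
      · rw [dB_hL (rfl : M + 1 = M + 1) hN _ (by omega), map_sub (psi x _ _ _),
          psi_succ_hL x (show m + l = M + 1 by omega) hM' h h' _ (by omega) (by omega),
          ih (show m + l = M + 1 by omega) hM' h h' (by omega) (by omega) (by omega) (by omega)
            rfl (by omega)]
        simp only [map_sub, map_add, LinearMap.map_smul]
        module

end Relations

end Operators

section Bracket

variable {k A : Type u} [Field k] [Ring A] [Algebra k A]

/-- Application of `x` to the first `m` letters of a word. -/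
def lamX {m p l N N' : ℕ} (x : T k A m →ₗ[k] X k A p) (h : m + l = N) (h' : p + l = N') :
    T k A N →ₗ[k] X k A N' :=
  appendX h' ∘ₗ TensorProduct.map x LinearMap.id ∘ₗ (cat h).symm.toLinearMap

@[simp] lemma lamX_cat {m p l N N' : ℕ} (x : T k A m →ₗ[k] X k A p) (h : m + l = N)
    (h' : p + l = N') (w : T k A m) (w' : T k A l) :
    lamX x h h' (cat h (w ⊗ₜ[k] w')) = appendX h' (x w ⊗ₜ[k] w') := by
  simp [lamX]

lemma lext_lamX {m p l N N' : ℕ} (x : T k A m →ₗ[k] X k A p) (h : m + l = N) (h' : p + l = N') :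
    lext (lamX x h h') = lam x h h' := rfl

lemma lext_add {N N' : ℕ} (φ χ : T k A N →ₗ[k] X k A N') (y : Bar k A N) :
    lext (φ + χ) y = lext φ y + lext χ y := by
  induction y using bar_induction with
  | add x y hx hy => simp only [map_add, hx, hy]; abel
  | zero => simp
  | H a w b => simp [TensorProduct.add_tmul]

lemma lext_smul {N N' : ℕ} (c : k) (φ : T k A N →ₗ[k] X k A N') (y : Bar k A N) :
    lext (c • φ) y = c • lext φ y := by
  induction y using bar_induction with
  | add x y hx hy => simp only [map_add, hx, hy, smul_add]
  | zero => simp only [TensorProduct.tmul_zero, TensorProduct.zero_tmul, map_zero, LinearMap.zero_apply, smul_zero]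
  | H a w b =>
    rw [lext_tmul, lext_tmul, LinearMap.smul_apply, smul_comm a c, TensorProduct.smul_tmul']

lemma lext_sub {N N' : ℕ} (φ χ : T k A N →ₗ[k] X k A N') (y : Bar k A N) :
    lext (φ - χ) y = lext φ y - lext χ y := by
  rw [sub_eq_add_neg, ← neg_one_smul k χ, lext_add, lext_smul, neg_one_smul, sub_eq_add_neg]

lemma lext_comp_mid {N N₁ N' : ℕ} (φ : T k A N₁ →ₗ[k] X k A N') (χ : T k A N →ₗ[k] T k A N₁)
    (y : Bar k A N) : lext (φ ∘ₗ χ) y = lext φ (mid χ y) := by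
  induction y using bar_induction with
  | add x y hx hy => simp only [map_add, hx, hy]
  | zero => simp only [TensorProduct.tmul_zero, TensorProduct.zero_tmul, map_zero, LinearMap.zero_apply, smul_zero]
  | H a w b => simp

lemma lext_map_comp {N N₁ N' : ℕ} (φ : T k A N →ₗ[k] X k A N₁) (χ : T k A N₁ →ₗ[k] T k A N')
    (y : Bar k A N) :
    lext (TensorProduct.map LinearMap.id χ ∘ₗ φ) y = mid χ (lext φ y) := by
  induction y using bar_induction with
  | add x y hx hy => simp only [map_add, hx, hy]
  | zero => simp only [TensorProduct.tmul_zero, TensorProduct.zero_tmul, map_zero, LinearMap.zero_apply, smul_zero]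
  | H a w b =>
    rw [lext_tmul, lext_tmul, LinearMap.comp_apply]
    have : ∀ z : X k A N₁, (a • TensorProduct.map LinearMap.id χ z) ⊗ₜ[k] b =
        mid χ ((a • z) ⊗ₜ[k] b) := by
      intro z
      induction z using TensorProduct.induction_on with
      | zero => simp only [TensorProduct.tmul_zero, TensorProduct.zero_tmul, map_zero, LinearMap.zero_apply, smul_zero]
      | add x y hx hy => simp only [map_add, smul_add, TensorProduct.add_tmul, hx, hy]
      | tmul x y => rfl
    exact this _

variable {m p n q N s : ℕ}

/-- One half of the bracket. -/
def bul (x : T k A m →ₗ[k] X k A p) (y : T k A n →ₗ[k] X k A q) (hm : 1 ≤ m) (hN : N + 1 = m + n)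
    (hs : p + q = s) : T k A N →ₗ[k] X k A s :=
  lamX x (rfl : m + q = m + q) hs ∘ₗ psiT y m (by omega) (Nat.add_comm q m) +
    eps k m p • (TensorProduct.map LinearMap.id (psiT x q (N := q + (m - 1)) (by omega) hs) ∘ₗ
      lamX y (l := m - 1) (by omega) rfl)

/-- The bracket of `x` and `y`. -/
def br (x : T k A m →ₗ[k] X k A p) (y : T k A n →ₗ[k] X k A q) (hm : 1 ≤ m) (hn : 1 ≤ n)
    (hN : N + 1 = m + n) (hs : p + q = s) : T k A N →ₗ[k] X k A s :=
  bul x y hm hN hs - eps k n q ^ (m + p + 1) • bul y x hn (by omega) (by omega)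

lemma lext_bul (x : T k A m →ₗ[k] X k A p) (y : T k A n →ₗ[k] X k A q) (hm : 1 ≤ m)
    (hN : N + 1 = m + n) (hs : p + q = s) {l M M₁ : ℕ} (hl : l + 1 = m) (h1 : n + m = N + 1)
    (h2 : q + m = M) (h3 : m + q = M) (h4 : n + l = N) (h5 : q + l = M₁) (h6 : m + q = M₁ + 1)
    (z : Bar k A N) :
    lext (bul x y hm hN hs) z = lam x h3 hs (psi y m h1 h2 z) +
      eps k m p • psi x q h6 hs (lam y h4 h5 z) := by
  obtain rfl : l = m - 1 := by omega
  subst h3 h5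
  rw [bul, lext_add, lext_smul, lext_comp_mid, lext_map_comp]
  rfl

lemma rm_one {N : ℕ} (z : Bar k A N) : rm 1 z = z := by
  induction z using bar_induction with
  | add x y hx hy => rw [map_add, hx, hy]
  | zero => simp only [TensorProduct.tmul_zero, TensorProduct.zero_tmul, map_zero, LinearMap.zero_apply, smul_zero]
  | H a w b => simp

/-- `s ⊗ b ↦ us ⊗ b`. -/
def putX {p q N : ℕ} (h : p + q = N) (u : X k A p) : T k A q ⊗[k] A →ₗ[k] Bar k A N :=
  TensorProduct.map (appendX h ∘ₗ TensorProduct.mk k _ _ u) LinearMap.id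

lemma put_eq_putX {p q N : ℕ} (h : p + q = N) (w : T k A p) :
    put h w = putX h ((1 : A) ⊗ₜ[k] w) := rfl

@[simp] lemma putX_tmul {p q N : ℕ} (h : p + q = N) (u : X k A p) (s : T k A q) (b : A) :
    putX h u (s ⊗ₜ[k] b) = appendX h (u ⊗ₜ[k] s) ⊗ₜ[k] b := rfl

lemma putX_smul {p q N : ℕ} (h : p + q = N) (a : A) (u : X k A p) (v : T k A q ⊗[k] A) :
    putX h (a • u) v = a • putX h u v := by
  induction v using TensorProduct.induction_on with
  | zero => simp only [TensorProduct.tmul_zero, TensorProduct.zero_tmul, map_zero, LinearMap.zero_apply, smul_zero]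
  | add x y hx hy => simp only [map_add, smul_add, hx, hy]
  | tmul s b => simp [smul_appendX]

lemma putX_add {p q N : ℕ} (h : p + q = N) (u u' : X k A p) (v : T k A q ⊗[k] A) :
    putX h (u + u') v = putX h u v + putX h u' v := by
  rw [putX, map_add, LinearMap.comp_add, TensorProduct.map_add_left]
  rfl

lemma lam_put (x : T k A m →ₗ[k] X k A p) {M : ℕ} (h2 : m + q = M) (h3 : p + q = s) (w : T k A m)
    (v : T k A q ⊗[k] A) : lam x h2 h3 (put h2 w v) = putX h3 (x w) v := by
  induction v using TensorProduct.induction_on with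
  | zero => simp only [TensorProduct.tmul_zero, TensorProduct.zero_tmul, map_zero, LinearMap.zero_apply, smul_zero]
  | add x y hx hy => simp only [map_add, hx, hy]
  | tmul s b => simp

lemma rho_appendX (y : T k A n →ₗ[k] X k A q) {M : ℕ} (h4 : p + n = M) (h3 : p + q = s)
    (u : X k A p) (w : T k A n) (b : A) :
    rho y h4 h3 (appendX h4 (u ⊗ₜ[k] w) ⊗ₜ[k] b) =
      (- eps k n q) ^ p • rm b (putX h3 u (sB q (closeD k A q (y w)))) := by
  induction u using TensorProduct.induction_on with
  | zero => simp [putX]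
  | add x y hx hy =>
    simp only [TensorProduct.add_tmul, map_add, hx, hy, putX_add, smul_add]
  | tmul a u =>
    rw [appendX_tmul, rho_tmul, put_eq_putX, ← smul_rm, ← putX_smul, smul_tmul_X, mul_one]

lemma lam_rho (x : T k A m →ₗ[k] X k A p) (y : T k A n →ₗ[k] X k A q) {M M' : ℕ}
    (h1 : m + n = N) (h2 : m + q = M) (h3 : p + q = s) (h4 : p + n = M') (z : Bar k A N) :
    lam x h2 h3 (rho y h1 h2 z) = (- eps k n q) ^ (m + p) • rho y h4 h3 (lam x h1 h4 z) := by
  induction z using bar_induction with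
  | add x y hx hy => simp only [map_add, hx, hy, smul_add]
  | zero => simp only [TensorProduct.tmul_zero, TensorProduct.zero_tmul, map_zero, LinearMap.zero_apply, smul_zero]
  | H a w b =>
    induction w using cat_induction h1 with
    | add x y hx hy =>
      simp only [TensorProduct.tmul_add, TensorProduct.add_tmul, map_add, hx, hy, smul_add]
    | zero => simp only [TensorProduct.tmul_zero, TensorProduct.zero_tmul, map_zero, LinearMap.zero_apply, smul_zero]
    | H w w' =>
      rw [rho_tmul, lam_tmul, ← smul_appendX, rho_appendX, LinearMap.map_smul, isL_lam, isR_lam,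
        lam_put, putX_smul, smul_rm, smul_smul, pow_add, mul_assoc, ← mul_pow, neg_mul_neg,
        eps_mul_self, one_pow, mul_one]

section

variable {x : T k A m →ₗ[k] X k A p} {x' : T k A (m + 1) →ₗ[k] X k A p}
  {y : T k A n →ₗ[k] X k A q} {y' : T k A (n + 1) →ₗ[k] X k A q}

lemma Rel.lam_dB (hx : Rel x x') {l l' N N₁ N' N₁' : ℕ} (h : m + l = N) (h' : p + l = N')
    (h₁ : m + l' = N₁) (h₁' : p + l' = N₁') (hl : l + 1 = l') (h₂ : (m + 1) + l = N₁)
    (hN : N + 1 = N₁) (hN' : N' + 1 = N₁') (z : Bar k A N₁) :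
    lam x h h' (dB hN z) = eps k m p • (lam x' h₂ h' z - dB hN' (lam x h₁ h₁' z)) := by
  rw [hx h h' h₁ h₁' hl h₂ hN hN', sub_sub_cancel, smul_smul, eps_mul_self, one_smul]

lemma Rel.psi_dB (hx : Rel x x') {l N N₁ N' N₁' : ℕ} (h : m + l = N + 1) (h' : p + l = N')
    (h₁ : m + (l + 1) = N₁ + 1) (h₁' : p + (l + 1) = N₁') (h₂ : m + l = N₁) (h₃ : l + m = N₁)
    (h₄ : l + p = N') (h₅ : (m + 1) + l = N₁ + 1) (hN : N + 1 = N₁) (hN' : N' + 1 = N₁')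
    (y : Bar k A N₁) :
    psi x l h h' (dB hN y) = eps k m p • (dB hN' (psi x (l + 1) h₁ h₁' y) - lam x h₂ h' y
      + rho x h₃ h₄ y + psi x' l h₅ h' y) := by
  rw [dB_psi hx h h' h₁ h₁' h₂ h₃ h₄ h₅ hN hN']
  simp only [smul_add, smul_sub, smul_smul, eps_mul_self, one_smul]
  abel

lemma d_bul_dB (hx : Rel x x') (hy : Rel y y') (hm : 1 ≤ m) {N₁ : ℕ}
    (hN : N + 1 = m + n) (hs : p + q = s) (hN₁ : N + 1 = N₁) (hm' : 1 ≤ m + 1)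
    (h₁ : N₁ + 1 = m + 1 + n) (h₂ : N₁ + 1 = m + (n + 1)) (h₃ : m + n = N₁) (h₅ : n + m = N₁)
    {M : ℕ} (h₆ : m + q = M) (h₈ : q + p = s)
    (h₁₀ : q + m = M) (z : Bar k A N₁) :
    d k A s (lext (bul x y hm hN hs) (dB hN₁ z)) =
      eps k n q • d k A s (lext (bul x y' hm h₂ hs) z)
      + (eps k m p * eps k n q) • d k A s (lext (bul x' y hm' h₁ hs) z)
      + eps k n q • (d k A s (lam x h₆ hs (rho y h₃ h₆ z))
        - d k A s (rho x h₁₀ h₈ (lam y h₅ h₁₀ z))) := by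
  obtain ⟨l, hl⟩ : ∃ l, l + 1 = m := ⟨m - 1, by omega⟩
  obtain ⟨M₁, hM₁⟩ : ∃ M₁, q + l = M₁ := ⟨_, rfl⟩
  rw [lext_bul x y hm hN hs hl (show n + m = N + 1 by omega) h₁₀ h₆ (by omega) hM₁ (by omega),
    lext_bul x y' hm h₂ hs hl (show n + 1 + m = N₁ + 1 by omega) h₁₀ h₆ (by omega) hM₁ (by omega),
    lext_bul x' y hm' h₁ hs (rfl : m + 1 = m + 1) (show n + (m + 1) = N₁ + 1 by omega)
      (show q + (m + 1) = M + 1 by omega) (by omega) h₅ h₁₀ (by omega),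
    hy.psi_dB _ _ (by omega) (show q + (m + 1) = M + 1 by omega) h₅ h₃ h₆ (by omega) hN₁ rfl,
    hy.lam_dB (show n + l = N by omega) hM₁ h₅ h₁₀ hl (by omega) hN₁ (show M₁ + 1 = M by omega)]
  simp only [map_add, map_sub, LinearMap.map_smul]
  rw [hx.psi_dB (show m + q = M₁ + 1 by omega) hs (by omega) (rfl : p + (q + 1) = p + (q + 1)) h₆
    h₁₀ h₈ (by omega) (show M₁ + 1 = M by omega) (by omega),
    hx.lam_dB h₆ hs (show m + (q + 1) = M + 1 by omega) (rfl : p + (q + 1) = p + (q + 1)) rfl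
      (by omega) rfl (by omega), eps_succ_left]
  simp only [map_add, map_sub, LinearMap.map_smul, d_dB]
  linear_combination (norm := module) - (eps k n q • eps_mul_self (k := k) m p) •
    (d k A s (rho x h₁₀ h₈ (lam y h₅ h₁₀ z)) - d k A s (lam x h₆ hs (lam y h₅ h₁₀ z)))

lemma lext_br (x : T k A m →ₗ[k] X k A p) (y : T k A n →ₗ[k] X k A q) (hm : 1 ≤ m) (hn : 1 ≤ n)
    (hN : N + 1 = m + n) (hs : p + q = s) (z : Bar k A N) :
    lext (br x y hm hn hN hs) z = lext (bul x y hm hN hs) z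
      - eps k n q ^ (m + p + 1) • lext (bul y x hn (by omega) (by omega)) z := by
  rw [br, lext_sub, lext_smul]

lemma eps_pow (m p n q : ℕ) : eps k n q ^ (m + p + 1) = eps k m p ^ (n + q + 1) := by
  rw [eps, eps, ← pow_mul, ← pow_mul, mul_comm]

lemma d_br_dB (hx : Rel x x') (hy : Rel y y') (hm : 1 ≤ m) (hn : 1 ≤ n) {N₁ : ℕ}
    (hN : N + 1 = m + n) (hs : p + q = s) (hN₁ : N + 1 = N₁) (hm' : 1 ≤ m + 1) (hn' : 1 ≤ n + 1)
    (h₁ : N₁ + 1 = m + 1 + n) (h₂ : N₁ + 1 = m + (n + 1)) (z : Bar k A N₁) :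
    d k A s (lext (br x y hm hn hN hs) (dB hN₁ z)) =
      eps k n q • d k A s (lext (br x y' hm hn' h₂ hs) z)
      + (eps k m p * eps k n q) • d k A s (lext (br x' y hm' hn h₁ hs) z) := by
  rw [lext_br, lext_br, lext_br]
  simp only [map_sub, LinearMap.map_smul]
  rw [d_bul_dB hx hy hm hN hs hN₁ hm' h₁ h₂ (by omega) (by omega) (rfl : m + q = m + q)
      (by omega) (Nat.add_comm q m),
    d_bul_dB hy hx hn (by omega) (by omega) hN₁ hn' (by omega) (by omega) (by omega) (by omega)
      (rfl : n + p = n + p) hs (Nat.add_comm p n),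
    lam_rho x y (by omega) (by omega) hs (Nat.add_comm p n),
    lam_rho y x (by omega) (by omega) (show q + p = s by omega) (Nat.add_comm q m)]
  have e1 : (- eps k n q) ^ (m + p) = - eps k m p * (eps k n q * eps k n q ^ (m + p + 1)) := by
    rw [pow_succ, mul_comm (_ ^ _), ← mul_assoc (eps k n q), eps_mul_self, one_mul, neg_pow]
    congr 1
    simp [eps, pow_succ]
  have e2 : (- eps k m p) ^ (n + q) = - eps k n q * (eps k m p * eps k n q ^ (m + p + 1)) := by
    rw [eps_pow, pow_succ, mul_comm (_ ^ _), ← mul_assoc (eps k m p), eps_mul_self, one_mul,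
      neg_pow]
    congr 1
    simp [eps, pow_succ]
  have e3 : eps k (n + 1) q ^ (m + p + 1) = eps k m p * eps k n q ^ (m + p + 1) := by
    rw [eps_succ_left, neg_pow]; rfl
  have e4 : eps k n q ^ (m + 1 + p + 1) = eps k n q * eps k n q ^ (m + p + 1) := by
    rw [← pow_succ']; congr 1; ring
  rw [e1, e2, e3, e4]
  have hx2 := eps_mul_self (k := k) m p
  have hy2 := eps_mul_self (k := k) n q
  set κ := eps k n q ^ (m + p + 1)
  set ex := eps k m p
  set ey := eps k n q
  have hκ : κ * κ = 1 := by
    rw [← mul_pow, hy2, one_pow]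
  simp only [LinearMap.map_smul]
  match_scalars
  all_goals first
    | ring1
    | linear_combination (ex * κ) * hy2
    | linear_combination (-ex * κ) * hy2
    | linear_combination (ey * κ * κ) * hx2 + ey * hκ

end

end Bracket

section Cochains

variable {k A : Type u} [Field k] [Ring A] [Algebra k A]

lemma negOnePow_smul {M : Type*} [AddCommGroup M] [Module k M] {z : ℤ} {n : ℕ}
    (h : ∃ r : ℤ, z = n + 2 * r) (v : M) : z.negOnePow • v = (-1 : k) ^ n • v := by
  obtain ⟨r, rfl⟩ := h
  rw [Int.negOnePow_add, Int.negOnePow_two_mul, mul_one]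
  rcases Nat.even_or_odd n with hn | hn
  · rw [hn.neg_one_pow, Int.negOnePow_even _ ((Int.even_coe_nat n).2 hn), one_smul, one_smul]
  · rw [hn.neg_one_pow, Int.negOnePow_odd _ ((Int.odd_coe_nat n).2 hn), Units.neg_smul, one_smul,
      neg_one_smul]

lemma slot_smul {i l a b N N' : ℕ} (hN : i + a + l = N) (hN' : i + b + l = N') (c : k)
    (φ : T k A a →ₗ[k] T k A b) : slot i l hN hN' (c • φ) = c • slot i l hN hN' φ := by
  refine LinearMap.ext fun w => ?_
  simp [slot, TensorProduct.map_smul_left, TensorProduct.map_smul_right, LinearMap.smul_comp,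
    LinearMap.comp_smul]

lemma slot_add {i l a b N N' : ℕ} (hN : i + a + l = N) (hN' : i + b + l = N')
    (φ χ : T k A a →ₗ[k] T k A b) :
    slot i l hN hN' (φ + χ) = slot i l hN hN' φ + slot i l hN hN' χ := by
  refine LinearMap.ext fun w => ?_
  simp [slot, TensorProduct.map_add_left, TensorProduct.map_add_right, LinearMap.add_comp,
    LinearMap.comp_add]

variable {m p n q N s : ℕ}

lemma lamX_add {l N' : ℕ} (x y : T k A m →ₗ[k] X k A p) (h : m + l = N) (h' : p + l = N') :
    lamX (x + y) h h' = lamX x h h' + lamX y h h' := by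
  simp only [lamX, TensorProduct.map_add_left, LinearMap.add_comp, LinearMap.comp_add]

lemma lamX_smul {l N' : ℕ} (c : k) (x : T k A m →ₗ[k] X k A p) (h : m + l = N) (h' : p + l = N') :
    lamX (c • x) h h' = c • lamX x h h' := by
  simp only [lamX, TensorProduct.map_smul_left, LinearMap.smul_comp, LinearMap.comp_smul]

lemma psiT_add {t N' : ℕ} (x y : T k A m →ₗ[k] X k A p) (h : m + t = N + 1) (h' : p + t = N') :
    psiT (x + y) t h h' = psiT x t h h' + psiT y t h h' := by
  simp only [psiT, LinearMap.comp_add, slot_add, smul_add, Finset.sum_add_distrib]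

lemma psiT_smul {t N' : ℕ} (c : k) (x : T k A m →ₗ[k] X k A p) (h : m + t = N + 1)
    (h' : p + t = N') : psiT (c • x) t h h' = c • psiT x t h h' := by
  simp only [psiT, LinearMap.comp_smul, slot_smul, smul_comm _ c, Finset.smul_sum]

lemma bul_add_left (x x' : T k A m →ₗ[k] X k A p) (y : T k A n →ₗ[k] X k A q) (hm : 1 ≤ m)
    (hN : N + 1 = m + n) (hs : p + q = s) :
    bul (x + x') y hm hN hs = bul x y hm hN hs + bul x' y hm hN hs := by
  simp only [bul, lamX_add, psiT_add, LinearMap.add_comp, TensorProduct.map_add_right, smul_add]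
  abel

lemma bul_add_right (x : T k A m →ₗ[k] X k A p) (y y' : T k A n →ₗ[k] X k A q) (hm : 1 ≤ m)
    (hN : N + 1 = m + n) (hs : p + q = s) :
    bul x (y + y') hm hN hs = bul x y hm hN hs + bul x y' hm hN hs := by
  simp only [bul, lamX_add, psiT_add, LinearMap.comp_add, smul_add]
  abel

lemma bul_smul_left (c : k) (x : T k A m →ₗ[k] X k A p) (y : T k A n →ₗ[k] X k A q) (hm : 1 ≤ m)
    (hN : N + 1 = m + n) (hs : p + q = s) : bul (c • x) y hm hN hs = c • bul x y hm hN hs := by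
  simp only [bul, lamX_smul, psiT_smul, LinearMap.smul_comp, TensorProduct.map_smul_right,
    smul_add, smul_comm _ c]

lemma bul_smul_right (c : k) (x : T k A m →ₗ[k] X k A p) (y : T k A n →ₗ[k] X k A q) (hm : 1 ≤ m)
    (hN : N + 1 = m + n) (hs : p + q = s) : bul x (c • y) hm hN hs = c • bul x y hm hN hs := by
  simp only [bul, lamX_smul, psiT_smul, LinearMap.comp_smul, smul_add, smul_comm _ c]

lemma br_add_left (x x' : T k A m →ₗ[k] X k A p) (y : T k A n →ₗ[k] X k A q) (hm : 1 ≤ m)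
    (hn : 1 ≤ n) (hN : N + 1 = m + n) (hs : p + q = s) :
    br (x + x') y hm hn hN hs = br x y hm hn hN hs + br x' y hm hn hN hs := by
  simp only [br, bul_add_left, bul_add_right, smul_add]
  abel

lemma br_add_right (x : T k A m →ₗ[k] X k A p) (y y' : T k A n →ₗ[k] X k A q) (hm : 1 ≤ m)
    (hn : 1 ≤ n) (hN : N + 1 = m + n) (hs : p + q = s) :
    br x (y + y') hm hn hN hs = br x y hm hn hN hs + br x y' hm hn hN hs := by
  simp only [br, bul_add_left, bul_add_right, smul_add]
  abel

lemma br_smul_left (c : k) (x : T k A m →ₗ[k] X k A p) (y : T k A n →ₗ[k] X k A q) (hm : 1 ≤ m)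
    (hn : 1 ≤ n) (hN : N + 1 = m + n) (hs : p + q = s) :
    br (c • x) y hm hn hN hs = c • br x y hm hn hN hs := by
  simp only [br, bul_smul_left, bul_smul_right, smul_sub, smul_comm _ c]

lemma br_smul_right (c : k) (x : T k A m →ₗ[k] X k A p) (y : T k A n →ₗ[k] X k A q) (hm : 1 ≤ m)
    (hn : 1 ≤ n) (hN : N + 1 = m + n) (hs : p + q = s) :
    br x (c • y) hm hn hN hs = c • br x y hm hn hN hs := by
  simp only [br, bul_smul_left, bul_smul_right, smul_sub, smul_comm _ c]

lemma br_symm (x : T k A m →ₗ[k] X k A p) (y : T k A n →ₗ[k] X k A q) (hm : 1 ≤ m)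
    (hn : 1 ≤ n) (hN : N + 1 = m + n) (hN' : N + 1 = n + m) (hs : p + q = s) (hs' : q + p = s) :
    br x y hm hn hN hs = - (eps k n q ^ (m + p + 1) • br y x hn hm hN' hs') := by
  have h := eps_mul_self (k := k) m p
  rw [br, br, ← eps_pow, smul_sub, smul_smul, ← mul_pow, h, one_pow, one_smul]
  abel

lemma piR_comp_closeD (x : T k A m →ₗ[k] X k A p) :
    piR k A p ∘ₗ closeD k A p ∘ₗ x = (-1 : k) ^ p • x :=
  LinearMap.ext fun w => piR_closeD p (x w)

lemma bullet_closeD (x : T k A m →ₗ[k] X k A p) (y : T k A n →ₗ[k] X k A q) (hm : 1 ≤ m)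
    (hN : N + 1 = m + n) (hs : p + q = s) :
    bullet hm hN hs (closeD k A p ∘ₗ x) (closeD k A q ∘ₗ y) = closeD k A s ∘ₗ bul x y hm hN hs := by
  have e : piB k A q ∘ₗ closeD k A q ∘ₗ y =
      (-1 : k) ^ q • (consBar LinearMap.id (Nat.add_comm 1 q) ∘ₗ y) := by
    rw [piB, LinearMap.comp_assoc, piR_comp_closeD, LinearMap.comp_smul]
  have e' : piB k A p ∘ₗ closeD k A p ∘ₗ x =
      (-1 : k) ^ p • (consBar LinearMap.id (Nat.add_comm 1 p) ∘ₗ x) := by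
    rw [piB, LinearMap.comp_assoc, piR_comp_closeD, LinearMap.comp_smul]
  have hpq : (-1 : k) ^ p * (-1) ^ q * (-1) ^ (p + q) = 1 := by
    rw [← pow_add, neg_one_pow_mul_self]
  have h1 : ∀ i : Fin m, ((p : ℤ) + q + i * ((q : ℤ) - n - 1)).negOnePow •
      bulletPos hN hs (closeD k A p ∘ₗ x) (closeD k A q ∘ₗ y) i =
      closeD k A s ∘ₗ lamX x (rfl : m + q = m + q) hs ∘ₗ (eps k n q ^ (i : ℕ) •
        slot (i : ℕ) (m - 1 - i) (by omega) (by omega)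
          (consBar LinearMap.id (Nat.add_comm 1 q) ∘ₗ y)) := by
    intro i
    rw [negOnePow_smul (k := k) (n := p + q + i * (n + q + 1)), bulletPos, e, piR_comp_closeD,
      slot_smul, TensorProduct.map_smul_left, pow_add, mul_comm (i : ℕ), pow_mul]
    · simp only [LinearMap.comp_smul, LinearMap.smul_comp, smul_smul]
      congr 1
      · simp only [eps]
        linear_combination ((-1) ^ (n + q + 1)) ^ (i : ℕ) * hpq
    · exact ⟨- (i * (n + 1)), by push_cast; ring⟩
  have h2 : ∀ j : Fin q, ((p : ℤ) + q + (j + 1) * ((p : ℤ) - m - 1)).negOnePow •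
      bulletNeg hm hN hs (closeD k A p ∘ₗ x) (closeD k A q ∘ₗ y) j =
      closeD k A s ∘ₗ (eps k m p • (TensorProduct.map LinearMap.id (eps k m p ^ (j : ℕ) •
        slot (j : ℕ) (q - 1 - j) (by omega) (by omega)
          (consBar LinearMap.id (Nat.add_comm 1 p) ∘ₗ x)) ∘ₗ
        lamX y (l := m - 1) (N := N) (by omega) rfl)) := by
    intro j
    rw [negOnePow_smul (k := k) (n := p + q + (j + 1) * (m + p + 1)), bulletNeg, e',
      piR_comp_closeD, slot_smul, TensorProduct.map_smul_left, pow_add, mul_comm ((j : ℕ) + 1),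
      pow_mul]
    · simp only [LinearMap.comp_smul, LinearMap.smul_comp, smul_smul, TensorProduct.map_smul_right]
      congr 1
      simp only [eps]
      linear_combination ((-1) ^ (m + p + 1)) ^ ((j : ℕ) + 1) * hpq
    · exact ⟨- ((j + 1) * (m + 1)), by push_cast; ring⟩
  rw [bullet, Finset.sum_congr rfl fun i _ => h1 i, Finset.sum_congr rfl fun j _ => h2 j, bul,
    psiT, psiT, LinearMap.comp_add]
  have h3 : ∀ f : Fin q → (T k A (q + (m - 1)) →ₗ[k] T k A s),
      TensorProduct.map (LinearMap.id (R := k) (M := A)) (∑ j, f j) =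
        ∑ j, TensorProduct.map LinearMap.id (f j) :=
    fun f => map_sum (LinearMap.lTensorHom A) f Finset.univ
  rw [h3]
  refine LinearMap.ext fun w => ?_
  simp only [LinearMap.add_apply, LinearMap.sum_apply, LinearMap.comp_apply, LinearMap.smul_apply,
    map_sum, LinearMap.map_smul, Finset.smul_sum]

lemma sgBracket_closeD (x : T k A m →ₗ[k] X k A p) (y : T k A n →ₗ[k] X k A q) (hm : 1 ≤ m)
    (hn : 1 ≤ n) (hN : N + 1 = m + n) (hs : p + q = s) :
    sgBracket hm hn hN hs (closeD k A p ∘ₗ x) (closeD k A q ∘ₗ y) =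
      closeD k A s ∘ₗ br x y hm hn hN hs := by
  rw [sgBracket, bullet_closeD, bullet_closeD, negOnePow_smul (k := k)
    (n := (n + q + 1) * (m + p + 1)) ⟨- (m * q + m + p * n + n), by push_cast; ring⟩]
  rw [br, LinearMap.comp_sub, LinearMap.comp_smul, eps, ← pow_mul]

lemma closeD_mem_Coch (x : T k A m →ₗ[k] X k A p) : closeD k A p ∘ₗ x ∈ Coch k A m p :=
  fun w => ⟨cap (x w), rfl⟩

lemma exists_closeD {f : T k A m →ₗ[k] B k A p} (hf : f ∈ Coch k A m p) :
    ∃ x : T k A m →ₗ[k] X k A p, closeD k A p ∘ₗ x = f := by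
  refine ⟨(-1 : k) ^ p • (piR k A p ∘ₗ f), LinearMap.ext fun w => ?_⟩
  obtain ⟨y, hy⟩ := hf w
  rw [LinearMap.comp_apply, LinearMap.smul_apply, LinearMap.comp_apply, ← hy, LinearMap.map_smul,
    closeD_piR_d, smul_smul, neg_one_pow_mul_self, one_smul]

lemma lam_eq_lext (x : T k A m →ₗ[k] X k A p) (h : m + 0 = m) (h' : p + 0 = p) (y : Bar k A m) :
    lam x h h' y = lext x y := by
  induction y using bar_induction with
  | add x y hx hy => rw [map_add, map_add, hx, hy]
  | zero => simp only [TensorProduct.tmul_zero, TensorProduct.zero_tmul, map_zero, LinearMap.zero_apply, smul_zero]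
  | H a w b => rw [lam_cap_one, lext_tmul]

lemma delta_closeD_apply (x : T k A m →ₗ[k] X k A p) (h : m + 1 = n) (w : T k A n) :
    delta (actB k A p) h (closeD k A p ∘ₗ x) w =
      d k A p (lext x (dB h (cap ((1 : A) ⊗ₜ[k] w)))) := by
  rw [delta_closeD x h rfl rfl, lam_eq_lext]

lemma lext_cap_one (x : T k A m →ₗ[k] X k A p) (w : T k A m) :
    lext x (cap ((1 : A) ⊗ₜ[k] w)) = cap (x w) := by
  rw [cap_apply, lext_tmul, one_smul]; rfl

lemma d_lext_cap_one (x : T k A m →ₗ[k] X k A p) (w : T k A m) :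
    d k A p (lext x (cap ((1 : A) ⊗ₜ[k] w))) = closeD k A p (x w) := by
  rw [lext_cap_one]; rfl

lemma Rel.delta {x : T k A m →ₗ[k] X k A p} {x' : T k A (m + 1) →ₗ[k] X k A p} (hx : Rel x x') :
    delta (actB k A p) rfl (closeD k A p ∘ₗ x) = eps k m p • (closeD k A p ∘ₗ x') := by
  refine LinearMap.ext fun w => ?_
  have h := hx.lam_dB (l := 0) (N := m) (N' := p) rfl rfl (rfl : m + 1 = m + 1)
    (rfl : p + 1 = p + 1) rfl rfl rfl rfl (cap ((1 : A) ⊗ₜ[k] w))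
  rw [delta_closeD x rfl rfl rfl, h, LinearMap.map_smul, map_sub, d_dB, sub_zero, lam_eq_lext,
    d_lext_cap_one]
  rfl

lemma Rel.delta_br {x : T k A m →ₗ[k] X k A p} {x' : T k A (m + 1) →ₗ[k] X k A p}
    {y : T k A n →ₗ[k] X k A q} {y' : T k A (n + 1) →ₗ[k] X k A q} (hx : Rel x x')
    (hy : Rel y y') (hm : 1 ≤ m) (hn : 1 ≤ n) {N₁ : ℕ}
    (hN : N + 1 = m + n) (hs : p + q = s) (hN₁ : N + 1 = N₁) (hm' : 1 ≤ m + 1) (hn' : 1 ≤ n + 1)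
    (h₁ : N₁ + 1 = m + 1 + n) (h₂ : N₁ + 1 = m + (n + 1)) :
    TateHochschild.delta (actB k A s) hN₁ (closeD k A s ∘ₗ br x y hm hn hN hs) =
      eps k n q • (closeD k A s ∘ₗ br x y' hm hn' h₂ hs)
      + (eps k m p * eps k n q) • (closeD k A s ∘ₗ br x' y hm' hn h₁ hs) := by
  refine LinearMap.ext fun w => ?_
  rw [delta_closeD_apply, d_br_dB hx hy hm hn hN hs hN₁ hm' hn' h₁ h₂, d_lext_cap_one,
    d_lext_cap_one]
  rfl

lemma mem_ZExt {f : T k A m →ₗ[k] B k A p} : f ∈ ZExt k A m p ↔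
    f ∈ Coch k A m p ∧ delta (actB k A p) (rfl : m + 1 = m + 1) f = 0 := Iff.rfl

lemma rel_zero_of_mem_ZExt {x : T k A m →ₗ[k] X k A p}
    (hx : closeD k A p ∘ₗ x ∈ ZExt k A m p) : Rel x 0 := by
  have : xdelta x = 0 := by
    rw [xdelta, (mem_ZExt.1 hx).2, LinearMap.comp_zero, smul_zero]
  rw [← this]
  exact rel_xdelta x

lemma br_zero_left (y : T k A n →ₗ[k] X k A q) (hm : 1 ≤ m)
    (hn : 1 ≤ n) (hN : N + 1 = m + n) (hs : p + q = s) :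
    br (0 : T k A m →ₗ[k] X k A p) y hm hn hN hs = 0 := by
  rw [← zero_smul k (0 : T k A m →ₗ[k] X k A p), br_smul_left, zero_smul]

lemma br_zero_right (x : T k A m →ₗ[k] X k A p) (hm : 1 ≤ m)
    (hn : 1 ≤ n) (hN : N + 1 = m + n) (hs : p + q = s) :
    br x (0 : T k A n →ₗ[k] X k A q) hm hn hN hs = 0 := by
  rw [← zero_smul k (0 : T k A n →ₗ[k] X k A q), br_smul_right, zero_smul]

/-- The bracket of cocycles is a cocycle. -/
lemma sgBracket_mem_ZExt {f : T k A m →ₗ[k] B k A p} {g : T k A n →ₗ[k] B k A q}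
    (hf : f ∈ ZExt k A m p) (hg : g ∈ ZExt k A n q) (hm : 1 ≤ m) (hn : 1 ≤ n)
    (hN : N + 1 = m + n) (hs : p + q = s) : sgBracket hm hn hN hs f g ∈ ZExt k A N s := by
  obtain ⟨x, rfl⟩ := exists_closeD hf.1
  obtain ⟨y, rfl⟩ := exists_closeD hg.1
  rw [sgBracket_closeD]
  refine mem_ZExt.2 ⟨closeD_mem_Coch _, ?_⟩
  rw [(rel_zero_of_mem_ZExt hf).delta_br (rel_zero_of_mem_ZExt hg) hm hn hN hs
    rfl (by omega) (by omega) (by omega) (by omega), br_zero_left, br_zero_right]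
  simp

lemma sgBracket_symm {f : T k A m →ₗ[k] B k A p} {g : T k A n →ₗ[k] B k A q}
    (hf : f ∈ Coch k A m p) (hg : g ∈ Coch k A n q) (hm : 1 ≤ m) (hn : 1 ≤ n)
    (hN : N + 1 = m + n) (hN' : N + 1 = n + m) (hs : p + q = s) (hs' : q + p = s) :
    sgBracket hm hn hN hs f g =
      - (eps k n q ^ (m + p + 1) • sgBracket hn hm hN' hs' g f) := by
  obtain ⟨x, rfl⟩ := exists_closeD hf
  obtain ⟨y, rfl⟩ := exists_closeD hg
  rw [sgBracket_closeD, sgBracket_closeD, br_symm x y hm hn hN hN' hs hs', LinearMap.comp_neg,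
    LinearMap.comp_smul]

lemma sgBracket_add_left {f f' : T k A m →ₗ[k] B k A p} {g : T k A n →ₗ[k] B k A q}
    (hf : f ∈ Coch k A m p) (hf' : f' ∈ Coch k A m p) (hg : g ∈ Coch k A n q) (hm : 1 ≤ m)
    (hn : 1 ≤ n) (hN : N + 1 = m + n) (hs : p + q = s) : sgBracket hm hn hN hs (f + f') g =
      sgBracket hm hn hN hs f g + sgBracket hm hn hN hs f' g := by
  obtain ⟨x, rfl⟩ := exists_closeD hf
  obtain ⟨x', rfl⟩ := exists_closeD hf'
  obtain ⟨y, rfl⟩ := exists_closeD hg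
  rw [← LinearMap.comp_add, sgBracket_closeD, sgBracket_closeD, sgBracket_closeD, br_add_left,
    LinearMap.comp_add]

lemma sgBracket_add_right {f : T k A m →ₗ[k] B k A p} {g g' : T k A n →ₗ[k] B k A q}
    (hf : f ∈ Coch k A m p) (hg : g ∈ Coch k A n q) (hg' : g' ∈ Coch k A n q) (hm : 1 ≤ m)
    (hn : 1 ≤ n) (hN : N + 1 = m + n) (hs : p + q = s) : sgBracket hm hn hN hs f (g + g') =
      sgBracket hm hn hN hs f g + sgBracket hm hn hN hs f g' := by
  obtain ⟨x, rfl⟩ := exists_closeD hf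
  obtain ⟨y, rfl⟩ := exists_closeD hg
  obtain ⟨y', rfl⟩ := exists_closeD hg'
  rw [← LinearMap.comp_add, sgBracket_closeD, sgBracket_closeD, sgBracket_closeD, br_add_right,
    LinearMap.comp_add]

lemma sgBracket_smul_left (c : k) {f : T k A m →ₗ[k] B k A p} {g : T k A n →ₗ[k] B k A q}
    (hf : f ∈ Coch k A m p) (hg : g ∈ Coch k A n q) (hm : 1 ≤ m)
    (hn : 1 ≤ n) (hN : N + 1 = m + n) (hs : p + q = s) : sgBracket hm hn hN hs (c • f) g =
      c • sgBracket hm hn hN hs f g := by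
  obtain ⟨x, rfl⟩ := exists_closeD hf
  obtain ⟨y, rfl⟩ := exists_closeD hg
  rw [← LinearMap.comp_smul, sgBracket_closeD, sgBracket_closeD, br_smul_left,
    LinearMap.comp_smul]

lemma sgBracket_smul_right (c : k) {f : T k A m →ₗ[k] B k A p} {g : T k A n →ₗ[k] B k A q}
    (hf : f ∈ Coch k A m p) (hg : g ∈ Coch k A n q) (hm : 1 ≤ m)
    (hn : 1 ≤ n) (hN : N + 1 = m + n) (hs : p + q = s) : sgBracket hm hn hN hs f (c • g) =
      c • sgBracket hm hn hN hs f g := by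
  obtain ⟨x, rfl⟩ := exists_closeD hf
  obtain ⟨y, rfl⟩ := exists_closeD hg
  rw [← LinearMap.comp_smul, sgBracket_closeD, sgBracket_closeD, br_smul_right,
    LinearMap.comp_smul]

/-- The bracket of a cocycle and the coboundary of a cochain of positive degree. -/
lemma sgBracket_delta {f : T k A m →ₗ[k] B k A p} {g : T k A n →ₗ[k] B k A q}
    (hf : f ∈ ZExt k A m p) (hg : g ∈ Coch k A n q) (hm : 1 ≤ m) (hn : 1 ≤ n) {N₁ : ℕ}
    (hN : N + 1 = m + n) (hs : p + q = s) (hN₁ : N + 1 = N₁) (hn' : 1 ≤ n + 1)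
    (h₂ : N₁ + 1 = m + (n + 1)) :
    sgBracket hm hn' h₂ hs f (delta (actB k A q) rfl g) =
      delta (actB k A s) hN₁ (sgBracket hm hn hN hs f g) := by
  obtain ⟨x, rfl⟩ := exists_closeD hf.1
  obtain ⟨y, rfl⟩ := exists_closeD hg
  rw [(rel_xdelta y).delta, ← LinearMap.comp_smul, sgBracket_closeD, sgBracket_closeD,
    br_smul_right,
    (rel_zero_of_mem_ZExt hf).delta_br (rel_xdelta y) hm hn hN hs hN₁ (by omega) hn' (by omega) h₂,
    br_zero_left, LinearMap.comp_smul]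
  simp

end Cochains

section Extension

variable {k A : Type u} [Field k] [Ring A] [Algebra k A] {m p n q N s : ℕ}

/-- The map `x ⊗ id : Ā^{⊗m+1} → A ⊗ Ā^{⊗p+1}`. -/
def extX (x : T k A m →ₗ[k] X k A p) : T k A (m + 1) →ₗ[k] X k A (p + 1) := lamX x rfl rfl

lemma extX_cat (x : T k A m →ₗ[k] X k A p) (w : T k A m) (c : T k A 1) :
    extX x (cat rfl (w ⊗ₜ[k] c)) = appendX rfl (x w ⊗ₜ[k] c) := lamX_cat _ _ _ _ _

lemma lamX_extX (x : T k A m →ₗ[k] X k A p) {l l' N' : ℕ} (hl : 1 + l = l') (h : m + 1 + l = N)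
    (h' : p + 1 + l = N') (h₁ : m + l' = N) (h₁' : p + l' = N') :
    lamX (extX x) h h' = lamX x h₁ h₁' := by
  refine ext_cat3 h₁ hl fun u v z => ?_
  rw [lamX_cat, ← cat_assoc h rfl h₁ hl, lamX_cat, extX_cat, appendX_appendX h' rfl h₁' hl]

lemma lamX_cat_snoc (x : T k A m →ₗ[k] X k A p) {l l' N' N₁ N₁' : ℕ} (hl : l + 1 = l')
    (h : m + l = N) (h' : p + l = N') (h₁ : m + l' = N₁) (h₁' : p + l' = N₁') (hN : N + 1 = N₁)
    (hN' : N' + 1 = N₁') (w : T k A N) (c : T k A 1) :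
    lamX x h₁ h₁' (cat hN (w ⊗ₜ[k] c)) = appendX hN' (lamX x h h' w ⊗ₜ[k] c) := by
  induction w using cat_induction h with
  | add x y hx hy => simp only [TensorProduct.add_tmul, map_add, hx, hy]
  | zero => simp only [TensorProduct.tmul_zero, TensorProduct.zero_tmul, map_zero, LinearMap.zero_apply, smul_zero]
  | H u v =>
    rw [cat_assoc hN h h₁ hl, lamX_cat, lamX_cat, appendX_appendX hN' h' h₁' hl]

lemma slot_cat_snoc {i l l' a b N' N₁ N₁' : ℕ} (hl : l + 1 = l') (hN : i + a + l = N)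
    (hN' : i + b + l = N') (h₁ : i + a + l' = N₁) (h₁' : i + b + l' = N₁') (h : N + 1 = N₁)
    (h' : N' + 1 = N₁') (φ : T k A a →ₗ[k] T k A b) (w : T k A N) (c : T k A 1) :
    slot i l' h₁ h₁' φ (cat h (w ⊗ₜ[k] c)) = cat h' (slot i l hN hN' φ w ⊗ₜ[k] c) := by
  have e1 : i + (a + l) = N := by omega
  have e2 : i + (b + l) = N' := by omega
  have e3 : i + (a + l + 1) = N₁ := by omega
  have e4 : i + (b + l + 1) = N₁' := by omega
  have e5 : a + l' = a + l + 1 := by omega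
  have e6 : b + l' = b + l + 1 := by omega
  induction w using cat_induction e1 with
  | add x y hx hy => simp only [TensorProduct.add_tmul, map_add, hx, hy]
  | zero => simp only [TensorProduct.tmul_zero, TensorProduct.zero_tmul, map_zero, LinearMap.zero_apply, smul_zero]
  | H u w =>
    induction w using cat_induction (rfl : a + l = a + l) with
    | add x y hx hy => simp only [TensorProduct.tmul_add, TensorProduct.add_tmul, map_add, hx, hy]
    | zero => simp only [TensorProduct.tmul_zero, TensorProduct.zero_tmul, map_zero, LinearMap.zero_apply, smul_zero]
    | H v z =>
      rw [slot_cat hN hN' φ e1 rfl e2 rfl, cat_assoc h e1 e3 rfl, cat_assoc rfl rfl e5 hl,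
        slot_cat h₁ h₁' φ e3 e5 e4 e6, cat_assoc h' e2 e4 rfl, cat_assoc rfl rfl e6 hl]

lemma slot_extX (x : T k A m →ₗ[k] X k A p) {i l l' N' : ℕ} (hl : 1 + l = l')
    (h : i + (m + 1) + l = N) (h' : i + (p + 1 + 1) + l = N') (h₁ : i + m + l' = N)
    (h₁' : i + (p + 1) + l' = N') :
    slot i l h h' (consBar LinearMap.id (Nat.add_comm 1 (p + 1)) ∘ₗ extX x) =
      slot i l' h₁ h₁' (consBar LinearMap.id (Nat.add_comm 1 p) ∘ₗ x) := by
  have e1 : i + (m + l') = N := by omega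
  have e2 : m + 1 + l = m + l' := by omega
  have e3 : i + (p + 1 + l') = N' := by omega
  have e4 : p + 1 + 1 + l = p + 1 + l' := by omega
  refine ext_cat e1 fun u w => ?_
  induction w using cat_induction (rfl : m + l' = m + l') with
  | add x y hx hy => simp only [TensorProduct.tmul_add, map_add, hx, hy]
  | zero => simp only [TensorProduct.tmul_zero, TensorProduct.zero_tmul, map_zero, LinearMap.zero_apply, smul_zero]
  | H v w =>
    induction w using cat_induction hl with
    | add x y hx hy => simp only [TensorProduct.tmul_add, map_add, hx, hy]
    | zero => simp only [TensorProduct.tmul_zero, TensorProduct.zero_tmul, map_zero, LinearMap.zero_apply, smul_zero]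
    | H c z =>
      rw [slot_cat h₁ h₁' _ e1 rfl e3 rfl, ← cat_assoc e2 rfl rfl hl,
        slot_cat h h' _ e1 e2 e3 e4, LinearMap.comp_apply, extX_cat,
        consBar_appendX _ (Nat.add_comm 1 (p + 1)) rfl rfl (Nat.add_comm 1 p),
        cat_assoc e4 rfl rfl hl]
      rfl

lemma eps_succ_succ (m p : ℕ) : eps k (m + 1) (p + 1) = eps k m p := by
  simp only [eps]; ring

lemma psiT_succ (x : T k A m →ₗ[k] X k A p) {t N' : ℕ} (h : m + (t + 1) = N + 1)
    (h' : p + (t + 1) = N') (h₁ : m + 1 + t = N + 1) (h₁' : p + 1 + t = N') (h₂ : t + m + 0 = N)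
    (h₂' : t + (p + 1) + 0 = N') :
    psiT x (t + 1) h h' = psiT (extX x) t h₁ h₁' +
      eps k m p ^ t • slot t 0 h₂ h₂' (consBar LinearMap.id (Nat.add_comm 1 p) ∘ₗ x) := by
  rw [psiT, Fin.sum_univ_castSucc, psiT]
  congr 1
  · refine Finset.sum_congr rfl fun j _ => ?_
    rw [eps_succ_succ, slot_extX x (l' := t - j) (by omega) _ _ (by omega) (by omega)]
    simp
  · simp

lemma psiT_extX_cat (x : T k A m →ₗ[k] X k A p) {t N' : ℕ} (h : m + t = N + 1) (h' : p + t = N')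
    (h₁ : m + 1 + t = N + 1 + 1) (h₁' : p + 1 + t = N' + 1) (w : T k A N) (c : T k A 1) :
    psiT (extX x) t h₁ h₁' (cat rfl (w ⊗ₜ[k] c)) = cat rfl (psiT x t h h' w ⊗ₜ[k] c) := by
  rw [psiT, psiT]
  simp only [LinearMap.sum_apply, LinearMap.smul_apply, TensorProduct.sum_tmul, map_sum,
    ← TensorProduct.smul_tmul', map_smul]
  refine Finset.sum_congr rfl fun j _ => ?_
  rw [eps_succ_succ, slot_extX x (l' := t - j) (by omega) _ _ (by omega) (by omega),
    slot_cat_snoc (l := t - 1 - j) (by omega) (by omega) (by omega) _ _ rfl rfl]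

lemma appendX_map {a b a' b' : ℕ} (φ : T k A a →ₗ[k] T k A b) (φ' : T k A a' →ₗ[k] T k A b')
    (h : a + 1 = a') (h' : b + 1 = b') (c : T k A 1)
    (H : ∀ w, φ' (cat h (w ⊗ₜ[k] c)) = cat h' (φ w ⊗ₜ[k] c)) (z : X k A a) :
    TensorProduct.map LinearMap.id φ' (appendX h (z ⊗ₜ[k] c)) =
      appendX h' (TensorProduct.map LinearMap.id φ z ⊗ₜ[k] c) := by
  induction z using TensorProduct.induction_on with
  | zero => simp only [TensorProduct.tmul_zero, TensorProduct.zero_tmul, map_zero, LinearMap.zero_apply, smul_zero]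
  | add x y hx hy => simp only [TensorProduct.add_tmul, map_add, hx, hy]
  | tmul a w => simp [H]

lemma lamX_slot (x : T k A m →ₗ[k] X k A p) {b M M' : ℕ} (φ : T k A n →ₗ[k] T k A b)
    (h1 : m + n = N) (h2 : m + n + 0 = N) (h3 : m + b + 0 = M) (h4 : m + b = M) (h5 : p + b = s)
    (h6 : p + n = M') (h7 : p + n + 0 = M') (h8 : p + b + 0 = s) :
    lamX x h4 h5 ∘ₗ slot m 0 h2 h3 φ =
      TensorProduct.map LinearMap.id (slot p 0 h7 h8 φ) ∘ₗ lamX x h1 h6 := by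
  have e : ∀ {i a r : ℕ} (hh : i + a = r) (u : T k A i) (v : T k A a),
      cat hh (u ⊗ₜ[k] v) = cat (show i + (a + 0) = r from hh)
        (u ⊗ₜ[k] cat (rfl : a + 0 = a + 0) (v ⊗ₜ[k] nil)) := by
    intro i a r hh u v
    rw [cat_nil_right]
  refine ext_cat h1 fun u v => ?_
  rw [LinearMap.comp_apply, LinearMap.comp_apply, lamX_cat, e h1,
    slot_cat h2 h3 φ _ _ (show m + (b + 0) = M by omega) rfl, ← e h4, lamX_cat]
  generalize x u = z
  induction z using TensorProduct.induction_on with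
  | zero => simp only [TensorProduct.tmul_zero, TensorProduct.zero_tmul, map_zero, LinearMap.zero_apply, smul_zero]
  | add x y hx hy => simp only [TensorProduct.add_tmul, map_add, hx, hy]
  | tmul a w =>
    rw [appendX_tmul, appendX_tmul, TensorProduct.map_tmul, e h6,
      slot_cat h7 h8 φ _ _ (show p + (b + 0) = s by omega) rfl, ← e h5]
    rfl

variable (x : T k A m →ₗ[k] X k A p) (y : T k A n →ₗ[k] X k A q)

lemma bul_apply (hm : 1 ≤ m) (hN : N + 1 = m + n) (hs : p + q = s) {l M M₁ : ℕ} (hl : l + 1 = m)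
    (h1 : m + q = M) (h2 : n + m = N + 1) (h3 : q + m = M) (h4 : n + l = N) (h5 : q + l = M₁)
    (h6 : m + q = M₁ + 1) (w : T k A N) :
    bul x y hm hN hs w = lamX x h1 hs (psiT y m h2 h3 w) +
      eps k m p • TensorProduct.map LinearMap.id (psiT x q h6 hs) (lamX y h4 h5 w) := by
  subst hl h1 h5
  rfl

lemma bul_extX_left (hm : 1 ≤ m) (hN : N + 1 = m + n) (hs : p + q = s) (hm' : 1 ≤ m + 1)
    (hN' : N + 1 + 1 = m + 1 + n) (hs' : p + 1 + q = s + 1) {M : ℕ}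
    (h1 : m + n + 0 = N + 1) (h2 : m + (q + 1) + 0 = M) (h3 : m + (q + 1) = M)
    (h4 : p + (q + 1) = s + 1) :
    bul (extX x) y hm' hN' hs' = extX (bul x y hm hN hs) + eps k n q ^ m •
      (lamX x h3 h4 ∘ₗ slot m 0 h1 h2 (consBar LinearMap.id (Nat.add_comm 1 q) ∘ₗ y)) := by
  obtain ⟨l, rfl⟩ : ∃ l, m = l + 1 := ⟨m - 1, by omega⟩
  obtain rfl : M = l + 1 + q + 1 := by omega
  refine ext_cat (rfl : N + 1 = N + 1) fun w c => ?_
  rw [bul_apply (extX x) y hm' hN' hs' (rfl : l + 1 + 1 = _) (show l + 1 + 1 + q = l + 1 + q + 1 by omega)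
    (by omega) (by omega) (show n + (l + 1) = N + 1 by omega) (show q + (l + 1) = q + l + 1 by omega)
    (by omega), LinearMap.add_apply, extX_cat,
    bul_apply x y hm hN hs (rfl : l + 1 = _) (show l + 1 + q = l + 1 + q by omega)
    (by omega) (by omega) (show n + l = N by omega) (show q + l = q + l by omega)
    (by omega), lamX_extX x (show 1 + q = q + 1 by omega) _ _ h3 h4,
    psiT_succ y _ _ (by omega) (by omega) h1 h2, LinearMap.add_apply,
    psiT_extX_cat y (N' := l + 1 + q) (by omega) (by omega), map_add,
    lamX_cat_snoc x (rfl : q + 1 = _) rfl hs _ _ rfl rfl, eps_succ_succ,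
    lamX_cat_snoc y (rfl : l + 1 = _) (by omega) (rfl : q + l = q + l) _ _ rfl rfl,
    appendX_map (psiT x q (by omega) hs) _ rfl rfl c (psiT_extX_cat x _ _ _ _ · c)]
  simp only [TensorProduct.add_tmul, map_add, ← TensorProduct.smul_tmul', map_smul,
    LinearMap.smul_apply, LinearMap.comp_apply]
  abel

lemma bul_extX_right (hn : 1 ≤ n) (hN : N + 1 = n + m) (hs : q + p = s) 
    (hN' : N + 1 + 1 = n + (m + 1)) (hs' : q + (p + 1) = s + 1) {M : ℕ}
    (h1 : m + n = N + 1) (h2 : p + n = M) (h3 : p + n + 0 = M) (h4 : p + (q + 1) + 0 = s + 1) :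
    bul y (extX x) hn hN' hs' = extX (bul y x hn hN hs) + (eps k n q * eps k n q ^ p) •
      (TensorProduct.map LinearMap.id (slot p 0 h3 h4 (consBar LinearMap.id (Nat.add_comm 1 q) ∘ₗ y))
        ∘ₗ lamX x h1 h2) := by
  obtain ⟨l, rfl⟩ : ∃ l, n = l + 1 := ⟨n - 1, by omega⟩
  obtain rfl : M = p + l + 1 := by omega
  refine ext_cat (rfl : N + 1 = N + 1) fun w c => ?_
  rw [bul_apply y (extX x) hn hN' hs' (rfl : l + 1 = _) (show l + 1 + (p + 1) = l + 1 + p + 1 by omega)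
    (by omega) (by omega) (show m + 1 + l = N + 1 by omega) (show p + 1 + l = p + l + 1 by omega)
    (by omega), LinearMap.add_apply, extX_cat,
    bul_apply y x hn hN hs (rfl : l + 1 = _) (show l + 1 + p = l + 1 + p by omega)
    (by omega) (by omega) (show m + l = N by omega) (show p + l = p + l by omega)
    (by omega), lamX_extX x (show 1 + l = l + 1 by omega) _ _ h1 h2,
    psiT_succ y _ _ (by omega) (by omega) h3 h4,
    psiT_extX_cat x (N' := l + 1 + p) (by omega) (by omega),
    lamX_cat_snoc y (rfl : p + 1 = _) rfl hs _ _ rfl rfl, TensorProduct.map_add_right,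
    LinearMap.add_apply,
    lamX_cat_snoc x (rfl : l + 1 = _) (by omega) (rfl : p + l = p + l) _ _ rfl rfl,
    appendX_map (psiT y p (by omega) hs) _ rfl rfl c (psiT_extX_cat y _ _ _ _ · c)]
  simp only [TensorProduct.add_tmul, map_add, ← TensorProduct.smul_tmul', map_smul,
    LinearMap.smul_apply, LinearMap.comp_apply, TensorProduct.map_smul_right, smul_add, mul_smul]
  rw [lamX_cat_snoc x (rfl : l + 1 = _) (by omega) (rfl : p + l = p + l) _ _ rfl rfl]
  abel

lemma br_extX_left (hm : 1 ≤ m) (hn : 1 ≤ n) (hN : N + 1 = m + n) (hs : p + q = s)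
    (hm' : 1 ≤ m + 1) (hN' : N + 1 + 1 = m + 1 + n) (hs' : p + 1 + q = s + 1) :
    br (extX x) y hm' hn hN' hs' = extX (br x y hm hn hN hs) := by
  have key : ∀ u v : T k A N →ₗ[k] X k A s, ∀ c : k, extX (u - c • v) = extX u - c • extX v := by
    intro u v c
    have e : u - c • v = u + (-c) • v := by module
    rw [e, extX, lamX_add, lamX_smul]
    simp only [extX]
    module
  rw [br, br, key, bul_extX_left x y hm hN hs hm' hN' hs' (by omega)
    (show m + (q + 1) + 0 = m + (q + 1) by omega) (by omega) (by omega),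
    bul_extX_right x y hn (by omega) (by omega) (by omega) (by omega) (by omega)
    (rfl : p + n = p + n) (by omega) (by omega),
    lamX_slot x _ (by omega) _ _ _ _ rfl (by omega) (by omega)]
  have e : eps k n q ^ (m + 1 + (p + 1) + 1) * (eps k n q * eps k n q ^ p) = eps k n q ^ m := by
    simp only [eps, ← pow_mul, ← pow_add]
    refine npow_congr ?_
    obtain ⟨r, hr⟩ : ∃ r, n + q + 1 = r := ⟨_, rfl⟩
    rw [hr]
    have : r * (m + 1 + (p + 1) + 1) + (r + r * p) = r * m + 2 * (r * p + 2 * r) := by ring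
    omega
  have e' : eps k n q ^ (m + 1 + (p + 1) + 1) = eps k n q ^ (m + p + 1) := by
    simp only [eps, ← pow_mul]
    exact npow_congr (by
      have : (n + q + 1) * (m + 1 + (p + 1) + 1) = (n + q + 1) * (m + p + 1) + 2 * (n + q + 1) := by
        ring
      omega)
  rw [smul_add, smul_smul, e, e']
  abel

lemma br_extX_right (hm : 1 ≤ m) (hn : 1 ≤ n) (hN : N + 1 = m + n) (hs : p + q = s)
    (hn' : 1 ≤ n + 1) (hN' : N + 1 + 1 = m + (n + 1)) (hs' : p + (q + 1) = s + 1) :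
    br x (extX y) hm hn' hN' hs' = extX (br x y hm hn hN hs) := by
  rw [br_symm x (extX y) hm hn' hN' (by omega) hs' (by omega), br_extX_left y x hn hm (by omega)
    (by omega) hn' (by omega) (by omega), br_symm x y hm hn hN (by omega) hs (by omega),
    eps_succ_succ]
  rw [extX, extX, ← neg_smul, ← neg_smul, lamX_smul]

end Extension

section BimoduleCochains

variable {k A : Type u} [Field k] [Ring A] [Algebra k A] {M N p : ℕ}

lemma Rel.extX {m p : ℕ} {x : T k A m →ₗ[k] X k A p} {x' : T k A (m + 1) →ₗ[k] X k A p}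
    (hx : Rel x x') : Rel (extX x) (extX x') := by
  intro l l' N N₁ N' N₁' h h' h₁ h₁' hl h₂ hN hN' y
  have e := hx (l := l + 1) (l' := l' + 1) (show m + (l + 1) = N by omega)
    (show p + (l + 1) = N' by omega) (show m + (l' + 1) = N₁ by omega)
    (show p + (l' + 1) = N₁' by omega) (by omega) (by omega) hN hN' y
  rw [← lext_lamX, ← lext_lamX, ← lext_lamX, lamX_extX x (Nat.add_comm 1 l') h₁ h₁',
    lamX_extX x' (Nat.add_comm 1 l) h₂ h', lamX_extX x (Nat.add_comm 1 l) h h', eps_succ_succ]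
  exact e

/-- The bimodule extension of a cochain with values in `A ⊗ Ā^{⊗p} ⊗ A`. -/
def bext (φ : T k A N →ₗ[k] Bar k A p) : Bar k A N →ₗ[k] Bar k A p :=
  bimoduleExt (actBar k A p) φ

lemma bext_tmul (φ : T k A N →ₗ[k] Bar k A p) (a b : A) (w : T k A N) :
    bext φ ((a ⊗ₜ[k] w) ⊗ₜ[k] b) = a • rm b (φ w) := by
  rw [← actBar_apply]
  simp [bext, bimoduleExt]

lemma isL_bext (φ : T k A N →ₗ[k] Bar k A p) : IsL (bext φ) := by
  intro a x
  induction x using bar_induction with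
  | add x y hx hy => simp only [map_add, smul_add, hx, hy]
  | zero => simp only [TensorProduct.tmul_zero, TensorProduct.zero_tmul, map_zero, LinearMap.zero_apply, smul_zero]
  | H c w d => simp [bext_tmul, mul_smul]

lemma isR_bext (φ : T k A N →ₗ[k] Bar k A p) : IsR (bext φ) := by
  intro a x
  induction x using bar_induction with
  | add x y hx hy => simp only [map_add, hx, hy]
  | zero => simp only [TensorProduct.tmul_zero, TensorProduct.zero_tmul, map_zero, LinearMap.zero_apply, smul_zero]
  | H c w d => simp [bext_tmul, rm_mul, smul_rm]

/-- The restriction of a map to words. -/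
def onWords (K : Bar k A N →ₗ[k] Bar k A p) : T k A N →ₗ[k] Bar k A p :=
  K ∘ₗ cap ∘ₗ TensorProduct.mk k A (T k A N) 1

lemma onWords_apply (K : Bar k A N →ₗ[k] Bar k A p) (w : T k A N) :
    onWords K w = K (cap ((1 : A) ⊗ₜ[k] w)) := rfl

lemma onWords_bext (φ : T k A N →ₗ[k] Bar k A p) : onWords (bext φ) = φ :=
  LinearMap.ext fun w => by rw [onWords_apply, cap_apply, bext_tmul, one_smul, rm_one]

lemma bext_onWords {K : Bar k A N →ₗ[k] Bar k A p} (hL : IsL K) (hR : IsR K) :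
    bext (onWords K) = K := by
  ext1
  refine LinearMap.ext fun x => LinearMap.ext fun b => ?_
  induction x using TensorProduct.induction_on with
  | zero => simp only [TensorProduct.tmul_zero, TensorProduct.zero_tmul, map_zero, LinearMap.zero_apply, smul_zero]
  | add x y hx hy => simp only [map_add, LinearMap.add_apply, hx, hy]
  | tmul a w =>
    change bext (onWords K) ((a ⊗ₜ[k] w) ⊗ₜ[k] b) = K ((a ⊗ₜ[k] w) ⊗ₜ[k] b)
    rw [bext_tmul, onWords_apply, ← hR, ← hL, ← tmul_eq_smul_rm]

lemma delta_eq_onWords (φ : T k A N →ₗ[k] Bar k A p) (h : N + 1 = M) :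
    delta (actBar k A p) h φ = onWords (bext φ ∘ₗ dB h) :=
  LinearMap.ext fun w => by
    rw [onWords_apply, LinearMap.comp_apply, cap_apply, dB_tmul, one_smul, rm_one]; rfl

lemma bext_dB_eq_zero {φ : T k A N →ₗ[k] Bar k A p} {h : N + 1 = M}
    (H : delta (actBar k A p) h φ = 0) : bext φ ∘ₗ dB h = 0 := by
  rw [← bext_onWords ((isL_bext φ).comp (isL_dB h)) ((isR_bext φ).comp (isR_dB h)),
    ← delta_eq_onWords, H]
  ext1
  refine LinearMap.ext fun x => LinearMap.ext fun b => ?_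
  induction x using TensorProduct.induction_on with
  | zero => simp only [TensorProduct.tmul_zero, TensorProduct.zero_tmul, map_zero, LinearMap.zero_apply, smul_zero]
  | add x y hx hy => simp only [map_add, LinearMap.add_apply, hx, hy]
  | tmul a w =>
    change bext 0 ((a ⊗ₜ[k] w) ⊗ₜ[k] b) = 0
    rw [bext_tmul]; simp

lemma d_smul_rm (a b : A) (x : Bar k A p) :
    d k A p (a • rm b x) = actB k A p a (d k A p x) b := by
  cases p with
  | zero =>
    rw [d_zero, aug_smul, aug_rm, ← mul_assoc]; rfl
  | succ p =>
    change dB rfl _ = actBar k A p a (dB rfl x) b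
    rw [actBar_apply, isL_dB, isR_dB]

lemma bimoduleExt_d (φ : T k A N →ₗ[k] Bar k A p) (y : Bar k A N) :
    bimoduleExt (actB k A p) (d k A p ∘ₗ φ) y = d k A p (bext φ y) := by
  induction y using bar_induction with
  | add x y hx hy => simp only [map_add, hx, hy]
  | zero => simp only [TensorProduct.tmul_zero, TensorProduct.zero_tmul, map_zero, LinearMap.zero_apply, smul_zero]
  | H a w b => rw [bext_tmul, d_smul_rm]; rfl

lemma delta_d (φ : T k A N →ₗ[k] Bar k A p) (h : N + 1 = M) :
    delta (actB k A p) h (d k A p ∘ₗ φ) = d k A p ∘ₗ delta (actBar k A p) h φ :=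
  LinearMap.ext fun w => bimoduleExt_d φ (dbar h w)

lemma Rel.dB_cap_extX {m p : ℕ} {x : T k A m →ₗ[k] X k A p} (hx : Rel x 0) (w : T k A (m + 1)) :
    dB rfl (cap (TateHochschild.extX x w)) =
      -(eps k m p • TateHochschild.delta (actBar k A p) (rfl : m + 1 = m + 1) (cap ∘ₗ x) w) := by
  have e := hx (l := 0) (l' := 1) rfl rfl rfl rfl rfl rfl (rfl : m + 1 = m + 1)
    (rfl : p + 1 = p + 1) (cap ((1 : A) ⊗ₜ[k] w))
  have e1 : lam x (l := 1) (rfl : m + 1 = m + 1) (rfl : p + 1 = p + 1) (cap ((1 : A) ⊗ₜ[k] w)) =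
      cap (TateHochschild.extX x w) := by
    rw [← lext_lamX, lext_cap_one]; rfl
  have e2 : lam (0 : T k A (m + 1) →ₗ[k] X k A p) (l := 0) rfl rfl (cap ((1 : A) ⊗ₜ[k] w)) = 0 := by
    rw [← lext_lamX, lext_cap_one]; simp [lamX]
  have e3 : bext (cap ∘ₗ x) = lam x (l := 0) rfl rfl := by
    rw [← bext_onWords (isL_lam x rfl rfl) (isR_lam x rfl rfl)]
    congr 1
    refine LinearMap.ext fun w => ?_
    rw [onWords_apply, lam_eq_lext, lext_cap_one]; rfl
  rw [e1, e2, zero_sub] at e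
  rw [delta_eq_onWords, e3, onWords_apply, LinearMap.comp_apply]
  exact e

end BimoduleCochains

namespace FrobeniusForm

variable {k A : Type u} [Field k] [Ring A] [Algebra k A] (F : FrobeniusForm k A)
  [FiniteDimensional k A]

lemma sum_mul_u_tmul_v {V : Type u} [AddCommGroup V] [Module k V] (Φ : A →ₗ[k] A →ₗ[k] V) (b : A) :
    ∑ j, Φ (b * F.u j) (F.v j) = ∑ j, Φ (F.u j) (F.v j * b) := by
  have e1 : ∀ j, b * F.u j = ∑ l, F.form (F.v l * b) (F.u j) • F.u l := by
    intro j
    conv_lhs => rw [← F.sum_form_v (b * F.u j)]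
    exact Finset.sum_congr rfl fun l _ => by rw [F.assoc]
  have e2 : ∀ l, F.v l * b = ∑ j, F.form (F.v l * b) (F.u j) • F.v j := fun l =>
    (F.sum_form_u _).symm
  simp_rw [e1]
  conv_rhs => enter [2, l]; rw [e2 l]
  simp only [map_sum, map_smul, LinearMap.sum_apply, LinearMap.smul_apply]
  exact Finset.sum_comm

variable {M N N' p : ℕ}

/-- `x ⊗ b ↦ ⟨b, 1⟩ x`. -/
def formR (p : ℕ) : Bar k A p →ₗ[k] X k A p :=
  (TensorProduct.rid k _).toLinearMap ∘ₗ TensorProduct.map LinearMap.id (F.form.flip 1)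

@[simp] lemma formR_tmul (x : X k A p) (b : A) : F.formR p (x ⊗ₜ[k] b) = F.form b 1 • x := rfl

lemma formR_smul (a : A) (y : Bar k A p) : F.formR p (a • y) = a • F.formR p y := by
  induction y using bar_induction with
  | add x y hx hy => simp only [smul_add, map_add, hx, hy]
  | zero => simp only [TensorProduct.tmul_zero, TensorProduct.zero_tmul, map_zero, LinearMap.zero_apply, smul_zero]
  | H c w d => rw [TensorProduct.smul_tmul', formR_tmul, formR_tmul, smul_comm]

lemma sum_formR (y : Bar k A p) : ∑ j, F.formR p (rm (F.u j) y) ⊗ₜ[k] F.v j = y := by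
  induction y using bar_induction with
  | add x y hx hy =>
    simp only [map_add, TensorProduct.add_tmul, Finset.sum_add_distrib, hx, hy]
  | zero => simp
  | H c w d =>
    conv_rhs => rw [← F.sum_form_u d]
    simp only [rm_tmul, formR_tmul, F.assoc, mul_one, TensorProduct.tmul_sum, TensorProduct.tmul_smul,
      TensorProduct.smul_tmul']

/-- The contraction of the complex of bimodule maps `Bar_• → Bar_p` in positive degrees. -/
def hop (h : N + 1 = N') (G : Bar k A N' →ₗ[k] Bar k A p) : Bar k A N →ₗ[k] Bar k A p :=
  (-1 : k) ^ N' • ∑ j, (TensorProduct.mk k (X k A p) A).flip (F.v j) ∘ₗ F.formR p ∘ₗ G ∘ₗ hR h ∘ₗ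
    rm (F.u j)

lemma hop_apply (h : N + 1 = N') (G : Bar k A N' →ₗ[k] Bar k A p) (y : Bar k A N) :
    F.hop h G y = (-1 : k) ^ N' • ∑ j, F.formR p (G (hR h (rm (F.u j) y))) ⊗ₜ[k] F.v j := by
  simp [hop]

lemma isL_hop (h : N + 1 = N') {G : Bar k A N' →ₗ[k] Bar k A p} (hG : IsL G) :
    IsL (F.hop h G) := by
  intro a y
  have e : ∀ j, F.formR p (G (hR h (rm (F.u j) (a • y)))) ⊗ₜ[k] F.v j =
      a • (F.formR p (G (hR h (rm (F.u j) y))) ⊗ₜ[k] F.v j) := by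
    intro j
    rw [smul_rm, isL_hR, hG, formR_smul, TensorProduct.smul_tmul']
  rw [hop_apply, hop_apply, smul_comm a]
  simp only [e, Finset.smul_sum]

lemma isR_hop (h : N + 1 = N') (G : Bar k A N' →ₗ[k] Bar k A p) :
    IsR (F.hop h G) := by
  intro b y
  rw [hop_apply, hop_apply, LinearMap.map_smul, map_sum]
  congr 1
  induction y using bar_induction with
  | add x y hx hy =>
    simp only [map_add, TensorProduct.add_tmul, Finset.sum_add_distrib, hx, hy]
  | zero => simp only [TensorProduct.tmul_zero, TensorProduct.zero_tmul, map_zero, LinearMap.zero_apply, smul_zero]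
  | H a w c =>
    have := F.sum_mul_u_tmul_v (V := Bar k A p)
      ((TensorProduct.mk k (X k A p) A) ∘ₗ F.formR p ∘ₗ G ∘ₗ hR h ∘ₗ
        TensorProduct.mk k (X k A N) A (a ⊗ₜ[k] w) ∘ₗ LinearMap.mulLeft k c) b
    simpa [mul_assoc] using this

lemma hop_identity (h : N + 1 = N') (h' : N' + 1 = M) {G : Bar k A N' →ₗ[k] Bar k A p}
    (hG : IsR G) : F.hop h' (G ∘ₗ dB h') + F.hop h G ∘ₗ dB h = G := by
  refine LinearMap.ext fun y => ?_
  rw [LinearMap.add_apply, LinearMap.comp_apply, hop_apply, hop_apply]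
  conv_rhs => rw [← F.sum_formR (G y)]
  subst h'
  simp only [LinearMap.comp_apply, dB_hR h, map_sub, LinearMap.map_smul, isR_dB h _ _, hG _ _,
    TensorProduct.sub_tmul, Finset.sum_sub_distrib, ← TensorProduct.smul_tmul', ← Finset.smul_sum]
  rw [smul_sub, smul_smul, pow_succ]
  linear_combination (norm := module) neg_one_pow_mul_self (k := k) N' •
    (∑ j, F.formR p (rm (F.u j) (G y)) ⊗ₜ[k] F.v j : Bar k A p)

/-- Cocycles of positive degree with values in `A ⊗ Ā^{⊗p} ⊗ A` are coboundaries. -/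
lemma exists_delta_eq (F : FrobeniusForm k A) {φ : T k A (N + 1) →ₗ[k] Bar k A p}
    (H : delta (actBar k A p) (rfl : N + 1 + 1 = N + 1 + 1) φ = 0) :
    ∃ χ : T k A N →ₗ[k] Bar k A p, delta (actBar k A p) rfl χ = φ := by
  refine ⟨onWords (F.hop rfl (bext φ)), ?_⟩
  have e := F.hop_identity (rfl : N + 1 = N + 1) (rfl : N + 1 + 1 = N + 1 + 1) (isR_bext φ)
  rw [bext_dB_eq_zero H] at e
  have z : F.hop (rfl : N + 1 + 1 = N + 1 + 1) (0 : Bar k A (N + 2) →ₗ[k] Bar k A p) = 0 := by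
    simp [hop]
  rw [z, zero_add] at e
  rw [delta_eq_onWords, bext_onWords (F.isL_hop rfl (isL_bext φ)) (F.isR_hop rfl _), e,
    onWords_bext]

end FrobeniusForm

section Classes

variable {k V V₁ V₂ H H₁ H₂ W : Type u} [Field k] [AddCommGroup V] [Module k V]
  [AddCommGroup V₁] [Module k V₁] [AddCommGroup V₂] [Module k V₂]
  [AddCommGroup H] [Module k H] [AddCommGroup H₁] [Module k H₁] [AddCommGroup H₂] [Module k H₂]
  [AddCommGroup W] [Module k W]

/-- The map `c` presents `H` as the quotient of the cocycles `Z` by the coboundaries `B ∩ Z`. -/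
structure IsCls {Z : Submodule k V} (c : Z →ₗ[k] H) (B : Submodule k V) : Prop where
  surjective : Function.Surjective c
  eq_zero_iff : ∀ z : Z, c z = 0 ↔ (z : V) ∈ B

lemma isCls_cls (Z B : Submodule k V) : IsCls (cls Z B) B where
  surjective := Submodule.mkQ_surjective _
  eq_zero_iff z := by
    rw [cls, Submodule.mkQ_apply, Submodule.Quotient.mk_eq_zero]; rfl

variable {Z B : Submodule k V} {c : Z →ₗ[k] H} {Z₁ B₁ : Submodule k V₁} {c₁ : Z₁ →ₗ[k] H₁}
  {Z₂ B₂ : Submodule k V₂} {c₂ : Z₂ →ₗ[k] H₂}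

lemma IsCls.eq_iff (hc : IsCls c B) (z z' : Z) : c z = c z' ↔ (z : V) - z' ∈ B := by
  rw [← sub_eq_zero, ← map_sub, hc.eq_zero_iff]; rfl

lemma IsCls.exists_lift (hc : IsCls c B) (L : Z →ₗ[k] W) (hL : ∀ z : Z, (z : V) ∈ B → L z = 0) :
    ∃ φ : H →ₗ[k] W, ∀ z, φ (c z) = L z := by
  refine ⟨(LinearMap.ker c).liftQ L (fun z hz => hL z ((hc.eq_zero_iff z).1 hz)) ∘ₗ
    (c.quotKerEquivOfSurjective hc.surjective).symm.toLinearMap, fun z => ?_⟩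
  have : (c.quotKerEquivOfSurjective hc.surjective).symm (c z) = (LinearMap.ker c).mkQ z := by
    rw [LinearEquiv.symm_apply_eq]; rfl
  rw [LinearMap.comp_apply, LinearEquiv.coe_coe, this]
  rfl

lemma IsCls.exists_map (hc : IsCls c B) (hc₁ : IsCls c₁ B₁) (L : V →ₗ[k] V₁)
    (hZ : ∀ z ∈ Z, L z ∈ Z₁) (hB : ∀ z ∈ Z, z ∈ B → L z ∈ B₁) :
    ∃ φ : H →ₗ[k] H₁, Induces c c₁ L φ := by
  obtain ⟨φ, hφ⟩ := hc.exists_lift (c₁ ∘ₗ L.restrict hZ)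
    (fun z hz => (hc₁.eq_zero_iff _).2 (hB z z.2 hz))
  exact ⟨φ, fun z => ⟨hZ z z.2, hφ z⟩⟩

lemma IsCls.exists_bilin (hc : IsCls c B) (hc₁ : IsCls c₁ B₁) (hc₂ : IsCls c₂ B₂)
    (b : V → V₁ → V₂) (hZ : ∀ x ∈ Z, ∀ y ∈ Z₁, b x y ∈ Z₂)
    (add_left : ∀ x ∈ Z, ∀ x' ∈ Z, ∀ y ∈ Z₁, b (x + x') y = b x y + b x' y)
    (smul_left : ∀ (r : k), ∀ x ∈ Z, ∀ y ∈ Z₁, b (r • x) y = r • b x y)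
    (add_right : ∀ x ∈ Z, ∀ y ∈ Z₁, ∀ y' ∈ Z₁, b x (y + y') = b x y + b x y')
    (smul_right : ∀ (r : k), ∀ x ∈ Z, ∀ y ∈ Z₁, b x (r • y) = r • b x y)
    (hB : ∀ x ∈ Z, x ∈ B → ∀ y ∈ Z₁, b x y ∈ B₂)
    (hB' : ∀ x ∈ Z, ∀ y ∈ Z₁, y ∈ B₁ → b x y ∈ B₂) :
    ∃ φ : H →ₗ[k] H₁ →ₗ[k] H₂, Induces₂ c c₁ c₂ b (fun x y => φ x y) := by
  let L : Z →ₗ[k] Z₁ →ₗ[k] H₂ := LinearMap.mk₂ k (fun x y => c₂ ⟨b x y, hZ x x.2 y y.2⟩)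
    (fun x x' y => by
      rw [← map_add]; exact congrArg c₂ (Subtype.ext (add_left x x.2 x' x'.2 y y.2)))
    (fun r x y => by
      rw [← map_smul]; exact congrArg c₂ (Subtype.ext (smul_left r x x.2 y y.2)))
    (fun x y y' => by
      rw [← map_add]; exact congrArg c₂ (Subtype.ext (add_right x x.2 y y.2 y' y'.2)))
    (fun r x y => by
      rw [← map_smul]; exact congrArg c₂ (Subtype.ext (smul_right r x x.2 y y.2)))
  obtain ⟨φ, hφ⟩ := hc.exists_lift L fun z hz => LinearMap.ext fun y =>
    (hc₂.eq_zero_iff _).2 (hB z z.2 hz y y.2)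
  obtain ⟨χ, hχ⟩ := hc₁.exists_lift φ.flip fun y hy => LinearMap.ext fun x => by
    obtain ⟨x, rfl⟩ := hc.surjective x
    rw [LinearMap.flip_apply, hφ]
    exact (hc₂.eq_zero_iff _).2 (hB' x x.2 y y.2 hy)
  refine ⟨χ.flip, fun x y => ⟨hZ x x.2 y y.2, ?_⟩⟩
  change χ (c₁ y) (c x) = _
  rw [hχ, LinearMap.flip_apply, hφ]
  rfl

lemma Induces.surjective {L : V → V₁} {φ : H → H₁} (h : Induces c c₁ L φ) (hc₁ : IsCls c₁ B₁)
    (H : ∀ y ∈ Z₁, ∃ x ∈ Z, y - L x ∈ B₁) : Function.Surjective φ := by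
  intro y
  obtain ⟨y, rfl⟩ := hc₁.surjective y
  obtain ⟨x, hx, hxy⟩ := H y y.2
  obtain ⟨hm, e⟩ := h ⟨x, hx⟩
  exact ⟨c ⟨x, hx⟩, by rw [e, eq_comm, hc₁.eq_iff]; exact hxy⟩

lemma Induces.injective {L : V → V₁} {φ : H →ₗ[k] H₁} (h : Induces c c₁ L φ) (hc : IsCls c B)
    (hc₁ : IsCls c₁ B₁) (H : ∀ x ∈ Z, L x ∈ B₁ → x ∈ B) : Function.Injective φ := by
  rw [← LinearMap.ker_eq_bot, LinearMap.ker_eq_bot']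
  intro x hx
  obtain ⟨x, rfl⟩ := hc.surjective x
  obtain ⟨hm, e⟩ := h x
  rw [e, hc₁.eq_zero_iff] at hx
  exact (hc.eq_zero_iff x).2 (H x x.2 hx)

lemma Induces.exists_equiv {L : V → V₁} {φ : H →ₗ[k] H₁} (h : Induces c c₁ L φ) (hc : IsCls c B)
    (hc₁ : IsCls c₁ B₁) (hi : ∀ x ∈ Z, L x ∈ B₁ → x ∈ B)
    (hs : ∀ y ∈ Z₁, ∃ x ∈ Z, y - L x ∈ B₁) :
    ∃ e : H ≃ₗ[k] H₁, Induces c c₁ L e :=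
  ⟨LinearEquiv.ofBijective φ ⟨h.injective hc hc₁ hi, h.surjective hc₁ hs⟩, h⟩

end Classes

section Stages

variable {k A : Type u} [Field k] [Ring A] [Algebra k A]

lemma isCls_extClass (M p : ℕ) : IsCls (extClass k A M p) (BExt k A M p) :=
  isCls_cls (ZExt k A M p) (BExt k A M p)

/-- The map `closeD ∘ x ↦ closeD ∘ (x ⊗ id)` on cochains. -/
def thetaC (M p : ℕ) : (T k A M →ₗ[k] B k A p) →ₗ[k] (T k A (M + 1) →ₗ[k] B k A (p + 1)) where
  toFun f := (-1 : k) ^ p • (closeD k A (p + 1) ∘ₗ extX (piR k A p ∘ₗ f))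
  map_add' f g := by
    rw [LinearMap.comp_add, extX, lamX_add, LinearMap.comp_add, smul_add]; rfl
  map_smul' r f := by
    rw [LinearMap.comp_smul, extX, lamX_smul, LinearMap.comp_smul, smul_comm]; rfl

lemma thetaC_apply {M p : ℕ} (f : T k A M →ₗ[k] B k A p) :
    thetaC M p f = (-1 : k) ^ p • (closeD k A (p + 1) ∘ₗ extX (piR k A p ∘ₗ f)) := rfl

lemma extX_smul {M p : ℕ} (r : k) (x : T k A M →ₗ[k] X k A p) : extX (r • x) = r • extX x :=
  lamX_smul _ _ _ _

lemma thetaC_closeD {M p : ℕ} (x : T k A M →ₗ[k] X k A p) :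
    thetaC M p (closeD k A p ∘ₗ x) = closeD k A (p + 1) ∘ₗ extX x := by
  rw [thetaC_apply, piR_comp_closeD, extX_smul, LinearMap.comp_smul, smul_smul,
    neg_one_pow_mul_self, one_smul]

lemma theta_eq (M p : ℕ) (f : T k A M →ₗ[k] B k A p) :
    theta M p f = (-1 : k) ^ (M + p) • thetaC M p f := by
  rw [thetaC_apply, smul_smul, ← pow_add, npow_congr (show (M + p + p) % 2 = M % 2 by omega)]
  rfl

lemma thetaC_delta {M p : ℕ} {f : T k A M →ₗ[k] B k A p} (hf : f ∈ Coch k A M p) :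
    thetaC (M + 1) p (delta (actB k A p) rfl f) =
      delta (actB k A (p + 1)) rfl (thetaC M p f) := by
  obtain ⟨x, rfl⟩ := exists_closeD hf
  rw [(rel_xdelta x).delta, LinearMap.map_smul, thetaC_closeD, thetaC_closeD,
    (rel_xdelta x).extX.delta, eps_succ_succ]

lemma thetaC_mem_Coch {M p : ℕ} (f : T k A M →ₗ[k] B k A p) :
    thetaC M p f ∈ Coch k A (M + 1) (p + 1) :=
  Submodule.smul_mem _ _ (closeD_mem_Coch _)

lemma thetaC_mem_ZExt {M p : ℕ} {f : T k A M →ₗ[k] B k A p} (hf : f ∈ ZExt k A M p) :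
    thetaC M p f ∈ ZExt k A (M + 1) (p + 1) :=
  mem_ZExt.2 ⟨thetaC_mem_Coch f, by rw [← thetaC_delta hf.1, (mem_ZExt.1 hf).2, map_zero]⟩

lemma thetaC_mem_BExt {M p : ℕ} {f : T k A M →ₗ[k] B k A p} (hf : f ∈ BExt k A M p) :
    thetaC M p f ∈ BExt k A (M + 1) (p + 1) := by
  cases M with
  | zero =>
    rw [(Submodule.mem_bot k).1 hf, map_zero]
    exact Submodule.zero_mem _
  | succ M =>
    obtain ⟨g, hg, rfl⟩ := hf
    exact ⟨thetaC M p g, thetaC_mem_Coch g, (thetaC_delta hg).symm⟩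

/-- The sign relating `thetaC` to the transition maps `phi`. -/
def stageSign (k : Type u) [Field k] (M p : ℕ) : k := if M = 0 then (-1) ^ p else 1

lemma stageSign_mul_self (M p : ℕ) : stageSign k M p * stageSign k M p = 1 := by
  rw [stageSign]
  split_ifs
  · exact neg_one_pow_mul_self p
  · exact one_mul 1

lemma phi_eq {m : ℤ} {M p : ℕ} (h : (M : ℤ) = m + p) (f : T k A M →ₗ[k] B k A p) :
    phi m M p f = stageSign k M p • thetaC M p f := by
  have h1 : (m + p).negOnePow • theta M p f = (-1 : k) ^ p • thetaC M p f := by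
    rw [negOnePow_smul (k := k) (n := M) ⟨0, by omega⟩, theta_eq, smul_smul, ← pow_add,
      npow_congr (show (M + (M + p)) % 2 = p % 2 by omega)]
  have h2 : m.negOnePow • theta M p f = thetaC M p f := by
    rw [negOnePow_smul (k := k) (n := M + p) ⟨-p, by push_cast; omega⟩, theta_eq, smul_smul,
      neg_one_pow_mul_self, one_smul]
  rw [phi, h1, h2, stageSign]
  by_cases hp : p = (-m).toNat
  · rw [if_pos hp]
    by_cases hM : M = 0
    · rw [if_pos hM]
    · obtain rfl : p = 0 := by omega
      rw [if_neg hM, pow_zero]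
  · rw [if_neg hp, if_neg (by omega), one_smul]

/-- The transition map of the inductive system on cochains, as a linear map. -/
def phiC (M p : ℕ) : (T k A M →ₗ[k] B k A p) →ₗ[k] (T k A (M + 1) →ₗ[k] B k A (p + 1)) :=
  stageSign k M p • thetaC M p

lemma phiC_apply {M p : ℕ} (f : T k A M →ₗ[k] B k A p) :
    phiC M p f = stageSign k M p • thetaC M p f := rfl

lemma exists_phiExt (M p : ℕ) : ∃ φ : Ext k A M p →ₗ[k] Ext k A (M + 1) (p + 1),
    Induces (extClass k A M p) (extClass k A (M + 1) (p + 1)) (phiC M p) φ :=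
  (isCls_extClass M p).exists_map (isCls_extClass (M + 1) (p + 1)) (phiC M p)
    (fun _ hf => Submodule.smul_mem _ _ (thetaC_mem_ZExt hf))
    (fun _ _ hf => Submodule.smul_mem _ _ (thetaC_mem_BExt hf))

/-- The transition map on cohomology. -/
def phiExt (M p : ℕ) : Ext k A M p →ₗ[k] Ext k A (M + 1) (p + 1) := (exists_phiExt M p).choose

lemma phiExt_induces (M p : ℕ) : Induces (extClass k A M p) (extClass k A (M + 1) (p + 1))
    (phiC M p) (phiExt (k := k) (A := A) M p) := (exists_phiExt M p).choose_spec

lemma d_mem_Coch {M p : ℕ} (φ : T k A M →ₗ[k] Bar k A p) : d k A p ∘ₗ φ ∈ Coch k A M p :=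
  fun w => ⟨φ w, rfl⟩

lemma mem_Omega_succ {p : ℕ} {y : Bar k A p} : y ∈ Omega k A (p + 1) ↔ d k A p y = 0 := by
  refine ⟨?_, fun h => ?_⟩
  · rintro ⟨z, rfl⟩
    exact d_dB rfl z
  · obtain ⟨z, rfl⟩ := exists_dB (rfl : p + 1 = p + 1) h
    exact ⟨z, rfl⟩

lemma d_comp_mem_ZExt {M p : ℕ} {χ : T k A M →ₗ[k] Bar k A p}
    {f : T k A (M + 1) →ₗ[k] B k A (p + 1)} (hf : f ∈ ZExt k A (M + 1) (p + 1))
    (hχ : delta (actBar k A p) (rfl : M + 1 = M + 1) χ = f) : d k A p ∘ₗ χ ∈ ZExt k A M p := by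
  refine mem_ZExt.2 ⟨d_mem_Coch χ, ?_⟩
  rw [delta_d, hχ]
  exact LinearMap.ext fun w => mem_Omega_succ.1 (hf.1 w)

/-- A cocycle `δχ` is cohomologous to the stabilization of the cocycle `∓ d ∘ χ`. -/
lemma add_thetaC_d_mem_BExt {M p : ℕ} {χ : T k A M →ₗ[k] Bar k A p}
    {f : T k A (M + 1) →ₗ[k] B k A (p + 1)} (hf : f ∈ ZExt k A (M + 1) (p + 1))
    (hχ : delta (actBar k A p) (rfl : M + 1 = M + 1) χ = f) :
    f + eps k M p • thetaC M p (d k A p ∘ₗ χ) ∈ BExt k A (M + 1) (p + 1) := by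
  have hg := d_comp_mem_ZExt hf hχ
  obtain ⟨x, hx⟩ := exists_closeD hg.1
  have hx0 : Rel x 0 := rel_zero_of_mem_ZExt (hx ▸ hg)
  rw [← hx, thetaC_closeD]
  refine ⟨(χ - cap ∘ₗ x : T k A M →ₗ[k] Bar k A p), fun w => ?_, ?_⟩
  · refine mem_Omega_succ.2 ?_
    change d k A p (χ w - cap (x w)) = 0
    rw [map_sub, sub_eq_zero]
    exact (LinearMap.congr_fun hx w).symm
  · change delta (actBar k A p) rfl (χ - cap ∘ₗ x) = _
    rw [map_sub, hχ]
    refine LinearMap.ext fun w => ?_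
    have e := hx0.dB_cap_extX w
    have e2 : delta (actBar k A p) rfl (cap ∘ₗ x) w =
        -(eps k M p • dB rfl (cap (extX x w))) := by
      rw [e, smul_neg, neg_neg, smul_smul, eps_mul_self, one_smul]
    let f' : T k A (M + 1) →ₗ[k] Bar k A p := f
    change f' w - delta (actBar k A p) rfl (cap ∘ₗ x) w = _
    rw [e2, sub_neg_eq_add]
    rfl

lemma thetaC_surj (F : FrobeniusForm k A) [FiniteDimensional k A] {M p : ℕ}
    {f : T k A (M + 1) →ₗ[k] B k A (p + 1)} (hf : f ∈ ZExt k A (M + 1) (p + 1)) :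
    ∃ g ∈ ZExt k A M p, f - thetaC M p g ∈ BExt k A (M + 1) (p + 1) := by
  obtain ⟨χ, hχ⟩ := F.exists_delta_eq (φ := f) (mem_ZExt.1 hf).2
  refine ⟨-(eps k M p • (d k A p ∘ₗ χ)),
    neg_mem (Submodule.smul_mem _ _ (d_comp_mem_ZExt hf hχ)), ?_⟩
  rw [map_neg, LinearMap.map_smul, sub_neg_eq_add]
  exact add_thetaC_d_mem_BExt hf hχ

lemma thetaC_inj (F : FrobeniusForm k A) [FiniteDimensional k A] {M p : ℕ}
    {f : T k A (M + 1) →ₗ[k] B k A p} (hf : f ∈ ZExt k A (M + 1) p)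
    (h : thetaC (M + 1) p f ∈ BExt k A (M + 2) (p + 1)) : f ∈ BExt k A (M + 1) p := by
  obtain ⟨x, rfl⟩ := exists_closeD hf.1
  have hx0 : Rel x 0 := rel_zero_of_mem_ZExt hf
  rw [thetaC_closeD] at h
  obtain ⟨g, hg, hgx⟩ := h
  let g' : T k A (M + 1) →ₗ[k] Bar k A p := g
  obtain ⟨χ, hχ⟩ := F.exists_delta_eq (φ := cap ∘ₗ x + eps k (M + 1) p • g') (by
    rw [map_add, LinearMap.map_smul]
    refine LinearMap.ext fun w => ?_
    have e : delta (actBar k A p) (rfl : M + 1 + 1 = M + 1 + 1) g' w = dB rfl (cap (extX x w)) :=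
      LinearMap.congr_fun hgx w
    rw [LinearMap.add_apply, LinearMap.smul_apply, e, hx0.dB_cap_extX w, smul_neg, smul_smul,
      eps_mul_self, one_smul, add_neg_cancel]
    rfl)
  refine ⟨d k A p ∘ₗ χ, d_mem_Coch χ, ?_⟩
  rw [delta_d, hχ]
  refine LinearMap.ext fun w => ?_
  have e0 : d k A p (g' w) = 0 := mem_Omega_succ.1 (hg w)
  rw [LinearMap.comp_apply, LinearMap.add_apply, LinearMap.smul_apply, map_add, LinearMap.map_smul,
    e0, smul_zero, add_zero]
  rfl

lemma phiExt_surjective (F : FrobeniusForm k A) [FiniteDimensional k A] (M p : ℕ) :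
    Function.Surjective (phiExt (k := k) (A := A) M p) :=
  (phiExt_induces M p).surjective (isCls_extClass _ _) fun y hy => by
    obtain ⟨g, hg, h⟩ := thetaC_surj F hy
    refine ⟨stageSign k M p • g, Submodule.smul_mem _ _ hg, ?_⟩
    rwa [phiC_apply, LinearMap.map_smul, smul_smul, stageSign_mul_self, one_smul]

lemma phiExt_injective (F : FrobeniusForm k A) [FiniteDimensional k A] {M : ℕ} (hM : 1 ≤ M)
    (p : ℕ) : Function.Injective (phiExt (k := k) (A := A) M p) :=
  (phiExt_induces M p).injective (isCls_extClass _ _) (isCls_extClass _ _) fun x hx h => by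
    obtain ⟨M, rfl⟩ : ∃ l, M = l + 1 := ⟨M - 1, by omega⟩
    rw [phiC_apply, stageSign, if_neg (by omega), one_smul] at h
    exact thetaC_inj F hx h

end Stages

section Colimit

variable {k A : Type u} [Field k] [Ring A] [Algebra k A]

/-- The iterated transition maps. -/
def up : ∀ (j : ℕ) {M p M' p' : ℕ}, M + j = M' → p + j = p' → Ext k A M p →ₗ[k] Ext k A M' p'
  | 0, _, _, _, _, h, h' => by subst h h'; exact LinearMap.id
  | j + 1, M, p, _, _, h, h' =>
    up j (M := M + 1) (p := p + 1) (by omega) (by omega) ∘ₗ phiExt M p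

lemma up_succ {j M p M' p' : ℕ} (h : M + (j + 1) = M') (h' : p + (j + 1) = p')
    (h₁ : M + 1 + j = M') (h₁' : p + 1 + j = p') (e : Ext k A M p) :
    up (j + 1) h h' e = up j h₁ h₁' (phiExt M p e) := rfl

lemma up_succ' {j M p M' p' : ℕ} (h : M + (j + 1) = M' + 1) (h' : p + (j + 1) = p' + 1)
    (h₁ : M + j = M') (h₁' : p + j = p') (e : Ext k A M p) :
    up (j + 1) h h' e = phiExt M' p' (up j h₁ h₁' e) := by
  induction j generalizing M p with
  | zero => subst h₁ h₁'; rfl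
  | succ j ih =>
    rw [up_succ h h' (by omega) (by omega), ih _ _ (by omega) (by omega),
      up_succ h₁ h₁' (by omega) (by omega)]

lemma up_surjective (F : FrobeniusForm k A) [FiniteDimensional k A] {j M p M' p' : ℕ}
    (h : M + j = M') (h' : p + j = p') : Function.Surjective (up (k := k) (A := A) j h h') := by
  induction j generalizing M p with
  | zero => subst h h'; exact Function.surjective_id
  | succ j ih => exact (ih _ _).comp (phiExt_surjective F M p)

lemma up_injective (F : FrobeniusForm k A) [FiniteDimensional k A] {j M p M' p' : ℕ}
    (h : M + j = M') (h' : p + j = p') (hM : 1 ≤ M) :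
    Function.Injective (up (k := k) (A := A) j h h') := by
  induction j generalizing M p with
  | zero => subst h h'; exact Function.injective_id
  | succ j ih => exact (ih _ _ (by omega)).comp (phiExt_injective F hM p)

/-- The iterated transition map as an isomorphism, in the degrees `M ≥ 1`. -/
def upEquiv (F : FrobeniusForm k A) [FiniteDimensional k A] {j M p M' p' : ℕ}
    (h : M + j = M') (h' : p + j = p') (hM : 1 ≤ M) : Ext k A M p ≃ₗ[k] Ext k A M' p' :=
  LinearEquiv.ofBijective (up j h h') ⟨up_injective F _ _ hM, up_surjective F _ _⟩

lemma upEquiv_symm_up (F : FrobeniusForm k A) [FiniteDimensional k A] {i j M p M' p' : ℕ}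
    (hij : i = j) (h : M + j = M') (h' : p + j = p') (h₁ : M + i = M') (h₁' : p + i = p')
    (hM : 1 ≤ M) (e : Ext k A M p) : (upEquiv F h₁ h₁' hM).symm (up j h h' e) = e := by
  subst hij
  exact (upEquiv F h₁ h₁' hM).symm_apply_apply e

lemma toSg_phiExt (m : ℤ) {M p : ℕ} (h : (M : ℤ) = m + p) (h' : ((M + 1 : ℕ) : ℤ) = m + (p + 1 : ℕ))
    (e : Ext k A M p) : toSg k A m (M + 1) (p + 1) h' (phiExt M p e) = toSg k A m M p h e := by
  obtain ⟨f, rfl⟩ := (isCls_extClass M p).surjective e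
  obtain ⟨hg, e⟩ := phiExt_induces M p f
  rw [e, eq_comm, ← sub_eq_zero, toSg, toSg, LinearMap.comp_apply, LinearMap.comp_apply, ← map_sub,
    Submodule.mkQ_apply, Submodule.Quotient.mk_eq_zero]
  exact Submodule.subset_span ⟨M, p, h, f, ⟨phiC M p f, hg⟩, (phi_eq h f.1).symm, rfl⟩

lemma toSg_up (m : ℤ) {j M p M' p' : ℕ} (h : M + j = M') (h' : p + j = p')
    (hM : (M : ℤ) = m + p) (hM' : (M' : ℤ) = m + p') (e : Ext k A M p) :
    toSg k A m M' p' hM' (up j h h' e) = toSg k A m M p hM e := by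
  induction j generalizing M p with
  | zero => subst h h'; rfl
  | succ j ih =>
    rw [up_succ h h' (by omega) (by omega), ih _ _ (by push_cast; omega), toSg_phiExt m hM]

lemma toSg_surjective (F : FrobeniusForm k A) [FiniteDimensional k A] (m : ℤ) {M p : ℕ}
    (h : (M : ℤ) = m + p) : Function.Surjective (toSg k A m M p h) := by
  classical
  rw [← LinearMap.range_eq_top, eq_top_iff]
  rintro x -
  obtain ⟨x, rfl⟩ := (sgRel k A m).mkQ_surjective x
  induction x using DirectSum.induction_on with
  | zero => rw [map_zero]; exact Submodule.zero_mem _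
  | add x y hx hy => rw [map_add]; exact Submodule.add_mem _ hx hy
  | of x e =>
    obtain ⟨⟨M', p'⟩, h'⟩ := x
    change toSg k A m M' p' h' e ∈ _
    simp only at h'
    rcases le_total p' p with hp | hp
    · obtain ⟨j, rfl⟩ := Nat.exists_eq_add_of_le hp
      obtain rfl : M = M' + j := by push_cast at h; omega
      exact ⟨up j rfl rfl e, toSg_up m rfl rfl h' h e⟩
    · obtain ⟨j, rfl⟩ := Nat.exists_eq_add_of_le hp
      obtain rfl : M' = M + j := by push_cast at h'; omega
      obtain ⟨e, rfl⟩ := up_surjective F (j := j) rfl rfl e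
      exact ⟨e, (toSg_up m rfl rfl h h' e).symm⟩

/-- For `M ≥ 1` the groups `Ext^{m+p}(A, Ω̄^p(A))` have compatible maps to `Ext^M(A, Ω̄^p(A))`. -/
lemma exists_retract (F : FrobeniusForm k A) [FiniteDimensional k A] (m : ℤ) {M p : ℕ} (hM : 1 ≤ M)
    (h : (M : ℤ) = m + p) : ∃ τ : ∀ x : Lev m, Ext k A x.1.1 x.1.2 →ₗ[k] Ext k A M p,
      (∀ (M' p' : ℕ) (h₁ : (M' : ℤ) = m + p') (h₂ : ((M' + 1 : ℕ) : ℤ) = m + (p' + 1 : ℕ))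
        (e : Ext k A M' p'), τ ⟨(M' + 1, p' + 1), h₂⟩ (phiExt M' p' e) = τ ⟨(M', p'), h₁⟩ e) ∧
      ∀ e, τ ⟨(M, p), h⟩ e = e := by
  classical
  let τ : ∀ x : Lev m, Ext k A x.1.1 x.1.2 →ₗ[k] Ext k A M p := fun x =>
    if hx : x.1.2 ≤ p then
      up (p - x.1.2) (by have := x.2; omega) (by omega)
    else (upEquiv F (j := x.1.2 - p) (M' := x.1.1) (p' := x.1.2) (by have := x.2; omega)
      (by omega) hM).symm.toLinearMap
  have h1 : ∀ (j M' p' : ℕ) (h₁ : (M' : ℤ) = m + p') (hj : M' + j = M) (hj' : p' + j = p) (e),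
      τ ⟨(M', p'), h₁⟩ e = up j hj hj' e := by
    intro j M' p' h₁ hj hj' e
    obtain rfl : j = p - p' := by omega
    simp only [τ]
    rw [dif_pos (by omega)]
  have h2 : ∀ (j M' p' : ℕ) (h₁ : (M' : ℤ) = m + p') (hj : M + j = M') (hj' : p + j = p') (e),
      τ ⟨(M', p'), h₁⟩ (up j hj hj' e) = e := by
    intro j M' p' h₁ hj hj' e
    rcases j with _ | j
    · subst hj hj'
      exact h1 0 _ _ h₁ rfl rfl e
    · simp only [τ]
      rw [dif_neg (by omega)]
      exact upEquiv_symm_up F (by omega) hj hj' _ _ hM e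
  refine ⟨τ, fun M' p' h₁ h₂ e => ?_, fun e => h2 0 M p h rfl rfl e⟩
  rcases lt_or_ge p' p with hp | hp
  · obtain ⟨j, rfl⟩ : ∃ j, p = p' + 1 + j := ⟨p - p' - 1, by omega⟩
    rw [h1 (j + 1) M' p' h₁ (by omega) (by omega), h1 j (M' + 1) (p' + 1) h₂ (by omega) rfl]
    rfl
  · obtain ⟨j, rfl⟩ : ∃ j, p' = p + j := ⟨p' - p, by omega⟩
    obtain rfl : M' = M + j := by omega
    obtain ⟨e, rfl⟩ := up_surjective F (j := j) rfl rfl e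
    rw [h2 j _ _ h₁ rfl rfl, ← up_succ' (j := j) (M' := M + j) (p' := p + j) rfl rfl rfl rfl,
      h2 (j + 1) _ _ h₂ rfl rfl]

lemma toSg_injective (F : FrobeniusForm k A) [FiniteDimensional k A] (m : ℤ) {M p : ℕ} (hM : 1 ≤ M)
    (h : (M : ℤ) = m + p) : Function.Injective (toSg k A m M p h) := by
  classical
  obtain ⟨τ, hτ, hid⟩ := exists_retract F m hM h
  let σ : (DirectSum (Lev m) fun x => Ext k A x.1.1 x.1.2) →ₗ[k] Ext k A M p :=
    DirectSum.toModule k (Lev m) _ τ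
  have hσ : sgRel k A m ≤ LinearMap.ker σ := by
    refine Submodule.span_le.2 ?_
    rintro y ⟨M', p', h', f, g, hg, rfl⟩
    rw [SetLike.mem_coe, LinearMap.mem_ker, map_sub, sub_eq_zero, DirectSum.toModule_lof,
      DirectSum.toModule_lof, ← hτ M' p' h' (by push_cast; omega)]
    congr 1
    obtain ⟨hm, e⟩ := phiExt_induces M' p' f
    rw [e]
    congr 1
    exact Subtype.ext ((phi_eq h' f.1).symm.trans hg.symm)
  intro e e' H
  have H2 := congrArg ((sgRel k A m).liftQ σ hσ) H
  have key : ∀ e, (sgRel k A m).liftQ σ hσ (toSg k A m M p h e) = e := by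
    intro e
    rw [toSg, LinearMap.comp_apply, Submodule.mkQ_apply, Submodule.liftQ_apply,
      DirectSum.toModule_lof, hid]
  rwa [key, key] at H2

/-- The canonical map to the colimit is an isomorphism in the degrees `M ≥ 1`. -/
def toSgEquiv (F : FrobeniusForm k A) [FiniteDimensional k A] (m : ℤ) {M p : ℕ} (hM : 1 ≤ M)
    (h : (M : ℤ) = m + p) : Ext k A M p ≃ₗ[k] ExtSg k A m :=
  LinearEquiv.ofBijective (toSg k A m M p h) ⟨toSg_injective F m hM h, toSg_surjective F m h⟩

end Colimit

section BracketOnExt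

variable {k A : Type u} [Field k] [Ring A] [Algebra k A] {M N p q r s : ℕ}

lemma sgBracket_thetaC_left {f : T k A M →ₗ[k] B k A p} {g : T k A N →ₗ[k] B k A q}
    (hf : f ∈ Coch k A M p) (hg : g ∈ Coch k A N q) (hM : 1 ≤ M) (hN : 1 ≤ N)
    (hr : r + 1 = M + N) (hs : p + q = s) (hM' : 1 ≤ M + 1) (hr' : r + 1 + 1 = M + 1 + N)
    (hs' : p + 1 + q = s + 1) :
    sgBracket hM' hN hr' hs' (thetaC M p f) g = thetaC r s (sgBracket hM hN hr hs f g) := by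
  obtain ⟨x, rfl⟩ := exists_closeD hf
  obtain ⟨y, rfl⟩ := exists_closeD hg
  rw [thetaC_closeD, sgBracket_closeD, sgBracket_closeD, thetaC_closeD, br_extX_left]

lemma sgBracket_thetaC_right {f : T k A M →ₗ[k] B k A p} {g : T k A N →ₗ[k] B k A q}
    (hf : f ∈ Coch k A M p) (hg : g ∈ Coch k A N q) (hM : 1 ≤ M) (hN : 1 ≤ N)
    (hr : r + 1 = M + N) (hs : p + q = s) (hN' : 1 ≤ N + 1) (hr' : r + 1 + 1 = M + (N + 1))
    (hs' : p + (q + 1) = s + 1) :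
    sgBracket hM hN' hr' hs' f (thetaC N q g) = thetaC r s (sgBracket hM hN hr hs f g) := by
  obtain ⟨x, rfl⟩ := exists_closeD hf
  obtain ⟨y, rfl⟩ := exists_closeD hg
  rw [thetaC_closeD, sgBracket_closeD, sgBracket_closeD, thetaC_closeD, br_extX_right]

lemma sgBracket_mem_BExt_right (F : FrobeniusForm k A) [FiniteDimensional k A]
    {f : T k A M →ₗ[k] B k A p} {g : T k A N →ₗ[k] B k A q}
    (hf : f ∈ ZExt k A M p) (hg : g ∈ ZExt k A N q) (hgB : g ∈ BExt k A N q) (hM : 1 ≤ M)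
    (hN : 1 ≤ N) (hr : r + 1 = M + N) (hs : p + q = s) :
    sgBracket hM hN hr hs f g ∈ BExt k A r s := by
  have pos : ∀ {N q r s : ℕ} {g : T k A (N + 1) →ₗ[k] B k A q} (_ : g ∈ BExt k A (N + 1) q)
      (_ : 1 ≤ N) (hN' : 1 ≤ N + 1) (hr : r + 1 = M + (N + 1)) (hs : p + q = s),
      sgBracket hM hN' hr hs f g ∈ BExt k A r s := by
    rintro N q r s g ⟨h, hh, rfl⟩ hN hN' hr hs
    obtain ⟨r, rfl⟩ : ∃ l, r = l + 1 := ⟨r - 1, by omega⟩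
    rw [sgBracket_delta hf hh hM hN (by omega) hs rfl hN' hr]
    refine ⟨_, ?_, rfl⟩
    obtain ⟨x, rfl⟩ := exists_closeD hf.1
    obtain ⟨y, rfl⟩ := exists_closeD hh
    rw [sgBracket_closeD]
    exact closeD_mem_Coch _
  obtain ⟨r, rfl⟩ : ∃ l, r = l + 1 := ⟨r - 1, by omega⟩
  refine thetaC_inj F (sgBracket_mem_ZExt hf hg hM hN hr hs) ?_
  rw [← sgBracket_thetaC_right hf.1 hg.1 hM hN hr hs (by omega) (by omega) (by omega)]
  exact pos (thetaC_mem_BExt hgB) hN _ _ _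

lemma sgBracket_mem_BExt_left (F : FrobeniusForm k A) [FiniteDimensional k A]
    {f : T k A M →ₗ[k] B k A p} {g : T k A N →ₗ[k] B k A q}
    (hf : f ∈ ZExt k A M p) (hg : g ∈ ZExt k A N q) (hfB : f ∈ BExt k A M p) (hM : 1 ≤ M)
    (hN : 1 ≤ N) (hr : r + 1 = M + N) (hs : p + q = s) :
    sgBracket hM hN hr hs f g ∈ BExt k A r s := by
  rw [sgBracket_symm hf.1 hg.1 hM hN hr (by omega) hs (by omega)]
  exact neg_mem (Submodule.smul_mem _ _ (sgBracket_mem_BExt_right F hg hf hfB hN hM _ _))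

lemma exists_sgExt (F : FrobeniusForm k A) [FiniteDimensional k A] (hM : 1 ≤ M)
    (hN : 1 ≤ N) (hr : r + 1 = M + N) (hs : p + q = s) :
    ∃ φ : Ext k A M p →ₗ[k] Ext k A N q →ₗ[k] Ext k A r s,
      Induces₂ (extClass k A M p) (extClass k A N q) (extClass k A r s) (sgBracket hM hN hr hs)
        (fun x y => φ x y) :=
  (isCls_extClass M p).exists_bilin (isCls_extClass N q) (isCls_extClass r s) _
    (fun _ hf _ hg => sgBracket_mem_ZExt hf hg hM hN hr hs)
    (fun _ hf _ hf' _ hg => sgBracket_add_left hf.1 hf'.1 hg.1 hM hN hr hs)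
    (fun c _ hf _ hg => sgBracket_smul_left c hf.1 hg.1 hM hN hr hs)
    (fun _ hf _ hg _ hg' => sgBracket_add_right hf.1 hg.1 hg'.1 hM hN hr hs)
    (fun c _ hf _ hg => sgBracket_smul_right c hf.1 hg.1 hM hN hr hs)
    (fun _ hf hfB _ hg => sgBracket_mem_BExt_left F hf hg hfB hM hN hr hs)
    (fun _ hf _ hg hgB => sgBracket_mem_BExt_right F hf hg hgB hM hN hr hs)

/-- The bracket on the groups `Ext^M(A, Ω̄^p(A))`, `M ≥ 1`. -/
def sgExt (F : FrobeniusForm k A) [FiniteDimensional k A] (hM : 1 ≤ M) (hN : 1 ≤ N)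
    (hr : r + 1 = M + N) (hs : p + q = s) :
    Ext k A M p →ₗ[k] Ext k A N q →ₗ[k] Ext k A r s := (exists_sgExt F hM hN hr hs).choose

lemma sgExt_induces (F : FrobeniusForm k A) [FiniteDimensional k A] (hM : 1 ≤ M) (hN : 1 ≤ N)
    (hr : r + 1 = M + N) (hs : p + q = s) :
    Induces₂ (extClass k A M p) (extClass k A N q) (extClass k A r s) (sgBracket hM hN hr hs)
        (fun x y => sgExt F hM hN hr hs x y) := (exists_sgExt F hM hN hr hs).choose_spec

lemma phiC_eq_thetaC (hM : 1 ≤ M) (f : T k A M →ₗ[k] B k A p) : phiC M p f = thetaC M p f := by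
  rw [phiC_apply, stageSign, if_neg (by omega), one_smul]

lemma sgExt_phiExt_left (F : FrobeniusForm k A) [FiniteDimensional k A] (hM : 1 ≤ M) (hN : 1 ≤ N)
    (hr : r + 1 = M + N) (hs : p + q = s) (hM' : 1 ≤ M + 1) (hr' : r + 1 + 1 = M + 1 + N)
    (hs' : p + 1 + q = s + 1) (α : Ext k A M p) (β : Ext k A N q) :
    sgExt F hM' hN hr' hs' (phiExt M p α) β = phiExt r s (sgExt F hM hN hr hs α β) := by
  obtain ⟨f, rfl⟩ := (isCls_extClass M p).surjective α
  obtain ⟨g, rfl⟩ := (isCls_extClass N q).surjective β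
  obtain ⟨h1, e1⟩ := phiExt_induces M p f
  obtain ⟨h2, e2⟩ := sgExt_induces F hM hN hr hs f g
  obtain ⟨h3, e3⟩ := sgExt_induces F hM' hN hr' hs' ⟨_, h1⟩ g
  obtain ⟨h4, e4⟩ := phiExt_induces r s ⟨_, h2⟩
  simp only at e1 e2 e3 e4
  rw [e1, e2, e3, e4]
  congr 2
  rw [phiC_eq_thetaC hM, phiC_eq_thetaC (by omega), sgBracket_thetaC_left f.2.1 g.2.1]

lemma sgExt_phiExt_right (F : FrobeniusForm k A) [FiniteDimensional k A] (hM : 1 ≤ M) (hN : 1 ≤ N)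
    (hr : r + 1 = M + N) (hs : p + q = s) (hN' : 1 ≤ N + 1) (hr' : r + 1 + 1 = M + (N + 1))
    (hs' : p + (q + 1) = s + 1) (α : Ext k A M p) (β : Ext k A N q) :
    sgExt F hM hN' hr' hs' α (phiExt N q β) = phiExt r s (sgExt F hM hN hr hs α β) := by
  obtain ⟨f, rfl⟩ := (isCls_extClass M p).surjective α
  obtain ⟨g, rfl⟩ := (isCls_extClass N q).surjective β
  obtain ⟨h1, e1⟩ := phiExt_induces N q g
  obtain ⟨h2, e2⟩ := sgExt_induces F hM hN hr hs f g
  obtain ⟨h3, e3⟩ := sgExt_induces F hM hN' hr' hs' f ⟨_, h1⟩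
  obtain ⟨h4, e4⟩ := phiExt_induces r s ⟨_, h2⟩
  simp only at e1 e2 e3 e4
  rw [e1, e2, e3, e4]
  congr 2
  rw [phiC_eq_thetaC hN, phiC_eq_thetaC (by omega), sgBracket_thetaC_right f.2.1 g.2.1]

lemma sgExt_up_left (F : FrobeniusForm k A) [FiniteDimensional k A] {j M' p' r' s' : ℕ} (hM : 1 ≤ M)
    (hN : 1 ≤ N) (hr : r + 1 = M + N) (hs : p + q = s) (hj : M + j = M') (hj' : p + j = p')
    (hM' : 1 ≤ M') (hr' : r' + 1 = M' + N) (hs' : p' + q = s') (h : r + j = r') (h' : s + j = s')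
    (α : Ext k A M p) (β : Ext k A N q) :
    sgExt F hM' hN hr' hs' (up j hj hj' α) β = up j h h' (sgExt F hM hN hr hs α β) := by
  induction j generalizing M p r s with
  | zero => subst hj hj' h h'; rfl
  | succ j ih =>
    rw [up_succ hj hj' (by omega) (by omega), ih (r := r + 1) (s := s + 1) (by omega) (by omega)
      (by omega) _ _ (by omega) (by omega), sgExt_phiExt_left F hM hN hr hs,
      up_succ h h' (by omega) (by omega)]

lemma sgExt_up_right (F : FrobeniusForm k A) [FiniteDimensional k A] {j N' q' r' s' : ℕ} (hM : 1 ≤ M)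
    (hN : 1 ≤ N) (hr : r + 1 = M + N) (hs : p + q = s) (hj : N + j = N') (hj' : q + j = q')
    (hN' : 1 ≤ N') (hr' : r' + 1 = M + N') (hs' : p + q' = s') (h : r + j = r') (h' : s + j = s')
    (α : Ext k A M p) (β : Ext k A N q) :
    sgExt F hM hN' hr' hs' α (up j hj hj' β) = up j h h' (sgExt F hM hN hr hs α β) := by
  induction j generalizing N q r s with
  | zero => subst hj hj' h h'; rfl
  | succ j ih =>
    rw [up_succ hj hj' (by omega) (by omega), ih (r := r + 1) (s := s + 1) (by omega) (by omega)
      (by omega) _ _ (by omega) (by omega), sgExt_phiExt_right F hM hN hr hs,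
      up_succ h h' (by omega) (by omega)]

/-- The bracket on the colimits, for a degree `m ≥ 1` and a degree `-n ≤ -1`. -/
def sgColim (F : FrobeniusForm k A) [FiniteDimensional k A] {m n : ℕ} (hm : 1 ≤ m) :
    ExtSg k A m →ₗ[k] ExtSg k A (-n) →ₗ[k] ExtSg k A (m - n - 1) :=
  ((sgExt F hm le_rfl rfl (Nat.zero_add (n + 1))).compr₂
      (toSg k A (m - n - 1) m (n + 1) (by push_cast; ring))).compl₁₂
    (toSgEquiv F (m : ℤ) hm (p := 0) (by simp)).symm.toLinearMap
    (toSgEquiv F (-n : ℤ) le_rfl (p := n + 1) (by push_cast; ring)).symm.toLinearMap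

lemma sgColim_toSg (F : FrobeniusForm k A) [FiniteDimensional k A] {m n : ℕ} (hm : 1 ≤ m)
    (α : Ext k A m 0) (β : Ext k A 1 (n + 1)) :
    sgColim F hm (toSg k A m m 0 (by simp) α) (toSg k A (-n) 1 (n + 1) (by push_cast; ring) β) =
      toSg k A (m - n - 1) m (n + 1) (by push_cast; ring)
        (sgExt F hm le_rfl rfl (Nat.zero_add (n + 1)) α β) := by
  have e1 : toSg k A m m 0 (by simp) α = toSgEquiv F (m : ℤ) hm (p := 0) (by simp) α := rfl
  have e2 : toSg k A (-n) 1 (n + 1) (by push_cast; ring) β =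
    toSgEquiv F (-n : ℤ) le_rfl (p := n + 1) (by push_cast; ring) β := rfl
  rw [e1, e2, sgColim, LinearMap.compl₁₂_apply, LinearEquiv.coe_coe, LinearEquiv.coe_coe,
    LinearEquiv.symm_apply_apply, LinearEquiv.symm_apply_apply]
  rfl

lemma sgColim_induces (F : FrobeniusForm k A) [FiniteDimensional k A] {m n : ℕ} (hm : 1 ≤ m)
    (M p N q r : ℕ) (hM : 1 ≤ M) (hN : 1 ≤ N) (hMp : (M : ℤ) = m + p)
    (hNq : (N : ℤ) = -n + q) (hr : r + 1 = M + N) (hrs : (r : ℤ) = (m - n - 1 : ℤ) + (p + q : ℕ)) :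
    Induces₂ (toSg k A m M p hMp ∘ₗ extClass k A M p) (toSg k A (-n) N q hNq ∘ₗ extClass k A N q)
      (toSg k A (m - n - 1) r (p + q) hrs ∘ₗ extClass k A r (p + q))
      (sgBracket hM hN hr rfl) (fun x y => sgColim F hm x y) := by
  intro f g
  obtain ⟨h, e⟩ := sgExt_induces F hM hN hr rfl f g
  refine ⟨h, ?_⟩
  simp only at e
  simp only [LinearMap.comp_apply]
  rw [← e]
  obtain ⟨α, hα⟩ := up_surjective F (j := p) (M := m) (p := 0) (M' := M) (p' := p) (by omega)
    (by omega) (extClass k A M p f)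
  obtain ⟨j, rfl⟩ : ∃ j, N = 1 + j := ⟨N - 1, by omega⟩
  obtain rfl : q = n + 1 + j := by push_cast at hNq; omega
  obtain ⟨β, hβ⟩ := up_surjective F (j := j) (M := 1) (p := n + 1) (M' := 1 + j) (p' := n + 1 + j)
    rfl rfl (extClass k A _ _ g)
  rw [← hα, ← hβ, toSg_up _ _ _ (by simp), toSg_up _ _ _ (by push_cast; ring), sgColim_toSg,
    sgExt_up_left F hm (by omega) (r := m + j) (s := n + 1 + j) (by omega) (by omega) _ _ _ _ _
      (by omega) (by omega),
    sgExt_up_right F hm le_rfl (r := m) (s := n + 1) (by omega) (by omega) _ _ _ _ _ rfl rfl,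
    toSg_up _ _ _ (by push_cast; ring), toSg_up _ _ _ (by push_cast; ring)]

end BracketOnExt

section TwistedChains

variable {k A : Type u} [Field k] [Ring A] [Algebra k A] (σ : A →ₐ[k] A) {N r s : ℕ}

/-- The map `x ⊗ w ⊗ y ↦ y σ(x) ⊗ w`. -/
def tauS : Bar k A N →ₗ[k] X k A N :=
  TensorProduct.map (LinearMap.mul' k A ∘ₗ TensorProduct.map LinearMap.id σ.toLinearMap)
      LinearMap.id ∘ₗ
    (TensorProduct.assoc k A A (T k A N)).symm.toLinearMap ∘ₗ
    (TensorProduct.comm k (X k A N) A).toLinearMap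

@[simp] lemma tauS_tmul (x y : A) (w : T k A N) :
    tauS σ ((x ⊗ₜ[k] w) ⊗ₜ[k] y) = (y * σ x) ⊗ₜ[k] w := rfl

lemma tauS_smul (a : A) (x : Bar k A N) : tauS σ (a • x) = tauS σ (rm (σ a) x) := by
  induction x using bar_induction with
  | add x y hx hy => simp only [smul_add, map_add, hx, hy]
  | zero => simp only [TensorProduct.tmul_zero, TensorProduct.zero_tmul, map_zero, LinearMap.zero_apply, smul_zero]
  | H c w d => simp [mul_assoc]

/-- The map `a ⊗ w ↦ 1 ⊗ w ⊗ a`. -/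
def iota : X k A N →ₗ[k] Bar k A N :=
  TensorProduct.map (TensorProduct.mk k A (T k A N) 1) LinearMap.id ∘ₗ
    (TensorProduct.comm k A (T k A N)).toLinearMap

@[simp] lemma iota_tmul (a : A) (w : T k A N) :
    iota (a ⊗ₜ[k] w) = ((1 : A) ⊗ₜ[k] w) ⊗ₜ[k] a := rfl

@[simp] lemma tauS_iota (z : X k A N) : tauS σ (iota z) = z := by
  induction z using TensorProduct.induction_on with
  | zero => simp only [TensorProduct.tmul_zero, TensorProduct.zero_tmul, map_zero, LinearMap.zero_apply, smul_zero]
  | add x y hx hy => simp only [map_add, hx, hy]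
  | tmul a w => simp

/-- The Hochschild differential of the chain complex of `A` twisted by `σ`. -/
def bdry (h : r + 1 = s) : X k A s →ₗ[k] X k A r := tauS σ ∘ₗ dB h ∘ₗ iota

lemma bdry_apply (h : r + 1 = s) (z : X k A s) : bdry σ h z = tauS σ (dB h (iota z)) := rfl

lemma bdry_tauS (h : r + 1 = s) (x : Bar k A s) : bdry σ h (tauS σ x) = tauS σ (dB h x) := by
  induction x using bar_induction with
  | add x y hx hy => simp only [map_add, hx, hy]
  | zero => simp only [TensorProduct.tmul_zero, TensorProduct.zero_tmul, map_zero, LinearMap.zero_apply, smul_zero]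
  | H a w b =>
    have e : iota (tauS σ ((a ⊗ₜ[k] w) ⊗ₜ[k] b)) = rm (σ a) (((1 : A) ⊗ₜ[k] w) ⊗ₜ[k] b) := by simp
    have e' : ((a ⊗ₜ[k] w) ⊗ₜ[k] b : Bar k A s) = a • (((1 : A) ⊗ₜ[k] w) ⊗ₜ[k] b) := by simp
    rw [bdry_apply, e, isR_dB, e', isL_dB, tauS_smul]

end TwistedChains

namespace FrobeniusForm

variable {k A : Type u} [Field k] [Ring A] [Algebra k A] (F : FrobeniusForm k A)
  [FiniteDimensional k A] {N p r s : ℕ}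

lemma nakayamaInv_mul (x y : A) :
    F.nakayamaInv (x * y) = F.nakayamaInv x * F.nakayamaInv y := by
  rw [← F.nakayamaInv_nakayama (F.nakayamaInv x * F.nakayamaInv y), nakayama_mul,
    nakayama_nakayamaInv, nakayama_nakayamaInv]

/-- The Nakayama automorphism as an algebra map. -/
def nu : A →ₐ[k] A := AlgHom.ofLinearMap F.nakayama F.nakayama_one F.nakayama_mul

/-- The inverse of the Nakayama automorphism as an algebra map. -/
def nuInv : A →ₐ[k] A := AlgHom.ofLinearMap F.nakayamaInv F.nakayamaInv_one F.nakayamaInv_mul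

lemma nu_apply (x : A) : F.nu x = F.nakayama x := rfl

lemma nuInv_apply (x : A) : F.nuInv x = F.nakayamaInv x := rfl

lemma partialD_eq (h : r + 1 = s) : F.partialD h = bdry F.nuInv h := by
  refine TensorProduct.ext' fun a w => ?_
  rw [bdry_apply, iota_tmul, dB_tmul, one_smul]
  simp only [partialD, LinearMap.comp_apply, TensorProduct.map_tmul, LinearMap.id_apply]
  generalize dbar h w = x
  induction x using bar_induction with
  | add x y hx hy => simp only [TensorProduct.tmul_add, map_add, hx, hy]
  | zero => simp only [TensorProduct.tmul_zero, TensorProduct.zero_tmul, map_zero, LinearMap.zero_apply, smul_zero]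
  | H x w y => simp [mul_assoc, nuInv_apply]

lemma sum_u_mul_nakayama_tmul_v {V : Type u} [AddCommGroup V] [Module k V] (Φ : A →ₗ[k] A →ₗ[k] V)
    (a : A) : ∑ j, Φ (F.u j * F.nakayama a) (F.v j) = ∑ j, Φ (F.u j) (a * F.v j) := by
  have e1 : ∀ j, F.u j * F.nakayama a = ∑ l, F.form (a * F.v l) (F.u j) • F.u l := by
    intro j
    conv_lhs => rw [← F.sum_form_v (F.u j * F.nakayama a)]
    refine Finset.sum_congr rfl fun l _ => ?_
    rw [← F.assoc, ← F.nakayama_spec, F.assoc]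
  have e2 : ∀ l, a * F.v l = ∑ j, F.form (a * F.v l) (F.u j) • F.v j := fun l =>
    (F.sum_form_u _).symm
  simp_rw [e1]
  conv_rhs => enter [2, l]; rw [e2 l]
  simp only [map_sum, map_smul, LinearMap.sum_apply, LinearMap.smul_apply]
  exact Finset.sum_comm

lemma sum_u_mul_tmul_v {V : Type u} [AddCommGroup V] [Module k V] (Φ : A →ₗ[k] A →ₗ[k] V)
    (a : A) : ∑ j, Φ (F.u j * a) (F.v j) = ∑ j, Φ (F.u j) (F.nakayamaInv a * F.v j) := by
  rw [← sum_u_mul_nakayama_tmul_v, nakayama_nakayamaInv]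

/-- The map `x ↦ ∑ u_i x v_i`. -/
def tr : Bar k A N →ₗ[k] Bar k A N := ∑ j, (actBar k A N (F.u j)).flip (F.v j)

lemma tr_apply (x : Bar k A N) : F.tr x = ∑ j, F.u j • rm (F.v j) x := by
  simp [tr, actBar_apply]

/-- The map `a ⊗ w ↦ ∑ u_i ⊗ w ⊗ a v_i`. -/
def cas (N : ℕ) : X k A N →ₗ[k] Bar k A N := F.tr ∘ₗ iota

lemma cas_apply (z : X k A N) : F.cas N z = F.tr (iota z) := rfl

lemma smul_tr (a : A) (x : Bar k A N) : a • F.tr x = rm a (F.tr x) := by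
  have := F.sum_mul_u_tmul_v ((actBar k A N).flip x) a
  simp only [LinearMap.flip_apply, actBar_apply] at this
  simpa [tr_apply, Finset.smul_sum, smul_smul, smul_rm, rm_mul] using this

lemma dB_tr (h : r + 1 = s) (x : Bar k A s) : dB h (F.tr x) = F.tr (dB h x) := by
  simp only [tr_apply, map_sum]
  exact Finset.sum_congr rfl fun j _ => by rw [isL_dB, isR_dB]

lemma cas_tauS (x : Bar k A N) : F.cas N (tauS F.nuInv x) = F.tr x := by
  induction x using bar_induction with
  | add x y hx hy => simp only [map_add, hx, hy]
  | zero => simp only [TensorProduct.tmul_zero, TensorProduct.zero_tmul, map_zero, LinearMap.zero_apply, smul_zero]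
  | H a w b =>
    have := F.sum_u_mul_tmul_v (V := Bar k A N)
      (((TensorProduct.mk k (X k A N) A) ∘ₗ (TensorProduct.mk k A (T k A N)).flip w).compl₂
        (LinearMap.mulLeft k b)) a
    simp only [LinearMap.compl₂_apply, LinearMap.comp_apply, LinearMap.flip_apply,
      TensorProduct.mk_apply, LinearMap.mulLeft_apply] at this
    simpa [cas_apply, tr_apply, nuInv_apply, mul_assoc] using this.symm

lemma dB_cas (h : r + 1 = s) (z : X k A s) : dB h (F.cas s z) = F.cas r (F.partialD h z) := by
  rw [partialD_eq, bdry_apply, cas_tauS, cas_apply, dB_tr]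

/-- The inverse of `cas` on invariant elements. -/
def casInv (N : ℕ) : Bar k A N →ₗ[k] X k A N := tauS F.nuInv ∘ₗ cap ∘ₗ F.formR N

lemma casInv_tmul (a b : A) (w : T k A N) : F.casInv N ((a ⊗ₜ[k] w) ⊗ₜ[k] b) =
    F.form b 1 • (F.nakayamaInv a ⊗ₜ[k] w) := by
  rw [casInv, LinearMap.comp_apply, LinearMap.comp_apply, formR_tmul, map_smul, map_smul, cap_apply,
    tauS_tmul, one_mul, nuInv_apply]

lemma casInv_tr (x : Bar k A N) : F.casInv N (F.tr x) = tauS F.nuInv x := by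
  induction x using bar_induction with
  | add x y hx hy => simp only [map_add, hx, hy]
  | zero => simp only [TensorProduct.tmul_zero, TensorProduct.zero_tmul, map_zero, LinearMap.zero_apply, smul_zero]
  | H a w b =>
    simp only [tr_apply, rm_tmul, map_sum]
    have e : ∀ j, F.casInv N (F.u j • ((a ⊗ₜ[k] w) ⊗ₜ[k] (b * F.v j))) =
        (F.nakayamaInv (F.form b (F.v j) • F.u j) * F.nakayamaInv a) ⊗ₜ[k] w := by
      intro j
      rw [TensorProduct.smul_tmul', TensorProduct.smul_tmul', smul_eq_mul, casInv_tmul, F.assoc,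
        mul_one, nakayamaInv_mul, map_smul, smul_mul_assoc, TensorProduct.smul_tmul']
    have e2 : F.nakayama b = ∑ j, F.form b (F.v j) • F.u j := by simp [nakayama]
    simp only [e]
    rw [← TensorProduct.sum_tmul, ← Finset.sum_mul, ← map_sum, ← e2, nakayamaInv_nakayama]
    rfl

lemma casInv_cas (z : X k A N) : F.casInv N (F.cas N z) = z := by
  rw [cas_apply, casInv_tr, tauS_iota]

lemma cas_casInv {x : Bar k A N} (hx : ∀ a : A, a • x = rm a x) : F.cas N (F.casInv N x) = x := by
  conv_rhs => rw [← F.sum_formR x]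
  rw [casInv, LinearMap.comp_apply, LinearMap.comp_apply, cas_tauS, tr_apply]
  refine Finset.sum_congr rfl fun j _ => ?_
  rw [← hx, formR_smul, rm_cap, TensorProduct.smul_tmul']

lemma cas_tmul (a : A) (w : T k A N) :
    F.cas N (a ⊗ₜ[k] w) = ∑ j, ((F.u j * F.nakayama a) ⊗ₜ[k] w) ⊗ₜ[k] F.v j := by
  have := F.sum_u_mul_nakayama_tmul_v (V := Bar k A N)
    ((TensorProduct.mk k (X k A N) A) ∘ₗ (TensorProduct.mk k A (T k A N)).flip w) a
  simp only [LinearMap.comp_apply, LinearMap.flip_apply, TensorProduct.mk_apply] at this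
  rw [this, cas_apply, tr_apply]
  refine Finset.sum_congr rfl fun j _ => ?_
  simp

lemma cap_casimirSnoc (z : X k A N) : cap (F.casimirSnoc N z) = hR rfl (F.cas N z) := by
  induction z using TensorProduct.induction_on with
  | zero => simp only [TensorProduct.tmul_zero, TensorProduct.zero_tmul, map_zero, LinearMap.zero_apply, smul_zero]
  | add x y hx hy => simp only [map_add, hx, hy]
  | tmul a w =>
    rw [cas_tmul, map_sum]
    simp [casimirSnoc, cap_apply]

lemma aug_cas (z : X k A 0) : aug (F.cas 0 z) = F.mu z nil := by
  induction z using TensorProduct.induction_on with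
  | zero => simp only [TensorProduct.tmul_zero, TensorProduct.zero_tmul, map_zero, LinearMap.zero_apply, smul_zero]
  | add x y hx hy => simp only [map_add, LinearMap.add_apply, hx, hy]
  | tmul a w => simp [cas_apply, tr_apply, mu]

lemma mu_eq_zero_iff (z : X k A 0) : F.mu z = 0 ↔ aug (F.cas 0 z) = 0 := by
  rw [aug_cas]
  exact ⟨fun h => by rw [h]; rfl, fun h => ext_nil h⟩

end FrobeniusForm

section ZeroCochains

variable {k A : Type u} [Field k] [Ring A] [Algebra k A] {p : ℕ}

lemma rm_scalar {N : ℕ} (c : k) (b : A) (x : Bar k A N) : rm (c • b) x = c • rm b x := by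
  induction x using bar_induction with
  | add x y hx hy => rw [map_add, map_add, hx, hy, smul_add]
  | zero => simp only [TensorProduct.tmul_zero, TensorProduct.zero_tmul, map_zero, LinearMap.zero_apply, smul_zero]
  | H a w d => simp

lemma delta_zero_iff (φ : T k A 0 →ₗ[k] Bar k A p) :
    delta (actBar k A p) (rfl : 0 + 1 = 0 + 1) φ = 0 ↔ ∀ a : A, a • φ nil = rm a (φ nil) := by
  refine ⟨fun h a => ?_, fun h => ?_⟩
  · have e := LinearMap.congr_fun (bext_dB_eq_zero h)
      (hL (Nat.add_comm 1 0) ((a ⊗ₜ[k] nil) ⊗ₜ[k] (1 : A)))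
    rw [LinearMap.comp_apply, dB_hL_zero, map_sub, bext_tmul, bext_tmul, aug_tmul] at e
    simpa [rm_one, sub_eq_zero] using e
  · have key : ∀ y, bext φ (dB (rfl : 0 + 1 = 0 + 1) y) = 0 := by
      intro y
      induction y using hL_induction (Nat.add_comm 1 0) with
      | add x y hx hy => rw [map_add, map_add, hx, hy, add_zero]
      | smul a x hx => rw [isL_dB, isL_bext, hx, smul_zero]
      | H x =>
        rw [dB_hL_zero, map_sub, sub_eq_zero]
        induction x using bar_induction with
        | add x y hx hy => simp only [map_add, TensorProduct.tmul_add, hx, hy]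
        | zero => simp only [TensorProduct.tmul_zero, TensorProduct.zero_tmul, map_zero, LinearMap.zero_apply, smul_zero]
        | H a w b =>
          obtain ⟨e, rfl⟩ : ∃ e : k, w = e • nil := ⟨_, eq_smul_nil w⟩
          rw [bext_tmul, bext_tmul, aug_tmul, map_smul φ, LinearMap.map_smul (rm b), rm_scalar,
            map_smul empty, empty_nil, smul_eq_mul, mul_one, one_smul, rm_mul, ← h a, smul_rm,
            smul_comm]
    rw [delta_eq_onWords]
    exact LinearMap.ext fun w => key _

end ZeroCochains

namespace FrobeniusForm

variable {k A : Type u} [Field k] [Ring A] [Algebra k A] (F : FrobeniusForm k A)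
  [FiniteDimensional k A] {N p s : ℕ}

lemma kappaChain_apply (h : N + 1 + p = s) (z : X k A N) (w : T k A p) :
    F.kappaChain h z w = closeD k A s (appendX h (F.casimirSnoc N z ⊗ₜ[k] w)) := rfl

/-- The element `∑ u_i ν(a) ⊗ w ⊗ v̄_i` as a cochain of degree zero. -/
def casCoch (z : X k A N) : T k A 0 →ₗ[k] X k A (N + 1) :=
  appendX (rfl : N + 1 + 0 = N + 1) ∘ₗ TensorProduct.mk k _ _ (F.casimirSnoc N z)

lemma appendX_nil (x : X k A N) : appendX (rfl : N + 0 = N) (x ⊗ₜ[k] nil) = x := by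
  induction x using TensorProduct.induction_on with
  | zero => simp only [TensorProduct.tmul_zero, TensorProduct.zero_tmul, map_zero, LinearMap.zero_apply, smul_zero]
  | add x y hx hy => simp only [TensorProduct.add_tmul, map_add, hx, hy]
  | tmul a w => simp

lemma casCoch_nil (z : X k A N) : F.casCoch z nil = F.casimirSnoc N z := appendX_nil _

lemma kappaChain_zero (z : X k A N) :
    F.kappaChain (rfl : N + 1 + 0 = N + 1) z = closeD k A (N + 1) ∘ₗ F.casCoch z := rfl

lemma thetaC_kappaChain (h : N + 1 + p = s) (h' : N + 1 + (p + 1) = s + 1) (z : X k A N) :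
    thetaC p s (F.kappaChain h z) = F.kappaChain h' z := by
  have e : F.kappaChain h z = closeD k A s ∘ₗ appendX h ∘ₗ
    TensorProduct.mk k _ _ (F.casimirSnoc N z) := rfl
  rw [e, thetaC_closeD]
  refine ext_cat (rfl : p + 1 = p + 1) fun w c => ?_
  rw [LinearMap.comp_apply, extX_cat, kappaChain_apply]
  congr 1
  exact appendX_appendX _ _ _ _ _ _ _

/-- The cycles of the negative part of the complete complex. -/
def IsCycle (z : X k A N) : Prop := d k A N (F.cas N z) = 0

lemma cas_injective (N : ℕ) : Function.Injective (F.cas N) :=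
  Function.LeftInverse.injective F.casInv_cas

lemma isCycle_succ_iff (z : X k A (N + 1)) : F.IsCycle z ↔ F.partialD rfl z = 0 := by
  rw [IsCycle, d_succ, dB_cas]
  exact map_eq_zero_iff (F.cas N) (F.cas_injective N)

variable {F}

lemma IsCycle.dB_cap {z : X k A N} (hz : F.IsCycle z) :
    dB rfl (cap (F.casimirSnoc N z)) = -((-1 : k) ^ N • F.cas N z) := by
  rw [cap_casimirSnoc, dB_hR_eq, show d k A N (F.cas N z) = 0 from hz, map_zero, map_zero, zero_sub]

lemma IsCycle.mem_ZExt_zero {z : X k A N} (hz : F.IsCycle z) :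
    closeD k A (N + 1) ∘ₗ F.casCoch z ∈ ZExt k A 0 (N + 1) := by
  refine mem_ZExt.2 ⟨closeD_mem_Coch _, ?_⟩
  let φ : T k A 0 →ₗ[k] Bar k A N := closeD k A (N + 1) ∘ₗ F.casCoch z
  refine (delta_zero_iff φ).2 fun a => ?_
  have e : φ nil = -((-1 : k) ^ N • F.cas N z) := by
    rw [← hz.dB_cap, ← F.casCoch_nil]; rfl
  rw [e, smul_neg, map_neg, LinearMap.map_smul, cas_apply, smul_comm, smul_tr]

lemma IsCycle.mem_ZExt {z : X k A N} (hz : F.IsCycle z) (h : N + 1 + p = s) :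
    F.kappaChain h z ∈ ZExt k A p s := by
  induction p generalizing s with
  | zero => subst h; exact hz.mem_ZExt_zero
  | succ p ih =>
    obtain ⟨s, rfl⟩ : ∃ l, s = l + 1 := ⟨s - 1, by omega⟩
    rw [← F.thetaC_kappaChain (by omega) h]
    exact thetaC_mem_ZExt (ih _)

variable (F)

lemma exists_cas_of_mem_ZExt_zero {f : T k A 0 →ₗ[k] B k A (N + 1)} (hf : f ∈ ZExt k A 0 (N + 1)) :
    ∃ z : X k A N, F.IsCycle z ∧ F.kappaChain (rfl : N + 1 + 0 = N + 1) z = f := by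
  let φ : T k A 0 →ₗ[k] Bar k A N := f
  have h1 := (delta_zero_iff φ).1 (mem_ZExt.1 hf).2
  have h2 : F.cas N (F.casInv N (φ nil)) = φ nil := F.cas_casInv h1
  have hz : F.IsCycle (F.casInv N (φ nil)) := by
    rw [IsCycle, h2]
    exact mem_Omega_succ.1 (hf.1 nil)
  have hz' : F.IsCycle (-((-1 : k) ^ N • F.casInv N (φ nil))) := by
    rw [IsCycle, map_neg, map_smul, map_neg, map_smul, show d k A N (F.cas N _) = 0 from hz, smul_zero, neg_zero]
  refine ⟨_, hz', ext_nil ?_⟩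
  rw [kappaChain_zero, LinearMap.comp_apply, casCoch_nil]
  refine (hz'.dB_cap).trans ?_
  rw [map_neg, map_smul, h2, smul_neg, neg_neg, smul_smul, neg_one_pow_mul_self, one_smul]
  rfl

lemma exists_kappaChain {h : N + 1 + p = s} {f : T k A p →ₗ[k] B k A s} (hf : f ∈ ZExt k A p s) :
    ∃ z : X k A N, F.IsCycle z ∧ f - F.kappaChain h z ∈ BExt k A p s := by
  induction p generalizing s with
  | zero =>
    subst h
    obtain ⟨z, hz, rfl⟩ := F.exists_cas_of_mem_ZExt_zero hf
    exact ⟨z, hz, by rw [sub_self]; exact Submodule.zero_mem _⟩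
  | succ p ih =>
    obtain ⟨s, rfl⟩ : ∃ l, s = l + 1 := ⟨s - 1, by omega⟩
    obtain ⟨g, hg, e⟩ := thetaC_surj F hf
    obtain ⟨z, hz, e'⟩ := ih (h := by omega) hg
    refine ⟨z, hz, ?_⟩
    have := Submodule.add_mem _ e (thetaC_mem_BExt e')
    rwa [map_sub, F.thetaC_kappaChain _ h, sub_add_sub_cancel] at this

lemma isCycle_partialD (z : X k A (N + 1)) : F.IsCycle (F.partialD rfl z) := by
  rw [IsCycle, ← dB_cas, d_dB]

lemma delta_cas (z : X k A N) :
    delta (actBar k A N) (rfl : 0 + 1 = 0 + 1)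
      ((LinearMap.toSpanSingleton k _ (F.cas N z)) ∘ₗ empty.toLinearMap) = 0 :=
  (delta_zero_iff _).2 fun a => by
    simp [cas_apply, smul_tr]

lemma kappaChain_partialD (h : N + 1 + (p + 1) = s) (z : X k A (N + 1)) :
    F.kappaChain h (F.partialD rfl z) ∈ BExt k A (p + 1) s := by
  induction p generalizing s with
  | zero =>
    subst h
    have hz := F.isCycle_partialD z
    rw [← F.thetaC_kappaChain rfl, kappaChain_zero, thetaC_closeD]
    have hx0 := rel_zero_of_mem_ZExt hz.mem_ZExt_zero
    let φ : T k A 0 →ₗ[k] Bar k A (N + 1) :=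
      LinearMap.toSpanSingleton k _ (F.cas (N + 1) z) ∘ₗ empty.toLinearMap
    let h : T k A 0 →ₗ[k] Bar k A (N + 1) :=
      -(eps k 0 (N + 1) • (cap ∘ₗ F.casCoch (F.partialD rfl z) + (-1 : k) ^ N • φ))
    refine ⟨h, fun w => mem_Omega_succ.2 ?_, ?_⟩
    · have e : d k A (N + 1) (cap (F.casCoch (F.partialD rfl z) nil)) =
          -((-1 : k) ^ N • F.cas N (F.partialD rfl z)) := by
        rw [casCoch_nil]; exact hz.dB_cap
      have e2 : d k A (N + 1) (φ nil) = F.cas N (F.partialD rfl z) := by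
        change dB rfl (φ nil) = _
        rw [← dB_cas]; simp [φ]
      have e0 : h nil = -(eps k 0 (N + 1) • (cap (F.casCoch (F.partialD rfl z) nil) +
        (-1 : k) ^ N • φ nil)) := rfl
      have e3 : d k A (N + 1) (h nil) = 0 := by
        rw [e0, map_neg, LinearMap.map_smul, map_add, LinearMap.map_smul, e, e2]
        exact neg_eq_zero.2 ((congrArg _ (neg_add_cancel _)).trans (smul_zero _))
      rw [eq_smul_nil w]
      change d k A (N + 1) (h (empty w • nil)) = 0
      rw [map_smul, map_smul, e3, smul_zero]
    · change delta (actBar k A (N + 1)) rfl h = _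
      refine LinearMap.ext fun w => ?_
      refine Eq.trans ?_ (hx0.dB_cap_extX w).symm
      have e3 : delta (actBar k A (N + 1)) (rfl : 0 + 1 = 0 + 1) φ = 0 := F.delta_cas z
      simp only [h, map_neg, LinearMap.map_smul, map_add, e3, smul_zero, add_zero]
      rfl
  | succ p ih =>
    obtain ⟨s, rfl⟩ : ∃ l, s = l + 1 := ⟨s - 1, by omega⟩
    rw [← F.thetaC_kappaChain (by omega) h]
    exact thetaC_mem_BExt (ih _)

lemma IsCycle.exists_partialD {z : X k A N} (hz : F.IsCycle z) {h : N + 1 + (p + 1) = s}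
    (hB : F.kappaChain h z ∈ BExt k A (p + 1) s) : ∃ y, F.partialD rfl y = z := by
  induction p generalizing s with
  | zero =>
    subst h
    rw [← F.thetaC_kappaChain rfl, kappaChain_zero, thetaC_closeD] at hB
    obtain ⟨g, hg, hgx⟩ := hB
    let g' : T k A 0 →ₗ[k] Bar k A (N + 1) := g
    have hx0 := rel_zero_of_mem_ZExt hz.mem_ZExt_zero
    let φ : T k A 0 →ₗ[k] Bar k A (N + 1) := cap ∘ₗ F.casCoch z + eps k 0 (N + 1) • g'
    have hφ : delta (actBar k A (N + 1)) (rfl : 0 + 1 = 0 + 1) φ = 0 := by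
      simp only [φ, map_add, LinearMap.map_smul]
      refine LinearMap.ext fun w => ?_
      have e : delta (actBar k A (N + 1)) (rfl : 0 + 1 = 0 + 1) g' w =
        dB rfl (cap (extX (F.casCoch z) w)) := LinearMap.congr_fun hgx w
      rw [LinearMap.add_apply, LinearMap.smul_apply, e, hx0.dB_cap_extX w, smul_neg, smul_smul,
        eps_mul_self, one_smul, add_neg_cancel]
      rfl
    have e1 := F.cas_casInv ((delta_zero_iff φ).1 hφ)
    have e2 : dB rfl (φ nil) = -((-1 : k) ^ N • F.cas N z) := by
      have e0 : dB rfl (g' nil) = 0 := mem_Omega_succ.1 (hg nil)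
      rw [← hz.dB_cap, LinearMap.add_apply, map_add, LinearMap.smul_apply, LinearMap.map_smul, e0,
        smul_zero, add_zero, LinearMap.comp_apply, casCoch_nil]
    rw [← e1, dB_cas] at e2
    refine ⟨-((-1 : k) ^ N • F.casInv (N + 1) (φ nil)), F.cas_injective N ?_⟩
    rw [map_neg, map_neg, map_smul, map_smul, e2, smul_neg, neg_neg, smul_smul,
      neg_one_pow_mul_self, one_smul]
  | succ p ih =>
    obtain ⟨s, rfl⟩ : ∃ l, s = l + 1 := ⟨s - 1, by omega⟩
    rw [← F.thetaC_kappaChain (by omega) h] at hB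
    exact ih (thetaC_inj F (hz.mem_ZExt _) hB)

lemma mem_Z_iff {r s : ℤ} (h : r + 1 = s) (z : D k A r) : z ∈ F.Z r ↔ F.dhat r s h z = 0 := by
  subst h; exact Iff.rfl

lemma mem_Bd_iff {r s : ℤ} (h : r + 1 = s) (z : D k A s) :
    z ∈ F.Bd s ↔ ∃ y, F.dhat r s h y = z := by
  obtain rfl : r = s - 1 := by omega
  exact Iff.rfl

lemma mem_Z_negSucc (z : D k A (Int.negSucc N)) : z ∈ F.Z (Int.negSucc N) ↔
    F.IsCycle (N := N) z := by
  cases N with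
  | zero =>
    refine (F.mem_Z_iff (s := Int.ofNat 0) (by rfl) z).trans (Iff.trans ?_ (F.mu_eq_zero_iff z))
    exact Iff.rfl
  | succ N =>
    refine (F.mem_Z_iff (s := Int.negSucc N) (by omega) z).trans
      (Iff.trans ?_ (F.isCycle_succ_iff z).symm)
    exact Iff.rfl

lemma mem_Bd_negSucc (z : D k A (Int.negSucc N)) : z ∈ F.Bd (Int.negSucc N) ↔
    ∃ y, F.partialD (rfl : N + 1 = N + 1) y = z :=
  F.mem_Bd_iff (r := Int.negSucc (N + 1)) (by omega) z

lemma isCls_clsHH (r : ℤ) : IsCls (F.clsHH r) (F.Bd r) := isCls_cls _ _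

lemma isCls_clsHH1 (r : ℤ) : IsCls (F.clsHH1 r) (F.Bd1 r) := isCls_cls _ _

/-- The isomorphisms `κ`. -/
lemma exists_kappaEquiv {r : ℤ} (hr : r < 0) {p s : ℕ} (hp : 1 ≤ p) (h : (p : ℤ) - r = s) :
    ∃ κ : F.HH r ≃ₗ[k] Ext k A p s, Induces (F.clsHH r) (extClass k A p s) (F.kappa r p s h) κ := by
  obtain ⟨N, rfl⟩ := Int.eq_negSucc_of_lt_zero hr
  obtain ⟨p, rfl⟩ : ∃ l, p = l + 1 := ⟨p - 1, by omega⟩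
  have h' : N + 1 + (p + 1) = s := by omega
  obtain ⟨φ, hφ⟩ := (F.isCls_clsHH (Int.negSucc N)).exists_map (isCls_extClass (p + 1) s)
    (F.kappa (Int.negSucc N) (p + 1) s h)
    (fun z hz => ((F.mem_Z_negSucc z).1 hz).mem_ZExt h')
    (fun z _ hz => by
      obtain ⟨y, rfl⟩ := (F.mem_Bd_negSucc z).1 hz
      exact F.kappaChain_partialD h' y)
  refine hφ.exists_equiv (F.isCls_clsHH _) (isCls_extClass _ _) (fun z hz hB => ?_) fun f hf => ?_
  · exact (F.mem_Bd_negSucc z).2 (IsCycle.exists_partialD F ((F.mem_Z_negSucc z).1 hz) (h := h') hB)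
  · obtain ⟨z, hz, e⟩ := F.exists_kappaChain (h := h') hf
    exact ⟨z, (F.mem_Z_negSucc z).2 hz, e⟩

end FrobeniusForm

section Automorphisms

variable {k A : Type u} [Field k] [Ring A] [Algebra k A] (σ : A →ₐ[k] A) {N N' p q r s : ℕ}

/-- The map of `Ā` induced by an algebra map. -/
def barS : Abar k A →ₗ[k] Abar k A := FrobeniusForm.barMap σ.toLinearMap (map_one σ)

@[simp] lemma barS_proj (a : A) : barS σ (proj k A a) = proj k A (σ a) := rfl

/-- The map of `Ā^{⊗N}` induced by an algebra map. -/
def actT : T k A N →ₗ[k] T k A N := PiTensorProduct.map fun _ => barS σ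

lemma emb_actT (x : T k A N) : emb N (actT σ x) =
    TensorAlgebra.lift k (TensorAlgebra.ι k ∘ₗ barS σ) (emb N x) := by
  have : emb N ∘ₗ actT σ =
      (TensorAlgebra.lift k (TensorAlgebra.ι k ∘ₗ barS σ)).toLinearMap ∘ₗ emb N := by
    refine PiTensorProduct.ext (MultilinearMap.ext fun x => ?_)
    simp only [LinearMap.compMultilinearMap_apply, LinearMap.comp_apply, actT,
      PiTensorProduct.map_tprod, emb, TensorPower.toTensorAlgebra_tprod, TensorAlgebra.tprod_apply,
      AlgHom.toLinearMap_apply, map_list_prod, List.map_ofFn]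
    congr 2
    funext i
    simp
  exact LinearMap.congr_fun this x

@[simp] lemma actT_cat (h : p + q = r) (x : T k A p) (y : T k A q) :
    actT σ (cat h (x ⊗ₜ[k] y)) = cat h (actT σ x ⊗ₜ[k] actT σ y) :=
  emb_injective _ (by simp [emb_actT])

@[simp] lemma actT_letter (x : Abar k A) : actT σ (letter x) = letter (barS σ x) :=
  emb_injective _ (by simp [emb_actT])

@[simp] lemma actT_nil : actT σ (nil : T k A 0) = nil :=
  emb_injective _ (by simp [emb_actT])

@[simp] lemma empty_actT (x : T k A 0) : empty (actT σ x) = empty x := by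
  conv_lhs => rw [eq_smul_nil x, map_smul, actT_nil]
  simp

/-- The map of `A ⊗ Ā^{⊗N}` induced by an algebra map. -/
def actX : X k A N →ₗ[k] X k A N := TensorProduct.map σ.toLinearMap (actT σ)

@[simp] lemma actX_tmul (a : A) (w : T k A N) : actX σ (a ⊗ₜ[k] w) = σ a ⊗ₜ[k] actT σ w := rfl

/-- The map of `A ⊗ Ā^{⊗N} ⊗ A` induced by an algebra map. -/
def mapB : Bar k A N →ₗ[k] Bar k A N := TensorProduct.map (actX σ) σ.toLinearMap

@[simp] lemma mapB_tmul (x : X k A N) (b : A) : mapB σ (x ⊗ₜ[k] b) = actX σ x ⊗ₜ[k] σ b := rfl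

lemma mapB_smul (a : A) (x : Bar k A N) : mapB σ (a • x) = σ a • mapB σ x := by
  induction x using bar_induction with
  | add x y hx hy => simp only [smul_add, map_add, hx, hy]
  | zero => simp only [TensorProduct.tmul_zero, TensorProduct.zero_tmul, map_zero, LinearMap.zero_apply, smul_zero]
  | H c w d => simp

lemma mapB_rm (a : A) (x : Bar k A N) : mapB σ (rm a x) = rm (σ a) (mapB σ x) := by
  induction x using bar_induction with
  | add x y hx hy => simp only [map_add, hx, hy]
  | zero => simp only [TensorProduct.tmul_zero, TensorProduct.zero_tmul, map_zero, LinearMap.zero_apply, smul_zero]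
  | H c w d => simp

lemma mapB_hL (h : 1 + N = N') (x : Bar k A N) : mapB σ (hL h x) = hL h (mapB σ x) := by
  induction x using bar_induction with
  | add x y hx hy => simp only [map_add, hx, hy]
  | zero => simp only [TensorProduct.tmul_zero, TensorProduct.zero_tmul, map_zero, LinearMap.zero_apply, smul_zero]
  | H c w d => simp

lemma aug_mapB (x : Bar k A 0) : aug (mapB σ x) = σ (aug x) := by
  induction x using bar_induction with
  | add x y hx hy => simp only [map_add, hx, hy]
  | zero => simp only [TensorProduct.tmul_zero, TensorProduct.zero_tmul, map_zero, LinearMap.zero_apply, smul_zero]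
  | H c w d => simp

lemma mapB_dB (h : r + 1 = s) (x : Bar k A s) : mapB σ (dB h x) = dB h (mapB σ x) := by
  induction r generalizing s with
  | zero =>
    induction x using hL_induction (show 1 + 0 = s by omega) with
    | add x y hx hy => simp only [map_add, hx, hy]
    | smul a x hx => rw [isL_dB, mapB_smul, mapB_smul, isL_dB, hx]
    | H x =>
      rw [mapB_hL, dB_hL_zero, dB_hL_zero, map_sub, aug_mapB]
      simp
  | succ r ih =>
    induction x using hL_induction (show 1 + (r + 1) = s by omega) with
    | add x y hx hy => simp only [map_add, hx, hy]
    | smul a x hx => rw [isL_dB, mapB_smul, mapB_smul, isL_dB, hx]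
    | H x =>
      rw [mapB_hL, dB_hL rfl h _ (by omega), dB_hL rfl h _ (by omega), map_sub, mapB_hL, ih]

end Automorphisms

section Product

variable {k A : Type u} [Field k] [Ring A] [Algebra k A] {a b c N N' : ℕ}

lemma putX_scalar {p q N : ℕ} (h : p + q = N) (r : k) (u : X k A p) (v : T k A q ⊗[k] A) :
    putX h (r • u) v = r • putX h u v := by
  rw [putX, map_smul, LinearMap.comp_smul, TensorProduct.map_smul_left, LinearMap.smul_apply]
  rfl

/-- The product `(x ⊗ w ⊗ y)(x' ⊗ w' ⊗ y') = x ⊗ w \overline{yx'} w' ⊗ y'`. -/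
def mulB (h : a + (1 + b) = c) : Bar k A a →ₗ[k] Bar k A b →ₗ[k] Bar k A c :=
  TensorProduct.lift (LinearMap.mk₂ k
    (fun u y => putX h u ∘ₗ TensorProduct.map (consBar LinearMap.id rfl) LinearMap.id ∘ₗ
      Algebra.lsmul k k (Bar k A b) y)
    (fun u u' y => LinearMap.ext fun γ => putX_add h u u' _)
    (fun r u y => LinearMap.ext fun γ => putX_scalar h r u _)
    (fun u y y' => by rw [map_add, LinearMap.comp_add, LinearMap.comp_add])
    (fun r u y => by rw [map_smul, LinearMap.comp_smul, LinearMap.comp_smul]))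

@[simp] lemma mulB_tmul (h : a + (1 + b) = c) (x y x' y' : A) (w : T k A a) (w' : T k A b) :
    mulB h ((x ⊗ₜ[k] w) ⊗ₜ[k] y) ((x' ⊗ₜ[k] w') ⊗ₜ[k] y') =
      (x ⊗ₜ[k] cat h (w ⊗ₜ[k] cat rfl (letter (proj k A (y * x')) ⊗ₜ[k] w'))) ⊗ₜ[k] y' := rfl

lemma mulB_smul (h : a + (1 + b) = c) (r : A) (x : Bar k A a) (y : Bar k A b) :
    mulB h (r • x) y = r • mulB h x y := by
  induction x using bar_induction with
  | add x y hx hy => simp only [smul_add, map_add, LinearMap.add_apply, hx, hy]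
  | zero => simp only [TensorProduct.tmul_zero, TensorProduct.zero_tmul, map_zero, LinearMap.zero_apply, smul_zero]
  | H x w y' =>
    induction y using bar_induction with
    | add x y hx hy => simp only [smul_add, map_add, hx, hy]
    | zero => simp only [TensorProduct.tmul_zero, TensorProduct.zero_tmul, map_zero, LinearMap.zero_apply, smul_zero]
    | H => simp

lemma mulB_rm (h : a + (1 + b) = c) (r : A) (x : Bar k A a) (y : Bar k A b) :
    mulB h x (rm r y) = rm r (mulB h x y) := by
  induction x using bar_induction with
  | add x y hx hy => simp only [map_add, LinearMap.add_apply, hx, hy]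
  | zero => simp only [TensorProduct.tmul_zero, TensorProduct.zero_tmul, map_zero, LinearMap.zero_apply, smul_zero]
  | H x w y' =>
    induction y using bar_induction with
    | add x y hx hy => simp only [map_add, hx, hy]
    | zero => simp only [TensorProduct.tmul_zero, TensorProduct.zero_tmul, map_zero, LinearMap.zero_apply, smul_zero]
    | H => simp

lemma rm_mulB (h : a + (1 + b) = c) (r : A) (x : Bar k A a) (y : Bar k A b) :
    mulB h (rm r x) y = mulB h x (r • y) := by
  induction x using bar_induction with
  | add x y hx hy => simp only [map_add, LinearMap.add_apply, hx, hy]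
  | zero => simp only [TensorProduct.tmul_zero, TensorProduct.zero_tmul, map_zero, LinearMap.zero_apply, smul_zero]
  | H x w y' =>
    induction y using bar_induction with
    | add x y hx hy => simp only [smul_add, map_add, hx, hy]
    | zero => simp only [TensorProduct.tmul_zero, TensorProduct.zero_tmul, map_zero, LinearMap.zero_apply, smul_zero]
    | H => simp [mul_assoc]

lemma hL_mulB {a' c' : ℕ} (h : a + (1 + b) = c) (ha : 1 + a = a') (hc : 1 + c = c')
    (h' : a' + (1 + b) = c') (x : Bar k A a) (y : Bar k A b) :
    mulB h' (hL ha x) y = hL hc (mulB h x y) := by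
  induction x using bar_induction with
  | add x y hx hy => simp only [map_add, LinearMap.add_apply, hx, hy]
  | zero => simp only [TensorProduct.tmul_zero, TensorProduct.zero_tmul, map_zero, LinearMap.zero_apply, smul_zero]
  | H x w y' =>
    induction y using bar_induction with
    | add x y hx hy => simp only [map_add, hx, hy]
    | zero => simp only [TensorProduct.tmul_zero, TensorProduct.zero_tmul, map_zero, LinearMap.zero_apply, smul_zero]
    | H => simp [cat_assoc h' ha hc h]

lemma hL_sub (h : 1 + N = N') (x y : Bar k A N) : hL h (x - y) = hL h x - hL h y := map_sub _ x y

lemma mulB_sub_left (h : a + (1 + b) = c) (x x' : Bar k A a) (y : Bar k A b) :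
    mulB h (x - x') y = mulB h x y - mulB h x' y := by
  rw [map_sub, LinearMap.sub_apply]

lemma mulB_zero (h : 0 + (1 + b) = c) (h' : 1 + b = c) (x y : A) (γ : Bar k A b) :
    mulB h ((x ⊗ₜ[k] nil) ⊗ₜ[k] y) γ = x • hL h' (y • γ) := by
  subst h'
  induction γ using bar_induction with
  | add γ γ' h1 h2 => simp only [smul_add, map_add, h1, h2]
  | zero => simp only [TensorProduct.tmul_zero, TensorProduct.zero_tmul, map_zero, LinearMap.zero_apply, smul_zero]
  | H => simp

lemma mulB_zero_zero (h : 0 + (1 + 0) = 1) (β γ : Bar k A 0) :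
    dB rfl (mulB h β γ) = aug β • γ - rm (aug γ) β := by
  induction β using bar_induction with
  | add x y hx hy => simp only [map_add, LinearMap.add_apply, add_smul, hx, hy]; abel
  | zero => simp
  | H x w y =>
    obtain ⟨e, rfl⟩ : ∃ e : k, w = e • nil := ⟨_, eq_smul_nil w⟩
    have : ((x ⊗ₜ[k] (e • nil : T k A 0)) ⊗ₜ[k] y : Bar k A 0) = e • ((x ⊗ₜ[k] nil) ⊗ₜ[k] y) := by
      simp [TensorProduct.smul_tmul']
    rw [this, map_smul, LinearMap.smul_apply, LinearMap.map_smul, LinearMap.map_smul (rm _),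
      map_smul aug, smul_assoc, ← smul_sub, mulB_zero h (by omega), isL_dB, dB_hL_zero, aug_smul,
      smul_sub, smul_smul]
    simp

lemma dB_mulB_zero_left {b' : ℕ} (h : 0 + (1 + b) = b + 1) (hb : b' + 1 = b)
    (h' : 0 + (1 + b') = b) (β : Bar k A 0) (γ : Bar k A b) :
    dB rfl (mulB h β γ) = aug β • γ - mulB h' β (dB hb γ) := by
  induction β using bar_induction with
  | add x y hx hy => simp only [map_add, LinearMap.add_apply, add_smul, hx, hy]; abel
  | zero => simp
  | H x w y =>
    obtain ⟨e, rfl⟩ : ∃ e : k, w = e • nil := ⟨_, eq_smul_nil w⟩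
    have : ((x ⊗ₜ[k] (e • nil : T k A 0)) ⊗ₜ[k] y : Bar k A 0) = e • ((x ⊗ₜ[k] nil) ⊗ₜ[k] y) := by
      simp [TensorProduct.smul_tmul']
    rw [this, map_smul, LinearMap.smul_apply, LinearMap.map_smul, map_smul (mulB h'),
      LinearMap.smul_apply, map_smul aug, smul_assoc, ← smul_sub, mulB_zero h (by omega),
      mulB_zero h' (by omega), isL_dB, dB_hL hb rfl _ (by omega), isL_dB, smul_sub, smul_smul]
    simp

lemma dB_mulB_zero_right {a' : ℕ} (ha : a' + 1 = a) (h : a + (1 + 0) = a + 1)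
    (h' : a' + (1 + 0) = a) (β : Bar k A a) (γ : Bar k A 0) :
    dB rfl (mulB h β γ) = mulB h' (dB ha β) γ + (-1 : k) ^ (a + 1) • rm (aug γ) β := by
  induction a' generalizing a with
  | zero =>
    subst ha
    induction β using hL_induction (show 1 + 0 = 0 + 1 by omega) with
    | add x y hx hy => simp only [map_add, LinearMap.add_apply, smul_add, hx, hy]; abel
    | smul r x hx =>
      rw [mulB_smul, isL_dB, hx, isL_dB, mulB_smul, smul_add, smul_rm, smul_comm r]
    | H x =>
      rw [hL_mulB (c := 1) (by omega) _ (by omega), dB_hL (rfl : 0 + 1 = 1) _ _ (by omega),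
        mulB_zero_zero, dB_hL_zero, mulB_sub_left, mulB_zero _ (show 1 + 0 = 0 + 1 by omega),
        hL_sub, isR_hL, one_smul]
      simp
      abel
  | succ a' ih =>
    induction β using hL_induction (show 1 + (a' + 1) = a by omega) with
    | add x y hx hy => simp only [map_add, LinearMap.add_apply, smul_add, hx, hy]; abel
    | smul r x hx =>
      rw [mulB_smul, isL_dB, hx, isL_dB, mulB_smul, smul_add, smul_rm, smul_comm r]
    | H x =>
      subst ha
      rw [hL_mulB (c := a' + 1 + 1) (by omega) _ (by omega),
        dB_hL (rfl : a' + 1 + 1 = a' + 1 + 1) _ _ (by omega), ih rfl rfl rfl,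
        dB_hL (rfl : a' + 1 = a' + 1) _ _ (by omega), mulB_sub_left, map_add,
        hL_mulB (c := a' + 1) (by omega) _ (by omega), LinearMap.map_smul, isR_hL,
        pow_succ _ (a' + 1 + 1)]
      module

lemma dB_mulB {a' b' c' : ℕ} (ha : a' + 1 = a) (hb : b' + 1 = b) (hc : c' + 1 = c)
    (h : a + (1 + b) = c) (h₁ : a' + (1 + b) = c') (h₂ : a + (1 + b') = c')
    (β : Bar k A a) (γ : Bar k A b) :
    dB hc (mulB h β γ) = mulB h₁ (dB ha β) γ + (-1 : k) ^ (a + 1) • mulB h₂ β (dB hb γ) := by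
  induction a' generalizing a c c' with
  | zero =>
    subst ha
    induction β using hL_induction (show 1 + 0 = 0 + 1 by omega) with
    | add x y hx hy => simp only [map_add, LinearMap.add_apply, smul_add, hx, hy]; abel
    | smul r x hx => rw [mulB_smul, isL_dB, hx, isL_dB, mulB_smul, mulB_smul, smul_add, smul_comm r]
    | H x =>
      obtain rfl : c' = b + 1 := by omega
      rw [hL_mulB (c := b + 1) (by omega) _ (by omega), dB_hL (rfl : b + 1 = b + 1) _ _ (by omega),
        dB_mulB_zero_left _ hb (by omega), dB_hL_zero, mulB_sub_left,
        mulB_zero _ (by omega), hL_sub, hL_mulB (c := b) (by omega) _ (by omega), one_smul]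
      simp
      abel
  | succ a' ih =>
    induction β using hL_induction (show 1 + (a' + 1) = a by omega) with
    | add x y hx hy => simp only [map_add, LinearMap.add_apply, smul_add, hx, hy]; abel
    | smul r x hx => rw [mulB_smul, isL_dB, hx, isL_dB, mulB_smul, mulB_smul, smul_add, smul_comm r]
    | H x =>
      obtain ⟨e, rfl⟩ : ∃ e, c' = e + 1 := ⟨c' - 1, by omega⟩
      subst ha
      rw [hL_mulB (c := e + 1) (by omega) _ (by omega),
        dB_hL (rfl : e + 1 = e + 1) _ _ (by omega), ih rfl rfl (by omega) (by omega) (by omega),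
        dB_hL (rfl : a' + 1 = a' + 1) _ _ (by omega), mulB_sub_left, map_add,
        hL_mulB (c := e) (by omega) _ (by omega), hL_mulB (c := e) (by omega) _ (by omega),
        LinearMap.map_smul, pow_succ _ (a' + 1 + 1)]
      module

end Product

section Deconcatenation

variable {k A : Type u} [Field k] [Ring A] [Algebra k A] {V W : Type u} [AddCommGroup V]
  [Module k V] [AddCommGroup W] [Module k W] {i j N : ℕ}

/-- The map `x ⊗ ww' ⊗ y ↦ Φ(x ⊗ w ⊗ 1, 1 ⊗ w' ⊗ y)`. -/
def dec (h : i + j = N) (Φ : Bar k A i →ₗ[k] Bar k A j →ₗ[k] V) : Bar k A N →ₗ[k] V :=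
  TensorProduct.lift (Φ.compl₁₂ ((TensorProduct.mk k (X k A i) A).flip 1)
      (TensorProduct.map (TensorProduct.mk k A (T k A j) 1) LinearMap.id)) ∘ₗ
    (TensorProduct.assoc k (X k A i) (T k A j) A).toLinearMap ∘ₗ
    TensorProduct.map ((TensorProduct.assoc k A (T k A i) (T k A j)).symm.toLinearMap ∘ₗ
      TensorProduct.map LinearMap.id (cat h).symm.toLinearMap) LinearMap.id

@[simp] lemma dec_tmul (h : i + j = N) (Φ : Bar k A i →ₗ[k] Bar k A j →ₗ[k] V) (x y : A)
    (w : T k A i) (w' : T k A j) : dec h Φ ((x ⊗ₜ[k] cat h (w ⊗ₜ[k] w')) ⊗ₜ[k] y) =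
      Φ ((x ⊗ₜ[k] w) ⊗ₜ[k] 1) (((1 : A) ⊗ₜ[k] w') ⊗ₜ[k] y) := by
  simp [dec]

lemma dec_induction (h : i + j = N) {p : Bar k A N → Prop} (x : Bar k A N)
    (add : ∀ x y, p x → p y → p (x + y)) (zero : p 0)
    (H : ∀ a w w' b, p ((a ⊗ₜ[k] cat h (w ⊗ₜ[k] w')) ⊗ₜ[k] b)) : p x := by
  induction x using bar_induction with
  | add x y hx hy => exact add _ _ hx hy
  | zero => exact zero
  | H a w b =>
    induction w using cat_induction h with
    | add x y hx hy => rw [TensorProduct.tmul_add, TensorProduct.add_tmul]; exact add _ _ hx hy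
    | zero => simpa using zero
    | H x y => exact H _ _ _ _

lemma map_dec (f : V →ₗ[k] W) (h : i + j = N) (Φ : Bar k A i →ₗ[k] Bar k A j →ₗ[k] V)
    (x : Bar k A N) : f (dec h Φ x) = dec h (Φ.compr₂ f) x := by
  induction x using dec_induction h with
  | add x y hx hy => simp only [map_add, hx, hy]
  | zero => simp only [TensorProduct.tmul_zero, TensorProduct.zero_tmul, map_zero, LinearMap.zero_apply, smul_zero]
  | H => simp

lemma dec_add (h : i + j = N) (Φ Ψ : Bar k A i →ₗ[k] Bar k A j →ₗ[k] V) (x : Bar k A N) :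
    dec h (Φ + Ψ) x = dec h Φ x + dec h Ψ x := by
  induction x using dec_induction h with
  | add x y hx hy => simp only [map_add, hx, hy]; abel
  | zero => simp
  | H => simp

lemma dec_scalar (h : i + j = N) (c : k) (Φ : Bar k A i →ₗ[k] Bar k A j →ₗ[k] V)
    (x : Bar k A N) : dec h (c • Φ) x = c • dec h Φ x := by
  induction x using dec_induction h with
  | add x y hx hy => simp only [map_add, smul_add, hx, hy]
  | zero => simp only [TensorProduct.tmul_zero, TensorProduct.zero_tmul, map_zero, LinearMap.zero_apply, smul_zero]
  | H => simp

lemma dec_smul (h : i + j = N) (Φ : Bar k A i →ₗ[k] Bar k A j →ₗ[k] V) (a : A) (x : Bar k A N) :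
    dec h Φ (a • x) = dec h (Φ ∘ₗ Algebra.lsmul k k _ a) x := by
  induction x using dec_induction h with
  | add x y hx hy => simp only [map_add, smul_add, hx, hy]
  | zero => simp only [TensorProduct.tmul_zero, TensorProduct.zero_tmul, map_zero, LinearMap.zero_apply, smul_zero]
  | H => simp

lemma dec_hL {i' N' : ℕ} (h : i + j = N) (hi : 1 + i = i') (hN : 1 + N = N') (h' : i' + j = N')
    (Φ : Bar k A i' →ₗ[k] Bar k A j →ₗ[k] V) (x : Bar k A N) :
    dec h' Φ (hL hN x) = dec h (Φ ∘ₗ hL hi) x := by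
  induction x using dec_induction h with
  | add x y hx hy => simp only [map_add, hx, hy]
  | zero => simp only [TensorProduct.tmul_zero, TensorProduct.zero_tmul, map_zero, LinearMap.zero_apply, smul_zero]
  | H => simp [← cat_assoc h' hi hN h]

lemma dec_zero_left_hL (hN : 1 + N = j) (h : 0 + j = j)
    (Φ : Bar k A 0 →ₗ[k] Bar k A j →ₗ[k] V) (x : Bar k A N) :
    dec h Φ (hL hN x) = Φ (((1 : A) ⊗ₜ[k] nil) ⊗ₜ[k] 1) (hL hN x) := by
  induction x using bar_induction with
  | add x y hx hy => simp only [map_add, hx, hy]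
  | zero => simp only [TensorProduct.tmul_zero, TensorProduct.zero_tmul, map_zero, LinearMap.zero_apply, smul_zero]
  | H a w b =>
    rw [hL_tmul]
    conv_lhs => rw [← cat_nil_left h (consBar LinearMap.id hN (a ⊗ₜ[k] w))]
    rw [dec_tmul]

lemma dec_zero_left (h : 0 + j = j) (Φ : Bar k A 0 →ₗ[k] Bar k A j →ₗ[k] V)
    (a b : A) (w : T k A j) :
    dec h Φ ((a ⊗ₜ[k] w) ⊗ₜ[k] b) =
      Φ ((a ⊗ₜ[k] nil) ⊗ₜ[k] 1) (((1 : A) ⊗ₜ[k] w) ⊗ₜ[k] b) := by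
  conv_lhs => rw [← cat_nil_left h w]
  rw [dec_tmul]

lemma dec_zero_right (h : i + 0 = i) (Φ : Bar k A i →ₗ[k] Bar k A 0 →ₗ[k] V) (a b : A)
    (w : T k A i) : dec h Φ ((a ⊗ₜ[k] w) ⊗ₜ[k] b) =
      Φ ((a ⊗ₜ[k] w) ⊗ₜ[k] 1) (((1 : A) ⊗ₜ[k] nil) ⊗ₜ[k] b) := by
  conv_lhs => rw [← cat_nil_right h w]
  rw [dec_tmul]

/-- The deconcatenation of the differential, for a map `Φ` over the tensor product over `A`. -/
lemma dec_dB {N' : ℕ} (h : i + j = N) (hN : N + 1 = N') (h₁ : i + 1 + j = N')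
    (h₂ : i + (j + 1) = N') (Φ : Bar k A i →ₗ[k] Bar k A j →ₗ[k] V)
    (hΦ : ∀ a γ β, Φ (rm a γ) β = Φ γ (a • β)) (x : Bar k A N') :
    dec h Φ (dB hN x) =
      dec h₁ (Φ ∘ₗ dB rfl) x + (-1 : k) ^ i • dec h₂ (Φ.compl₂ (dB rfl)) x := by
  induction i generalizing N N' with
  | zero =>
    obtain rfl : j = N := by omega
    induction x using hL_induction (show 1 + j = N' by omega) generalizing Φ with
    | add x y hx hy => simp only [map_add, smul_add, hx _ hΦ, hy _ hΦ]; abel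
    | smul a x hx =>
      have e : (Φ ∘ₗ Algebra.lsmul k k _ a) ∘ₗ dB rfl =
          (Φ ∘ₗ dB rfl) ∘ₗ Algebra.lsmul k k _ a := by
        refine LinearMap.ext fun γ => ?_
        change Φ (a • dB rfl γ) = Φ (dB rfl (a • γ))
        rw [isL_dB]
      rw [isL_dB, dec_smul, dec_smul, dec_smul, hx, e]
      · rfl
      · intro a' γ β
        simp only [LinearMap.comp_apply, Algebra.lsmul_coe, ← smul_rm, hΦ]
    | H x =>
      subst hN
      obtain ⟨R, e1, e2⟩ : ∃ R : Bar k A j, dB rfl (hL (show 1 + j = j + 1 by omega) x) = x - R ∧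
          dec h Φ R = Φ (((1 : A) ⊗ₜ[k] nil) ⊗ₜ[k] 1) R := by
        cases j with
        | zero =>
          exact ⟨_, dB_hL_zero _ _ _, dec_zero_left _ _ _ _ _⟩
        | succ j =>
          exact ⟨_, dB_hL rfl rfl _ (by omega) x, dec_zero_left_hL _ _ _ _⟩
      have e3 := dec_hL (show 0 + j = j by omega) (show 1 + 0 = 0 + 1 by omega)
        (show 1 + j = j + 1 by omega) h₁ (Φ ∘ₗ dB rfl) x
      have e4 : dec h ((Φ ∘ₗ dB rfl) ∘ₗ hL (show 1 + 0 = 0 + 1 by omega)) x =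
          dec h Φ x - Φ (((1 : A) ⊗ₜ[k] nil) ⊗ₜ[k] 1) x := by
        clear e1 e3
        induction x using bar_induction with
        | add x y hx hy => simp only [map_add, hx, hy]; abel
        | zero => simp
        | H a w b =>
          rw [dec_zero_left, dec_zero_left, LinearMap.comp_apply, LinearMap.comp_apply, dB_hL_zero,
            map_sub, LinearMap.sub_apply]
          have := hΦ a (((1 : A) ⊗ₜ[k] nil) ⊗ₜ[k] 1) (((1 : A) ⊗ₜ[k] w) ⊗ₜ[k] b)
          simp at this
          simp [this]
      rw [e1, map_sub, e2, e3, e4, dec_zero_left_hL, LinearMap.compl₂_apply, e1, map_sub, pow_zero,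
        one_smul]
      abel
  | succ i ih =>
    obtain ⟨M, rfl⟩ : ∃ M, N = M + 1 := ⟨N - 1, by omega⟩
    induction x using hL_induction (show 1 + (M + 1) = N' by omega) generalizing Φ with
    | add x y hx hy => simp only [map_add, smul_add, hx _ hΦ, hy _ hΦ]; abel
    | smul a x hx =>
      have e : (Φ ∘ₗ Algebra.lsmul k k _ a) ∘ₗ dB rfl =
          (Φ ∘ₗ dB rfl) ∘ₗ Algebra.lsmul k k _ a := by
        refine LinearMap.ext fun γ => ?_
        change Φ (a • dB rfl γ) = Φ (dB rfl (a • γ))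
        rw [isL_dB]
      rw [isL_dB, dec_smul, dec_smul, dec_smul, hx, e]
      · rfl
      · intro a' γ β
        simp only [LinearMap.comp_apply, Algebra.lsmul_coe, ← smul_rm, hΦ]
    | H x =>
      have e := ih (N := M) (N' := M + 1) (by omega) rfl (by omega) (by omega)
        (Φ ∘ₗ hL (show 1 + i = i + 1 by omega))
        (fun a γ β => by rw [LinearMap.comp_apply, isR_hL, hΦ]; rfl) x
      have e1 : dec h Φ (hL (show 1 + M = M + 1 by omega) (dB rfl x)) = _ :=
        (dec_hL (show i + j = M by omega) (show 1 + i = i + 1 by omega) _ h Φ (dB rfl x)).trans e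
      have e2 := dec_hL (show i + 1 + j = M + 1 by omega) (show 1 + (i + 1) = i + 1 + 1 by omega)
        (show 1 + (M + 1) = N' by omega) h₁ (Φ ∘ₗ dB rfl) x
      have e3 := dec_hL (show i + (j + 1) = M + 1 by omega) (show 1 + i = i + 1 by omega)
        (show 1 + (M + 1) = N' by omega) h₂ (Φ.compl₂ (dB rfl)) x
      have e4 : Φ ∘ₗ dB rfl ∘ₗ hL (show 1 + (i + 1) = i + 1 + 1 by omega) =
          Φ + (-1 : k) • (Φ ∘ₗ hL (show 1 + i = i + 1 by omega)) ∘ₗ dB rfl := by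
        refine LinearMap.ext fun γ => ?_
        simp only [LinearMap.comp_apply, LinearMap.add_apply, LinearMap.smul_apply]
        rw [dB_hL (rfl : i + 1 = i + 1) rfl _ (by omega), map_sub]
        module
      rw [e2, e3, LinearMap.comp_assoc, e4, dec_add, dec_scalar,
        dB_hL (rfl : M + 1 = M + 1) hN _ (by omega), map_sub, e1, pow_succ]
      have e5 : (Φ.compl₂ (dB (rfl : j + 1 = j + 1))) ∘ₗ hL (show 1 + i = i + 1 by omega) =
        (Φ ∘ₗ hL (show 1 + i = i + 1 by omega)).compl₂ (dB rfl) := rfl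
      rw [e5]
      module

end Deconcatenation

section AntidiagonalSums

variable {k : Type u} [Field k] {V W : Type u} [AddCommGroup V] [Module k V] [AddCommGroup W]
  [Module k W]

/-- The sum of a family over the pairs `(i, j)` with `i + j = N`. -/
def sumAD : ∀ N : ℕ, (∀ i j : ℕ, i + j = N → V) → V
  | 0, f => f 0 0 rfl
  | N + 1, f => f 0 (N + 1) (by omega) + sumAD N fun i j h => f (i + 1) j (by omega)

lemma sumAD_succ_left {N : ℕ} (f : ∀ i j : ℕ, i + j = N + 1 → V) :
    sumAD (N + 1) f = f 0 (N + 1) (by omega) + sumAD N fun i j h => f (i + 1) j (by omega) := rfl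

lemma sumAD_congr {N : ℕ} {f g : ∀ i j : ℕ, i + j = N → V} (h : ∀ i j e, f i j e = g i j e) :
    sumAD N f = sumAD N g := by
  congr 1
  funext i j e
  exact h i j e

lemma sumAD_succ_right {N : ℕ} (f : ∀ i j : ℕ, i + j = N + 1 → V) :
    sumAD (N + 1) f = (sumAD N fun i j h => f i (j + 1) (by omega)) + f (N + 1) 0 (by omega) := by
  induction N with
  | zero => rfl
  | succ N ih => rw [sumAD_succ_left, ih]; exact (add_assoc _ _ _).symm

lemma sumAD_add {N : ℕ} (f g : ∀ i j : ℕ, i + j = N → V) :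
    (sumAD N fun i j h => f i j h + g i j h) = sumAD N f + sumAD N g := by
  induction N with
  | zero => rfl
  | succ N ih => rw [sumAD_succ_left, ih, sumAD_succ_left, sumAD_succ_left]; abel

lemma map_sumAD {N : ℕ} (φ : V →ₗ[k] W) (f : ∀ i j : ℕ, i + j = N → V) :
    φ (sumAD N f) = sumAD N fun i j h => φ (f i j h) := by
  induction N with
  | zero => rfl
  | succ N ih => rw [sumAD_succ_left, map_add, ih, sumAD_succ_left]

lemma smul_sumAD {N : ℕ} (c : k) (f : ∀ i j : ℕ, i + j = N → V) :
    c • sumAD N f = sumAD N fun i j h => c • f i j h :=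
  map_sumAD (c • (LinearMap.id : V →ₗ[k] V)) f

lemma sumAD_eq_sum {N : ℕ} (f : ∀ i j : ℕ, i + j = N → V) :
    sumAD N f = ∑ i : Fin (N + 1), f i (N - i) (by omega) := by
  induction N with
  | zero => simp [sumAD]
  | succ N ih =>
    rw [sumAD_succ_left, ih]
    refine Eq.trans ?_ (Fin.sum_univ_succ _).symm
    refine congrArg₂ (fun a b : V => a + b) rfl (Finset.sum_congr rfl fun i _ => ?_)
    have : N - (i : ℕ) = N + 1 - (i.succ : Fin (N + 2)) := by simp
    simp only [Fin.val_succ] at this ⊢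
    congr 1

end AntidiagonalSums

section CyclicHomotopy

variable {k A : Type u} [Field k] [Ring A] [Algebra k A] (σ : A →ₐ[k] A) {i j l m N r s : ℕ}

/-- The map `(γ, β) ↦ τ(K(β) · σγ)`, where `τ(x ⊗ w ⊗ y) = yσ(x) ⊗ w`. -/
def cyc (h : l + (1 + i) = r) (K : Bar k A j →ₗ[k] Bar k A l) :
    Bar k A i →ₗ[k] Bar k A j →ₗ[k] X k A r :=
  ((mulB (k := k) (A := A) h ∘ₗ K).flip ∘ₗ mapB σ).compr₂ (tauS σ)

@[simp] lemma cyc_apply (h : l + (1 + i) = r) (K : Bar k A j →ₗ[k] Bar k A l) (γ : Bar k A i)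
    (β : Bar k A j) : cyc σ h K γ β = tauS σ (mulB h (K β) (mapB σ γ)) := rfl

lemma cyc_balanced (h : l + (1 + i) = r) {K : Bar k A j →ₗ[k] Bar k A l} (hK : IsL K) (a : A)
    (γ : Bar k A i) (β : Bar k A j) : cyc σ h K (rm a γ) β = cyc σ h K γ (a • β) := by
  rw [cyc_apply, cyc_apply, hK, mulB_smul, tauS_smul, mapB_rm, mulB_rm]

lemma dec_cyc_iota_tauS (hN : i + j = N) (h : l + (1 + i) = r) {K : Bar k A j →ₗ[k] Bar k A l}
    (hK : IsR K) (x : Bar k A N) :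
    dec hN (cyc σ h K) (iota (tauS σ x)) = dec hN (cyc σ h K) x := by
  induction x using dec_induction hN with
  | add x y hx hy => simp only [map_add, hx, hy]
  | zero => simp only [TensorProduct.tmul_zero, TensorProduct.zero_tmul, map_zero, LinearMap.zero_apply, smul_zero]
  | H a w w' b =>
    rw [tauS_tmul, iota_tmul, dec_tmul, dec_tmul, cyc_apply, cyc_apply]
    have e1 : ((1 : A) ⊗ₜ[k] w') ⊗ₜ[k] (b * σ a) = rm (σ a) (((1 : A) ⊗ₜ[k] w') ⊗ₜ[k] b) := by simp
    have e2 : ((a ⊗ₜ[k] w) ⊗ₜ[k] 1 : Bar k A i) = a • (((1 : A) ⊗ₜ[k] w) ⊗ₜ[k] 1) := by simp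
    rw [e1, e2, hK, mapB_smul, rm_mulB]

/-- The sum of `(-1)^{iN} 1 ⊗ \overline{w'} y \overline{σ(x w)} ⊗ 1` over all `ww'` with `w` of
length `i`, up to the last contraction. -/
def cycSum (N : ℕ) : Bar k A N →ₗ[k] X k A (N + 1) :=
  sumAD N fun i j h => (-1 : k) ^ (i * N) •
    dec h (cyc σ (show j + (1 + i) = N + 1 by omega) LinearMap.id)

lemma cycSum_apply (x : Bar k A N) : cycSum σ N x = sumAD N fun i j h => (-1 : k) ^ (i * N) •
    dec h (cyc σ (show j + (1 + i) = N + 1 by omega) LinearMap.id) x :=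
  map_sumAD (LinearMap.applyₗ x) _

lemma cycSum_iota_tauS (x : Bar k A N) : cycSum σ N (iota (tauS σ x)) = cycSum σ N x := by
  rw [cycSum_apply, cycSum_apply]
  exact sumAD_congr fun i j h => by rw [dec_cyc_iota_tauS _ _ _ (fun _ _ => rfl)]

lemma dec_cyc_left (h : 0 + N = N) (x : Bar k A N) {K : Bar k A N →ₗ[k] Bar k A l} (hK : IsL K)
    (c : k) {Ψ : Bar k A 0 →ₗ[k] Bar k A N →ₗ[k] X k A l}
    (hΨ : ∀ γ β, Ψ γ β = c • tauS σ (rm (σ (aug γ)) (K β))) : dec h Ψ x = c • tauS σ (K x) := by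
  induction x using bar_induction with
  | add x y hx hy => simp only [map_add, smul_add, hx, hy]
  | zero => simp only [TensorProduct.tmul_zero, TensorProduct.zero_tmul, map_zero, LinearMap.zero_apply, smul_zero]
  | H a w b =>
    rw [dec_zero_left, hΨ, ← tauS_smul, ← hK]
    simp

lemma dec_cyc_right (h : N + 0 = N) (x : Bar k A N)
    {Ψ : Bar k A N →ₗ[k] Bar k A 0 →ₗ[k] X k A N}
    (hΨ : ∀ γ β, Ψ γ β = tauS σ (aug β • mapB σ γ)) : dec h Ψ x = actX σ (tauS σ x) := by
  induction x using bar_induction with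
  | add x y hx hy => simp only [map_add, hx, hy]
  | zero => simp only [TensorProduct.tmul_zero, TensorProduct.zero_tmul, map_zero, LinearMap.zero_apply, smul_zero]
  | H a w b =>
    rw [dec_zero_right, hΨ]
    simp

lemma dec_sub (h : i + j = N) {V : Type u} [AddCommGroup V] [Module k V]
    (Φ Ψ : Bar k A i →ₗ[k] Bar k A j →ₗ[k] V) (x : Bar k A N) :
    dec h (Φ - Ψ) x = dec h Φ x - dec h Ψ x := by
  rw [eq_sub_iff_add_eq, ← dec_add, sub_add_cancel]

/-- The boundary of `cycSum`. -/
lemma bdry_cycSum_aux (N : ℕ) (x : Bar k A N) (P Q : ∀ i j : ℕ, i + j = N → X k A N)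
    (hP : ∀ i j h (h' : j + (1 + i) = N), P i (j + 1) h = (-1 : k) ^ (i * N) •
      dec h ((cyc σ h' LinearMap.id).compl₂ (dB rfl)) x)
    (hP0 : ∀ i h, P i 0 h = (-1 : k) ^ (i * N) • actX σ (tauS σ x))
    (hQ : ∀ i j h (h' : j + (1 + i) = N), Q (i + 1) j h = (-1 : k) ^ ((i + 1) * N + j + 1) •
      dec h (cyc σ h' LinearMap.id ∘ₗ dB rfl) x)
    (hQ0 : ∀ j h, Q 0 j h = (-1 : k) ^ (j + 1) • tauS σ x) :
    bdry σ rfl (cycSum σ N x) = sumAD N P + sumAD N Q := by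
  rw [cycSum_apply, map_sumAD, ← sumAD_add]
  refine sumAD_congr fun i j h => ?_
  rw [LinearMap.map_smul, map_dec]
  have e : ∀ {s : ℕ} (hs : j + (1 + i) = s + 1) (γ : Bar k A i) (β : Bar k A j),
      (cyc σ hs LinearMap.id).compr₂ (bdry σ rfl) γ β =
        tauS σ (dB rfl (mulB hs β (mapB σ γ))) := fun hs γ β => by
    rw [LinearMap.compr₂_apply, cyc_apply, bdry_tauS, LinearMap.id_apply]
  rcases i with _ | i <;> rcases j with _ | j
  · obtain rfl : N = 0 := by omega
    have e1 := dec_cyc_right σ h x (Ψ := (((Algebra.lsmul k k (Bar k A 0)).toLinearMap ∘ₗ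
      aug).flip ∘ₗ mapB σ).compr₂ (tauS σ)) (fun γ β => rfl)
    have e2 := dec_cyc_left σ h x (K := LinearMap.id) (fun _ _ => rfl) (-1)
      (Ψ := (cyc σ (show 0 + (1 + 0) = 0 + 1 by omega) LinearMap.id).compr₂ (bdry σ rfl) -
        (((Algebra.lsmul k k (Bar k A 0)).toLinearMap ∘ₗ aug).flip ∘ₗ mapB σ).compr₂ (tauS σ))
      (fun γ β => by
        rw [LinearMap.sub_apply, LinearMap.sub_apply, e, mulB_zero_zero, aug_mapB, map_sub,
          LinearMap.id_apply, neg_one_smul, sub_eq_iff_eq_add, neg_add_eq_sub]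
        rfl)
    rw [dec_sub, sub_eq_iff_eq_add] at e2
    rw [e2, e1, hP0, hQ0, LinearMap.id_apply]
    simp [add_comm]
  · obtain rfl : j + 1 = N := by omega
    have e2 := dec_cyc_left σ h x (K := LinearMap.id) (fun _ _ => rfl) ((-1) ^ (j + 1 + 1))
      (Ψ := (cyc σ (show j + 1 + (1 + 0) = j + 1 + 1 by omega) LinearMap.id).compr₂ (bdry σ rfl) -
        (cyc σ (show j + (1 + 0) = j + 1 by omega) LinearMap.id).compl₂ (dB rfl))
      (fun γ β => by
        rw [LinearMap.sub_apply, LinearMap.sub_apply, e, dB_mulB_zero_right rfl _ (by omega),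
          aug_mapB, map_add, LinearMap.map_smul, sub_eq_iff_eq_add']
        rfl)
    rw [dec_sub, sub_eq_iff_eq_add'] at e2
    rw [e2, hP _ _ _ (by omega), hQ0, LinearMap.id_apply]
    simp
  · obtain rfl : i + 1 = N := by omega
    have e1 := dec_cyc_right σ h x (Ψ := (((Algebra.lsmul k k (Bar k A (i + 1))).toLinearMap ∘ₗ
      aug).flip ∘ₗ mapB σ).compr₂ (tauS σ)) (fun γ β => rfl)
    have e2 : (cyc σ (show 0 + (1 + (i + 1)) = i + 1 + 1 by omega) LinearMap.id).compr₂
        (bdry σ rfl) = (((Algebra.lsmul k k (Bar k A (i + 1))).toLinearMap ∘ₗ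
      aug).flip ∘ₗ mapB σ).compr₂ (tauS σ) - cyc σ (show 0 + (1 + i) = i + 1 by omega)
        LinearMap.id ∘ₗ dB rfl := by
      refine LinearMap.ext fun γ => LinearMap.ext fun β => ?_
      rw [e, dB_mulB_zero_left _ rfl (by omega), map_sub, ← mapB_dB]
      rfl
    rw [e2, dec_sub, e1, hP0, hQ _ _ _ (by omega), pow_succ]
    module
  · obtain ⟨s, rfl⟩ : ∃ s, N = s + 1 := ⟨N - 1, by omega⟩
    have e2 : (cyc σ (show j + 1 + (1 + (i + 1)) = s + 1 + 1 by omega) LinearMap.id).compr₂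
        (bdry σ rfl) = (cyc σ (show j + (1 + (i + 1)) = s + 1 by omega)
          LinearMap.id).compl₂ (dB rfl) + (-1 : k) ^ (j + 1 + 1) • (cyc σ (show j + 1 + (1 + i) = s + 1 by omega) LinearMap.id ∘ₗ dB rfl) := by
      refine LinearMap.ext fun γ => LinearMap.ext fun β => ?_
      rw [e, dB_mulB rfl rfl rfl _ (by omega) (by omega), map_add, LinearMap.map_smul, ← mapB_dB]
      rfl
    rw [e2, dec_add, dec_scalar, hP _ _ _ (by omega), hQ _ _ _ (by omega), smul_add, smul_smul, ← pow_add]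
    congr 2

lemma bdry_cycSum_zero (x : Bar k A 0) :
    bdry σ rfl (cycSum σ 0 x) = actX σ (tauS σ x) - tauS σ x := by
  rw [bdry_cycSum_aux σ 0 x (fun _ _ _ => actX σ (tauS σ x)) (fun _ _ _ => - tauS σ x)]
  · simp [sumAD, sub_eq_add_neg]
  · intro i j h h'; omega
  · intro i h; simp
  · intro i j h h'; omega
  · intro j h
    obtain rfl : j = 0 := by omega
    simp

lemma bdry_cycSum_succ (M : ℕ) (x : Bar k A (M + 1)) :
    bdry σ rfl (cycSum σ (M + 1) x) =
      cycSum σ M (dB rfl x) + (-1 : k) ^ (M + 1) • (actX σ (tauS σ x) - tauS σ x) := by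
  rw [bdry_cycSum_aux σ (M + 1) x
    (fun i j => match j with
      | 0 => fun _ => (-1 : k) ^ (i * (M + 1)) • actX σ (tauS σ x)
      | j + 1 => fun h => (-1 : k) ^ (i * (M + 1)) • dec h
        ((cyc σ (show j + (1 + i) = M + 1 by omega) LinearMap.id).compl₂ (dB rfl)) x)
    (fun i => match i with
      | 0 => fun j _ => (-1 : k) ^ (j + 1) • tauS σ x
      | i + 1 => fun j h => (-1 : k) ^ ((i + 1) * (M + 1) + j + 1) • dec h
        (cyc σ (show j + (1 + i) = M + 1 by omega) LinearMap.id ∘ₗ dB rfl) x)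
    (fun _ _ _ _ => rfl) (fun _ _ => rfl) (fun _ _ _ _ => rfl) (fun _ _ => rfl),
    sumAD_succ_right, sumAD_succ_left, cycSum_apply]
  have e : ∀ i j (h : i + j = M), (-1 : k) ^ (i * M) •
      dec h (cyc σ (show j + (1 + i) = M + 1 by omega) LinearMap.id) (dB rfl x) =
      (-1 : k) ^ (i * (M + 1)) • dec (show i + (j + 1) = M + 1 by omega)
        ((cyc σ (show j + (1 + i) = M + 1 by omega) LinearMap.id).compl₂ (dB rfl)) x +
      (-1 : k) ^ ((i + 1) * (M + 1) + j + 1) • dec (show i + 1 + j = M + 1 by omega)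
        (cyc σ (show j + (1 + i) = M + 1 by omega) LinearMap.id ∘ₗ dB rfl) x := by
    intro i j h
    rw [dec_dB h rfl (show i + 1 + j = M + 1 by omega) (show i + (j + 1) = M + 1 by omega) _
      (cyc_balanced σ _ fun _ _ => rfl), smul_add, smul_smul, ← pow_add,
      npow_congr (k := k) (a := i * M) (b := (i + 1) * (M + 1) + j + 1)
        (by subst h; ring_nf; omega)]
    exact add_comm _ _
  have e' : (-1 : k) ^ ((M + 1) * (M + 1)) = (-1) ^ (M + 1) :=
    npow_congr (by rcases Nat.mod_two_eq_zero_or_one (M + 1) with h | h <;> simp [Nat.mul_mod, h])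
  rw [sumAD_congr e, sumAD_add]
  dsimp only
  rw [e', pow_succ _ (M + 1)]
  module

/-- The Connes operator of the chain complex twisted by `σ`. -/
def conX : X k A N →ₗ[k] X k A (N + 1) :=
  TensorProduct.mk k A _ 1 ∘ₗ FrobeniusForm.connesWord σ.toLinearMap (map_one σ) rfl

lemma conX_eq (z : X k A N) : conX σ z = (-1 : k) ^ N • cycSum σ N (iota z) := by
  induction z using TensorProduct.induction_on with
  | zero => simp only [TensorProduct.tmul_zero, TensorProduct.zero_tmul, map_zero, LinearMap.zero_apply, smul_zero]
  | add x y hx hy => simp only [map_add, smul_add, hx, hy]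
  | tmul a w =>
    rw [cycSum_apply, sumAD_eq_sum, conX, LinearMap.comp_apply]
    simp only [FrobeniusForm.connesWord, LinearMap.sum_apply, map_sum, Finset.smul_sum]
    refine Finset.sum_congr rfl fun i _ => ?_
    rw [LinearMap.smul_apply, LinearMap.map_smul, smul_smul, ← pow_add,
      show N + (i : ℕ) * N = (i + 1) * N by ring]
    congr 1
    induction w using cat_induction (show (i : ℕ) + (N - i) = N by omega) with
    | zero => simp only [TensorProduct.tmul_zero, TensorProduct.zero_tmul, map_zero, LinearMap.zero_apply, smul_zero]
    | add x y hx hy => simp only [TensorProduct.tmul_add, map_add, hx, hy]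
    | H w w' =>
      rw [iota_tmul, dec_tmul]
      simp
      exact congrArg ((1 : A) ⊗ₜ[k] ·) (cat_assoc _ _ _ _ _ _ _)

lemma bdry_conX_zero (z : X k A 0) : bdry σ rfl (conX σ z) = actX σ z - z := by
  rw [conX_eq, pow_zero, one_smul, bdry_cycSum_zero, tauS_iota]

lemma bdry_conX (z : X k A (N + 1)) :
    bdry σ rfl (conX σ z) + conX σ (bdry σ rfl z) = actX σ z - z := by
  rw [conX_eq, conX_eq, LinearMap.map_smul, bdry_cycSum_succ, tauS_iota, bdry_apply,
    cycSum_iota_tauS, smul_add, smul_smul, neg_one_pow_mul_self, pow_succ]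
  module

end CyclicHomotopy

section CartanHomotopy

variable {k A : Type u} [Field k] [Ring A] [Algebra k A] (σ : A →ₐ[k] A) {i j l m N r s : ℕ}
  (f : T k A m →ₗ[k] X k A 0)

lemma psi_of_zero {p t N' : ℕ} (h : m + t = N + 1) (h' : p + t = N') (y : Bar k A N) :
    psi (0 : T k A m →ₗ[k] X k A p) t h h' y = 0 := by
  have : psiT (0 : T k A m →ₗ[k] X k A p) t h h' = 0 := by
    simpa using psiT_smul (0 : k) (0 : T k A m →ₗ[k] X k A p) h h'
  rw [psi, this]
  induction y using bar_induction with
  | add x y hx hy => simp only [map_add, hx, hy, add_zero]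
  | zero => simp only [TensorProduct.tmul_zero, TensorProduct.zero_tmul, map_zero, LinearMap.zero_apply, smul_zero]
  | H => simp

/-- Insertion of a cochain `f` in all places of a word of length `m + l`. -/
def insF (l : ℕ) : Bar k A (m + l) →ₗ[k] Bar k A (l + 1) :=
  psi f (l + 1) (show m + (l + 1) = m + l + 1 from rfl) (Nat.zero_add _)

/-- The difference of the applications of a cochain `f` to the first and to the last letters. -/
def endF (l : ℕ) : Bar k A (m + l) →ₗ[k] Bar k A l :=
  lam f (rfl : m + l = m + l) (Nat.zero_add _) - rho f (Nat.add_comm l m) (add_zero _)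

lemma isL_insF : IsL (insF f l) := isL_psi _ _ _

lemma isR_insF : IsR (insF f l) := isR_psi _ _ _

lemma dB_insF_zero (y : Bar k A (m + 0)) : dB rfl (insF f 0 y) = endF f 0 y :=
  dB_psi_one f rfl _ rfl rfl (by omega) rfl y

lemma Rel.dB_insF_succ {f : T k A m →ₗ[k] X k A 0} (hf : Rel f 0) (y : Bar k A (m + (l + 1))) :
    dB rfl (insF f (l + 1) y) = eps k m 0 • insF f l (dB rfl y) + endF f (l + 1) y := by
  have := dB_psi hf (l := l + 1) (N := m + l) (N₁ := m + (l + 1)) rfl (Nat.zero_add _) rfl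
    (Nat.zero_add _) rfl (Nat.add_comm _ _) (add_zero _) (by omega) rfl rfl y
  rw [psi_of_zero, sub_zero, add_sub_assoc] at this
  exact this

/-- The homotopy relating the operators `f ⋆ -` and `B`: insertion of `f`, rotation. -/
def cartanSum (L : ℕ) : Bar k A (m + L) →ₗ[k] X k A (L + 1 + 1) :=
  sumAD L fun i l h => (-1 : k) ^ (i * (m + L)) •
    dec (show i + (m + l) = m + L by omega) (cyc σ (show l + 1 + (1 + i) = L + 1 + 1 by omega)
      (insF f l))

lemma cartanSum_apply (L : ℕ) (x : Bar k A (m + L)) : cartanSum σ f L x =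
    sumAD L fun i l h => (-1 : k) ^ (i * (m + L)) •
      dec (show i + (m + l) = m + L by omega) (cyc σ (show l + 1 + (1 + i) = L + 1 + 1 by omega)
        (insF f l)) x :=
  map_sumAD (LinearMap.applyₗ x) _

lemma cartanSum_iota_tauS (L : ℕ) (x : Bar k A (m + L)) :
    cartanSum σ f L (iota (tauS σ x)) = cartanSum σ f L x := by
  rw [cartanSum_apply, cartanSum_apply]
  exact sumAD_congr fun i j h => by rw [dec_cyc_iota_tauS _ _ _ (isR_insF _)]

/-- The rotated insertions of `f` at both ends of a word. -/
def endSum (L : ℕ) (x : Bar k A (m + L)) : X k A (L + 1) :=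
  sumAD L fun i l h => (-1 : k) ^ (i * (m + L)) •
    dec (show i + (m + l) = m + L by omega) (cyc σ (show l + (1 + i) = L + 1 by omega)
      (endF f l)) x

variable {f}

lemma bdry_cartanSum_aux (hf : Rel f 0) (L : ℕ) (x : Bar k A (m + L))
    (P Q : ∀ i j : ℕ, i + j = L → X k A (L + 1))
    (hP : ∀ i l h, P i (l + 1) h = ((-1 : k) ^ (i * (m + L)) * eps k m 0) •
      dec (show i + (m + l + 1) = m + L by omega) ((cyc σ (show l + 1 + (1 + i) = L + 1 by omega)
        (insF f l)).compl₂ (dB rfl)) x)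
    (hP0 : ∀ i h, P i 0 h = 0)
    (hQ : ∀ i l h, Q (i + 1) l h = (-1 : k) ^ ((i + 1) * (m + L) + l) •
      dec (show i + 1 + (m + l) = m + L by omega) (cyc σ (show l + 1 + (1 + i) = L + 1 by omega)
        (insF f l) ∘ₗ dB rfl) x)
    (hQ0 : ∀ h, Q 0 L h = (-1 : k) ^ L • tauS σ (insF f L x)) :
    bdry σ rfl (cartanSum σ f L x) = sumAD L P + sumAD L Q + endSum σ f L x := by
  rw [cartanSum_apply, endSum, map_sumAD, ← sumAD_add, ← sumAD_add]
  refine sumAD_congr fun i l h => ?_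
  rw [LinearMap.map_smul, map_dec]
  set Φ := (cyc σ (show l + 1 + (1 + i) = L + 1 + 1 by omega)
    (insF f l)).compr₂ (bdry σ rfl) with hΦ
  have e : ∀ (γ : Bar k A i) (β : Bar k A (m + l)), Φ γ β =
        tauS σ (dB rfl (mulB (show l + 1 + (1 + i) = L + 1 + 1 by omega)
          (insF f l β) (mapB σ γ))) := fun γ β => by
    rw [LinearMap.compr₂_apply, cyc_apply, bdry_tauS]
  obtain ⟨Ψ, hΨ, hΨQ⟩ : ∃ Ψ : Bar k A i →ₗ[k] Bar k A (m + l) →ₗ[k] X k A (L + 1),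
      (∀ γ β, Φ γ β = tauS σ (mulB (show l + (1 + i) = L + 1 by omega)
          (dB rfl (insF f l β)) (mapB σ γ)) + Ψ γ β) ∧
      (-1 : k) ^ (i * (m + L)) • dec (show i + (m + l) = m + L by omega) Ψ x = Q i l h := by
    rcases i with _ | i
    · obtain rfl : l = L := by omega
      refine ⟨Φ - cyc σ (show l + (1 + 0) = l + 1 by omega)
        (dB rfl ∘ₗ insF f l), fun γ β => ?_, ?_⟩
      · rw [LinearMap.sub_apply, LinearMap.sub_apply, cyc_apply, LinearMap.comp_apply]
        abel
      · rw [dec_cyc_left σ _ x (K := insF f l) (isL_insF _)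
          ((-1) ^ (l + 1 + 1)), hQ0]
        · rw [npow_congr (k := k) (a := l + 1 + 1) (b := l) (by omega)]
          simp
        · intro γ β
          rw [LinearMap.sub_apply, LinearMap.sub_apply, e, dB_mulB_zero_right rfl _ (by omega),
            aug_mapB, map_add, LinearMap.map_smul, cyc_apply, LinearMap.comp_apply]
          abel
    · refine ⟨(-1 : k) ^ l • (cyc σ (show l + 1 + (1 + i) = L + 1 by omega)
        (insF f l) ∘ₗ dB rfl), fun γ β => ?_, ?_⟩
      · obtain ⟨L, rfl⟩ : ∃ L', L = L' + 1 := ⟨L - 1, by omega⟩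
        rw [e, dB_mulB rfl rfl rfl _ (by omega) (by omega), map_add, LinearMap.map_smul, ← mapB_dB,
          npow_congr (k := k) (a := l + 1 + 1) (b := l) (by omega)]
        rfl
      · rw [dec_scalar, hQ, smul_smul, ← pow_add]
  rcases l with _ | l
  · have e2 : Φ = cyc σ (show 0 + (1 + i) = L + 1 by omega)
        (endF f 0) + Ψ := by
      refine LinearMap.ext fun γ => LinearMap.ext fun β => ?_
      rw [hΨ, LinearMap.add_apply, LinearMap.add_apply, cyc_apply,
        dB_insF_zero]
    rw [e2, dec_add, smul_add, hΨQ, hP0]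
    abel
  · have e2 : Φ = eps k m 0 • (cyc σ (show l + 1 + (1 + i) = L + 1 by omega)
        (insF f l)).compl₂ (dB rfl) +
        cyc σ (show l + 1 + (1 + i) = L + 1 by omega)
        (endF f (l + 1)) + Ψ := by
      refine LinearMap.ext fun γ => LinearMap.ext fun β => ?_
      rw [hΨ, hf.dB_insF_succ, map_add, LinearMap.add_apply, map_add, LinearMap.map_smul,
        LinearMap.smul_apply, LinearMap.map_smul]
      rfl
    rw [e2, dec_add, dec_add, dec_scalar, smul_add, smul_add, hΨQ, hP, smul_smul]
    abel

lemma exists_bdry_cartanSum (hf : Rel f 0) (L : ℕ) (z : X k A (m + L))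
    (hz : ∀ r (h : r + 1 = m + L), bdry σ h z = 0) :
    bdry σ rfl (cartanSum σ f L (iota z)) =
      endSum σ f L (iota z) + (-1 : k) ^ L • tauS σ (insF f L (iota z)) := by
  rcases L with _ | M
  · rw [bdry_cartanSum_aux σ hf 0 (iota z) (fun _ _ _ => 0)
      (fun _ _ _ => tauS σ (insF f 0 (iota z)))]
    · simp [sumAD, add_comm]
    · intro i j h; omega
    · intro i h; rfl
    · intro i j h; omega
    · intro h; simp
  have hz' : cartanSum σ f M (dB rfl (iota z)) = 0 := by
    rw [← cartanSum_iota_tauS]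
    have := hz (m + M) rfl
    rw [bdry_apply] at this
    rw [this, map_zero, map_zero]
  have e : ∀ i l (h : i + l = M), (-1 : k) ^ (i * (m + M)) •
      dec (show i + (m + l) = m + M by omega) (cyc σ (show l + 1 + (1 + i) = M + 1 + 1 by omega)
        (insF f l)) (dB (rfl : m + M + 1 = m + M + 1) (iota z)) = eps k m 0 •
      ((((-1 : k) ^ (i * (m + (M + 1))) * eps k m 0) •
      dec (show i + (m + l + 1) = m + (M + 1) by omega)
        ((cyc σ (show l + 1 + (1 + i) = M + 1 + 1 by omega) (insF f l)).compl₂ (dB rfl)) (iota z)) +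
      (-1 : k) ^ ((i + 1) * (m + (M + 1)) + l) • dec (show i + 1 + (m + l) = m + (M + 1) by omega)
        (cyc σ (show l + 1 + (1 + i) = M + 1 + 1 by omega) (insF f l) ∘ₗ dB rfl) (iota z)) := by
    intro i l h
    rw [dec_dB (show i + (m + l) = m + M by omega) rfl
      (show i + 1 + (m + l) = m + M + 1 by omega) (show i + (m + l + 1) = m + M + 1 by omega) _
      (cyc_balanced σ _ (isL_insF f)), smul_add, smul_smul, ← pow_add, smul_add, smul_smul,
      smul_smul, mul_comm ((-1 : k) ^ (i * (m + (M + 1)))), ← mul_assoc, eps_mul_self, one_mul, eps,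
      ← pow_add, npow_congr (k := k) (a := i * (m + M))
        (b := m + 0 + 1 + ((i + 1) * (m + (M + 1)) + l)) (by subst h; ring_nf; omega)]
    exact add_comm _ _
  rw [cartanSum_apply, sumAD_congr e, ← smul_sumAD, sumAD_add] at hz'
  have hz'' := congrArg (eps k m 0 • ·) hz'
  simp only [smul_smul, eps_mul_self, one_smul, smul_zero] at hz''
  rw [bdry_cartanSum_aux σ hf (M + 1) (iota z)
    (fun i l => match l with
      | 0 => fun _ => 0
      | l + 1 => fun h => ((-1 : k) ^ (i * (m + (M + 1))) * eps k m 0) •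
        dec (show i + (m + l + 1) = m + (M + 1) by omega)
          ((cyc σ (show l + 1 + (1 + i) = M + 1 + 1 by omega) (insF f l)).compl₂ (dB rfl)) (iota z))
    (fun i => match i with
      | 0 => fun l _ => (-1 : k) ^ l • tauS σ (insF f (M + 1) (iota z))
      | i + 1 => fun l h => (-1 : k) ^ ((i + 1) * (m + (M + 1)) + l) •
        dec (show i + 1 + (m + l) = m + (M + 1) by omega)
          (cyc σ (show l + 1 + (1 + i) = M + 1 + 1 by omega) (insF f l) ∘ₗ dB rfl) (iota z))
    (fun _ _ _ => rfl) (fun _ _ => rfl) (fun _ _ _ => rfl) (fun _ => rfl),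
    sumAD_succ_right, sumAD_succ_left]
  dsimp only
  linear_combination (norm := module) hz''

end CartanHomotopy

section FixedPart

variable {k : Type u} [Field k] {V₀ V₁ V₂ : Type u} [AddCommGroup V₀] [Module k V₀]
  [AddCommGroup V₁] [Module k V₁] [AddCommGroup V₂] [Module k V₂]

/-- Endomorphisms with a group inverse, so that `V = ker S ⊕ im S`. -/
def Splits (S : V₁ →ₗ[k] V₁) : Prop := ∃ U : V₁ →ₗ[k] V₁, (∀ x, S (S (U x)) = S x) ∧
  ∀ x, U (S x) = S (U x)

lemma Splits.eq_zero {S : V₁ →ₗ[k] V₁} (hS : Splits S) {x : V₁} (hx : S (S x) = 0) : S x = 0 := by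
  obtain ⟨U, h1, h2⟩ := hS
  rw [← h1 x, ← h2, ← h2, hx, map_zero]

lemma splits_of_span {f : V₁ →ₗ[k] V₁} {s : Set V₁} (hs : ∀ x ∈ s, ∃ μ : k, f x = μ • x)
    (h : Submodule.span k s = ⊤) : Splits (LinearMap.id - f) := by
  let b := Module.Basis.ofSpan h.ge
  have hb : ∀ i, ∃ μ : k, f (b i) = μ • b i := fun i =>
    hs _ (Module.Basis.ofSpan_subset h.ge ⟨i, rfl⟩)
  choose μ hμ using hb
  obtain ⟨U, hU⟩ : ∃ U : V₁ →ₗ[k] V₁, ∀ i, U (b i) = (1 - μ i)⁻¹ • b i :=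
    ⟨b.constr k fun i => (1 - μ i)⁻¹ • b i, fun i => b.constr_basis k _ i⟩
  have hS : ∀ i, (LinearMap.id - f : V₁ →ₗ[k] V₁) (b i) = (1 - μ i) • b i := fun i => by
    rw [LinearMap.sub_apply, hμ, sub_smul, one_smul]; rfl
  refine ⟨U, ?_, ?_⟩
  · refine LinearMap.congr_fun (f := (LinearMap.id - f) ∘ₗ (LinearMap.id - f) ∘ₗ U)
      (g := LinearMap.id - f) (b.ext fun i => ?_)
    rw [LinearMap.comp_apply, LinearMap.comp_apply, hU, map_smul, hS, map_smul, map_smul, hS,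
      smul_smul, smul_smul]
    congr 1
    by_cases h1 : 1 - μ i = 0
    · rw [h1]; simp
    · rw [inv_mul_cancel₀ h1, one_mul]
  · refine LinearMap.congr_fun (f := U ∘ₗ (LinearMap.id - f))
      (g := (LinearMap.id - f) ∘ₗ U) (b.ext fun i => ?_)
    rw [LinearMap.comp_apply, LinearMap.comp_apply, hU, map_smul, hS, map_smul, hU, smul_comm]

lemma Splits.exists_fixed {S₁ : V₁ →ₗ[k] V₁} {S₂ : V₂ →ₗ[k] V₂} (h₁ : Splits S₁) (h₂ : Splits S₂)
    {d₀ : V₀ →ₗ[k] V₁} {d : V₁ →ₗ[k] V₂} (hd : ∀ x, d (S₁ x) = S₂ (d x))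
    (hB : ∀ x, d x = 0 → ∃ y, d₀ y = S₁ x) {z : V₁} (hz : d z = 0) :
    ∃ z₁, S₁ z₁ = 0 ∧ d z₁ = 0 ∧ ∃ y, d₀ y = z - z₁ := by
  obtain ⟨U, e1, e2⟩ := id h₁
  have e3 : d (S₁ (U z)) = 0 := by
    rw [hd]
    exact h₂.eq_zero (by rw [← hd, ← hd, e1, hd, hz, map_zero])
  have e4 : d (S₁ (U (U z))) = 0 := by
    rw [hd]
    exact h₂.eq_zero (by rw [← hd, ← hd, e1, e3])
  obtain ⟨y, hy⟩ := hB _ e4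
  exact ⟨z - S₁ (U z), by rw [map_sub, e1, sub_self], by rw [map_sub, hz, e3, sub_zero], y,
    by rw [hy, e1, sub_sub_cancel]⟩

lemma Splits.exists_fixed_boundary {S₀ : V₀ →ₗ[k] V₀} {S₁ : V₁ →ₗ[k] V₁} (h₀ : Splits S₀)
    (h₁ : Splits S₁) {d₀ : V₀ →ₗ[k] V₁} (hd : ∀ x, d₀ (S₀ x) = S₁ (d₀ x)) {z : V₁} (hz : S₁ z = 0)
    {y : V₀} (hy : d₀ y = z) : ∃ y₁, S₀ y₁ = 0 ∧ d₀ y₁ = z := by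
  obtain ⟨U, e1, e2⟩ := h₀
  refine ⟨y - S₀ (U y), by rw [map_sub, e1, sub_self], ?_⟩
  have : S₁ (d₀ (U y)) = 0 := h₁.eq_zero (by rw [← hd, ← hd, e1, hd, hy, hz])
  rw [map_sub, hd, this, hy, sub_zero]

end FixedPart

section EigenWords

variable {k A : Type u} [Field k] [Ring A] [Algebra k A]

lemma span_word_eq_top {s : Set A} (hs : Submodule.span k s = ⊤) (r : ℕ) :
    Submodule.span k {w : T k A r | ∃ a : Fin r → A, (∀ i, a i ∈ s) ∧ w = word a} = ⊤ := by
  induction r with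
  | zero =>
    refine eq_top_iff.2 fun w hw => ?_
    clear hw
    have : (nil : T k A 0) = word (k := k) ![] :=
      emb_injective _ (by
        rw [emb_nil, emb, word, TensorPower.toTensorAlgebra_tprod, TensorAlgebra.tprod_apply]; simp)
    rw [eq_smul_nil w, this]
    exact Submodule.smul_mem _ _ (Submodule.subset_span ⟨_, fun i => i.elim0, rfl⟩)
  | succ r ih =>
    refine eq_top_iff.2 fun w hw => ?_
    clear hw
    have h : 1 + r = r + 1 := by omega
    induction w using cat_induction h with
    | add x y hx hy => exact Submodule.add_mem _ hx hy
    | zero => exact Submodule.zero_mem _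
    | H x y =>
      obtain ⟨a, ha⟩ : ∃ a : A, x = letter (proj k A a) :=
        ⟨sec k A (letter.symm x), by simp [proj_sec]⟩
      subst ha
      have hy : y ∈ Submodule.span k {w : T k A r | ∃ a : Fin r → A, (∀ i, a i ∈ s) ∧ w = word a} := by
        rw [ih]; trivial
      have ha : a ∈ Submodule.span k s := by rw [hs]; trivial
      induction ha using Submodule.span_induction with
      | zero => simp
      | add a b _ _ h1 h2 =>
        simp only [map_add, TensorProduct.add_tmul]; exact Submodule.add_mem _ h1 h2
      | smul c a _ h1 =>
        simp only [map_smul, ← TensorProduct.smul_tmul']; exact Submodule.smul_mem _ c h1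
      | mem a ha =>
        induction hy using Submodule.span_induction with
        | zero => simp
        | add a b _ _ h1 h2 =>
          simp only [map_add, TensorProduct.tmul_add]; exact Submodule.add_mem _ h1 h2
        | smul c a _ h1 =>
          simp only [map_smul, TensorProduct.tmul_smul]; exact Submodule.smul_mem _ c h1
        | mem y hy =>
          obtain ⟨b, hb, rfl⟩ := hy
          refine Submodule.subset_span ⟨Fin.cons a b, fun i => ?_, ?_⟩
          · refine Fin.cases ha (fun i => hb i) i
          · rw [letter_proj a ![a] rfl]
            refine cat_word h _ _ _ (fun j => by fin_cases j; rfl) fun j => ?_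
            have : (⟨1 + j, by omega⟩ : Fin (r + 1)) = j.succ := by ext; simp; omega
            rw [this, Fin.cons_succ]

lemma span_tmul_word_eq_top {s : Set A} (hs : Submodule.span k s = ⊤) (r : ℕ) :
    Submodule.span k {x : X k A r | ∃ (a₀ : A) (a : Fin r → A), a₀ ∈ s ∧ (∀ i, a i ∈ s) ∧
      x = a₀ ⊗ₜ[k] word a} = ⊤ := by
  refine eq_top_iff.2 fun x hx => ?_
  clear hx
  induction x using TensorProduct.induction_on with
  | zero => exact Submodule.zero_mem _
  | add x y hx hy => exact Submodule.add_mem _ hx hy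
  | tmul a w =>
    have ha : a ∈ Submodule.span k s := by rw [hs]; trivial
    have hw : w ∈ Submodule.span k {w : T k A r | ∃ a : Fin r → A, (∀ i, a i ∈ s) ∧ w = word a} := by
      rw [span_word_eq_top hs]; trivial
    induction ha using Submodule.span_induction with
    | zero => simp
    | add a b _ _ h1 h2 => rw [TensorProduct.add_tmul]; exact Submodule.add_mem _ h1 h2
    | smul c a _ h1 => rw [← TensorProduct.smul_tmul']; exact Submodule.smul_mem _ c h1
    | mem a ha =>
      induction hw using Submodule.span_induction with
      | zero => simp
      | add a b _ _ h1 h2 => rw [TensorProduct.tmul_add]; exact Submodule.add_mem _ h1 h2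
      | smul c a _ h1 => rw [TensorProduct.tmul_smul]; exact Submodule.smul_mem _ c h1
      | mem y hy =>
        obtain ⟨b, hb, rfl⟩ := hy
        exact Submodule.subset_span ⟨a, b, ha, hb, rfl⟩

lemma actT_word (σ : A →ₐ[k] A) {r : ℕ} (a : Fin r → A) :
    actT σ (word (k := k) a) = word fun i => σ (a i) := by
  rw [actT, word, PiTensorProduct.map_tprod]
  rfl

lemma word_smul {r : ℕ} (μ : Fin r → k) (a : Fin r → A) :
    word (k := k) (fun i => μ i • a i) = (∏ i, μ i) • word a := by
  simp only [word, map_smul]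
  exact MultilinearMap.map_smul_univ _ _ _

end EigenWords

section Equivariance

variable {k A : Type u} [Field k] [Ring A] [Algebra k A] (σ : A →ₐ[k] A) {N r s : ℕ}

lemma iota_actX (z : X k A N) : iota (actX σ z) = mapB σ (iota z) := by
  induction z using TensorProduct.induction_on with
  | zero => simp only [TensorProduct.tmul_zero, TensorProduct.zero_tmul, map_zero, LinearMap.zero_apply, smul_zero]
  | add x y hx hy => simp only [map_add, hx, hy]
  | tmul a w => simp

lemma tauS_mapB (x : Bar k A N) : tauS σ (mapB σ x) = actX σ (tauS σ x) := by
  induction x using bar_induction with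
  | add x y hx hy => simp only [map_add, hx, hy]
  | zero => simp only [TensorProduct.tmul_zero, TensorProduct.zero_tmul, map_zero, LinearMap.zero_apply, smul_zero]
  | H => simp

lemma bdry_actX (h : r + 1 = s) (z : X k A s) :
    bdry σ h (actX σ z) = actX σ (bdry σ h z) := by
  rw [bdry_apply, iota_actX, ← mapB_dB, tauS_mapB, bdry_apply]

end Equivariance

namespace FrobeniusForm

variable {k A : Type u} [Field k] [Ring A] [Algebra k A] (F : FrobeniusForm k A)
  [FiniteDimensional k A] {N p r s : ℕ}

/-- The eigenvectors of `ν`. -/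
def eigen : Set A := {a | ∃ μ : k, a ∈ Module.End.eigenspace F.nakayama μ}

lemma span_eigen (hdiag : ⨆ μ : k, Module.End.eigenspace F.nakayama μ = ⊤) :
    Submodule.span k F.eigen = ⊤ :=
  eq_top_iff.2 (hdiag ▸ iSup_le fun μ _ ha => Submodule.subset_span ⟨μ, ha⟩)

lemma nu_eigen {μ : k} {a : A} (ha : a ∈ Module.End.eigenspace F.nakayama μ) : F.nu a = μ • a :=
  Module.End.mem_eigenspace_iff.1 ha

lemma nuInv_eigen {μ : k} {a : A} (ha : a ∈ Module.End.eigenspace F.nakayama μ) :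
    F.nuInv a = μ⁻¹ • a := by
  have h : μ • F.nuInv a = a := by
    rw [← map_smul, ← F.nu_eigen ha]; exact F.nakayamaInv_nakayama a
  by_cases hμ : μ = 0
  · rw [← h, hμ]; simp
  · conv_rhs => rw [← h, smul_smul, inv_mul_cancel₀ hμ, one_smul]

lemma form_nu (a b : A) : F.form (F.nakayama a) (F.nakayama b) = F.form a b := by
  rw [← nakayama_spec, ← nakayama_spec]

lemma actX_nuInv_word {μ₀ : k} {μ : Fin r → k} {a₀ : A} {a : Fin r → A}
    (h₀ : a₀ ∈ Module.End.eigenspace F.nakayama μ₀)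
    (h : ∀ i, a i ∈ Module.End.eigenspace F.nakayama (μ i)) :
    actX F.nuInv (a₀ ⊗ₜ[k] word a) = (μ₀ * ∏ i, μ i)⁻¹ • (a₀ ⊗ₜ[k] word a) := by
  rw [actX_tmul, actT_word, F.nuInv_eigen h₀]
  simp_rw [fun i => F.nuInv_eigen (h i)]
  rw [word_smul, TensorProduct.tmul_smul, ← TensorProduct.smul_tmul', smul_smul, mul_inv,
    Finset.prod_inv_distrib, mul_comm]

lemma actT_nu_word {μ : Fin r → k} {a : Fin r → A}
    (h : ∀ i, a i ∈ Module.End.eigenspace F.nakayama (μ i)) :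
    actT F.nu (word (k := k) a) = (∏ i, μ i) • word a := by
  rw [actT_word]
  simp_rw [fun i => F.nu_eigen (h i)]
  rw [word_smul]

variable {F} in
lemma span_eigen_tmul (hdiag : ⨆ μ : k, Module.End.eigenspace F.nakayama μ = ⊤) {p : X k A r → Prop}
    (x : X k A r) (add : ∀ x y, p x → p y → p (x + y)) (smul : ∀ (c : k) x, p x → p (c • x))
    (H : ∀ (μ₀ : k) (μ : Fin r → k) (a₀ : A) (a : Fin r → A),
      a₀ ∈ Module.End.eigenspace F.nakayama μ₀ →
        (∀ i, a i ∈ Module.End.eigenspace F.nakayama (μ i)) → p (a₀ ⊗ₜ[k] word a)) : p x := by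
  have hx : x ∈ Submodule.span k {x : X k A r | ∃ (a₀ : A) (a : Fin r → A), a₀ ∈ F.eigen ∧
      (∀ i, a i ∈ F.eigen) ∧ x = a₀ ⊗ₜ[k] word a} := by
    rw [span_tmul_word_eq_top (F.span_eigen hdiag)]; trivial
  induction hx using Submodule.span_induction with
  | zero =>
    have h0 := H 0 (fun _ => 0) 0 (fun _ => 0) (Submodule.zero_mem _) fun _ => Submodule.zero_mem _
    rwa [TensorProduct.zero_tmul] at h0
  | add x y _ _ hx hy => exact add _ _ hx hy
  | smul c x _ hx => exact smul c x hx
  | mem x hx =>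
    obtain ⟨a₀, a, ⟨μ₀, h₀⟩, h, rfl⟩ := hx
    choose μ hμ using h
    exact H μ₀ μ a₀ a h₀ hμ

lemma splits_actX_nuInv (hdiag : ⨆ μ : k, Module.End.eigenspace F.nakayama μ = ⊤) (r : ℕ) :
    Splits (LinearMap.id - actX F.nuInv : X k A r →ₗ[k] X k A r) := by
  refine splits_of_span ?_ (span_tmul_word_eq_top (F.span_eigen hdiag) r)
  rintro x ⟨a₀, a, ⟨μ₀, h₀⟩, h, rfl⟩
  choose μ hμ using h
  exact ⟨_, F.actX_nuInv_word h₀ hμ⟩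

lemma splits_actX_nu (hdiag : ⨆ μ : k, Module.End.eigenspace F.nakayama μ = ⊤) (r : ℕ) :
    Splits (LinearMap.id - actX F.nu : X k A r →ₗ[k] X k A r) := by
  refine splits_of_span ?_ (span_tmul_word_eq_top (F.span_eigen hdiag) r)
  rintro x ⟨a₀, a, ⟨μ₀, h₀⟩, h, rfl⟩
  choose μ hμ using h
  refine ⟨μ₀ * ∏ i, μ i, ?_⟩
  rw [actX_tmul, F.actT_nu_word hμ, F.nu_eigen h₀, TensorProduct.tmul_smul,
    ← TensorProduct.smul_tmul', smul_smul, mul_comm]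

lemma mem_D1_negSucc (hdiag : ⨆ μ : k, Module.End.eigenspace F.nakayama μ = ⊤)
    (x : D k A (Int.negSucc r)) :
    x ∈ F.D1 (Int.negSucc r) ↔ (LinearMap.id - actX F.nuInv : X k A r →ₗ[k] X k A r) x = 0 := by
  let W : Submodule k (X k A r) := Submodule.span k
    {x : X k A r | ∃ (μ₀ : k) (μ : Fin r → k) (a₀ : A) (a : Fin r → A),
      μ₀ * ∏ i, μ i = 1 ∧ a₀ ∈ Module.End.eigenspace F.nakayama μ₀ ∧
      (∀ i, a i ∈ Module.End.eigenspace F.nakayama (μ i)) ∧ x = a₀ ⊗ₜ[k] word a}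
  let S : X k A r →ₗ[k] X k A r := LinearMap.id - actX F.nuInv
  let y : X k A r := x
  change y ∈ W ↔ S y = 0
  have hW : ∀ y ∈ W, S y = 0 := by
    intro y hy
    induction hy using Submodule.span_induction with
    | zero => exact map_zero _
    | add x y _ _ hx hy => rw [map_add, hx, hy, add_zero]
    | smul c x _ hx => rw [LinearMap.map_smul, hx, smul_zero]
    | mem y hy =>
      obtain ⟨μ₀, μ, a₀, a, h1, h₀, h, rfl⟩ := hy
      change a₀ ⊗ₜ[k] word a - actX F.nuInv (a₀ ⊗ₜ[k] word a) = 0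
      rw [F.actX_nuInv_word h₀ h, h1, inv_one, one_smul, sub_self]
  refine ⟨hW y, fun hy => ?_⟩
  obtain ⟨w, hw, v, hv⟩ : ∃ w ∈ W, ∃ v, y = w + S v := by
    refine span_eigen_tmul (p := fun y => ∃ w ∈ W, ∃ v, y = w + S v) hdiag y ?_ ?_ ?_
    · rintro _ _ ⟨w, hw, v, rfl⟩ ⟨w', hw', v', rfl⟩
      exact ⟨w + w', W.add_mem hw hw', v + v', by rw [map_add]; abel⟩
    · rintro c _ ⟨w, hw, v, rfl⟩
      exact ⟨c • w, W.smul_mem c hw, c • v, by rw [LinearMap.map_smul, smul_add]⟩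
    · intro μ₀ μ a₀ a h₀ h
      by_cases h1 : μ₀ * ∏ i, μ i = 1
      · exact ⟨_, Submodule.subset_span ⟨μ₀, μ, a₀, a, h1, h₀, h, rfl⟩, 0, by
          rw [map_zero, add_zero]⟩
      · have h2 : 1 - (μ₀ * ∏ i, μ i)⁻¹ ≠ 0 := fun h => h1 (inv_eq_one.1 (sub_eq_zero.1 h).symm)
        refine ⟨0, W.zero_mem, (1 - (μ₀ * ∏ i, μ i)⁻¹)⁻¹ • (a₀ ⊗ₜ[k] word a), ?_⟩
        have : S (a₀ ⊗ₜ[k] word a) = (1 - (μ₀ * ∏ i, μ i)⁻¹) • (a₀ ⊗ₜ[k] word a) := by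
          rw [sub_smul, one_smul, ← F.actX_nuInv_word h₀ h]; rfl
        rw [LinearMap.map_smul, this, smul_smul, inv_mul_cancel₀ h2, one_smul, zero_add]
  have : S v = 0 := (F.splits_actX_nuInv hdiag r).eq_zero (by
    change S (S v) = 0
    rw [hv, map_add, hW w hw, zero_add] at hy
    exact hy)
  rw [hv, this, add_zero]
  exact hw

lemma mem_D1_ofNat (hdiag : ⨆ μ : k, Module.End.eigenspace F.nakayama μ = ⊤) (f : T k A r →ₗ[k] A) :
    (show D k A (Int.ofNat r) from f) ∈ F.D1 (Int.ofNat r) ↔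
      ∀ w, F.nakayama (f w) = f (actT F.nu w) := by
  constructor
  · intro hf w
    have hw : w ∈ Submodule.span k {w : T k A r | ∃ a : Fin r → A, (∀ i, a i ∈ F.eigen) ∧
        w = word a} := by
      rw [span_word_eq_top (F.span_eigen hdiag)]; trivial
    induction hw using Submodule.span_induction with
    | zero => simp only [TensorProduct.tmul_zero, TensorProduct.zero_tmul, map_zero, LinearMap.zero_apply, smul_zero]
    | add x y _ _ hx hy => simp only [map_add, hx, hy]
    | smul c x _ hx => simp only [map_smul, hx]
    | mem x hx =>
      obtain ⟨a, ha, rfl⟩ := hx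
      choose μ hμ using ha
      rw [F.actT_nu_word hμ, map_smul]
      exact F.nu_eigen (hf μ a hμ)
  · intro hf μ a ha
    exact Module.End.mem_eigenspace_iff.2 (by rw [hf, F.actT_nu_word ha, map_smul])

/-- The pairing `(f, a ⊗ w) ↦ ⟨f(w), a⟩`. -/
def pair : (T k A r →ₗ[k] A) →ₗ[k] X k A r →ₗ[k] k where
  toFun f := TensorProduct.lift (F.form.flip.compl₂ f)
  map_add' f g := TensorProduct.ext' fun a w => by simp
  map_smul' c f := TensorProduct.ext' fun a w => by simp

@[simp] lemma pair_tmul (f : T k A r →ₗ[k] A) (a : A) (w : T k A r) :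
    F.pair f (a ⊗ₜ[k] w) = F.form (f w) a := rfl

/-- The duality between cochains and chains. -/
def pairEquiv (r : ℕ) : (T k A r →ₗ[k] A) ≃ₗ[k] (X k A r →ₗ[k] k) :=
  LinearEquiv.ofBijective F.pair ⟨fun f g h => LinearMap.ext fun w =>
      F.eq_of_form_left fun a => LinearMap.congr_fun h (a ⊗ₜ[k] w),
    fun φ => ⟨∑ j, (φ ∘ₗ TensorProduct.mk k A _ (F.u j)).smulRight (F.v j),
      TensorProduct.ext' fun a w => by
        rw [pair_tmul]
        conv_rhs => rw [← F.sum_form_v a]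
        simp [TensorProduct.sum_tmul, ← TensorProduct.smul_tmul', mul_comm]⟩⟩

lemma pair_delta (h : r + 1 = s) (f : T k A r →ₗ[k] A) (x : X k A s) :
    F.pair (delta (actA k A) h f) x = F.pair f (bdry F.nu h x) := by
  induction x using TensorProduct.induction_on with
  | zero => simp only [TensorProduct.tmul_zero, TensorProduct.zero_tmul, map_zero, LinearMap.zero_apply, smul_zero]
  | add x y hx hy => simp only [map_add, hx, hy]
  | tmul a w =>
    rw [bdry_apply, iota_tmul, dB_tmul, one_smul, pair_tmul]
    change F.form (bimoduleExt (actA k A) f (dbar h w)) a = _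
    induction dbar h w using bar_induction with
    | add x y hx hy => simp only [map_add, LinearMap.add_apply, hx, hy]
    | zero => simp only [TensorProduct.tmul_zero, TensorProduct.zero_tmul, map_zero, LinearMap.zero_apply, smul_zero]
    | H x w y =>
      simp only [bimoduleExt, TensorProduct.lift.tmul, LinearMap.compl₂_apply, actA, rm_tmul,
        tauS_tmul, pair_tmul, LinearMap.compr₂_apply, LinearMap.mul_apply']
      rw [F.assoc, F.assoc, F.nakayama_spec, F.assoc, nu_apply]

/-- The operator `f ↦ f - ν⁻¹ f ν`. -/
def shiftC (r : ℕ) : (T k A r →ₗ[k] A) →ₗ[k] (T k A r →ₗ[k] A) :=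
  (F.pairEquiv r).symm.toLinearMap ∘ₗ
    LinearMap.lcomp k k (LinearMap.id - actX F.nu) ∘ₗ (F.pairEquiv r).toLinearMap

lemma pair_shiftC (f : T k A r →ₗ[k] A) (x : X k A r) :
    F.pair (F.shiftC r f) x = F.pair f (x - actX F.nu x) := by
  have : F.pairEquiv r (F.shiftC r f) = F.pair f ∘ₗ (LinearMap.id - actX F.nu) := by
    simp [shiftC]; rfl
  exact LinearMap.congr_fun this x

lemma pair_ext {f g : T k A r →ₗ[k] A} (h : ∀ x, F.pair f x = F.pair g x) : f = g :=
  (F.pairEquiv r).injective (LinearMap.ext h)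

lemma exists_pair (φ : X k A r →ₗ[k] k) : ∃ f, ∀ x, F.pair f x = φ x :=
  ⟨(F.pairEquiv r).symm φ, fun x => LinearMap.congr_fun ((F.pairEquiv r).apply_symm_apply φ) x⟩

lemma splits_shiftC (hdiag : ⨆ μ : k, Module.End.eigenspace F.nakayama μ = ⊤) (r : ℕ) :
    Splits (F.shiftC r) := by
  obtain ⟨U, h1, h2⟩ := F.splits_actX_nu hdiag r
  obtain ⟨V, hU⟩ : ∃ V : (T k A r →ₗ[k] A) →ₗ[k] (T k A r →ₗ[k] A),
      ∀ f x, F.pair (V f) x = F.pair f (U x) :=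
    ⟨(F.pairEquiv r).symm.toLinearMap ∘ₗ LinearMap.lcomp k k U ∘ₗ (F.pairEquiv r).toLinearMap,
      fun f x => LinearMap.congr_fun ((F.pairEquiv r).apply_symm_apply (F.pair f ∘ₗ U)) x⟩
  refine ⟨V, fun f => F.pair_ext fun x => ?_, fun f => F.pair_ext fun x => ?_⟩
  · rw [pair_shiftC, pair_shiftC, hU, pair_shiftC]
    have := h1 x
    have h3 := h2 x
    have h4 := h2 (x - actX F.nu x)
    simp only [LinearMap.sub_apply, LinearMap.id_apply] at this h3 h4
    rw [h4, h3, this]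
  · rw [pair_shiftC, hU, hU, pair_shiftC]
    have h3 := h2 x
    simp only [LinearMap.sub_apply, LinearMap.id_apply] at h3
    rw [h3]

lemma shiftC_eq_zero_iff (f : T k A r →ₗ[k] A) :
    F.shiftC r f = 0 ↔ ∀ w, F.nakayama (f w) = f (actT F.nu w) := by
  constructor
  · intro h w
    refine F.eq_of_form_left fun a => ?_
    have := F.pair_shiftC f (F.nakayamaInv a ⊗ₜ[k] w)
    rw [h, map_zero, LinearMap.zero_apply, map_sub, actX_tmul, pair_tmul, pair_tmul, nu_apply, nakayama_nakayamaInv] at this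
    rw [← sub_eq_zero.1 this.symm]
    conv_lhs => rw [← F.nakayama_nakayamaInv a, form_nu]
  · intro h
    refine F.pair_ext fun x => ?_
    rw [pair_shiftC, map_zero, LinearMap.zero_apply, map_sub, sub_eq_zero]
    induction x using TensorProduct.induction_on with
    | zero => simp only [TensorProduct.tmul_zero, TensorProduct.zero_tmul, map_zero, LinearMap.zero_apply, smul_zero]
    | add x y hx hy => simp only [map_add, hx, hy]
    | tmul a w => rw [actX_tmul, pair_tmul, pair_tmul, ← h, nu_apply, form_nu]

end FrobeniusForm

namespace FrobeniusForm

variable {k A : Type u} [Field k] [Ring A] [Algebra k A] (F : FrobeniusForm k A)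
  [FiniteDimensional k A] {N M : ℕ}

lemma mem_Bd1_iff {r s : ℤ} (h : r + 1 = s) (z : D k A s) :
    z ∈ F.Bd1 s ↔ ∃ y ∈ F.D1 r, F.dhat r s h y = z := by
  obtain rfl : r = s - 1 := by omega
  exact Iff.rfl

lemma mem_Bd1_negSucc (hdiag : ⨆ μ : k, Module.End.eigenspace F.nakayama μ = ⊤)
    (z : D k A (Int.negSucc N)) : z ∈ F.Bd1 (Int.negSucc N) ↔
      ∃ y, (LinearMap.id - actX F.nuInv : X k A (N + 1) →ₗ[k] X k A (N + 1)) y = 0 ∧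
        bdry F.nuInv (rfl : N + 1 = N + 1) y = z := by
  refine (F.mem_Bd1_iff (r := Int.negSucc (N + 1)) (by omega) z).trans (exists_congr fun y => ?_)
  refine and_congr (F.mem_D1_negSucc hdiag y) ?_
  rw [← partialD_eq]
  exact Iff.rfl

lemma Bd1_le_Bd (r : ℤ) : F.Bd1 r ≤ F.Bd r := by
  rintro z ⟨y, -, rfl⟩
  exact ⟨y, rfl⟩

lemma exists_sub_mem_Bd (hdiag : ⨆ μ : k, Module.End.eigenspace F.nakayama μ = ⊤)
    {z : X k A N} (hz : F.IsCycle z) :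
    ∃ x : X k A N, (LinearMap.id - actX F.nuInv : X k A N →ₗ[k] X k A N) x = 0 ∧ F.IsCycle x ∧
      ∃ y, F.partialD (rfl : N + 1 = N + 1) y = z - x := by
  simp_rw [partialD_eq]
  cases N with
  | zero =>
    obtain ⟨U, h1, -⟩ := F.splits_actX_nuInv hdiag 0
    have h : bdry F.nuInv (rfl : 0 + 1 = 0 + 1) (-conX F.nuInv (U z)) =
        (LinearMap.id - actX F.nuInv : X k A 0 →ₗ[k] X k A 0) (U z) := by
      rw [map_neg, bdry_conX_zero]; simp
    refine ⟨z - bdry F.nuInv rfl (-conX F.nuInv (U z)), ?_, ?_, _, (sub_sub_cancel _ _).symm⟩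
    · rw [h, map_sub, h1, sub_self]
    · have h2 := F.isCycle_partialD (-conX F.nuInv (U z))
      rw [partialD_eq] at h2
      rw [IsCycle, map_sub, map_sub, hz, h2, sub_self]
  | succ N =>
    have hz' := (F.isCycle_succ_iff z).1 hz
    rw [partialD_eq] at hz'
    obtain ⟨x, h1, h2, h3⟩ := (F.splits_actX_nuInv hdiag (N + 1)).exists_fixed
      (F.splits_actX_nuInv hdiag N) (d₀ := bdry F.nuInv (rfl : N + 1 + 1 = N + 1 + 1))
      (d := bdry F.nuInv (rfl : N + 1 = N + 1))
      (fun x => by simp [bdry_actX])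
      (fun x hx => ⟨-conX F.nuInv x, by
        have := bdry_conX F.nuInv x
        rw [hx, map_zero, add_zero] at this
        rw [map_neg, this]; simp⟩) hz'
    exact ⟨x, h1, (F.isCycle_succ_iff x).2 (by rw [partialD_eq]; exact h2), h3⟩

/-- In negative degrees the inclusion of `𝒟_(1)` in `𝒟` is a quasi-isomorphism. -/
lemma exists_inclusionEquiv (hdiag : ⨆ μ : k, Module.End.eigenspace F.nakayama μ = ⊤) {r : ℤ}
    (hr : r < 0) : ∃ j : F.HH1 r ≃ₗ[k] F.HH r, Induces (F.clsHH1 r) (F.clsHH r) id j := by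
  obtain ⟨N, rfl⟩ := Int.eq_negSucc_of_lt_zero hr
  obtain ⟨φ, hφ⟩ := (F.isCls_clsHH1 (Int.negSucc N)).exists_map (F.isCls_clsHH (Int.negSucc N))
    LinearMap.id (fun z hz => hz.2) (fun z _ hz => F.Bd1_le_Bd _ hz)
  refine hφ.exists_equiv (F.isCls_clsHH1 _) (F.isCls_clsHH _) (fun z hz hB => ?_) fun z hz => ?_
  · obtain ⟨y, hy⟩ := (F.mem_Bd_negSucc z).1 hB
    rw [partialD_eq] at hy
    exact (F.mem_Bd1_negSucc hdiag z).2 ((F.splits_actX_nuInv hdiag (N + 1)).exists_fixed_boundary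
      (F.splits_actX_nuInv hdiag N) (d₀ := bdry F.nuInv (rfl : N + 1 = N + 1))
      (fun x => by simp [bdry_actX]) ((F.mem_D1_negSucc hdiag z).1 hz.1) hy)
  · obtain ⟨x, h1, h2, h3⟩ := F.exists_sub_mem_Bd hdiag ((F.mem_Z_negSucc z).1 hz)
    exact ⟨x, ⟨(F.mem_D1_negSucc hdiag x).2 h1, (F.mem_Z_negSucc x).2 h2⟩,
      (F.mem_Bd_negSucc _).2 h3⟩

lemma delta_shiftC {r s : ℕ} (h : r + 1 = s) (f : T k A r →ₗ[k] A) :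
    delta (actA k A) h (F.shiftC r f) = F.shiftC s (delta (actA k A) h f) :=
  F.pair_ext fun x => by
    rw [pair_delta, pair_shiftC, pair_shiftC, pair_delta, map_sub (bdry F.nu h), bdry_actX]

lemma exists_delta_eq_shiftC {f : T k A (M + 1) →ₗ[k] A}
    (hf : delta (actA k A) (rfl : M + 1 + 1 = M + 1 + 1) f = 0) :
    ∃ g : T k A M →ₗ[k] A, delta (actA k A) (rfl : M + 1 = M + 1) g = F.shiftC (M + 1) f := by
  obtain ⟨g, hg⟩ := F.exists_pair (-(F.pair f ∘ₗ conX F.nu))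
  refine ⟨g, F.pair_ext fun x => ?_⟩
  have h1 := congrArg (F.pair f) (bdry_conX F.nu x)
  rw [map_add, ← pair_delta, hf, map_zero, LinearMap.zero_apply, zero_add] at h1
  rw [pair_delta, hg, pair_shiftC, ← neg_sub, map_neg, ← h1]
  rfl

lemma mem_Omega_zero (a : A) : (show B k A 0 from a) ∈ Omega k A 0 :=
  ⟨(a ⊗ₜ[k] nil) ⊗ₜ[k] (1 : A), (aug_tmul a 1 nil).trans (by simp)⟩

lemma mem_Z_natCast (f : D k A (M : ℤ)) :
    f ∈ F.Z (M : ℤ) ↔ delta (actA k A) (rfl : M + 1 = M + 1) f = 0 :=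
  F.mem_Z_iff (s := Int.ofNat (M + 1)) (by simp) f

lemma mem_ZExt_toCoch (f : D k A (M : ℤ)) : toCoch M f ∈ ZExt k A M 0 ↔ f ∈ F.Z (M : ℤ) :=
  mem_ZExt.trans (Iff.trans (and_iff_right fun _ => mem_Omega_zero _) (F.mem_Z_natCast f).symm)

lemma mem_Bd1_natCast (hdiag : ⨆ μ : k, Module.End.eigenspace F.nakayama μ = ⊤)
    (f : D k A ((M + 1 : ℕ) : ℤ)) : f ∈ F.Bd1 ((M + 1 : ℕ) : ℤ) ↔
      ∃ g, F.shiftC M g = 0 ∧ delta (actA k A) (rfl : M + 1 = M + 1) g = f := by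
  refine (F.mem_Bd1_iff (r := Int.ofNat M) (by simp) f).trans (exists_congr fun g => ?_)
  refine and_congr ((F.mem_D1_ofNat hdiag g).trans (F.shiftC_eq_zero_iff g).symm) ?_
  exact Iff.rfl

/-- In positive degrees the inclusion of `𝒟_(1)` in `𝒟` is a quasi-isomorphism. -/
lemma exists_toCochEquiv (hdiag : ⨆ μ : k, Module.End.eigenspace F.nakayama μ = ⊤) {m : ℕ}
    (hm : 1 ≤ m) : ∃ j : F.HH1 m ≃ₗ[k] Ext k A m 0,
      Induces (F.clsHH1 m) (extClass k A m 0) (FrobeniusForm.toCoch m) j := by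
  obtain ⟨M, rfl⟩ : ∃ l, m = l + 1 := ⟨m - 1, by omega⟩
  obtain ⟨φ, hφ⟩ := (F.isCls_clsHH1 ((M + 1 : ℕ) : ℤ)).exists_map (isCls_extClass (M + 1) 0)
    (toCoch (M + 1)) (fun z hz => (F.mem_ZExt_toCoch z).2 hz.2) (fun z _ hz => by
      obtain ⟨g, -, h⟩ := (F.mem_Bd1_natCast hdiag z).1 hz
      exact ⟨g, fun _ => mem_Omega_zero _, h⟩)
  refine hφ.exists_equiv (F.isCls_clsHH1 _) (isCls_extClass _ _) (fun z hz hB => ?_) fun f hf => ?_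
  · obtain ⟨g, -, hg⟩ := hB
    exact (F.mem_Bd1_natCast hdiag z).2 ((F.splits_shiftC hdiag M).exists_fixed_boundary
      (F.splits_shiftC hdiag (M + 1)) (d₀ := delta (actA k A) (rfl : M + 1 = M + 1))
      (fun x => F.delta_shiftC rfl x)
      ((F.shiftC_eq_zero_iff z).2 ((F.mem_D1_ofNat hdiag z).1 hz.1)) hg)
  · have hf' : delta (actA k A) (rfl : M + 1 + 1 = M + 1 + 1) f = 0 := (mem_ZExt.1 hf).2
    obtain ⟨x, h1, h2, g, hg⟩ := (F.splits_shiftC hdiag (M + 1)).exists_fixed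
      (F.splits_shiftC hdiag (M + 1 + 1)) (d₀ := delta (actA k A) (rfl : M + 1 = M + 1))
      (d := delta (actA k A) (rfl : M + 1 + 1 = M + 1 + 1)) (fun x => F.delta_shiftC rfl x)
      (fun x hx => F.exists_delta_eq_shiftC hx) hf'
    exact ⟨x, ⟨(F.mem_D1_ofNat hdiag x).2 ((F.shiftC_eq_zero_iff x).1 h1),
      (F.mem_Z_natCast x).2 h2⟩, g, fun _ => mem_Omega_zero _, hg⟩

end FrobeniusForm

namespace FrobeniusForm

variable {k A : Type u} [Field k] [Ring A] [Algebra k A] (F : FrobeniusForm k A)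
  [FiniteDimensional k A] {i p N : ℕ}

/-- A bimodule map on words, contracted on the right with the form. -/
def hat (G : Bar k A i →ₗ[k] Bar k A p) : T k A i →ₗ[k] X k A p := F.formR p ∘ₗ onWords G

lemma hat_apply (G : Bar k A i →ₗ[k] Bar k A p) (w : T k A i) :
    F.hat G w = F.formR p (G (cap ((1 : A) ⊗ₜ[k] w))) := rfl

lemma hat_add (G H : Bar k A i →ₗ[k] Bar k A p) : F.hat (G + H) = F.hat G + F.hat H :=
  LinearMap.ext fun w => by simp [hat_apply]

lemma hat_smul (c : k) (G : Bar k A i →ₗ[k] Bar k A p) : F.hat (c • G) = c • F.hat G :=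
  LinearMap.ext fun w => by simp [hat_apply]

/-- The twisted partial trace over the last letter. -/
def ptr (i p : ℕ) : (T k A (i + 1) →ₗ[k] X k A (p + 1)) →ₗ[k] (T k A i →ₗ[k] X k A p) where
  toFun φ := ∑ j, F.formR p ∘ₗ dB rfl ∘ₗ (TensorProduct.mk k (X k A (p + 1)) A).flip (F.v j) ∘ₗ φ ∘ₗ
    (cat (rfl : i + 1 = i + 1)).toLinearMap ∘ₗ
    (TensorProduct.mk k (T k A i) (T k A 1)).flip (letter (proj k A (F.u j)))
  map_add' φ ψ := LinearMap.ext fun w => by simp [Finset.sum_add_distrib]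
  map_smul' c φ := LinearMap.ext fun w => by simp [Finset.smul_sum]

lemma ptr_apply (φ : T k A (i + 1) →ₗ[k] X k A (p + 1)) (w : T k A i) :
    F.ptr i p φ w = ∑ j, F.formR p (dB rfl
      (φ (cat (rfl : i + 1 = i + 1) (w ⊗ₜ[k] letter (proj k A (F.u j)))) ⊗ₜ[k] F.v j)) := by
  simp [ptr]

lemma hat_dB_hop (G : Bar k A (i + 1) →ₗ[k] Bar k A (p + 1)) :
    F.hat (dB rfl ∘ₗ F.hop rfl G) = (-1 : k) ^ (i + 1) • F.ptr i p (F.hat G) := by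
  refine LinearMap.ext fun w => ?_
  rw [hat_apply, LinearMap.comp_apply, hop_apply, LinearMap.smul_apply, ptr_apply,
    LinearMap.map_smul, LinearMap.map_smul, map_sum, map_sum]
  congr 1
  refine Finset.sum_congr rfl fun j _ => ?_
  rw [rm_cap, hR_tmul, appendX_tmul]
  rfl

lemma formR_rm_cap (b : A) (x : X k A p) : F.formR p (rm b (cap x)) = F.form b 1 • x := by
  rw [rm_cap, formR_tmul]

lemma sum_form_one : ∑ j, F.form (F.v j) 1 • F.u j = 1 := F.sum_form_v 1

lemma ptr_appendX (ψ : T k A (i + 1) →ₗ[k] X k A p) (c : A) (w : T k A i) :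
    F.ptr i p ((appendX (rfl : p + 1 = p + 1) ∘ₗ
        (TensorProduct.mk k _ _).flip (letter (proj k A c))) ∘ₗ ψ) w =
      (-1 : k) ^ (p + 1) • ψ (cat (rfl : i + 1 = i + 1) (w ⊗ₜ[k] letter (proj k A (F.nu c)))) := by
  let L : A →ₗ[k] T k A (i + 1) := (cat (rfl : i + 1 = i + 1)).toLinearMap ∘ₗ
    TensorProduct.mk k (T k A i) (T k A 1) w ∘ₗ letter.toLinearMap ∘ₗ proj k A
  have hL : L 1 = 0 := by simp [L, proj_one]
  have e : ∀ j, F.formR p (dB rfl (appendX (rfl : p + 1 = p + 1)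
      (ψ (L (F.u j)) ⊗ₜ[k] letter (proj k A c)) ⊗ₜ[k] F.v j)) =
      piR k A p (d k A p (ψ (L (F.form (F.v j) 1 • F.u j)) ⊗ₜ[k] c)) -
        (-1 : k) ^ p • ψ (L (F.form c (F.v j) • F.u j)) := by
    intro j
    have e1 : appendX (rfl : p + 1 = p + 1) (ψ (L (F.u j)) ⊗ₜ[k] letter (proj k A c)) ⊗ₜ[k] F.v j =
        rm (F.v j) (hR (rfl : p + 1 = p + 1) (ψ (L (F.u j)) ⊗ₜ[k] c)) := by
      rw [hR_tmul, ← cap_apply, rm_cap]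
    rw [e1, isR_dB, dB_hR_eq, map_sub, map_sub, formR_rm_cap, LinearMap.map_smul,
      LinearMap.map_smul, rm_tmul, formR_tmul, F.assoc, mul_one]
    simp only [map_smul, ← TensorProduct.smul_tmul']
  rw [ptr_apply]
  refine (Finset.sum_congr rfl fun j _ => e j).trans ?_
  rw [Finset.sum_sub_distrib, ← Finset.smul_sum]
  simp only [← map_sum, ← TensorProduct.sum_tmul]
  have e2 : ∑ j, F.form c (F.v j) • F.u j = F.nu c := by simp [nakayama, nu_apply]
  rw [sum_form_one, hL, e2, map_zero, TensorProduct.zero_tmul, map_zero, map_zero, zero_sub, pow_succ,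
    mul_neg_one, neg_smul]
  rfl

/-- The iterated twisted partial trace of a map `Ā^{⊗i} → A ⊗ Ā^{⊗(N+i)}`. -/
def descent (N : ℕ) : ∀ i, (T k A i →ₗ[k] X k A (N + i)) →ₗ[k] X k A N
  | 0 => (tauS F.nuInv ∘ₗ cap) ∘ₗ LinearMap.applyₗ nil
  | i + 1 => descent N i ∘ₗ ((-1 : k) ^ (i + 1) • F.ptr i (N + i))

lemma descent_zero (φ : T k A 0 →ₗ[k] X k A N) :
    F.descent N 0 φ = tauS F.nuInv (cap (φ nil)) := rfl

lemma descent_succ (φ : T k A (i + 1) →ₗ[k] X k A (N + i + 1)) :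
    F.descent N (i + 1) φ = (-1 : k) ^ (i + 1) • F.descent N i (F.ptr i (N + i) φ) := by
  rw [← LinearMap.map_smul]; rfl

lemma descent_hat_zero (G : Bar k A 0 →ₗ[k] Bar k A N) :
    F.descent N 0 (F.hat G) = F.casInv N (G (cap ((1 : A) ⊗ₜ[k] nil))) := rfl

lemma descent_hat_succ (G : Bar k A (i + 1) →ₗ[k] Bar k A (N + i + 1)) :
    F.descent N (i + 1) (F.hat G) = F.descent N i (F.hat (dB rfl ∘ₗ F.hop rfl G)) := by
  rw [hat_dB_hop, descent_succ, LinearMap.map_smul]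

lemma descent_appendX (ψ : T k A i →ₗ[k] X k A N) (c : T k A i) :
    F.descent N i ((appendX (rfl : N + i = N + i) ∘ₗ (TensorProduct.mk k _ _).flip c) ∘ₗ ψ) =
      (-1 : k) ^ (N * i) • tauS F.nuInv (cap (ψ (actT F.nu c))) := by
  induction i with
  | zero =>
    rw [descent_zero]
    obtain ⟨e, rfl⟩ : ∃ e : k, c = e • nil := ⟨_, eq_smul_nil c⟩
    simp [appendX_nil]
  | succ i ih =>
    induction c using cat_induction (rfl : i + 1 = i + 1) with
    | add x y hx hy =>
      rw [map_add, LinearMap.comp_add, LinearMap.add_comp, map_add, hx, hy]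
      simp only [map_add, smul_add]
    | zero => simp
    | H c x =>
      obtain ⟨a, rfl⟩ : ∃ a, x = letter (proj k A a) := by
        obtain ⟨y, rfl⟩ := letter.surjective x
        obtain ⟨a, rfl⟩ := Submodule.mkQ_surjective _ y
        exact ⟨a, rfl⟩
      have e1 : (appendX (rfl : N + (i + 1) = N + (i + 1)) ∘ₗ (TensorProduct.mk k _ _).flip
          (cat (rfl : i + 1 = i + 1) (c ⊗ₜ[k] letter (proj k A a)))) ∘ₗ ψ =
          (appendX (rfl : N + i + 1 = N + i + 1) ∘ₗ
            (TensorProduct.mk k _ _).flip (letter (proj k A a))) ∘ₗ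
          ((appendX (rfl : N + i = N + i) ∘ₗ (TensorProduct.mk k _ _).flip c) ∘ₗ ψ) :=
        LinearMap.ext fun w => (appendX_appendX _ _ _ _ _ _ _).symm
      let ψ' : T k A i →ₗ[k] X k A N := ψ ∘ₗ (cat (rfl : i + 1 = i + 1)).toLinearMap ∘ₗ
        (TensorProduct.mk k (T k A i) (T k A 1)).flip (letter (proj k A (F.nu a)))
      have e2 : F.ptr i (N + i) ((appendX (rfl : N + i + 1 = N + i + 1) ∘ₗ
            (TensorProduct.mk k _ _).flip (letter (proj k A a))) ∘ₗ
          ((appendX (rfl : N + i = N + i) ∘ₗ (TensorProduct.mk k _ _).flip c) ∘ₗ ψ)) =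
          (-1 : k) ^ (N + i + 1) • ((appendX (rfl : N + i = N + i) ∘ₗ
            (TensorProduct.mk k _ _).flip c) ∘ₗ ψ') :=
        LinearMap.ext fun w => F.ptr_appendX _ a w
      rw [e1]
      refine (F.descent_succ _).trans ?_
      rw [e2, LinearMap.map_smul, ih ψ', smul_smul, smul_smul, ← pow_add, ← pow_add, actT_cat,
        actT_letter, npow_congr (k := k) (a := i + 1 + (N + i + 1) + N * i) (b := N * (i + 1))
          (by ring_nf; omega)]
      rfl

/-- Up to boundaries, the descents of `G ∘ d` and of `d ∘ G` agree. -/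
lemma exists_descent_comp_dB {G : Bar k A i →ₗ[k] Bar k A (N + i + 1)} (hL : IsL G) (hR : IsR G) :
    ∃ y, F.descent N (i + 1) (F.hat (G ∘ₗ dB rfl)) =
      F.descent N i (F.hat (dB rfl ∘ₗ G)) + F.partialD rfl y := by
  induction i with
  | zero =>
    let x : Bar k A (N + 1) := G (cap ((1 : A) ⊗ₜ[k] nil))
    refine ⟨-F.casInv (N + 1) x, ?_⟩
    have e : F.hop rfl (G ∘ₗ dB rfl) (cap ((1 : A) ⊗ₜ[k] nil)) =
        x - F.cas (N + 1) (F.casInv (N + 1) x) := by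
      rw [hop_apply, npow_congr (k := k) (a := 0 + 1) (b := 1) rfl, pow_one, neg_one_smul, casInv, LinearMap.comp_apply,
        LinearMap.comp_apply, cas_tauS, tr_apply]
      conv_rhs => enter [1]; rw [← F.sum_formR x]
      rw [← Finset.sum_sub_distrib, ← Finset.sum_neg_distrib]
      refine Finset.sum_congr rfl fun j _ => ?_
      have e1 : dB (rfl : 0 + 1 = 0 + 1) (TateHochschild.hR rfl (rm (F.u j) (cap ((1 : A) ⊗ₜ[k] nil)))) =
          F.u j • cap ((1 : A) ⊗ₜ[k] nil) - rm (F.u j) (cap ((1 : A) ⊗ₜ[k] nil)) := by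
        rw [dB_hR_zero, rm_cap, aug_tmul]
        simp [cap_apply, TensorProduct.smul_tmul']
      rw [LinearMap.comp_apply, e1, map_sub, hL, hR, map_sub, formR_smul, rm_cap,
        TensorProduct.sub_tmul, neg_sub, TensorProduct.smul_tmul']
    rw [descent_hat_succ, descent_hat_zero, descent_hat_zero, LinearMap.comp_apply, e, map_sub,
      map_sub, map_neg, dB_cas, sub_eq_add_neg]
    exact congrArg (fun y => _ + -y) (F.casInv_cas (N := N) _)
  | succ i ih =>
    have e := F.hop_identity (rfl : i + 1 = i + 1) (rfl : i + 1 + 1 = i + 1 + 1) hR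
    obtain ⟨y, hy⟩ := ih (G := dB rfl ∘ₗ F.hop rfl G) ((isL_dB _).comp (F.isL_hop rfl hL))
      ((isR_dB _).comp (F.isR_hop rfl G))
    have e1 : dB (rfl : N + i + 1 = N + i + 1) ∘ₗ dB (rfl : N + i + 1 + 1 = N + i + 1 + 1) ∘ₗ
        F.hop rfl G = 0 := LinearMap.ext fun w => dB_dB _ _ _
    have e2 : F.hat (0 : Bar k A i →ₗ[k] Bar k A (N + i)) = 0 := by
      rw [← zero_smul k 0, hat_smul, zero_smul]
    rw [e1, e2, map_zero, zero_add] at hy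
    refine ⟨-y, ?_⟩
    rw [map_neg, ← hy, ← sub_eq_add_neg, eq_sub_iff_add_eq]
    refine (congrArg (· + _) (F.descent_hat_succ _)).trans ?_
    rw [← map_add, ← hat_add, LinearMap.comp_assoc, ← LinearMap.comp_add, e]

lemma hop_zero {M : ℕ} (h : i + 1 = M) : F.hop h (0 : Bar k A M →ₗ[k] Bar k A p) = 0 := by
  simp [hop]

lemma kappaChain_eq_cas {z : X k A N} (hz : F.IsCycle z) {f : T k A 0 →ₗ[k] B k A (N + 1)}
    (hf : f nil = F.cas N z) :
    f = (-1 : k) ^ (N + 1) • F.kappaChain (rfl : N + 1 + 0 = N + 1) z := by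
  refine ext_nil ?_
  have e : F.kappaChain (rfl : N + 1 + 0 = N + 1) z nil = -((-1 : k) ^ N • F.cas N z) := by
    rw [← hz.dB_cap, ← F.casCoch_nil]; rfl
  have key : ∀ x : Bar k A N, x = (-1 : k) ^ (N + 1) • -((-1 : k) ^ N • x) := fun x => by
    rw [smul_neg, smul_smul, pow_succ, mul_neg_one, neg_mul, neg_one_pow_mul_self, neg_one_smul,
      neg_neg]
  rw [LinearMap.smul_apply, e, hf]
  exact key _

/-- A cocycle of bimodule maps represents the image of its descent under `κ`. -/
lemma sub_kappaChain_descent_mem {G : Bar k A i →ₗ[k] Bar k A (N + i)} (hL : IsL G) (hR : IsR G)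
    (hG : G ∘ₗ dB (rfl : i + 1 = i + 1) = 0) (hd : ∀ y, d k A (N + i) (G y) = 0)
    (h : N + 1 + i = N + i + 1) {f : T k A i →ₗ[k] B k A (N + i + 1)} (hf : f = onWords G) :
    F.IsCycle (F.descent N i (F.hat G)) ∧
      f - (-1 : k) ^ ((N + 1) * (i + 1)) • F.kappaChain h (F.descent N i (F.hat G)) ∈
        BExt k A i (N + i + 1) := by
  induction i with
  | zero =>
    let x : Bar k A N := G (cap ((1 : A) ⊗ₜ[k] nil))
    have h1 : ∀ a : A, a • x = rm a x := by
      intro a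
      have e := LinearMap.congr_fun hG
        (TateHochschild.hR rfl (rm a (cap ((1 : A) ⊗ₜ[k] nil))))
      have e1 : dB (rfl : 0 + 1 = 0 + 1)
          (TateHochschild.hR rfl (rm a (cap ((1 : A) ⊗ₜ[k] nil)))) =
          a • cap ((1 : A) ⊗ₜ[k] nil) - rm a (cap ((1 : A) ⊗ₜ[k] nil)) := by
        rw [dB_hR_zero, rm_cap, aug_tmul]
        simp [cap_apply, TensorProduct.smul_tmul']
      rw [LinearMap.comp_apply, e1, map_sub, hL, hR] at e
      exact sub_eq_zero.1 e
    have h2 : F.cas N (F.casInv N x) = x := F.cas_casInv h1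
    have h3 : F.IsCycle (F.casInv N x) := by rw [IsCycle, h2]; exact hd _
    refine ⟨h3, ?_⟩
    have e := F.kappaChain_eq_cas h3 (f := f) (by rw [h2, hf]; rfl)
    rw [sub_eq_zero.2]
    · exact Submodule.zero_mem _
    · rw [zero_add, mul_one]
      exact e
  | succ i ih =>
    have e := F.hop_identity (rfl : i + 1 = i + 1) (rfl : i + 1 + 1 = i + 1 + 1) hR
    rw [hG, hop_zero, zero_add] at e
    let χ : T k A i →ₗ[k] Bar k A (N + (i + 1)) := onWords (F.hop rfl G)
    have hχ : bext χ = F.hop rfl G := bext_onWords (F.isL_hop rfl hL) (F.isR_hop rfl G)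
    have hδ : delta (actBar k A (N + (i + 1))) (rfl : i + 1 = i + 1) χ = f := by
      rw [delta_eq_onWords, hχ, e, hf]
    have hfZ : f ∈ ZExt k A (i + 1) (N + (i + 1) + 1) := by
      refine mem_ZExt.2 ⟨fun w => mem_Omega_succ.2 ?_, ?_⟩
      · rw [hf]; exact hd _
      · rw [hf]
        refine (delta_eq_onWords (onWords G) _).trans ?_
        rw [bext_onWords hL hR, hG]
        rfl
    obtain ⟨h1, h2⟩ := ih (G := dB rfl ∘ₗ F.hop rfl G) ((isL_dB _).comp (F.isL_hop rfl hL))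
      ((isR_dB _).comp (F.isR_hop rfl G))
      (by rw [LinearMap.comp_assoc, e]; exact LinearMap.ext fun y => hd y)
      (fun y => d_dB (rfl : N + i + 1 = N + i + 1) _) (by omega)
      (f := d k A (N + (i + 1)) ∘ₗ χ) rfl
    have h3 := F.descent_hat_succ G
    rw [← h3] at h1 h2
    refine ⟨h1, ?_⟩
    have h4 := add_thetaC_d_mem_BExt hfZ hδ
    have h5 := thetaC_mem_BExt h2
    rw [map_sub, LinearMap.map_smul, F.thetaC_kappaChain (s := N + i + 1) _ h] at h5
    replace h5 : thetaC i (N + (i + 1)) (d k A (N + (i + 1)) ∘ₗ χ) -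
      (-1 : k) ^ ((N + 1) * (i + 1)) • F.kappaChain h (F.descent N (i + 1) (F.hat G)) ∈
        BExt k A (i + 1) (N + (i + 1) + 1) := h5
    have h6 := sub_mem h4 (Submodule.smul_mem _ (eps k i (N + (i + 1))) h5)
    have e3 : (-1 : k) ^ ((N + 1) * (i + 1 + 1)) =
        - (eps k i (N + (i + 1)) * (-1 : k) ^ ((N + 1) * (i + 1))) := by
      rw [eps, ← pow_add, npow_congr (k := k) (a := (N + 1) * (i + 1 + 1))
        (b := i + (N + (i + 1)) + 1 + (N + 1) * (i + 1) + 1) (by ring_nf; omega), pow_succ,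
        mul_neg_one]
    rw [e3]
    convert h6 using 1
    module

end FrobeniusForm

section BracketWithInvariants

variable {k A : Type u} [Field k] [Ring A] [Algebra k A] {M N m p q s : ℕ}

lemma psiT_zero (x : T k A m →ₗ[k] X k A p) {N' : ℕ} (h : m + 0 = N + 1) (h' : p + 0 = N') :
    psiT x 0 h h' = 0 := by
  simp [psiT]

lemma psiT_one (x : T k A m →ₗ[k] X k A p) {N' : ℕ} (h : m + 1 = N + 1) (h' : p + 1 = N')
    (h₁ : 0 + m + 0 = N) (h₁' : 0 + (p + 1) + 0 = N') :
    psiT x 1 h h' = slot 0 0 h₁ h₁' (consBar LinearMap.id (Nat.add_comm 1 p) ∘ₗ x) := by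
  simp [psiT]

lemma lam_of_zero {l N' : ℕ} (h : m + l = N) (h' : p + l = N') (y : Bar k A N) :
    lam (0 : T k A m →ₗ[k] X k A p) h h' y = 0 := by
  induction y using bar_induction with
  | add x y hx hy => rw [map_add, hx, hy, add_zero]
  | zero => rw [map_zero]
  | H a w b =>
    induction w using cat_induction h with
    | add x y hx hy => rw [TensorProduct.tmul_add, TensorProduct.add_tmul, map_add, hx, hy, add_zero]
    | zero => simp only [TensorProduct.tmul_zero, TensorProduct.zero_tmul, map_zero, LinearMap.zero_apply, smul_zero]
    | H w w' => simp

lemma bul_extX_left_zero (x : T k A 0 →ₗ[k] X k A p) (y : T k A (M + 1) →ₗ[k] X k A 0)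
    (hm' : 1 ≤ 0 + 1) (hN' : M + 1 + 1 = 0 + 1 + (M + 1)) (hs' : p + 1 + 0 = s)
    (h1 : 0 + (M + 1) + 0 = M + 1) (h2 : 0 + (0 + 1) + 0 = 0 + 1) (h3 : 0 + (0 + 1) = 0 + 1)
    (h4 : p + (0 + 1) = s) :
    bul (extX x) y hm' hN' hs' =
      lamX x h3 h4 ∘ₗ slot 0 0 h1 h2 (consBar LinearMap.id (Nat.add_comm 1 0) ∘ₗ y) := by
  refine LinearMap.ext fun w => ?_
  rw [bul_apply (extX x) y hm' hN' hs' (rfl : 0 + 1 = 0 + 1) (show 0 + 1 + 0 = 0 + 1 by omega)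
    (by omega) (rfl : 0 + 1 = 0 + 1) (by omega) (rfl : 0 + 0 = 0 + 0) (by omega),
    psiT_one y _ _ h1 h2, lamX_extX x (Nat.add_comm 1 0) _ _ h3 h4, psiT_zero]
  simp only [TensorProduct.map_zero_right, LinearMap.zero_apply, smul_zero, add_zero,
    LinearMap.comp_apply]

lemma br_extX_zero (f : T k A (M + 1) →ₗ[k] X k A 0) (g : T k A 0 →ₗ[k] X k A p)
    (hm : 1 ≤ M + 1) (hn : 1 ≤ 0 + 1) (hN : M + 1 + 1 = M + 1 + (0 + 1)) (hs : 0 + (p + 1) = p + 1)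
    (hN' : M + 1 = M + 1 + 0) (hs' : 0 + p = p) :
    br f (extX g) hm hn hN hs = extX (bul f g hm hN' hs') := by
  have e : eps k (M + 1) 0 * eps k (M + 1) 0 ^ p = eps k (0 + 1) (p + 1) ^ (M + 1 + 0 + 1) := by
    simp only [eps]
    rw [← pow_mul, ← pow_mul, ← pow_add]
    exact npow_congr (by ring_nf; omega)
  rw [br, bul_extX_right g f hm hN' hs' hN hs (by omega) (rfl : p + (M + 1) = p + (M + 1)) rfl rfl,
    bul_extX_left_zero g f hn (by omega) (by omega) (by omega) rfl rfl rfl,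
    lamX_slot g _ (by omega) _ _ _ _ rfl (by omega) (by omega), e]
  exact add_sub_cancel_right _ _

variable {f : T k A (M + 1) →ₗ[k] X k A 0} {g : T k A 0 →ₗ[k] X k A (N + M + 1)}

variable (f g) in
/-- The maps whose component in degree `M` is `f • g`. -/
def bulMap (i : ℕ) : Bar k A i →ₗ[k] Bar k A (N + i + 1) :=
  lam f (show M + 1 + (N + i + 1) = N + M + 1 + (i + 1) by omega) (Nat.zero_add _) ∘ₗ
    psi g (i + 1) (Nat.zero_add _) rfl +
  eps k (M + 1) 0 • (psi f (N + i + 1) (show M + 1 + (N + i + 1) = N + M + 1 + i + 1 by omega)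
    (Nat.zero_add _) ∘ₗ lam g (Nat.zero_add i) rfl)

variable (f g) in
/-- The map `λ_f ρ_g`. -/
def lamRho (i : ℕ) : Bar k A i →ₗ[k] Bar k A (N + i) :=
  lam f (show M + 1 + (N + i) = N + M + 1 + i by omega) (Nat.zero_add _) ∘ₗ
    rho g (Nat.add_zero i) (Nat.add_comm i (N + M + 1))

variable (f g) in
/-- The map `ρ_f λ_g`. -/
def rhoLam (i : ℕ) : Bar k A i →ₗ[k] Bar k A (N + i) :=
  rho f (show N + i + (M + 1) = N + M + 1 + i by omega) (Nat.add_zero _) ∘ₗ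
    lam g (Nat.zero_add i) rfl

variable (f g) in
/-- Insertion of `f` in the boundary of `g`. -/
def insBd : Bar k A 0 →ₗ[k] Bar k A N :=
  psi f N (show M + 1 + N = N + M + 1 by omega) (Nat.zero_add _) ∘ₗ
    dB (rfl : N + M + 1 = N + M + 1) ∘ₗ lam g (Nat.zero_add 0) (Nat.add_zero (N + M + 1))

lemma isL_bulMap (i : ℕ) : IsL (bulMap f g i) := fun a y => by
  simp only [bulMap, LinearMap.add_apply, LinearMap.comp_apply, LinearMap.smul_apply,
    isL_psi _ _ _ _ _, isL_lam _ _ _ _ _, smul_add, smul_comm a]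

lemma isR_bulMap (i : ℕ) : IsR (bulMap f g i) := fun a y => by
  simp only [bulMap, LinearMap.add_apply, LinearMap.comp_apply, LinearMap.smul_apply,
    isR_psi _ _ _ _ _, isR_lam _ _ _ _ _, map_add, map_smul]

lemma lext_bul_eq (hm : 1 ≤ M + 1) (hN : M + 1 = M + 1 + 0) (hs : 0 + (N + M + 1) = N + M + 1)
    (y : Bar k A M) : lext (bul f g hm hN hs) y = bulMap f g M y :=
  lext_bul f g hm hN hs rfl (by omega) rfl (by omega) (by omega) rfl (by omega) y

lemma dB_bulMap_succ (hf : Rel f 0) (hg : Rel g 0) (i : ℕ) (y : Bar k A (i + 1)) :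
    dB rfl (bulMap f g (i + 1) y) = (-1 : k) ^ (N + 1) • bulMap f g i (dB rfl y) +
      eps k (M + 1) 0 • (lamRho f g (i + 1) y - rhoLam f g (i + 1) y) := by
  have e1 : dB (rfl : N + M + 1 + (i + 1) + 1 = N + M + 1 + (i + 1) + 1)
      (psi g (i + 2) (Nat.zero_add (i + 2)) rfl y) = eps k 0 (N + M + 1) •
      psi g (i + 1) (Nat.zero_add (i + 1)) rfl (dB rfl y) + lam g (Nat.zero_add (i + 1)) rfl y -
      rho g (Nat.add_zero (i + 1)) (Nat.add_comm (i + 1) (N + M + 1)) y := by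
    rw [dB_psi hg (Nat.zero_add (i + 1)) rfl (Nat.zero_add (i + 2)) rfl (Nat.zero_add (i + 1))
      (Nat.add_zero (i + 1)) (Nat.add_comm (i + 1) (N + M + 1)) (by omega) rfl rfl, psi_of_zero,
      sub_zero]
  have e2 : dB (rfl : N + M + 1 + i + 1 = N + M + 1 + i + 1)
      (lam g (Nat.zero_add (i + 1)) (rfl : N + M + 1 + (i + 1) = _) y) = - (eps k 0 (N + M + 1) •
      lam g (Nat.zero_add i) rfl (dB rfl y)) := by
    rw [hg (l := i) (l' := i + 1) (Nat.zero_add i) rfl (Nat.zero_add (i + 1)) rfl rfl (by omega)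
      rfl rfl, lam_of_zero, zero_sub]
  have e3 := hf (l := N + i + 1) (l' := N + i + 2) (N' := N + i + 1) (N₁' := N + i + 2)
    (N := N + M + 1 + (i + 1)) (N₁ := N + M + 1 + (i + 2)) (by omega) (Nat.zero_add _) (by omega)
    (Nat.zero_add _) rfl (by omega) rfl rfl (psi g (i + 2) (Nat.zero_add (i + 2)) rfl y)
  have e4 := dB_psi hf (l := N + i + 1) (N := N + M + 1 + i) (N₁ := N + M + 1 + (i + 1))
    (N' := N + i + 1) (N₁' := N + i + 2) (by omega) (Nat.zero_add _) (by omega) (Nat.zero_add _)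
    (by omega) (by omega) (Nat.add_zero _) (by omega) rfl rfl
    (lam g (Nat.zero_add (i + 1)) (rfl : N + M + 1 + (i + 1) = _) y)
  rw [lam_of_zero, e1, zero_sub] at e3
  rw [psi_of_zero, e2, sub_zero] at e4
  have hs : (-1 : k) ^ (N + 1) = - (eps k (M + 1) 0 * eps k 0 (N + M + 1)) := by
    rw [eps, eps, ← pow_add, ← mul_neg_one (((-1 : k)) ^ (_ + _)), ← pow_succ]
    exact npow_congr (by ring_nf; omega)
  have key : ∀ a : Bar k A (N + i + 1), a = dB (rfl : N + i + 1 + 1 = N + i + 1 + 1) (lam f (by omega) (Nat.zero_add _)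
      (psi g (i + 2) (Nat.zero_add (i + 2)) rfl y)) + eps k (M + 1) 0 • dB rfl (psi f (N + i + 2) (by omega) (Nat.zero_add _)
      (lam g (Nat.zero_add (i + 1)) rfl y)) → a = (-1 : k) ^ (N + 1) • bulMap f g i (dB rfl y) +
      eps k (M + 1) 0 • (lamRho f g (i + 1) y - rhoLam f g (i + 1) y) := by
    intro a ha
    rw [ha, e3, e4, hs, bulMap, lamRho, rhoLam]
    simp only [LinearMap.add_apply, LinearMap.comp_apply, LinearMap.smul_apply, map_add, map_sub,
      LinearMap.map_smul, map_neg, smul_add, smul_sub, smul_neg, smul_smul]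
    module
  refine key _ ?_
  rw [bulMap, LinearMap.add_apply, map_add, LinearMap.smul_apply, LinearMap.map_smul]
  rfl

lemma dB_bulMap_zero (hf : Rel f 0) (y : Bar k A 0) :
    dB rfl (bulMap f g 0 y) =
      eps k (M + 1) 0 • (lamRho f g 0 y - rhoLam f g 0 y) + insBd f g y := by
  have e1 := dB_psi_one g (rfl : 0 + 1 = 0 + 1) (rfl : N + M + 1 + 1 = N + M + 1 + 1) rfl
    (Nat.add_zero (N + M + 1)) rfl (Nat.add_comm 0 (N + M + 1)) y
  have e3 := hf (l := N) (l' := N + 1) (N' := N) (N₁' := N + 1)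
    (N := N + M + 1) (N₁ := N + M + 1 + 1) (by omega) (Nat.zero_add _) (by omega)
    (Nat.zero_add _) rfl (by omega) rfl rfl (psi g 1 (Nat.zero_add 1) rfl y)
  have e4 := dB_psi hf (l := N) (N := N + M) (N₁ := N + M + 1)
    (N' := N) (N₁' := N + 1) (by omega) (Nat.zero_add _) (by omega) (Nat.zero_add _)
    (by omega) (by omega) (Nat.add_zero _) (by omega) rfl rfl
    (lam g (Nat.zero_add 0) (Nat.add_zero (N + M + 1)) y)
  rw [lam_of_zero, e1, zero_sub] at e3
  rw [psi_of_zero, sub_zero] at e4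
  have key : ∀ a : Bar k A N, a = dB (rfl : N + 1 = N + 1) (lam f (by omega) (Nat.zero_add _)
      (psi g 1 (Nat.zero_add 1) rfl y)) + eps k (M + 1) 0 • dB rfl (psi f (N + 1) (by omega)
      (Nat.zero_add _) (lam g (Nat.zero_add 0) (Nat.add_zero (N + M + 1)) y)) →
      a = eps k (M + 1) 0 • (lam f (by omega) (Nat.zero_add _) (rho g rfl (Nat.add_comm 0 (N + M + 1)) y) -
        rho f (by omega) (Nat.add_zero _) (lam g (Nat.zero_add 0) (Nat.add_zero (N + M + 1)) y))
      + psi f N (by omega) (Nat.zero_add _) (dB rfl (lam g (Nat.zero_add 0) (Nat.add_zero (N + M + 1)) y)) := by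
    intro a ha
    rw [ha, e3, e4]
    simp only [map_sub, smul_add, smul_sub, smul_smul, eps_mul_self]
    module
  refine key _ ?_
  rw [bulMap, LinearMap.add_apply, map_add, LinearMap.smul_apply, LinearMap.map_smul]
  rfl

lemma dB_rho_zero (x : T k A m →ₗ[k] X k A (p + 1)) (h : 0 + m = m) (h' : 0 + (p + 1) = p + 1)
    (hm : m + 0 = m) (hp : p + 1 + 0 = p + 1) (y : Bar k A m) :
    dB rfl (rho x h h' y) = dB rfl (lam x hm hp y) := by
  induction y using one_induction with
  | add x y hx hy => simp only [map_add, hx, hy]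
  | smul a y hy => rw [isL_rho, isL_lam, isL_dB, isL_dB, hy]
  | H w b => rw [rho_zero x _ _ hm hp rfl (Nat.add_comm 1 _), map_sub, dB_dB, sub_zero]

lemma dB_lam_dB_one (hg : Rel g 0) (z : Bar k A 1) :
    dB (rfl : N + M + 1 = N + M + 1) (lam g (Nat.zero_add 0) (Nat.add_zero (N + M + 1))
      (dB rfl z)) = 0 := by
  rw [hg.lam_dB (l := 0) (l' := 1) (Nat.zero_add 0) (Nat.add_zero (N + M + 1)) (Nat.zero_add 1)
    (rfl : N + M + 1 + 1 = N + M + 1 + 1) rfl rfl rfl rfl, lam_of_zero, zero_sub,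
    LinearMap.map_smul, map_neg, dB_dB, neg_zero, smul_zero]

lemma dB_lam_rho (hg : Rel g 0) (y : Bar k A (M + 1)) :
    dB (rfl : N + M + 1 = N + M + 1) (lam g (Nat.zero_add 0) (Nat.add_zero (N + M + 1))
      (rho f (Nat.zero_add (M + 1)) (Nat.zero_add 0) y)) =
      dB rfl (lam g (Nat.zero_add 0) (Nat.add_zero (N + M + 1))
        (lam f (Nat.add_zero (M + 1)) (Nat.zero_add 0) y)) := by
  induction y using one_induction with
  | add x y hx hy => simp only [map_add, hx, hy]
  | smul a y hy =>
    simp only [isL_rho _ _ _ _ _, isL_lam _ _ _ _ _, isL_dB _ _ _, hy]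
  | H w b =>
    rw [rho_zero f _ _ (Nat.add_zero _) (Nat.zero_add 0) rfl (Nat.add_comm 1 _), map_sub, map_sub,
      dB_lam_dB_one hg, sub_zero]

lemma dB_lamRho_sub_rhoLam (hg : Rel g 0) (y : Bar k A (M + 1)) :
    dB (rfl : N + M + 1 = N + M + 1) (lamRho f g (M + 1) y - rhoLam f g (M + 1) y) = 0 := by
  have e3 := lam_rho f g (s := N + M + 1) (M := N + M + 1 + (M + 1)) (M' := 0)
    (Nat.add_zero (M + 1)) (Nat.add_comm _ _) (Nat.zero_add _) (Nat.zero_add 0) y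
  have e4 := lam_rho g f (s := N + M + 1) (M := 0) (M' := N + M + 1 + (M + 1))
    (Nat.zero_add (M + 1)) (Nat.zero_add 0) (Nat.add_zero _) rfl y
  have e5 := dB_rho_zero g (Nat.zero_add 0) (Nat.zero_add (N + M + 1)) (Nat.zero_add 0)
    (Nat.add_zero _) (lam f (Nat.add_zero (M + 1)) (Nat.zero_add 0) y)
  have e6 := dB_lam_rho (f := f) hg y
  have hs : (- eps k 0 (N + M + 1)) ^ (M + 1 + 0) * (- eps k (M + 1) 0) ^ (0 + (N + M + 1)) = 1 := by
    have h1 : - eps k 0 (N + M + 1) = (-1 : k) ^ (N + M + 1) := by rw [eps]; ring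
    have h2 : - eps k (M + 1) 0 = (-1 : k) ^ (M + 1) := by rw [eps]; ring
    rw [h1, h2, ← pow_mul, ← pow_mul, ← pow_add]
    exact (npow_congr (b := 0) (by ring_nf; omega)).trans (pow_zero _)
  have key : ∀ a b : Bar k A (N + M + 1), a = lam f (Nat.add_comm _ _) (Nat.zero_add _)
        (rho g (Nat.add_zero (M + 1)) (Nat.add_comm (M + 1) (N + M + 1)) y) →
      b = rho f rfl (Nat.add_zero _) (lam g (Nat.zero_add (M + 1)) (rfl : N + M + 1 + (M + 1) = _) y) →
      dB (rfl : N + M + 1 = N + M + 1) (a - b) = 0 := by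
    intro a b ha hb
    rw [map_sub, ha, e3, LinearMap.map_smul, e5, ← e6, e4, LinearMap.map_smul, smul_smul, hs, hb,
      one_smul, sub_self]
  exact key _ _ rfl rfl

lemma dB_bulMap_dB (hf : Rel f 0) (hg : Rel g 0) (y : Bar k A (M + 1)) :
    dB (rfl : N + M + 1 = N + M + 1) (bulMap f g M (dB (rfl : M + 1 = M + 1) y)) = 0 := by
  have e := congrArg (dB (rfl : N + M + 1 = N + M + 1)) (dB_bulMap_succ hf hg M y)
  rw [map_add, LinearMap.map_smul, LinearMap.map_smul, dB_lamRho_sub_rhoLam hg, smul_zero, add_zero]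
    at e
  have e2 : dB (rfl : N + M + 1 = N + M + 1) (dB rfl (bulMap f g (M + 1) y)) = 0 := dB_dB _ _ _
  rw [e2] at e
  have := congrArg (fun x => (-1 : k) ^ (N + 1) • x) e
  simpa [smul_smul, neg_one_pow_mul_self] using this.symm

end BracketWithInvariants

namespace FrobeniusForm

variable {k A : Type u} [Field k] [Ring A] [Algebra k A] (F : FrobeniusForm k A)
  [FiniteDimensional k A] {M N s : ℕ} {f : T k A (M + 1) →ₗ[k] X k A 0} {z : X k A (N + M)}

/-- Representatives of `[f, κ(z)]` under the maps `κ`, for `i = M`. -/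
def brDescent (f : T k A (M + 1) →ₗ[k] X k A 0) (z : X k A (N + M)) (i : ℕ) : X k A N :=
  F.descent N i (F.hat (dB rfl ∘ₗ bulMap f (F.casCoch z) i))

lemma isCycle_brDescent (hf : Rel f 0) (hz : F.IsCycle z) (hm : 1 ≤ M + 1)
    (hr : M + 1 + 1 = M + 1 + 1) (hs : 0 + (N + M + 1 + 1) = N + M + 1 + 1)
    (h : N + M + 1 + 1 = N + M + 1 + 1) (h' : N + 1 + (M + 1) = N + M + 1 + 1) :
    F.IsCycle (F.brDescent f z M) ∧
      sgBracket hm le_rfl hr hs (closeD k A 0 ∘ₗ f) (F.kappaChain (p := 1) h z) -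
        (-1 : k) ^ ((N + 1) * (M + 1)) • F.kappaChain h' (F.brDescent f z M) ∈
      BExt k A (M + 1) (N + M + 1 + 1) := by
  have hg := rel_zero_of_mem_ZExt hz.mem_ZExt_zero
  obtain ⟨h1, h2⟩ := F.sub_kappaChain_descent_mem (G := dB rfl ∘ₗ bulMap f (F.casCoch z) M)
    ((isL_dB _).comp (isL_bulMap M)) ((isR_dB _).comp (isR_bulMap M))
    (LinearMap.ext fun y => dB_bulMap_dB hf hg y)
    (fun y => d_dB (rfl : N + M + 1 = N + M + 1) _) (by omega)
    (f := closeD k A (N + M + 1) ∘ₗ bul f (F.casCoch z) hm rfl (Nat.zero_add _))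
    (LinearMap.ext fun w => by
      have e := lext_bul_eq (f := f) (g := F.casCoch z) hm rfl (Nat.zero_add _)
        (cap ((1 : A) ⊗ₜ[k] w))
      rw [lext_cap_one] at e
      exact congrArg (dB (rfl : N + M + 1 = N + M + 1)) e)
  refine ⟨h1, ?_⟩
  have h3 := thetaC_mem_BExt h2
  rw [map_sub, LinearMap.map_smul, F.thetaC_kappaChain (s := N + M + 1) _ h'] at h3
  have e1 : thetaC M (N + M + 1)
      (closeD k A (N + M + 1) ∘ₗ bul f (F.casCoch z) hm rfl (Nat.zero_add _)) =
      sgBracket hm le_rfl hr hs (closeD k A 0 ∘ₗ f) (F.kappaChain (p := 1) h z) := by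
    rw [← F.thetaC_kappaChain (p := 0) (s := N + M + 1) rfl h, kappaChain_zero, thetaC_closeD,
      thetaC_closeD, sgBracket_closeD, br_extX_zero]
  rw [← e1]
  exact h3

/-- The contributions of `λ_f ρ_g - ρ_f λ_g` to the descent. -/
def brTerm (f : T k A (M + 1) →ₗ[k] X k A 0) (z : X k A (N + M)) (i : ℕ) : X k A N :=
  F.descent N i (F.hat (lamRho f (F.casCoch z) i)) - F.descent N i (F.hat (rhoLam f (F.casCoch z) i))

lemma exists_brDescent (hf : Rel f 0) (hz : F.IsCycle z) (i : ℕ) :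
    ∃ y, (-1 : k) ^ ((N + 1) * (i + 1)) • F.brDescent f z i =
      ∑ j ∈ Finset.range (i + 1), (-1 : k) ^ ((N + 1) * (j + 1) + M) • F.brTerm f z j +
      (-1 : k) ^ (N + 1) • F.casInv N (insBd f (F.casCoch z) (cap ((1 : A) ⊗ₜ[k] nil))) +
      F.partialD rfl y := by
  have hg := rel_zero_of_mem_ZExt hz.mem_ZExt_zero
  have hε : eps k (M + 1) 0 = (-1 : k) ^ M := npow_congr (by omega)
  induction i with
  | zero =>
    refine ⟨0, ?_⟩
    let I : Bar k A 0 →ₗ[k] Bar k A (N + 0) := insBd f (F.casCoch z)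
    have e : dB (rfl : N + 0 + 1 = N + 0 + 1) ∘ₗ bulMap f (F.casCoch z) 0 =
        (-1 : k) ^ M • (lamRho f (F.casCoch z) 0 + (-1 : k) • rhoLam f (F.casCoch z) 0) + I := LinearMap.ext fun y => by
      refine (dB_bulMap_zero hf y).trans ?_
      rw [hε, sub_eq_add_neg, ← neg_one_smul k (rhoLam f (F.casCoch z) 0 y)]; rfl
    have e1 : F.brDescent f z 0 = (-1 : k) ^ M • F.brTerm f z 0 +
        F.casInv N (insBd f (F.casCoch z) (cap ((1 : A) ⊗ₜ[k] nil))) := by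
      have e2 : F.brDescent f z 0 = F.descent N 0 (F.hat
          ((-1 : k) ^ M • (lamRho f (F.casCoch z) 0 + (-1 : k) • rhoLam f (F.casCoch z) 0) + I)) := by
        rw [← e, brDescent]
      rw [e2, brTerm, hat_add, hat_smul, hat_add, hat_smul, LinearMap.map_add, LinearMap.map_smul, LinearMap.map_add,
        LinearMap.map_smul, neg_one_smul, ← sub_eq_add_neg]
      have e3 := F.descent_hat_zero (N := N) I
      rw [e3]
    rw [e1, Finset.sum_range_one, map_zero, add_zero, smul_add, smul_smul, ← pow_add, zero_add,
      mul_one]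
  | succ i ih =>
    obtain ⟨y, hy⟩ := ih
    have e : dB (rfl : N + i + 1 + 1 = N + i + 1 + 1) ∘ₗ bulMap f (F.casCoch z) (i + 1) =
        (-1 : k) ^ (N + 1) • (bulMap f (F.casCoch z) i ∘ₗ dB rfl) +
        (-1 : k) ^ M • (lamRho f (F.casCoch z) (i + 1) +
          (-1 : k) • rhoLam f (F.casCoch z) (i + 1)) := LinearMap.ext fun y => by
      refine (dB_bulMap_succ hf hg i y).trans ?_
      rw [hε, sub_eq_add_neg, ← neg_one_smul k (rhoLam f (F.casCoch z) (i + 1) y)]; rfl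
    obtain ⟨y', hy'⟩ := F.exists_descent_comp_dB (isL_bulMap (f := f) (g := F.casCoch z) i)
      (isR_bulMap i)
    have e1 : F.brDescent f z (i + 1) = (-1 : k) ^ (N + 1) • (F.brDescent f z i +
        F.partialD rfl y') + (-1 : k) ^ M • F.brTerm f z (i + 1) := by
      rw [brDescent, brTerm, brDescent, ← hy']
      refine (congrArg (fun G => F.descent N (i + 1) (F.hat G)) e).trans ?_
      rw [hat_add, hat_smul, hat_smul, hat_add, hat_smul, map_add, LinearMap.map_smul,
        LinearMap.map_smul, map_add, LinearMap.map_smul, neg_one_smul, ← sub_eq_add_neg]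
    refine ⟨y + (-1 : k) ^ ((N + 1) * (i + 1)) • y', ?_⟩
    rw [e1, Finset.sum_range_succ, smul_add, smul_smul, smul_smul, ← pow_add, ← pow_add,
      npow_congr (k := k) (a := (N + 1) * (i + 1 + 1) + (N + 1)) (b := (N + 1) * (i + 1))
        (by ring_nf; omega), smul_add, hy, map_add, LinearMap.map_smul]
    module

end FrobeniusForm

section CapWithCochain

variable {k A : Type u} [Field k] [Ring A] [Algebra k A] {m l R i j N M : ℕ}

/-- The map `a ⊗ ww' ↦ f(w')a ⊗ w`. -/
def capL (f : T k A m →ₗ[k] A) (h : l + m = R) : X k A R →ₗ[k] X k A l :=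
  (TensorProduct.comm k (T k A l) A).toLinearMap ∘ₗ
    TensorProduct.map LinearMap.id (LinearMap.mul' k A) ∘ₗ
    (TensorProduct.assoc k (T k A l) A A).toLinearMap ∘ₗ
    (TensorProduct.comm k A (T k A l ⊗[k] A)).toLinearMap ∘ₗ
    TensorProduct.map LinearMap.id (TensorProduct.map LinearMap.id f ∘ₗ (cat h).symm.toLinearMap)

@[simp] lemma capL_tmul (f : T k A m →ₗ[k] A) (h : l + m = R) (a : A) (w : T k A l) (w' : T k A m) :
    capL f h (a ⊗ₜ[k] cat h (w ⊗ₜ[k] w')) = (f w' * a) ⊗ₜ[k] w := by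
  simp [capL]

/-- A cochain with values in `A`, with values in `A ⊗ Ā^{⊗0}`. -/
def coX (f : T k A m →ₗ[k] A) : T k A m →ₗ[k] X k A 0 := (TensorProduct.mk k A _).flip nil ∘ₗ f

@[simp] lemma coX_apply (f : T k A m →ₗ[k] A) (w : T k A m) : coX f w = f w ⊗ₜ[k] nil := rfl

lemma closeD_coX (f : T k A m →ₗ[k] A) :
    closeD k A 0 ∘ₗ coX f = (show T k A m →ₗ[k] B k A 0 from f) :=
  LinearMap.ext fun w => (aug_tmul (f w) 1 nil).trans (by simp; rfl)

lemma lam_coX (f : T k A m →ₗ[k] A) (h : m + l = R) (h' : 0 + l = l) (a b : A) (w : T k A m)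
    (w' : T k A l) : lam (coX f) h h' ((a ⊗ₜ[k] cat h (w ⊗ₜ[k] w')) ⊗ₜ[k] b) =
      ((a * f w) ⊗ₜ[k] w') ⊗ₜ[k] b := by
  rw [lam_tmul, coX_apply, appendX_tmul, cat_nil_left]; rfl

lemma rho_coX (f : T k A m →ₗ[k] A) (h : l + m = R) (h' : l + 0 = l) (a b : A) (w : T k A l)
    (w' : T k A m) : rho (coX f) h h' ((a ⊗ₜ[k] cat h (w ⊗ₜ[k] w')) ⊗ₜ[k] b) =
      (-1 : k) ^ (m * l) • (a ⊗ₜ[k] w) ⊗ₜ[k] (f w' * b) := by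
  have e : sB 0 (closeD k A 0 (coX f w')) = nil ⊗ₜ[k] f w' :=
    congrArg (nil ⊗ₜ[k] ·) (LinearMap.congr_fun (closeD_coX f) w')
  have e1 : - eps k m 0 = (-1 : k) ^ m := by rw [eps]; ring
  rw [rho_tmul, e, put_tmul, cat_nil_right, e1, ← pow_mul]
  simp

variable (σ : A →ₐ[k] A)

/-- Nested decompositions of words into three parts. -/
lemma cat3_induction (h : i + j = R) (h' : N + l = j) {p : T k A R → Prop} (w : T k A R)
    (add : ∀ x y, p x → p y → p (x + y)) (zero : p 0)
    (H : ∀ x y z, p (cat h (x ⊗ₜ[k] cat h' (y ⊗ₜ[k] z)))) : p w := by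
  induction w using cat_induction h with
  | add x y hx hy => exact add _ _ hx hy
  | zero => exact zero
  | H x y =>
    induction y using cat_induction h' with
    | add y y' hy hy' =>
      rw [TensorProduct.tmul_add, map_add]
      exact add _ _ hy hy'
    | zero => simpa using zero
    | H y z => exact H x y z

lemma capL_dec_cyc_lam {f : T k A m →ₗ[k] A} (hf : ∀ w, σ (f w) = f (actT σ w))
    (h : i + (m + l) = R) {i' : ℕ} (h' : i' + l = R) (h₁ : l + (1 + i') = R + 1)
    {L : ℕ} (h₂ : l + (1 + i) = L) (h₃ : L + m = R + 1) (z : X k A R) :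
    capL f h₃ (dec h' (cyc σ h₁ LinearMap.id) (iota z)) =
      dec h (cyc σ h₂ (lam (coX f) rfl (Nat.zero_add l))) (iota z) := by
  induction z using TensorProduct.induction_on with
  | zero => simp only [TensorProduct.tmul_zero, TensorProduct.zero_tmul, map_zero, LinearMap.zero_apply, smul_zero]
  | add x y hx hy => simp only [map_add, hx, hy]
  | tmul a w =>
    induction w using cat3_induction h rfl with
    | zero => simp only [TensorProduct.tmul_zero, TensorProduct.zero_tmul, map_zero, LinearMap.zero_apply, smul_zero]
    | add x y hx hy => simp only [TensorProduct.tmul_add, map_add, hx, hy]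
    | H x y w =>
      rw [iota_tmul, dec_tmul, cyc_apply, lam_coX, mapB_tmul, actX_tmul, mulB_tmul, tauS_tmul,
        ← cat_assoc h' (show i + m = i' by omega) h rfl, dec_tmul, cyc_apply, LinearMap.id_apply,
        mapB_tmul, actX_tmul, mulB_tmul, tauS_tmul, actT_cat]
      simp only [map_one, mul_one, one_mul]
      rw [hf, ← cat_assoc (show 1 + i + m = 1 + i' by omega) rfl rfl (show i + m = i' by omega),
        ← cat_assoc h₃ h₂ h₁ (show 1 + i + m = 1 + i' by omega), capL_tmul, mul_one]

lemma dec_cyc_rho (f : T k A m →ₗ[k] A) (h : i + (m + l) = R)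
    {L L' : ℕ} (h₂ : l + (1 + i) = L') (h₃ : L + m = R) (h₄ : i + l = L) (z : X k A R) :
    dec h (cyc σ h₂ (rho (coX f) (Nat.add_comm l m) (Nat.add_zero l))) (iota z) =
      (-1 : k) ^ (m * l) • dec h₄ (cyc σ h₂ LinearMap.id) (iota (capL f h₃ z)) := by
  induction z using TensorProduct.induction_on with
  | zero => simp only [TensorProduct.tmul_zero, TensorProduct.zero_tmul, map_zero, LinearMap.zero_apply, smul_zero]
  | add x y hx hy => simp only [map_add, hx, hy, smul_add]
  | tmul a w =>
    induction w using cat3_induction h (Nat.add_comm l m) with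
    | zero => simp only [TensorProduct.tmul_zero, TensorProduct.zero_tmul, map_zero, LinearMap.zero_apply, smul_zero]
    | add x y hx hy => simp only [TensorProduct.tmul_add, map_add, hx, hy, smul_add]
    | H x y w =>
      rw [iota_tmul, dec_tmul, cyc_apply, rho_coX, ← cat_assoc h₃ h₄ h (Nat.add_comm l m), capL_tmul,
        iota_tmul, dec_tmul, cyc_apply, LinearMap.map_smul, LinearMap.smul_apply, LinearMap.map_smul]
      rfl

end CapWithCochain

namespace FrobeniusForm

variable {k A : Type u} [Field k] [Ring A] [Algebra k A] (F : FrobeniusForm k A)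
  [FiniteDimensional k A] {M N : ℕ} (f : T k A (M + 1) →ₗ[k] A)

lemma actT_nu_nuInv {r : ℕ} (w : T k A r) : actT F.nu (actT F.nuInv w) = w := by
  have e : ∀ x : Abar k A, barS F.nu (barS F.nuInv x) = x := fun x => by
    obtain ⟨a, rfl⟩ := Submodule.mkQ_surjective _ x
    exact congrArg (proj k A) (F.nakayama_nakayamaInv a)
  induction w using PiTensorProduct.induction_on with
  | smul_tprod c x => simp [actT, PiTensorProduct.map_tprod, e]
  | add x y hx hy => rw [map_add, map_add, hx, hy]

/-- The linear extension of `lamRho` to all chains, up to sign. -/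
def lamCas (N i : ℕ) : X k A (N + M) →ₗ[k] (T k A i →ₗ[k] X k A (N + i)) :=
  ∑ j, ((TensorProduct.mk k (T k A i) (T k A (N + M + 1))).flip.compr₂ (F.formR (N + i) ∘ₗ
    lam (coX f) (show M + 1 + (N + i) = N + M + 1 + i by omega) (Nat.zero_add _) ∘ₗ
    (TensorProduct.mk k (X k A (N + M + 1 + i)) A).flip (F.v j) ∘ₗ TensorProduct.mk k A _ 1 ∘ₗ
    (cat (Nat.add_comm i (N + M + 1))).toLinearMap)) ∘ₗ
    consBar (LinearMap.mulLeft k (F.u j) ∘ₗ F.nakayama) (Nat.add_comm 1 (N + M))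

lemma lamCas_tmul (i : ℕ) (a : A) (w : T k A (N + M)) (b : T k A i) :
    F.lamCas f N i (a ⊗ₜ[k] w) b = ∑ j, F.formR (N + i)
      (lam (coX f) (show M + 1 + (N + i) = N + M + 1 + i by omega) (Nat.zero_add _)
        (((1 : A) ⊗ₜ[k] cat (Nat.add_comm i (N + M + 1)) (b ⊗ₜ[k]
          cat (Nat.add_comm 1 (N + M)) (letter (proj k A (F.u j * F.nakayama a)) ⊗ₜ[k] w))) ⊗ₜ[k]
            F.v j)) := by
  simp [lamCas]

lemma hat_lamRho {z : X k A (N + M)} (hz : F.IsCycle z) (i : ℕ) :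
    F.hat (lamRho (coX f) (F.casCoch z) i) =
      (-1 : k) ^ ((N + M + 1) * (i + 1)) • F.lamCas f N i z := by
  have e1 : - eps k 0 (N + M + 1) = (-1 : k) ^ (N + M + 1) := by rw [eps]; ring
  let S : Bar k A (N + M) →ₗ[k] T k A (N + M + 1) ⊗[k] A :=
    TensorProduct.map (consBar LinearMap.id (Nat.add_comm 1 (N + M))) LinearMap.id
  have e2 : sB (N + M + 1) (closeD k A (N + M + 1) (F.casCoch z nil)) =
      (-1 : k) ^ (N + M + 1) • S (F.cas (N + M) z) := by
    have e : ∀ x : Bar k A (N + M), x = -((-1 : k) ^ (N + M) • F.cas (N + M) z) →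
        S x = (-1 : k) ^ (N + M + 1) • S (F.cas (N + M) z) := by
      rintro x rfl
      rw [pow_succ, map_neg, LinearMap.map_smul S]
      module
    exact e _ (by rw [← hz.dB_cap, casCoch_nil]; rfl)
  refine LinearMap.ext fun b => ?_
  rw [hat_apply, lamRho, LinearMap.comp_apply, cap_apply]
  have e3 : rho (F.casCoch z) (Nat.add_zero i) (Nat.add_comm i (N + M + 1))
      (((1 : A) ⊗ₜ[k] b) ⊗ₜ[k] (1 : A)) = (-1 : k) ^ ((N + M + 1) * (i + 1)) •
        put (Nat.add_comm i (N + M + 1)) b (S (F.cas (N + M) z)) := by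
    conv_lhs => rw [← cat_nil_right (Nat.add_zero i) b]
    rw [rho_tmul, e2, e1, rm_one, one_smul, LinearMap.map_smul, smul_smul,
      ← pow_mul, ← pow_add, mul_add_one]
  rw [e3, LinearMap.map_smul, LinearMap.map_smul, LinearMap.smul_apply]
  congr 1
  clear e3 e2 hz
  induction z using TensorProduct.induction_on with
  | zero => simp only [TensorProduct.tmul_zero, TensorProduct.zero_tmul, map_zero, LinearMap.zero_apply, smul_zero]
  | add x y hx hy => simp only [map_add, LinearMap.add_apply, hx, hy]
  | tmul a w =>
    rw [lamCas_tmul, cas_tmul, map_sum, map_sum, map_sum, map_sum]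
    rfl

lemma descent_lamCas (hf : ∀ w, F.nakayama (f w) = f (actT F.nu w)) {i j : ℕ}
    (h : j + (N + i) = N + M) (h₁ : N + i + (1 + j) = N + M + 1) (z : X k A (N + M)) :
    F.descent N i (F.lamCas f N i z) = (-1 : k) ^ (N * i) •
      capL f rfl (dec h (cyc F.nuInv h₁ LinearMap.id) (iota z)) := by
  induction z using TensorProduct.induction_on with
  | zero => simp only [TensorProduct.tmul_zero, TensorProduct.zero_tmul, map_zero, LinearMap.zero_apply, smul_zero]
  | add x y hx hy => simp only [map_add, hx, hy, smul_add]
  | tmul a w =>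
    induction w using cat3_induction h (rfl : N + i = N + i) with
    | zero => simp only [TensorProduct.tmul_zero, TensorProduct.zero_tmul, map_zero, LinearMap.zero_apply, smul_zero]
    | add x y hx hy => simp only [TensorProduct.tmul_add, map_add, hx, hy, smul_add]
    | H x y w =>
      let ψ : T k A i →ₗ[k] X k A N := (TensorProduct.mk k A _).flip y ∘ₗ f ∘ₗ
        (cat (show i + (1 + j) = M + 1 by omega)).toLinearMap ∘ₗ
        (TensorProduct.mk k (T k A i) _).flip (cat rfl (letter (proj k A (F.nakayama a)) ⊗ₜ[k] x))
      have e : F.lamCas f N i (a ⊗ₜ[k] cat h (x ⊗ₜ[k] cat rfl (y ⊗ₜ[k] w))) =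
          (appendX (rfl : N + i = N + i) ∘ₗ (TensorProduct.mk k _ _).flip w) ∘ₗ ψ := by
        refine LinearMap.ext fun b => ?_
        let Φ : A →ₗ[k] X k A (N + i) := (TensorProduct.mk k A _).flip (cat rfl (y ⊗ₜ[k] w)) ∘ₗ f ∘ₗ
          (cat (show i + (1 + j) = M + 1 by omega)).toLinearMap ∘ₗ TensorProduct.mk k (T k A i) _ b ∘ₗ
          (cat rfl).toLinearMap ∘ₗ (TensorProduct.mk k _ _).flip x ∘ₗ letter.toLinearMap ∘ₗ proj k A
        have e1 : Φ (F.nakayama a) = (appendX (rfl : N + i = N + i) ∘ₗ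
            (TensorProduct.mk k _ _).flip w) (ψ b) := rfl
        have e3 : Φ (F.nakayama a) = ∑ l, Φ (F.form (F.v l) 1 • F.u l * F.nakayama a) := by
          rw [← map_sum, ← Finset.sum_mul, sum_form_one, one_mul]
        rw [LinearMap.comp_apply, ← e1, lamCas_tmul, e3]
        refine Finset.sum_congr rfl fun l _ => ?_
        rw [← cat_assoc (show 1 + j + (N + i) = N + M + 1 by omega) rfl _ h,
          ← cat_assoc (show M + 1 + (N + i) = N + M + 1 + i by omega)
            (show i + (1 + j) = M + 1 by omega) _ (show 1 + j + (N + i) = N + M + 1 by omega), lam_coX,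
          formR_tmul, smul_mul_assoc, LinearMap.map_smul, one_mul]
        rfl
      rw [e, descent_appendX, iota_tmul, dec_tmul, cyc_apply, LinearMap.id_apply, mapB_tmul,
        actX_tmul, mulB_tmul, tauS_tmul]
      have hf' : ∀ t, F.nuInv (f (actT F.nu t)) = f t := fun t => by
        rw [← hf, nuInv_apply, nakayamaInv_nakayama]
      have e2 : ψ (actT F.nu w) = f (actT F.nu (cat (show i + (1 + j) = M + 1 by omega)
          (w ⊗ₜ[k] cat rfl (letter (proj k A a) ⊗ₜ[k] actT F.nuInv x)))) ⊗ₜ[k] y := by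
        rw [actT_cat, actT_cat, actT_letter, actT_nu_nuInv]; rfl
      rw [e2, cap_apply, tauS_tmul, hf', cat_assoc h₁ rfl rfl (show i + (1 + j) = M + 1 by omega),
        map_one, mul_one, mul_one, one_mul, capL_tmul, mul_one]

/-- The linear extension of `rhoLam` to all chains. -/
def rhoCas (N i : ℕ) : X k A (N + M) →ₗ[k] (T k A i →ₗ[k] X k A (N + i)) :=
  (TensorProduct.mk k (X k A (N + M + 1)) (T k A i)).compr₂ (F.formR (N + i) ∘ₗ
    rho (coX f) (show N + i + (M + 1) = N + M + 1 + i by omega) (Nat.add_zero _) ∘ₗ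
    cap ∘ₗ appendX (rfl : N + M + 1 + i = N + M + 1 + i)) ∘ₗ F.casimirSnoc (N + M)

lemma hat_rhoLam (z : X k A (N + M)) (i : ℕ) :
    F.hat (rhoLam (coX f) (F.casCoch z) i) = F.rhoCas f N i z := by
  refine LinearMap.ext fun b => ?_
  rw [hat_apply, rhoLam, LinearMap.comp_apply, cap_apply]
  conv_lhs => rw [← cat_nil_left (Nat.zero_add i) b]
  rw [lam_tmul, casCoch_nil, one_smul]
  rfl

lemma descent_rhoCas {i j r : ℕ} (h' : i + j = r) (h : N + r = N + M) (h₁ : j + (1 + i) = M + 1)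
    (a : A) (x : T k A N) (y : T k A i) (w : T k A j) :
    F.descent N i (F.rhoCas f N i (a ⊗ₜ[k] cat h (x ⊗ₜ[k] cat h' (y ⊗ₜ[k] w)))) =
      (-1 : k) ^ ((M + 1) * (N + i) + N * i) • ∑ l, F.form (f (cat h₁ (w ⊗ₜ[k] cat rfl
        (letter (proj k A (F.v l)) ⊗ₜ[k] actT F.nu y)))) 1 • (F.nuInv (F.u l) * a) ⊗ₜ[k] x := by
  let ψ : T k A i →ₗ[k] X k A N := (-1 : k) ^ ((M + 1) * (N + i)) • ∑ l,
    (F.form.flip 1 ∘ₗ f ∘ₗ (cat h₁).toLinearMap ∘ₗ TensorProduct.mk k _ _ w ∘ₗ (cat rfl).toLinearMap ∘ₗ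
      TensorProduct.mk k _ (T k A i) (letter (proj k A (F.v l)))).smulRight
        ((F.u l * F.nakayama a) ⊗ₜ[k] x)
  have hψ : ∀ b, ψ b = (-1 : k) ^ ((M + 1) * (N + i)) • ∑ l, F.form (f (cat h₁ (w ⊗ₜ[k] cat rfl
        (letter (proj k A (F.v l)) ⊗ₜ[k] b)))) 1 • (F.u l * F.nakayama a) ⊗ₜ[k] x := fun b => by
    simp [ψ]
  have e : F.rhoCas f N i (a ⊗ₜ[k] cat h (x ⊗ₜ[k] cat h' (y ⊗ₜ[k] w))) =
      (appendX (rfl : N + i = N + i) ∘ₗ (TensorProduct.mk k _ _).flip y) ∘ₗ ψ := by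
    refine LinearMap.ext fun b => ?_
    have e1 : F.rhoCas f N i (a ⊗ₜ[k] cat h (x ⊗ₜ[k] cat h' (y ⊗ₜ[k] w))) b = ∑ l,
        F.formR (N + i) (rho (coX f) (show N + i + (M + 1) = N + M + 1 + i by omega) (Nat.add_zero _)
          (((F.u l * F.nakayama a) ⊗ₜ[k] cat (rfl : N + M + 1 + i = N + M + 1 + i)
            (cat (rfl : N + M + 1 = N + M + 1) (cat h (x ⊗ₜ[k] cat h' (y ⊗ₜ[k] w)) ⊗ₜ[k]
              letter (proj k A (F.v l))) ⊗ₜ[k] b)) ⊗ₜ[k] 1)) := by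
      simp [rhoCas, casimirSnoc, cap_apply]
    rw [e1, LinearMap.comp_apply, hψ, LinearMap.map_smul, map_sum, Finset.smul_sum]
    refine Finset.sum_congr rfl fun l _ => ?_
    rw [cat_assoc rfl rfl (show N + M + (1 + i) = N + M + 1 + i by omega) rfl,
      ← cat_assoc (show N + i + j = N + M by omega) rfl h h',
      cat_assoc (show N + M + (1 + i) = N + M + 1 + i by omega) (show N + i + j = N + M by omega)
        (show N + i + (M + 1) = N + M + 1 + i by omega) h₁, rho_coX, LinearMap.map_smul, formR_tmul,
        mul_one, LinearMap.map_smul]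
    rfl
  rw [e, descent_appendX, hψ]
  simp only [LinearMap.map_smul, map_sum, cap_apply, tauS_tmul, smul_smul, ← pow_add, map_mul, one_mul,
    nuInv_apply, nakayamaInv_nakayama, Nat.add_comm (N * i)]

end FrobeniusForm

section SplitSums

variable {V : Type u} [AddCommGroup V]

lemma sum_range_eq_sumAD (M : ℕ) (g : ℕ → V) :
    ∑ i ∈ Finset.range (M + 1), g i = sumAD M fun _ i _ => g i := by
  induction M with
  | zero => simp [sumAD]
  | succ M ih => rw [Finset.sum_range_succ, ih, sumAD_succ_left, add_comm]

lemma sumAD_split (M L : ℕ) (g : ∀ i j : ℕ, i + j = L + 1 + M → V) :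
    sumAD (L + 1 + M) g = (sumAD M fun i j h => g i (L + 1 + j) (by omega)) +
      sumAD L fun i l h => g (i + (M + 1)) l (by omega) := by
  induction M with
  | zero => exact sumAD_succ_left g
  | succ M ih =>
    refine (sumAD_succ_left (N := L + 1 + M) g).trans ?_
    rw [ih, sumAD_succ_left]
    exact (add_assoc _ _ _).symm

end SplitSums

namespace FrobeniusForm

variable {k A : Type u} [Field k] [Ring A] [Algebra k A] (F : FrobeniusForm k A)
  [FiniteDimensional k A] {M N L R : ℕ} (f : T k A (M + 1) →ₗ[k] A)

lemma sum_nuInv_u_tmul_v {V : Type u} [AddCommGroup V] [Module k V] (Φ : A →ₗ[k] A →ₗ[k] V) :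
    ∑ l, Φ (F.nuInv (F.u l)) (F.v l) = ∑ l, Φ (F.v l) (F.u l) := by
  have e1 : ∀ l, F.nuInv (F.u l) = ∑ j, F.form (F.u j) (F.u l) • F.v j := fun l => by
    simp [nuInv_apply, nakayamaInv]
  conv_lhs => enter [2, l]; rw [e1]
  conv_rhs => enter [2, l]; rw [← F.sum_form_u (F.u l)]
  simp only [map_sum, map_smul, LinearMap.sum_apply, LinearMap.smul_apply]
  exact Finset.sum_comm

/-- The word `a_{i+1} ⋯ a_r a₀ σ(a₁ ⋯ a_i)`, for `a₀ ⊗ a₁ ⋯ a_r`. -/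
def rotWord (σ : A →ₗ[k] A) (hσ : σ 1 = 1) {i j r s : ℕ} (h : i + j = r) (h₁ : j + 1 + i = s) :
    X k A r →ₗ[k] T k A s :=
  (cat h₁).toLinearMap ∘ₗ (TensorProduct.comm k (T k A i) (T k A (j + 1))).toLinearMap ∘ₗ
    TensorProduct.map (PiTensorProduct.map fun _ => barMap σ hσ)
      ((cat rfl).toLinearMap ∘ₗ
        TensorProduct.map LinearMap.id (letter.toLinearMap ∘ₗ proj k A)) ∘ₗ
    (TensorProduct.assoc k (T k A i) (T k A j) A).toLinearMap ∘ₗ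
    (TensorProduct.comm k A (T k A i ⊗[k] T k A j)).toLinearMap ∘ₗ
    TensorProduct.map LinearMap.id (cat h).symm.toLinearMap

lemma rotWord_tmul {i j r s : ℕ} (h : i + j = r) (h₁ : j + 1 + i = s) (h₂ : j + (1 + i) = s) (a : A)
    (y : T k A i) (w : T k A j) :
    rotWord F.nakayama F.nakayama_one h h₁ (a ⊗ₜ[k] cat h (y ⊗ₜ[k] w)) =
      cat h₂ (w ⊗ₜ[k] cat rfl (letter (proj k A a) ⊗ₜ[k] actT F.nu y)) := by
  simp only [rotWord, LinearMap.comp_apply, TensorProduct.map_tmul, LinearEquiv.coe_coe,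
    LinearEquiv.symm_apply_apply, TensorProduct.comm_tmul, TensorProduct.assoc_tmul,
    LinearMap.id_apply]
  exact cat_assoc _ _ _ _ _ _ _

/-- The contribution of one rotation to the operator `Δ^ν`. -/
def deltaTerm (i j : ℕ) (h : i + j = M) : T k A M →ₗ[k] A :=
  ∑ l, (F.form.flip 1 ∘ₗ f ∘ₗ rotWord F.nakayama F.nakayama_one h
    (show j + 1 + i = M + 1 by omega) ∘ₗ TensorProduct.mk k A (T k A M) (F.u l)).smulRight (F.v l)

lemma deltaNu_eq (w : T k A M) : F.deltaNu rfl f w =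
    ∑ i : Fin (M + 1), (-1 : k) ^ ((i + 1) * M) • F.deltaTerm f i (M - i) (by omega) w := by
  have e : ∀ x, connesWord F.nakayama F.nakayama_one (rfl : M + 1 = M + 1) x =
      ∑ i : Fin (M + 1), (-1 : k) ^ ((i + 1) * M) •
        rotWord F.nakayama F.nakayama_one (show (i : ℕ) + (M - i) = M by omega)
          (show M - i + 1 + (i : ℕ) = M + 1 by omega) x := fun x => by
    simp only [connesWord, LinearMap.sum_apply, LinearMap.smul_apply]
    rfl
  simp only [deltaNu, deltaTerm, LinearMap.coe_mk, AddHom.coe_mk, LinearMap.sum_apply,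
    LinearMap.smulRight_apply, LinearMap.comp_apply, e, map_sum, LinearMap.map_smul,
    Finset.sum_smul, Finset.smul_sum, TensorProduct.mk_apply]
  rw [Finset.sum_comm]
  simp only [smul_assoc]

lemma deltaTerm_mul {i j : ℕ} (h : i + j = M) (a : A) (x : T k A N) (w : T k A M) :
    (F.deltaTerm f i j h w * a) ⊗ₜ[k] x = (-1 : k) ^ ((M + 1) * (N + i) + N * i) •
      F.descent N i (F.rhoCas f N i (a ⊗ₜ[k] cat (rfl : N + M = N + M) (x ⊗ₜ[k] w))) := by
  induction w using cat_induction h with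
  | zero => simp
  | add y y' hy hy' =>
    simp only [TensorProduct.tmul_add, map_add, smul_add, add_mul, TensorProduct.add_tmul, hy, hy']
  | H y w =>
    have h₂ : j + (1 + i) = M + 1 := by omega
    rw [F.descent_rhoCas f h rfl h₂, smul_smul, neg_one_pow_mul_self, one_smul]
    let Φ : A →ₗ[k] A →ₗ[k] X k A N := ((LinearMap.lsmul k (X k A N)).flip.compl₁₂
      ((TensorProduct.mk k A _).flip x ∘ₗ LinearMap.mulRight k a) (F.form.flip 1 ∘ₗ f ∘ₗ
        (cat h₂).toLinearMap ∘ₗ TensorProduct.mk k _ _ w ∘ₗ (cat rfl).toLinearMap ∘ₗ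
        (TensorProduct.mk k _ (T k A i)).flip (actT F.nu y) ∘ₗ letter.toLinearMap ∘ₗ proj k A))
    refine Eq.trans ?_ (F.sum_nuInv_u_tmul_v Φ).symm
    simp only [deltaTerm, LinearMap.sum_apply, LinearMap.smulRight_apply, LinearMap.comp_apply,
      TensorProduct.mk_apply, F.rotWord_tmul h _ h₂, Finset.sum_mul, TensorProduct.sum_tmul]
    exact Finset.sum_congr rfl fun l _ => by rw [smul_mul_assoc, ← TensorProduct.smul_tmul']; rfl

lemma capL_deltaNu (z : X k A (N + M)) :
    (-1 : k) ^ (M * N) • capL (F.deltaNu rfl f) rfl z =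
      ∑ i ∈ Finset.range (M + 1), (-1 : k) ^ ((N + 1) * (i + 1) + M + 1) •
        F.descent N i (F.rhoCas f N i z) := by
  induction z using TensorProduct.induction_on with
  | zero => simp
  | add x y hx hy => simp only [map_add, smul_add, Finset.sum_add_distrib, hx, hy]
  | tmul a w =>
    induction w using cat_induction (rfl : N + M = N + M) with
    | zero => simp
    | add x y hx hy =>
      simp only [TensorProduct.tmul_add, map_add, smul_add, Finset.sum_add_distrib, hx, hy]
    | H x W =>
      rw [capL_tmul]
      rw [F.deltaNu_eq, Finset.sum_range, Finset.sum_mul, TensorProduct.sum_tmul, Finset.smul_sum]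
      refine Finset.sum_congr rfl fun i _ => ?_
      rw [smul_mul_assoc, ← TensorProduct.smul_tmul', F.deltaTerm_mul f, smul_smul, smul_smul,
        ← pow_add, ← pow_add, npow_congr (k := k) (b := (N + 1) * ((i : ℕ) + 1) + M + 1)
          (by ring_nf; omega)]

lemma sum_descent_lamRho (hf : ∀ w, F.nakayama (f w) = f (actT F.nu w)) {z : X k A (N + M)}
    (hz : F.IsCycle z) :
    ∑ i ∈ Finset.range (M + 1), (-1 : k) ^ ((N + 1) * (i + 1) + M) •
        F.descent N i (F.hat (lamRho (coX f) (F.casCoch z) i)) =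
      sumAD M fun j i h => (-1 : k) ^ ((N + M) * i) • capL f rfl
        (dec (show j + (N + i) = N + M by omega)
          (cyc F.nuInv (show N + i + (1 + j) = N + M + 1 by omega) LinearMap.id) (iota z)) := by
  rw [sum_range_eq_sumAD]
  refine sumAD_congr fun j i h => ?_
  rw [F.hat_lamRho f hz, LinearMap.map_smul, F.descent_lamCas f hf (show j + (N + i) = N + M by omega)
    (by omega), smul_smul, smul_smul, ← pow_add, ← pow_add,
    npow_congr (k := k) (b := (N + M) * i) (by ring_nf; omega)]

lemma capL_conX_zero (h : 0 + M = R) (h' : 0 + (M + 1) = R + 1) (z : X k A R) :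
    (-1 : k) ^ ((M + 1) * R) • capL f h' (conX F.nuInv z) =
      sumAD M fun j i h => (-1 : k) ^ (R * i) • capL f h'
        (dec (show j + (0 + i) = R by omega)
          (cyc F.nuInv (show 0 + i + (1 + j) = R + 1 by omega) LinearMap.id) (iota z)) := by
  obtain rfl : M = R := by omega
  rw [conX_eq, cycSum_apply, LinearMap.map_smul, map_sumAD, smul_smul, ← pow_add, smul_sumAD]
  refine sumAD_congr fun j i h => ?_
  have key : ∀ i', i = i' → ∀ (h₁ : j + i = M) (h₂ : i + (1 + j) = M + 1) (h₃ : j + i' = M)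
      (h₄ : i' + (1 + j) = M + 1), dec h₁ (cyc F.nuInv h₂ LinearMap.id) (iota z) =
        dec h₃ (cyc F.nuInv h₄ LinearMap.id) (iota z) := by
    rintro _ rfl _ _ _ _; rfl
  rw [LinearMap.map_smul, smul_smul, ← pow_add, key (0 + i) (Nat.zero_add i).symm _ _ _ (by omega),
    npow_congr (k := k) (b := M * i) (by obtain rfl : M = j + i := (by omega); ring_nf; omega)]

lemma capL_conX_succ (z : X k A (L + 1 + M)) :
    (-1 : k) ^ ((M + 1) * (L + 1 + M)) • capL f rfl (conX F.nuInv z) =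
      (sumAD M fun j i h => (-1 : k) ^ ((L + 1 + M) * i) • capL f rfl
        (dec (show j + (L + 1 + i) = L + 1 + M by omega)
          (cyc F.nuInv (show L + 1 + i + (1 + j) = L + 1 + M + 1 by omega) LinearMap.id) (iota z))) +
      sumAD L fun i l h => (-1 : k) ^ ((i + 1) * (L + 1 + M)) • capL f rfl
        (dec (show i + (M + 1) + l = L + 1 + M by omega)
          (cyc F.nuInv (show l + (1 + (i + (M + 1))) = L + 1 + M + 1 by omega) LinearMap.id)
          (iota z)) := by
  have e := conX_eq F.nuInv (N := L + 1 + M) z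
  rw [e, cycSum_apply, LinearMap.map_smul, map_sumAD, smul_smul, ← pow_add, smul_sumAD, sumAD_split]
  congr 1
  · refine sumAD_congr fun j i h => ?_
    rw [LinearMap.map_smul, smul_smul, ← pow_add,
      npow_congr (k := k) (b := (L + 1 + M) * i) (by obtain rfl : M = j + i := (by omega); ring_nf; omega)]
  · refine sumAD_congr fun i l h => ?_
    rw [LinearMap.map_smul, smul_smul, ← pow_add,
      npow_congr (k := k) (b := (i + 1) * (L + 1 + M)) (by ring_nf; omega)]

end FrobeniusForm

namespace FrobeniusForm

variable {k A : Type u} [Field k] [Ring A] [Algebra k A] (F : FrobeniusForm k A)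
  [FiniteDimensional k A] {M N L R : ℕ} {f : T k A (M + 1) →ₗ[k] A}

lemma psi_cas {m t p N' : ℕ} (x : T k A m →ₗ[k] X k A p) (h : m + t = N + 1) (h' : p + t = N')
    (z : X k A N) :
    psi x t h h' (F.cas N z) = F.cas N' (TensorProduct.map LinearMap.id (psiT x t h h') z) := by
  induction z using TensorProduct.induction_on with
  | zero => simp only [TensorProduct.tmul_zero, TensorProduct.zero_tmul, map_zero, LinearMap.zero_apply, smul_zero]
  | add x y hx hy => simp only [map_add, hx, hy]
  | tmul a w =>
    rw [TensorProduct.map_tmul, cas_tmul, cas_tmul, map_sum]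
    rfl

lemma casInv_insBd {z : X k A (N + M)} (hz : F.IsCycle z) :
    F.casInv N (insBd (coX f) (F.casCoch z) (cap ((1 : A) ⊗ₜ[k] nil))) = (-1 : k) ^ (N + M + 1) •
      TensorProduct.map LinearMap.id (psiT (coX f) N (show M + 1 + N = N + M + 1 by omega)
        (Nat.zero_add N)) z := by
  have e : dB (rfl : N + M + 1 = N + M + 1) (lam (F.casCoch z) (Nat.zero_add 0)
      (Nat.add_zero (N + M + 1)) (cap ((1 : A) ⊗ₜ[k] nil))) =
        (-1 : k) ^ (N + M + 1) • F.cas (N + M) z := by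
    rw [cap_apply, lam_cap_one, one_smul, casCoch_nil]
    refine hz.dB_cap.trans ?_
    rw [pow_succ, mul_neg_one, neg_smul]
  rw [insBd, LinearMap.comp_apply, LinearMap.comp_apply, e, LinearMap.map_smul, LinearMap.map_smul,
    psi_cas, casInv_cas]

lemma IsCycle.bdry_eq_zero {z : X k A R} (hz : F.IsCycle z) (r : ℕ) (h : r + 1 = R) :
    bdry F.nuInv h z = 0 := by
  subst h
  rw [← partialD_eq]
  exact (F.isCycle_succ_iff z).1 hz

lemma exists_partialD_eq_endSum (hf : Rel (coX f) 0) (hR : M + 1 + L = R) {z : X k A R}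
    (hz : F.IsCycle z) : ∃ y, F.partialD rfl y =
      (sumAD L fun i l h => (-1 : k) ^ (i * R) •
        dec (show i + (M + 1 + l) = R by omega) (cyc F.nuInv (show l + (1 + i) = L + 1 by omega)
          (endF (coX f) l)) (iota z)) +
      (-1 : k) ^ L • TensorProduct.map LinearMap.id (psiT (coX f) (L + 1)
        (show M + 1 + (L + 1) = R + 1 by omega) (Nat.zero_add (L + 1))) z := by
  subst hR
  refine ⟨cartanSum F.nuInv (coX f) L (iota z), ?_⟩
  rw [partialD_eq, exists_bdry_cartanSum F.nuInv hf L z hz.bdry_eq_zero, endSum]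
  congr 2
  rw [insF]
  clear hz
  induction z using TensorProduct.induction_on with
  | zero => simp only [TensorProduct.tmul_zero, TensorProduct.zero_tmul, map_zero, LinearMap.zero_apply, smul_zero]
  | add x y hx hy => simp only [map_add, hx, hy]
  | tmul a w => rw [iota_tmul, psi, mid_tmul, tauS_tmul, map_one, mul_one]; rfl

lemma sumAD_endF (hf : ∀ w, F.nakayama (f w) = f (actT F.nu w)) (h : L + (M + 1) = R)
    (h₁ : L + 1 + (M + 1) = R + 1) (z : X k A R) :
    (-1 : k) ^ R • (sumAD L fun i l h => (-1 : k) ^ (i * R) •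
      dec (show i + (M + 1 + l) = R by omega) (cyc F.nuInv (show l + (1 + i) = L + 1 by omega)
        (endF (coX f) l)) (iota z)) =
    (sumAD L fun i l h => (-1 : k) ^ ((i + 1) * R) • capL f h₁
      (dec (show i + (M + 1) + l = R by omega)
        (cyc F.nuInv (show l + (1 + (i + (M + 1))) = R + 1 by omega) LinearMap.id) (iota z))) -
    (-1 : k) ^ ((M + 1) * R) • conX F.nuInv (capL f h z) := by
  have hf' : ∀ w, F.nuInv (f w) = f (actT F.nuInv w) := fun w => by
    rw [← F.actT_nu_nuInv w, ← hf, nuInv_apply, nakayamaInv_nakayama, actT_nu_nuInv]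
  rw [eq_sub_iff_add_eq, conX_eq, cycSum_apply, smul_smul, ← pow_add, smul_sumAD, smul_sumAD, ← sumAD_add]
  refine sumAD_congr fun i l hi => ?_
  rw [capL_dec_cyc_lam F.nuInv hf' (show i + (M + 1 + l) = R by omega) _ _
    (show l + (1 + i) = L + 1 by omega)]
  have e : ∀ (K K' : Bar k A (M + 1 + l) →ₗ[k] Bar k A l) (x : Bar k A R),
      dec (show i + (M + 1 + l) = R by omega) (cyc F.nuInv (show l + (1 + i) = L + 1 by omega)
        (K - K')) x = dec (show i + (M + 1 + l) = R by omega)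
          (cyc F.nuInv (show l + (1 + i) = L + 1 by omega) K) x -
        dec (show i + (M + 1 + l) = R by omega)
          (cyc F.nuInv (show l + (1 + i) = L + 1 by omega) K') x := fun K K' x => by
    induction x using dec_induction (show i + (M + 1 + l) = R by omega) with
    | add x y hx hy => simp only [map_add, hx, hy]; abel
    | zero => simp
    | H => simp
  rw [endF, e, dec_cyc_rho F.nuInv f _ _ h hi, smul_sub, smul_sub, smul_smul, smul_smul, smul_smul,
    smul_smul, ← pow_add, ← pow_add, ← pow_add, add_comm R, ← add_one_mul,
    npow_congr (k := k) (a := (i + 1) * R + (M + 1) * l) (b := (M + 1) * R + L + i * L)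
      (by
        subst h hi
        have : M ^ 2 % 2 = M % 2 := by
          rw [pow_two, Nat.mul_mod]
          rcases Nat.mod_two_eq_zero_or_one M with h | h <;> simp [h]
        ring_nf
        omega), sub_add_cancel]

lemma sum_descent_rhoLam (z : X k A (N + M)) :
    ∑ i ∈ Finset.range (M + 1), (-1 : k) ^ ((N + 1) * (i + 1) + M) •
        F.descent N i (F.hat (rhoLam (coX f) (F.casCoch z) i)) =
      -((-1 : k) ^ (M * N) • capL (F.deltaNu rfl f) rfl z) := by
  rw [capL_deltaNu, ← Finset.sum_neg_distrib]
  refine Finset.sum_congr rfl fun i _ => ?_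
  rw [hat_rhoLam, pow_succ _ (_ + M)]
  module

lemma exists_brDescent_eq (hf : ∀ w, F.nakayama (f w) = f (actT F.nu w)) (hf₀ : Rel (coX f) 0)
    {z : X k A (N + M)} (hz : F.IsCycle z) :
    ∃ y, (-1 : k) ^ ((N + 1) * (M + 1)) • F.brDescent (coX f) z M =
      (sumAD M fun j i h => (-1 : k) ^ ((N + M) * i) • capL f rfl
        (dec (show j + (N + i) = N + M by omega)
          (cyc F.nuInv (show N + i + (1 + j) = N + M + 1 by omega) LinearMap.id) (iota z))) +
      (-1 : k) ^ (M * N) • capL (F.deltaNu rfl f) rfl z +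
      (-1 : k) ^ M • TensorProduct.map LinearMap.id (psiT (coX f) N
        (show M + 1 + N = N + M + 1 by omega) (Nat.zero_add N)) z + F.partialD rfl y := by
  obtain ⟨y, hy⟩ := F.exists_brDescent hf₀ hz M
  refine ⟨y, ?_⟩
  simp only [brTerm, smul_sub, Finset.sum_sub_distrib] at hy
  rw [sum_descent_lamRho F f hf hz, casInv_insBd F hz, sum_descent_rhoLam, smul_smul, ← pow_add,
    npow_congr (k := k) (a := N + 1 + (N + M + 1)) (b := M) (by omega), sub_neg_eq_add] at hy
  exact hy

lemma exists_curly_zero (hf : ∀ w, F.nakayama (f w) = f (actT F.nu w)) (hf₀ : Rel (coX f) 0)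
    {z : X k A (0 + M)} (hz : F.IsCycle z) :
    ∃ y, (-1 : k) ^ ((M + 1) * (0 + M)) • capL f rfl (conX F.nuInv z) +
        (-1 : k) ^ (M * 0) • capL (F.deltaNu rfl f) rfl z =
      (-1 : k) ^ ((0 + 1) * (M + 1)) • F.brDescent (coX f) z M + F.partialD rfl y := by
  obtain ⟨y, hy⟩ := F.exists_brDescent_eq hf hf₀ hz
  refine ⟨-y, ?_⟩
  rw [psiT_zero, TensorProduct.map_zero_right, LinearMap.zero_apply, smul_zero, add_zero] at hy
  rw [hy, capL_conX_zero F f rfl rfl, map_neg, add_neg_cancel_right]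

lemma exists_curly_succ (hf : ∀ w, F.nakayama (f w) = f (actT F.nu w)) (hf₀ : Rel (coX f) 0)
    (h : L + (M + 1) = L + 1 + M) {z : X k A (L + 1 + M)} (hz : F.IsCycle z) :
    ∃ y, (-1 : k) ^ ((M + 1) * (L + 1 + M)) • capL f rfl (conX F.nuInv z) +
        (-1 : k) ^ (M * (L + 1)) • capL (F.deltaNu rfl f) rfl z -
        (-1 : k) ^ ((M + 1) * (L + 1 + M)) • conX F.nuInv (capL f h z) =
      (-1 : k) ^ ((L + 1 + 1) * (M + 1)) • F.brDescent (coX f) z M + F.partialD rfl y := by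
  obtain ⟨y, hy⟩ := F.exists_brDescent_eq hf hf₀ hz
  obtain ⟨y', hy'⟩ := F.exists_partialD_eq_endSum hf₀ (show M + 1 + L = L + 1 + M by omega) hz
  have e1 := F.sumAD_endF hf h rfl z
  have e2 := F.capL_conX_succ f z
  have e3 : TensorProduct.map LinearMap.id (psiT (coX f) (L + 1)
        (show M + 1 + (L + 1) = L + 1 + M + 1 by omega) (Nat.zero_add (L + 1))) z =
      (-1 : k) ^ L • (F.partialD rfl y' - sumAD L fun i l h => (-1 : k) ^ (i * (L + 1 + M)) •
        dec (show i + (M + 1 + l) = L + 1 + M by omega)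
          (cyc F.nuInv (show l + (1 + i) = L + 1 by omega) (endF (coX f) l)) (iota z)) := by
    rw [hy', add_sub_cancel_left, smul_smul, neg_one_pow_mul_self, one_smul]
  refine ⟨-(y + (-1 : k) ^ (L + M) • y'), ?_⟩
  have hs : (-1 : k) ^ (L + 1 + M) = - (-1 : k) ^ (L + M) := by
    rw [show L + 1 + M = L + M + 1 by omega, pow_succ, mul_neg_one]
  rw [hs] at e1
  rw [hy, e2, add_sub_right_comm, add_sub_assoc, ← e1, e3, smul_smul, ← pow_add, Nat.add_comm M L,
    map_neg, map_add, LinearMap.map_smul]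
  module

end FrobeniusForm

section Equivariance

variable {k A : Type u} [Field k] [Ring A] [Algebra k A] (σ : A →ₐ[k] A) {l m r s : ℕ}

lemma rotWord_actX {i j : ℕ} (h : i + j = r) (h₁ : j + 1 + i = s) (x : X k A r) :
    FrobeniusForm.rotWord σ.toLinearMap (map_one σ) h h₁ (actX σ x) =
      actT σ (FrobeniusForm.rotWord σ.toLinearMap (map_one σ) h h₁ x) := by
  have e : ∀ a (y : T k A i) (w : T k A j),
      FrobeniusForm.rotWord σ.toLinearMap (map_one σ) h h₁ (a ⊗ₜ[k] cat h (y ⊗ₜ[k] w)) =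
        cat h₁ (cat rfl (w ⊗ₜ[k] letter (proj k A a)) ⊗ₜ[k] actT σ y) := fun a y w => by
    simp only [FrobeniusForm.rotWord, LinearMap.comp_apply, TensorProduct.map_tmul,
      LinearEquiv.coe_coe, LinearEquiv.symm_apply_apply, TensorProduct.comm_tmul,
      TensorProduct.assoc_tmul, LinearMap.id_apply]
    rfl
  induction x using TensorProduct.induction_on with
  | zero => simp only [TensorProduct.tmul_zero, TensorProduct.zero_tmul, map_zero, LinearMap.zero_apply, smul_zero]
  | add x y hx hy => simp only [map_add, hx, hy]
  | tmul a w =>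
    induction w using cat_induction h with
    | zero => simp only [TensorProduct.tmul_zero, TensorProduct.zero_tmul, map_zero, LinearMap.zero_apply, smul_zero]
    | add x y hx hy => simp only [TensorProduct.tmul_add, map_add, hx, hy]
    | H y w => simp [e]

lemma connesWord_actX (h : r + 1 = s) (x : X k A r) :
    FrobeniusForm.connesWord σ.toLinearMap (map_one σ) h (actX σ x) =
      actT σ (FrobeniusForm.connesWord σ.toLinearMap (map_one σ) h x) := by
  have e : ∀ x, FrobeniusForm.connesWord σ.toLinearMap (map_one σ) h x =
      ∑ i : Fin (r + 1), (-1 : k) ^ (((i : ℕ) + 1) * r) •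
        FrobeniusForm.rotWord σ.toLinearMap (map_one σ) (show (i : ℕ) + (r - i) = r by omega)
          (show r - i + 1 + (i : ℕ) = s by omega) x := fun x => by
    simp only [FrobeniusForm.connesWord, LinearMap.sum_apply, LinearMap.smul_apply]
    rfl
  rw [e, e, map_sum]
  exact Finset.sum_congr rfl fun i _ => by rw [rotWord_actX, LinearMap.map_smul]

lemma conX_actX (x : X k A r) : conX σ (actX σ x) = actX σ (conX σ x) := by
  rw [conX, LinearMap.comp_apply, connesWord_actX, LinearMap.comp_apply, TensorProduct.mk_apply,
    TensorProduct.mk_apply, actX_tmul, map_one]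

variable {σ} in
lemma capL_actX {f : T k A m →ₗ[k] A} (hf : ∀ w, σ (f w) = f (actT σ w)) (h : l + m = r)
    (x : X k A r) : capL f h (actX σ x) = actX σ (capL f h x) := by
  induction x using TensorProduct.induction_on with
  | zero => simp only [TensorProduct.tmul_zero, TensorProduct.zero_tmul, map_zero, LinearMap.zero_apply, smul_zero]
  | add x y hx hy => simp only [map_add, hx, hy]
  | tmul a w =>
    induction w using cat_induction h with
    | zero => simp only [TensorProduct.tmul_zero, TensorProduct.zero_tmul, map_zero, LinearMap.zero_apply, smul_zero]
    | add x y hx hy => simp only [TensorProduct.tmul_add, map_add, hx, hy]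
    | H y w => rw [actX_tmul, actT_cat, capL_tmul, capL_tmul, actX_tmul, map_mul, hf]

end Equivariance

namespace FrobeniusForm

variable {k A : Type u} [Field k] [Ring A] [Algebra k A] (F : FrobeniusForm k A)
  [FiniteDimensional k A] {L M N R : ℕ}

lemma deltaNu_equivariant {f : T k A (M + 1) →ₗ[k] A}
    (hf : ∀ w, F.nakayama (f w) = f (actT F.nu w)) (w : T k A M) :
    F.nakayama (F.deltaNu rfl f w) = F.deltaNu rfl f (actT F.nu w) := by
  refine F.eq_of_form_left fun a => ?_
  rw [← F.nakayama_nakayamaInv a, form_nu, form_deltaNu, form_deltaNu]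
  have e := connesWord_actX F.nu (rfl : M + 1 = M + 1) (F.nakayamaInv a ⊗ₜ[k] w)
  have e1 : connesWord F.nakayama F.nakayama_one (rfl : M + 1 = M + 1)
      (F.nakayama (F.nakayamaInv a) ⊗ₜ[k] actT F.nu w) =
      actT F.nu (connesWord F.nakayama F.nakayama_one (rfl : M + 1 = M + 1)
        (F.nakayamaInv a ⊗ₜ[k] w)) := e
  rw [e1, ← hf]
  refine (F.form_nu _ 1).symm.trans ?_
  rw [F.nakayama_one]

lemma nuInv_equivariant {f : T k A M →ₗ[k] A} (hf : ∀ w, F.nakayama (f w) = f (actT F.nu w))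
    (w : T k A M) : F.nuInv (f w) = f (actT F.nuInv w) := by
  rw [← F.actT_nu_nuInv w, ← hf, nuInv_apply, nakayamaInv_nakayama, actT_nu_nuInv]

lemma curly_eq {r s t q r' s' : ℤ} (h : r + s - 1 = t) (hq : r + s = q) (hr : r' + 1 = r)
    (hs : s' + 1 = s) (α : D k A r) (β : D k A s) : F.curly r s t h α β =
      (r * s + r + s).negOnePow •
        ((r + 1).negOnePow • F.deltaHat q t (by omega) (F.star r s q hq α β)
          + r.negOnePow • F.star r' s t (by omega) (F.deltaHat r r' hr α) β
          + F.star r s' t (by omega) α (F.deltaHat s s' hs β)) := by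
  subst hq
  obtain rfl : r' = r - 1 := by omega
  obtain rfl : s' = s - 1 := by omega
  rfl

lemma curlyB_eq {r s t q r' s' : ℤ} (h : r + s - 1 = t) (hq : r + s = q) (hr : r' + 1 = r)
    (hs : s' + 1 = s) (α : D k A r) (β : D k A s) : F.curlyB r s t h α β =
      (r * s + r + s).negOnePow •
        ((s + 1).negOnePow • F.connesHat q t (by omega) (F.star r s q hq α β)
          + r.negOnePow • F.star r' s t (by omega) (F.deltaHat r r' hr α) β
          + s.negOnePow • F.star r s' t (by omega) α (F.connesHat s s' hs β)) := by
  subst hq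
  obtain rfl : r' = r - 1 := by omega
  obtain rfl : s' = s - 1 := by omega
  rfl

/-- The bracket `{f, z}` in degree `-1`. -/
def curlyZero (f : T k A (M + 1) →ₗ[k] A) (z : X k A (0 + M)) : X k A 0 :=
  (-1 : k) ^ ((M + 1) * (0 + M)) • capL f rfl (conX F.nuInv z) +
    (-1 : k) ^ (M * 0) • capL (F.deltaNu rfl f) rfl z

/-- The bracket `{f, z}` in the degrees below `-1`. -/
def curlySucc (f : T k A (M + 1) →ₗ[k] A) (z : X k A (L + 1 + M)) : X k A (L + 1) :=
  (-1 : k) ^ ((M + 1) * (L + 1 + M)) • capL f rfl (conX F.nuInv z) +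
    (-1 : k) ^ (M * (L + 1)) • capL (F.deltaNu rfl f) rfl z -
      (-1 : k) ^ ((M + 1) * (L + 1 + M)) • conX F.nuInv (capL f (by omega) z)

lemma map_negOnePow_smul {V W : Type*} [AddCommGroup V] [AddCommGroup W] [Module k V] [Module k W]
    (φ : V →ₗ[k] W) (z : ℤ) (v : V) : φ (z.negOnePow • v) = z.negOnePow • φ v := by
  rw [Units.smul_def, map_zsmul, Units.smul_def]

lemma exists_sq_eq (M : ℕ) : ∃ c : ℤ, (M : ℤ) * M = M + 2 * c := by
  obtain ⟨c, hc⟩ := Nat.even_mul_succ_self M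
  exact ⟨c - M, by push_cast [← @Nat.cast_inj ℤ] at hc; linear_combination hc⟩

variable (f : T k A (M + 1) →ₗ[k] A)

lemma smul_curlyZero (z : X k A (0 + M)) {e e₁ e₂ e₃ : ℤ}
    (he : e = Int.ofNat (M + 1) * Int.negSucc (0 + M) + Int.ofNat (M + 1) + Int.negSucc (0 + M))
    (h₁ : e₁ = Int.ofNat (M + 1)) (h₂ : e₂ = Int.negSucc (0 + M)) :
    e.negOnePow • (e₃.negOnePow • (0 : X k A 0) + e₁.negOnePow • capL (F.deltaNu rfl f) rfl z +
      e₂.negOnePow • capL f rfl (conX F.nuInv z)) = F.curlyZero f z := by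
  obtain ⟨c, hc⟩ := exists_sq_eq M
  rw [smul_zero e₃.negOnePow, zero_add (e₁.negOnePow • capL (F.deltaNu rfl f) rfl z), smul_add,
    smul_smul, smul_smul, ← Int.negOnePow_add, ← Int.negOnePow_add, curlyZero,
    negOnePow_smul (k := k) (z := e + e₂) (n := (M + 1) * (0 + M)),
    negOnePow_smul (k := k) (z := e + e₁) (n := M * 0)]
  · exact add_comm _ _
  · exact ⟨-c - M, by
      rw [he, h₁]
      simp only [Int.ofNat_eq_natCast, Int.negSucc_eq]
      push_cast
      linear_combination -hc⟩
  · exact ⟨-2 * c - 3 * M - 1, by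
      rw [he, h₂]
      simp only [Int.ofNat_eq_natCast, Int.negSucc_eq]
      push_cast
      linear_combination (-2) * hc⟩

lemma smul_curlySucc (z : X k A (L + 1 + M)) {e e₁ e₂ e₃ : ℤ} (he : e = Int.ofNat (M + 1) *
      Int.negSucc (L + 1 + M) + Int.ofNat (M + 1) + Int.negSucc (L + 1 + M))
    (h₃ : ∃ c, e₃ = Int.negSucc (L + 1 + M) + 1 + 2 * c)
    (h₁ : e₁ = Int.ofNat (M + 1)) (h₂ : e₂ = Int.negSucc (L + 1 + M)) :
    e.negOnePow • (e₃.negOnePow • conX F.nuInv (capL f (by omega) z) +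
      e₁.negOnePow • capL (F.deltaNu rfl f) rfl z +
      e₂.negOnePow • capL f rfl (conX F.nuInv z)) = F.curlySucc f z := by
  obtain ⟨c, hc⟩ := exists_sq_eq M
  obtain ⟨d, h₃⟩ := h₃
  rw [smul_add, smul_add, smul_smul, smul_smul, smul_smul, ← Int.negOnePow_add,
    ← Int.negOnePow_add, ← Int.negOnePow_add, curlySucc,
    negOnePow_smul (k := k) (z := e + e₂) (n := (M + 1) * (L + 1 + M)),
    negOnePow_smul (k := k) (z := e + e₁) (n := M * (L + 1)),
    negOnePow_smul (k := k) (z := e + e₃) (n := (M + 1) * (L + 1 + M) + 1),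
    pow_succ _ ((M + 1) * (L + 1 + M))]
  · module
  · exact ⟨-(M + 1) * (L + M + 1) - (L + M + 2) + d, by
      rw [he, h₃]
      simp only [Int.ofNat_eq_natCast, Int.negSucc_eq]
      push_cast
      ring⟩
  · exact ⟨-M * L - 2 * M - L - 1 - c, by
      rw [he, h₁]
      simp only [Int.ofNat_eq_natCast, Int.negSucc_eq]
      push_cast
      linear_combination -hc⟩
  · exact ⟨-(M + 1) * (L + M + 1) - (L + M + 2), by
      rw [he, h₂]
      simp only [Int.ofNat_eq_natCast, Int.negSucc_eq]
      push_cast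
      ring⟩

lemma curly_zero (z : X k A (0 + M))
    (h : Int.ofNat (M + 1) + Int.negSucc (0 + M) - 1 = Int.negSucc 0) :
    F.curly (Int.ofNat (M + 1)) (Int.negSucc (0 + M)) (Int.negSucc 0) h f z = F.curlyZero f z := by
  refine (F.curly_eq h (q := Int.ofNat 0) (r' := Int.ofNat M) (s' := Int.negSucc (0 + M + 1))
    (by rw [← sub_add_cancel (_ + _) 1, h]; rfl) rfl (by omega) _ _).trans ?_
  let W : X k A (0 + M + 1) := conX F.nuInv z
  change (Int.ofNat (M + 1) * Int.negSucc (0 + M) + Int.ofNat (M + 1) + Int.negSucc (0 + M)).negOnePow •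
    ((Int.ofNat (M + 1) + 1).negOnePow • (0 : X k A 0) + (Int.ofNat (M + 1)).negOnePow •
      capL (F.deltaNu rfl f) rfl z + capL f rfl ((Int.negSucc (0 + M)).negOnePow • W)) = _
  rw [map_negOnePow_smul]
  exact F.smul_curlyZero f z rfl rfl rfl

lemma curlyB_zero (z : X k A (0 + M))
    (h : Int.ofNat (M + 1) + Int.negSucc (0 + M) - 1 = Int.negSucc 0) :
    F.curlyB (Int.ofNat (M + 1)) (Int.negSucc (0 + M)) (Int.negSucc 0) h f z = F.curlyZero f z := by
  refine (F.curlyB_eq h (q := Int.ofNat 0) (r' := Int.ofNat M) (s' := Int.negSucc (0 + M + 1))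
    (by rw [← sub_add_cancel (_ + _) 1, h]; rfl) rfl (by omega) _ _).trans ?_
  let W : X k A (0 + M + 1) := conX F.nuInv z
  change (Int.ofNat (M + 1) * Int.negSucc (0 + M) + Int.ofNat (M + 1) + Int.negSucc (0 + M)).negOnePow •
    ((Int.negSucc (0 + M) + 1).negOnePow • (0 : X k A 0) + (Int.ofNat (M + 1)).negOnePow •
      capL (F.deltaNu rfl f) rfl z + (Int.negSucc (0 + M)).negOnePow • capL f rfl W) = _
  exact F.smul_curlyZero f z rfl rfl rfl

lemma curly_succ (z : X k A (L + 1 + M))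
    (h : Int.ofNat (M + 1) + Int.negSucc (L + 1 + M) - 1 = Int.negSucc (L + 1)) :
    F.curly (Int.ofNat (M + 1)) (Int.negSucc (L + 1 + M)) (Int.negSucc (L + 1)) h f z =
      F.curlySucc f z := by
  refine (F.curly_eq h (q := Int.negSucc L) (r' := Int.ofNat M) (s' := Int.negSucc (L + 1 + M + 1))
    (by omega) rfl (by omega) _ _).trans ?_
  let W : X k A (L + 1 + M + 1) := conX F.nuInv z
  let V : X k A (L + 1) := conX F.nuInv (capL f (by omega) z)
  change (Int.ofNat (M + 1) * Int.negSucc (L + 1 + M) + Int.ofNat (M + 1) +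
      Int.negSucc (L + 1 + M)).negOnePow •
    ((Int.ofNat (M + 1) + 1).negOnePow • ((Int.negSucc L).negOnePow • V) +
      (Int.ofNat (M + 1)).negOnePow •
      capL (F.deltaNu rfl f) rfl z + capL f rfl ((Int.negSucc (L + 1 + M)).negOnePow • W)) = _
  rw [map_negOnePow_smul, smul_smul, ← Int.negOnePow_add]
  refine F.smul_curlySucc f z rfl ⟨M + 1, ?_⟩ rfl rfl
  simp only [Int.ofNat_eq_natCast, Int.negSucc_eq]
  push_cast
  ring

lemma curlyB_succ (z : X k A (L + 1 + M))
    (h : Int.ofNat (M + 1) + Int.negSucc (L + 1 + M) - 1 = Int.negSucc (L + 1)) :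
    F.curlyB (Int.ofNat (M + 1)) (Int.negSucc (L + 1 + M)) (Int.negSucc (L + 1)) h f z =
      F.curlySucc f z := by
  refine (F.curlyB_eq h (q := Int.negSucc L) (r' := Int.ofNat M) (s' := Int.negSucc (L + 1 + M + 1))
    (by omega) rfl (by omega) _ _).trans ?_
  let W : X k A (L + 1 + M + 1) := conX F.nuInv z
  let V : X k A (L + 1) := conX F.nuInv (capL f (by omega) z)
  change (Int.ofNat (M + 1) * Int.negSucc (L + 1 + M) + Int.ofNat (M + 1) +
      Int.negSucc (L + 1 + M)).negOnePow •
    ((Int.negSucc (L + 1 + M) + 1).negOnePow • V +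
      (Int.ofNat (M + 1)).negOnePow • capL (F.deltaNu rfl f) rfl z +
      (Int.negSucc (L + 1 + M)).negOnePow • capL f rfl W) = _
  exact F.smul_curlySucc f z rfl ⟨0, by ring⟩ rfl rfl

/-- The bracket `{f, z}` in negative degrees. -/
def curlyX : ∀ {N : ℕ}, X k A (N + M) → X k A N
  | 0 => F.curlyZero f
  | _ + 1 => F.curlySucc f

lemma curly_negSucc (z : X k A (N + M))
    (h : Int.ofNat (M + 1) + Int.negSucc (N + M) - 1 = Int.negSucc N) :
    F.curly (Int.ofNat (M + 1)) (Int.negSucc (N + M)) (Int.negSucc N) h f z = F.curlyX f z := by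
  cases N with
  | zero => exact F.curly_zero f z h
  | succ L => exact F.curly_succ f z h

lemma curlyB_negSucc (z : X k A (N + M))
    (h : Int.ofNat (M + 1) + Int.negSucc (N + M) - 1 = Int.negSucc N) :
    F.curlyB (Int.ofNat (M + 1)) (Int.negSucc (N + M)) (Int.negSucc N) h f z = F.curlyX f z := by
  cases N with
  | zero => exact F.curlyB_zero f z h
  | succ L => exact F.curlyB_succ f z h

lemma curly_eq_curlyB {m n : ℕ} (hm : 1 ≤ m) (hmn : m ≤ n) {t : ℤ} (h : (m : ℤ) + -n - 1 = t)
    (f : D k A m) (z : D k A (-n)) : F.curly m (-n) t h f z = F.curlyB m (-n) t h f z := by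
  obtain ⟨M, rfl⟩ : ∃ M, m = M + 1 := ⟨m - 1, by omega⟩
  obtain ⟨N, rfl⟩ : ∃ N, n = N + M + 1 := ⟨n - (M + 1), by omega⟩
  obtain rfl : t = Int.negSucc N := by omega
  exact (F.curly_negSucc f z h).trans (F.curlyB_negSucc f z h).symm

variable {f}

lemma exists_curlyX_eq (hf : ∀ w, F.nakayama (f w) = f (actT F.nu w)) (hf₀ : Rel (coX f) 0)
    {z : X k A (N + M)} (hz : F.IsCycle z) :
    ∃ y, F.curlyX f z = (-1 : k) ^ ((N + 1) * (M + 1)) • F.brDescent (coX f) z M +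
      F.partialD rfl y := by
  cases N with
  | zero => exact F.exists_curly_zero hf hf₀ hz
  | succ L => exact F.exists_curly_succ hf hf₀ (by omega) hz

lemma actX_curlyX (hf : ∀ w, F.nakayama (f w) = f (actT F.nu w)) {z : X k A (N + M)}
    (hz : actX F.nuInv z = z) : actX F.nuInv (F.curlyX f z) = F.curlyX f z := by
  have h1 := F.nuInv_equivariant hf
  have h2 := F.nuInv_equivariant (F.deltaNu_equivariant hf)
  cases N with
  | zero =>
    change actX F.nuInv (F.curlyZero f z) = F.curlyZero f z
    rw [curlyZero, map_add, LinearMap.map_smul, LinearMap.map_smul, ← capL_actX h1, ← conX_actX,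
      ← capL_actX h2, hz]
  | succ L =>
    change actX F.nuInv (F.curlySucc f z) = F.curlySucc f z
    rw [curlySucc, map_sub, map_add, LinearMap.map_smul, LinearMap.map_smul, LinearMap.map_smul,
      ← capL_actX h1, ← conX_actX, ← conX_actX, ← capL_actX h1, ← capL_actX h2, hz]

lemma isCycle_curlyX (hf : ∀ w, F.nakayama (f w) = f (actT F.nu w)) (hf₀ : Rel (coX f) 0)
    {z : X k A (N + M)} (hz : F.IsCycle z) : F.IsCycle (F.curlyX f z) ∧
      ∀ (hm : 1 ≤ M + 1) (hr : M + 1 + 1 = M + 1 + 1)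
        (hs : 0 + (N + M + 1 + 1) = N + M + 1 + 1) (h : N + M + 1 + 1 = N + M + 1 + 1)
        (h' : N + 1 + (M + 1) = N + M + 1 + 1),
        F.kappaChain h' (F.curlyX f z) -
          sgBracket hm le_rfl hr hs (show T k A (M + 1) →ₗ[k] B k A 0 from f)
          (F.kappaChain (p := 1) h z) ∈ BExt k A (M + 1) (N + M + 1 + 1) := by
  obtain ⟨y, hy⟩ := F.exists_curlyX_eq hf hf₀ hz
  rw [hy]
  have hd := F.isCycle_partialD y
  refine ⟨?_, fun hm hr hs h h' => ?_⟩
  · have h1 := (F.isCycle_brDescent hf₀ hz (Nat.succ_pos M) rfl (Nat.zero_add _) rfl (by omega)).1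
    rw [IsCycle, map_add, map_add, LinearMap.map_smul, LinearMap.map_smul,
      show d k A N (F.cas N (F.brDescent (coX f) z M)) = 0 from h1,
      show d k A N (F.cas N (F.partialD rfl y)) = 0 from hd, smul_zero, add_zero]
  · have h1 := (F.isCycle_brDescent hf₀ hz hm hr hs h h').2
    rw [closeD_coX] at h1
    rw [map_add, LinearMap.map_smul, add_sub_right_comm, ← neg_sub]
    exact Submodule.add_mem _ (Submodule.neg_mem _ h1) (F.kappaChain_partialD h' y)

lemma mem_D1_negSucc_iff (hdiag : ⨆ μ : k, Module.End.eigenspace F.nakayama μ = ⊤)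
    (x : X k A N) : (show D k A (Int.negSucc N) from x) ∈ F.D1 (Int.negSucc N) ↔
      actX F.nuInv x = x := by
  rw [F.mem_D1_negSucc hdiag, LinearMap.sub_apply, LinearMap.id_apply, sub_eq_zero, eq_comm]

/-- The bracket `{f, z}` of cocycles of `𝒟_(1)` is a cocycle of `𝒟_(1)`, and `κ` carries it to
`[f, κ(z)]_sg` up to a coboundary. -/
lemma curly_mem_Z1 (hdiag : ⨆ μ : k, Module.End.eigenspace F.nakayama μ = ⊤) {m n : ℕ}
    (hm : 1 ≤ m) (hmn : m ≤ n) {t : ℤ} (h : (m : ℤ) + -n - 1 = t) {f : D k A m} {z : D k A (-n)}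
    (hf : f ∈ F.Z1 m) (hz : z ∈ F.Z1 (-n)) (h₁ : ((1 : ℕ) : ℤ) - -n = (n + 1 : ℕ))
    (h₂ : (m : ℤ) - t = (n + 1 : ℕ)) :
    F.curly m (-n) t h f z ∈ F.Z1 t ∧
      F.kappa t m (n + 1) h₂ (F.curly m (-n) t h f z) -
        sgBracket hm le_rfl rfl (Nat.zero_add (n + 1)) (toCoch m f) (F.kappa (-n) 1 (n + 1) h₁ z) ∈
        BExt k A m (n + 1) := by
  obtain ⟨M, rfl⟩ : ∃ M, m = M + 1 := ⟨m - 1, by omega⟩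
  obtain ⟨N, rfl⟩ : ∃ N, n = N + M + 1 := ⟨n - (M + 1), by omega⟩
  obtain rfl : t = Int.negSucc N := by omega
  let g : T k A (M + 1) →ₗ[k] A := f
  have h1 : ∀ w, F.nakayama (g w) = g (actT F.nu w) := (F.mem_D1_ofNat hdiag f).1 hf.1
  have h2 : Rel (coX g) 0 := rel_zero_of_mem_ZExt (by
    rw [closeD_coX]; exact (F.mem_ZExt_toCoch f).2 hf.2)
  have h3 : F.IsCycle (N := N + M) z := (F.mem_Z_negSucc z).1 hz.2
  have h4 : actX F.nuInv (N := N + M) z = z := (F.mem_D1_negSucc_iff hdiag z).1 hz.1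
  have e : F.curly (M + 1 : ℕ) (-(N + M + 1 : ℕ)) (Int.negSucc N) h f z = F.curlyX g z :=
    F.curly_negSucc g z h
  rw [e]
  have h5 := F.isCycle_curlyX h1 h2 h3
  exact ⟨⟨(F.mem_D1_negSucc_iff hdiag _).2 (F.actX_curlyX h1 h4), (F.mem_Z_negSucc _).2 h5.1⟩,
    h5.2 hm rfl (Nat.zero_add _) rfl (by omega)⟩

end FrobeniusForm

end TateHochschild

end

theorem mainTheorem7 {k A : Type u} [Field k] [Ring A] [Algebra k A] [FiniteDimensional k A]
    (F : FrobeniusForm k A) (hdiag : ⨆ μ : k, Module.End.eigenspace F.nakayama μ = ⊤)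
    (m n : ℕ) (hm : 1 ≤ m) (hmn : m ≤ n) :
    -- the two expressions for the bracket `{f, z}` agree
    (∀ (f : FrobeniusForm.D k A m) (z : FrobeniusForm.D k A (-n)),
      F.curly m (-n) (m - n - 1) (by ring) f z = F.curlyB m (-n) (m - n - 1) (by ring) f z) ∧
    ∃ (curly : F.HH1 m →ₗ[k] F.HH1 (-n) →ₗ[k] F.HH1 (m - n - 1))
      (jm : F.HH1 m ≃ₗ[k] Ext k A m 0)
      (jn : F.HH1 (-n) ≃ₗ[k] F.HH (-n))
      (jt : F.HH1 (m - n - 1) ≃ₗ[k] F.HH (m - n - 1))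
      (κn : F.HH (-n) ≃ₗ[k] Ext k A 1 (n + 1))
      (κt : F.HH (m - n - 1) ≃ₗ[k] Ext k A m (n + 1))
      (sg : Ext k A m 0 →ₗ[k] Ext k A 1 (n + 1) →ₗ[k] Ext k A m (n + 1))
      (tm : Ext k A m 0 ≃ₗ[k] ExtSg k A m)
      (tn : Ext k A 1 (n + 1) ≃ₗ[k] ExtSg k A (-n))
      (tt : Ext k A m (n + 1) ≃ₗ[k] ExtSg k A (m - n - 1))
      (SG : ExtSg k A m →ₗ[k] ExtSg k A (-n) →ₗ[k] ExtSg k A (m - n - 1)),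
      -- the bracket of the first row is induced by `{ , }`
      Induces₂ (F.clsHH1 m) (F.clsHH1 (-n)) (F.clsHH1 (m - n - 1))
        (F.curly m (-n) (m - n - 1) (by ring)) (fun x y => curly x y) ∧
      -- the upper vertical maps are induced by the inclusion of the subcomplex
      Induces (F.clsHH1 m) (extClass k A m 0) (FrobeniusForm.toCoch m) jm ∧
      Induces (F.clsHH1 (-n)) (F.clsHH (-n)) id jn ∧
      Induces (F.clsHH1 (m - n - 1)) (F.clsHH (m - n - 1)) id jt ∧
      -- the maps `κ`
      Induces (F.clsHH (-n)) (extClass k A 1 (n + 1))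
        (F.kappa (-n) 1 (n + 1) (by push_cast; ring)) κn ∧
      Induces (F.clsHH (m - n - 1)) (extClass k A m (n + 1))
        (F.kappa (m - n - 1) m (n + 1) (by push_cast; ring)) κt ∧
      -- the bracket of the third row is induced by `[ , ]_sg`
      Induces₂ (extClass k A m 0) (extClass k A 1 (n + 1)) (extClass k A m (n + 1))
        (sgBracket hm le_rfl rfl (Nat.zero_add (n + 1))) (fun x y => sg x y) ∧
      -- the lower vertical maps are the canonical maps to the colimits
      (∀ x, tm x = toSg k A m m 0 (by simp) x) ∧
      (∀ x, tn x = toSg k A (-n) 1 (n + 1) (by push_cast; ring) x) ∧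
      (∀ x, tt x = toSg k A (m - n - 1) m (n + 1) (by push_cast; ring) x) ∧
      -- the bracket of the last row is induced by `[ , ]_sg` at all stages of the colimits
      (∀ (M p N q r : ℕ) (hM : 1 ≤ M) (hN : 1 ≤ N) (hMp : (M : ℤ) = m + p)
        (hNq : (N : ℤ) = -n + q) (hr : r + 1 = M + N),
        Induces₂ (toSg k A m M p hMp ∘ₗ extClass k A M p) (toSg k A (-n) N q hNq ∘ₗ extClass k A N q)
          (toSg k A (m - n - 1) r (p + q) (by push_cast; omega) ∘ₗ extClass k A r (p + q))
          (sgBracket hM hN hr rfl) (fun x y => SG x y)) ∧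
      -- the diagram commutes
      (∀ α β, κt (jt (curly α β)) = sg (jm α) (κn (jn β))) ∧
      (∀ x y, tt (sg x y) = SG (tm x) (tn y)) := by
  obtain ⟨jm, hjm⟩ := F.exists_toCochEquiv hdiag hm
  obtain ⟨jn, hjn⟩ := F.exists_inclusionEquiv hdiag (r := -n) (by omega)
  obtain ⟨jt, hjt⟩ := F.exists_inclusionEquiv hdiag (r := m - n - 1) (by omega)
  obtain ⟨κn, hκn⟩ := F.exists_kappaEquiv (r := -n) (by omega) le_rfl
    (s := n + 1) (by push_cast; ring)
  obtain ⟨κt, hκt⟩ := F.exists_kappaEquiv (r := m - n - 1) (by omega) hm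
    (s := n + 1) (by push_cast; ring)
  let sg := sgExt F hm le_rfl rfl (Nat.zero_add (n + 1))
  have hsg := sgExt_induces F hm le_rfl rfl (Nat.zero_add (n + 1))
  refine ⟨F.curly_eq_curlyB hm hmn _, (sg.compl₁₂ jm.toLinearMap (jn ≪≫ₗ κn).toLinearMap).compr₂
    (jt ≪≫ₗ κt).symm.toLinearMap, jm, jn, jt, κn, κt, sg, toSgEquiv F (m : ℤ) hm (p := 0) (by simp),
    toSgEquiv F (-n : ℤ) le_rfl (p := n + 1) (by push_cast; ring),
    toSgEquiv F (m - n - 1 : ℤ) hm (p := n + 1) (by push_cast; ring), sgColim F hm, fun f z => ?_,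
    hjm, hjn, hjt, hκn, hκt, hsg, fun _ => rfl, fun _ => rfl, fun _ => rfl,
    fun M p N q r hM hN hMp hNq hr => sgColim_induces F hm M p N q r hM hN hMp hNq hr _,
    fun α β => ?_, fun α β => (sgColim_toSg F hm α β).symm⟩
  · obtain ⟨h1, h2⟩ := F.curly_mem_Z1 hdiag hm hmn (t := m - n - 1) (by ring) f.2 z.2
      (by push_cast; ring) (by push_cast; ring)
    refine ⟨h1, ?_⟩
    obtain ⟨h3, e3⟩ := hjm f
    obtain ⟨h4, e4⟩ := hjn z
    obtain ⟨h5, e5⟩ := hκn ⟨z, h4⟩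
    obtain ⟨h6, e6⟩ := hsg ⟨_, h3⟩ ⟨_, h5⟩
    obtain ⟨h7, e7⟩ := hjt ⟨_, h1⟩
    obtain ⟨h8, e8⟩ := hκt ⟨_, h7⟩
    refine ((jt ≪≫ₗ κt).symm_apply_eq.2 ?_)
    refine Eq.trans ?_ ((congrArg κt e7).trans e8).symm
    refine (congrArg₂ (fun a b => sg a b) e3 ((congrArg κn e4).trans e5)).trans (e6.trans ?_)
    rw [eq_comm, (isCls_extClass m (n + 1)).eq_iff]
    exact h2
  · exact (jt ≪≫ₗ κt).apply_symm_apply _
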